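/- **Setting.** Let $X$ and $S$ be smooth schemes over $\mathbb C$, let $\Delta\subset S$ be a reduced normal crossing divisor, and let $f:X\to S$ be a flat morphism which is a log smooth family of normal crossing varieties of dimension $d$: at each $x\in X$, either $f$ is smooth of relative dimension $d$, or étale-locally there are coordinates $\pi_1,\dots,\pi_m$ on $S$ and coordinates $x_1,\dots,x_{d+1},\pi_2,\dots,\pi_m$ on $X$ such that $f^*\pi_1=x_1\cdots x_r$ for some $1\le r\le d+1$, and $\pi_1\pi_2\cdots\pi_q=0$ is the equation of $\Delta$ for some $1\le q\le m$ (up to renumbering the coordinates). Put $Y=f^{-1}(\Delta)$, a normal crossing divisor, and $$\Omega^1_{X/S}(\log Y)=\Omega^1_X(\log Y)/f^*\Omega^1_S(\log\Delta).$$ For $s\in\Delta$ let $X_s$ be the fibre of $f$ over $s$, let $\Omega^1(\log)=\Omega^1_{X/S}(\log Y)|_{X_s}$, which is locally free, and let $\bar d:\mathcal O_{X_s}\to\Omega^1(\log)$ be the induced differential. Let $T(\log)$ be the sheaf of logarithmic derivations $u\circ\bar d$, $u\in\mathcal Hom(\Omega^1(\log),\mathcal O_{X_s})$; it is identified with the dual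 of $\Omega^1(\log)$. Let $S^2T(\log)\subset T(\log)\otimes T(\log)$ be the symmetric tensors. Let $\mathcal D$ be the sheaf of rings of operators on $\mathcal O_{X_s}$ generated by $\mathcal O_{X_s}$ and $T(\log)$, let $\mathcal D^0=\mathcal O_{X_s}$ and $\mathcal D^k=\{P\in\mathcal D:[P,a]\in\mathcal D^{k-1}\text{ for all local sections } a\text{ of }\mathcal O_{X_s}\}$. For a line bundle $L$ on $X_s$ let $\mathcal D^k(L)=L\otimes\mathcal D^k\otimes L^{*}$, acting on $L$. The symbols of $P\in\mathcal D^1(L)$ and $Q\in\mathcal D^2(L)$ are given by $$\sigma_1(P)(a)\,m=P(am)-aP(m),\qquad \sigma_2(Q)(\bar da,\bar db)=[[Q,a],b],$$ so that $\sigma_2(\partial\partial')=\partial\otimes\partial'+\partial'\otimes\partial$ for logarithmic derivations $\partial,\partial'$ (acting on $L$ through a local trivialization). Let $\mu_L:H^0(S^2T(\log))\to H^1(T(\log))$ be the connecting map of $$0\to \mathcal D^1(L)\to\mathcal D^2(L)\xrightarrow{\sigma_2}S^2T(\log)\to0$$ followed by $H^1(\sigma_1)$. Explicitly, if $P_i\in\mathcal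 D^2(L)(U_i)$ are local lifts of $\omega$ for an open cover $(U_i)$, then $\mu_L(\omega)$ is the class of the cocycle $(\sigma_1(P_j-P_i))$. If $s_i$ are local generators of $L$ with $s_j=u_{ij}s_i$, let $c_1(L)\in H^1(\Omega^1(\log))$ be the class of the cocycle $(\bar du_{ij}/u_{ij})$, that is, the image of the class of $L$ under $H^1(\mathcal O_{X_s}^*)\to H^1(\Omega^1(\log))$, $u\mapsto \bar du/u$. For $\omega\in H^0(S^2T(\log))$ and $c\in H^1(\Omega^1(\log))$ the class of $(\eta_{ij})$, let $\omega\cup c\in H^1(T(\log))$ be the class of $(\omega(\eta_{ij},\cdot))$. **Proposition.** Let $s\in\Delta$ and let $L$ be a line bundle on $X_s$ (for example $\mathcal L|_{X_s}$ for a line bundle $\mathcal L$ on $X$). 1. The sequence $$0\to\mathcal O_{X_s}\to\mathcal D^1(L)\xrightarrow{\sigma_1}T(\log)\to0$$ is exact. It has a well-defined extension class in $H^1(\Omega^1(\log))$: the class of the cocycle $(\rho_i-\rho_j)$, where the $\rho_i$ are local $\mathcal O$-linear splittings of $\sigma_1$ and the homomorphisms $\rho_i-\rho_j:T(\log)\to\mathcal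 O$ are regarded as sections of $\Omega^1(\log)$. This class equals $c_1(L)$. 2. For every $\omega\in H^0(S^2T(\log))$ the classes $\mu_L(\omega)$ and $\mu_{\mathcal O}(\omega)$ are well defined, where $\mu_{\mathcal O}$ is $\mu_L$ for $L=\mathcal O_{X_s}$, and $$\mu_L(\omega)=-\,\omega\cup c_1(L)+\mu_{\mathcal O}(\omega)\quad\text{in } H^1(T(\log)).$$ -/

import Mathlib

open CategoryTheory TopologicalSpace AlgebraicGeometry Opposite
open scoped TensorProduct
noncomputable section
namespace LogHeat
/-- An open cover of `X`, indexed by the points of `X`: an open neighbourhood of every point.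
Every open cover is refined by one of these, so they suffice to compute Cech cohomology. -/
structure PointCover (X : TopCat.{0}) where
  nbhd : X → Opens X
  mem : ∀ x, x ∈ nbhd x

namespace PointCover
variable {X : TopCat.{0}}
/-- `U ≤ V` means that `V` refines `U`. -/
instance : Preorder (PointCover X) where
  le U V := ∀ x, V.nbhd x ≤ U.nbhd x
  le_refl _ _ := le_rfl
  le_trans _ _ _ h₁ h₂ x := (h₂ x).trans (h₁ x)
instance : Nonempty (PointCover X) := ⟨⟨fun _ => ⊤, fun _ => trivial⟩⟩
instance : IsDirectedOrder (PointCover X) :=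
  ⟨fun U V => ⟨⟨fun x => U.nbhd x ⊓ V.nbhd x, fun x => ⟨U.mem x, V.mem x⟩⟩,
    fun _ => inf_le_left, fun _ => inf_le_right⟩⟩
end PointCover

section Cech
variable {X : TopCat.{0}}

/-- Restriction of sections of a presheaf of abelian groups. -/
def res (F : TopCat.Presheaf AddCommGrpCat.{0} X) {U V : Opens X} (h : V ≤ U) :
    F.obj (op U) →+ F.obj (op V) := (F.map (homOfLE h).op).hom

variable (F : TopCat.Presheaf AddCommGrpCat.{0} X)
@[simp] lemma res_self {U : Opens X} (h : U ≤ U) (a : F.obj (op U)) : res F h a = a := by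
  simp [res]
@[simp] lemma res_res {U V W : Opens X} (h : V ≤ U) (h' : W ≤ V) (a : F.obj (op U)) :
    res F h' (res F h a) = res F (h'.trans h) a := by
  simp only [res]
  rw [← ConcreteCategory.comp_apply, ← Functor.map_comp]
  rfl

/-- Cech 1-cocycles: families `c x y` on `U x ∩ U y` with
`c x z = c x y + c y z` on triple intersections. -/
def cocycles (U : PointCover X) :
    AddSubgroup (∀ x y : X, F.obj (op (U.nbhd x ⊓ U.nbhd y))) where
  carrier := {c | ∀ x y z : X,
    res F (show U.nbhd x ⊓ U.nbhd y ⊓ U.nbhd z ≤ U.nbhd x ⊓ U.nbhd z from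
        le_inf (inf_le_left.trans inf_le_left) inf_le_right) (c x z) =
      res F (show U.nbhd x ⊓ U.nbhd y ⊓ U.nbhd z ≤ U.nbhd x ⊓ U.nbhd y from inf_le_left) (c x y) +
      res F (show U.nbhd x ⊓ U.nbhd y ⊓ U.nbhd z ≤ U.nbhd y ⊓ U.nbhd z from
        inf_le_inf_right _ inf_le_right) (c y z)}
  zero_mem' := by intro x y z; simp
  add_mem' := by
    intro a b ha hb x y z
    simp only [Pi.add_apply, map_add, ha x y z, hb x y z]
    abel
  neg_mem' := by
    intro a ha x y z
    simp only [Pi.neg_apply, map_neg, ha x y z]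
    abel

/-- The coboundary `(b x) ↦ (b y - b x)`. -/
def coboundary (U : PointCover X) : (∀ x : X, F.obj (op (U.nbhd x))) →+ cocycles F U where
  toFun b := ⟨fun x y => res F inf_le_right (b y) - res F inf_le_left (b x), by
    intro x y z
    simp only [map_sub, res_res]
    abel⟩
  map_zero' := by ext; simp
  map_add' a b := by
    ext x y
    simp only [Pi.add_apply, map_add, AddSubgroup.coe_add]
    abel

/-- The first Cech cohomology group of a cover. -/
abbrev CechOne (U : PointCover X) : Type := cocycles F U ⧸ (coboundary F U).range

/-- Restriction of cocycles to a finer cover. -/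
def refineCocycle (U V : PointCover X) (h : U ≤ V) : cocycles F U →+ cocycles F V where
  toFun c := ⟨fun x y => res F (inf_le_inf (h x) (h y)) (c.1 x y), by
    intro x y z
    have := congrArg (res F (show V.nbhd x ⊓ V.nbhd y ⊓ V.nbhd z ≤ U.nbhd x ⊓ U.nbhd y ⊓ U.nbhd z
      from inf_le_inf (inf_le_inf (h x) (h y)) (h z))) (c.2 x y z)
    simpa only [map_add, res_res] using this⟩
  map_zero' := by ext; simp
  map_add' a b := by ext x y; simp

def refine (U V : PointCover X) (h : U ≤ V) : CechOne F U →+ CechOne F V :=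
  QuotientAddGroup.map _ _ (refineCocycle F U V h) (by
    rintro _ ⟨b, rfl⟩
    refine ⟨fun x => res F (h x) (b x), ?_⟩
    ext x y
    simp [coboundary, refineCocycle])

open Classical in
/-- First cohomology `H¹(X, F)` of a presheaf of abelian groups: the direct limit of the Cech groups
over all open covers. For a sheaf this is sheaf cohomology in degree one. -/
abbrev HOne : Type := AddCommGroup.DirectLimit (CechOne F) (refine F)

open Classical in
/-- The class of a cocycle. -/
def HOne.mk (U : PointCover X) (c : cocycles F U) : HOne F :=
  AddCommGroup.DirectLimit.of (CechOne F) (refine F) U (QuotientAddGroup.mk c)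

variable {F} {G : TopCat.Presheaf AddCommGrpCat.{0} X}

lemma res_app (φ : F ⟶ G) {U V : Opens X} (h : V ≤ U) (a : F.obj (op U)) :
    φ.app (op V) (res F h a) = res G h (φ.app (op U) a) := by
  have := φ.naturality (homOfLE h).op
  simp only [res]
  change (F.map (homOfLE h).op ≫ φ.app (op V)) a = _
  rw [this]; rfl

def mapCocycle (φ : F ⟶ G) (U : PointCover X) : cocycles F U →+ cocycles G U where
  toFun c := ⟨fun x y => φ.app _ (c.1 x y), by
    intro x y z
    have := congrArg (φ.app _) (c.2 x y z)
    simpa only [map_add, res_app] using this⟩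
  map_zero' := by ext; simp
  map_add' a b := by ext x y; simp

def mapCechOne (φ : F ⟶ G) (U : PointCover X) : CechOne F U →+ CechOne G U :=
  QuotientAddGroup.map _ _ (mapCocycle φ U) (by
    rintro _ ⟨b, rfl⟩
    refine ⟨fun x => φ.app _ (b x), ?_⟩
    ext x y
    simp [coboundary, mapCocycle, res_app])

open Classical in
/-- Functoriality of `H¹`. -/
def HOne.map (φ : F ⟶ G) : HOne F →+ HOne G :=
  AddCommGroup.DirectLimit.map (mapCechOne φ) (by
    intro U V h
    ext c
    simp [mapCechOne, refine, mapCocycle, refineCocycle, res_app])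
lemma HOne.map_mk (φ : F ⟶ G) (U : PointCover X) (c : cocycles F U) :
    HOne.map φ (HOne.mk F U c) = HOne.mk G U (mapCocycle φ U c) := by
  simp [HOne.map, HOne.mk, mapCechOne]
end Cech


section Algebra
variable (k B A C : Type) [CommRing k] [CommRing B] [CommRing A] [CommRing C]
  [Algebra k B] [Algebra k A]

/-- The regular differential forms inside the rational forms: the `A`-span of all `da`, `a ∈ A`. -/
def regularForms : Submodule A (Ω[FractionRing A⁄k]) :=
  Submodule.span A (Set.range fun a : A => KaehlerDifferential.D k (FractionRing A) (algebraMap A _ a))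

open ExteriorAlgebra in
/-- The regular 2-forms inside the rational 2-forms: the `A`-span of all `da ∧ db`. -/
def regularTwoForms : Submodule A (ExteriorAlgebra (FractionRing A) (Ω[FractionRing A⁄k])) :=
  Submodule.span A (Set.range fun a : A × A =>
    ι (FractionRing A) (KaehlerDifferential.D k (FractionRing A) (algebraMap A _ a.1)) *
    ι (FractionRing A) (KaehlerDifferential.D k (FractionRing A) (algebraMap A _ a.2)))

variable {A} in
open ExteriorAlgebra in
/-- Differential forms with logarithmic poles along the divisor defined by `I` (for a reduced normal
crossing divisor on a smooth scheme): the rational forms `η` such that `η` and `dη` have at most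
simple poles along the divisor. For a local equation `t` this says that `t η` and `t dη` are
regular; as `t dη = d(t η) - dt ∧ η`, it amounts to `t η` and `dt ∧ η` being regular. -/
def logForms (I : Ideal A) : Submodule A (Ω[FractionRing A⁄k]) where
  carrier := {η | ∀ t ∈ I, t • η ∈ regularForms k A ∧
    ι (FractionRing A) (KaehlerDifferential.D k (FractionRing A) (algebraMap A _ t)) *
      ι (FractionRing A) η ∈ regularTwoForms k A}
  zero_mem' := by intro t _; simp
  add_mem' := by
    intro x y hx hy t ht
    rw [smul_add, map_add, mul_add]
    exact ⟨add_mem (hx t ht).1 (hy t ht).1, add_mem (hx t ht).2 (hy t ht).2⟩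
  smul_mem' := by
    intro c x hx t ht
    refine ⟨by rw [smul_comm]; exact Submodule.smul_mem _ c (hx t ht).1, ?_⟩
    have h : (ι (FractionRing A)) (c • x) = c • (ι (FractionRing A)) x := by
      rw [← algebraMap_smul (FractionRing A) c x, map_smul, algebraMap_smul]
    rw [h, mul_smul_comm]
    exact Submodule.smul_mem _ c (hx t ht).2

lemma D_mem_logForms (I : Ideal A) (a : A) :
    KaehlerDifferential.D k (FractionRing A) (algebraMap A _ a) ∈ logForms k I := fun t _ =>
  ⟨Submodule.smul_mem _ _ (Submodule.subset_span ⟨a, rfl⟩), Submodule.subset_span ⟨(t, a), rfl⟩⟩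

variable [Algebra B A] [IsScalarTower k B A] [Algebra A C]

variable {B} in
/-- The `A`-module generated by the pull-backs to `A` of the logarithmic forms of `B` along `I`
(pull-back along a flat map `B → A` of a rational form `ξ = ω / b` with `ω` regular). -/
def pulledBackForms (I : Ideal B) : Submodule A (Ω[FractionRing A⁄k]) :=
  Submodule.span A {η | ∃ ξ ∈ logForms k I, ∃ b ∈ nonZeroDivisors B, ∃ ω : Ω[B⁄k],
    algebraMap B A b ∈ nonZeroDivisors A ∧
    b • ξ = KaehlerDifferential.map k k B (FractionRing B) ω ∧
    algebraMap B A b • η =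
      KaehlerDifferential.map k k A (FractionRing A) (KaehlerDifferential.map k k B A ω)}

variable {B} in
/-- Relative logarithmic forms: the logarithmic forms of `A` along the inverse image of the divisor
of `I`, modulo the pulled back logarithmic forms of `B` along the divisor of `I`. -/
abbrev RelLogForms (I : Ideal B) : Type :=
  logForms k (I.map (algebraMap B A)) ⧸
    (pulledBackForms k A I).submoduleOf (logForms k (I.map (algebraMap B A)))

variable {B} in
/-- The differential `A → Ω(log)` into the relative logarithmic forms. -/
def relLogD (I : Ideal B) : Derivation k A (RelLogForms k A I) where
  toFun a := Submodule.Quotient.mk ⟨_, D_mem_logForms k A (I.map (algebraMap B A)) a⟩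
  map_add' a b := by
    rw [← Submodule.Quotient.mk_add]; congr 1; ext; simp
  map_smul' c a := by
    simp only [RingHom.id_apply]
    rw [← Submodule.Quotient.mk_smul]; congr 1; ext
    simp [Algebra.smul_def, ← IsScalarTower.algebraMap_apply]
  map_one_eq_zero' := by
    refine (Submodule.Quotient.mk_eq_zero _).2 ?_
    simp only [Submodule.submoduleOf, Submodule.mem_comap, Submodule.subtype_apply, map_one, Derivation.map_one_eq_zero]
    exact zero_mem _
  leibniz' a b := by
    simp only [LinearMap.coe_mk, AddHom.coe_mk]
    rw [← Submodule.Quotient.mk_smul, ← Submodule.Quotient.mk_smul, ← Submodule.Quotient.mk_add]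
    congr 1; ext; simp

lemma relLogD_algebraMap (I : Ideal B) (b : B) : relLogD k A I (algebraMap B A b) = 0 := by
  refine (Submodule.Quotient.mk_eq_zero _).2 (Submodule.subset_span
    ⟨KaehlerDifferential.D k _ (algebraMap B _ b), D_mem_logForms k B I b, 1, one_mem _,
      KaehlerDifferential.D k B b, by simp [one_mem], by simp, ?_⟩)
  simp [← IsScalarTower.algebraMap_apply]

variable {B} in
/-- Restriction of the relative logarithmic forms to the fibre, with local ring `C`. -/
abbrev FibreLogForms (I : Ideal B) : Type := C ⊗[A] RelLogForms k A I

variable [IsLocalRing B]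

/-- `C` is the local ring of the fibre: the quotient of `A` by the ideal generated by the maximal
ideal of `B`. -/
structure IsFibreRing : Prop where
  surj : Function.Surjective (algebraMap A C)
  ker : RingHom.ker (algebraMap A C) = (IsLocalRing.maximalIdeal B).map (algebraMap B A)

variable {B A C}
lemma tmul_relLogD_eq_zero (h : IsFibreRing B A C) (I : Ideal B) {a : A} (ha : algebraMap A C a = 0) :
    (1 : C) ⊗ₜ[A] relLogD k A I a = 0 := by
  replace ha : a ∈ RingHom.ker (algebraMap A C) := ha
  have hk := h.ker
  rw [hk] at ha
  induction ha using Submodule.span_induction with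
  | mem x hx =>
    obtain ⟨b, hb, rfl⟩ := hx
    rw [relLogD_algebraMap, TensorProduct.tmul_zero]
  | zero => simp
  | add x y _ _ hx hy => rw [map_add, TensorProduct.tmul_add, hx, hy, add_zero]
  | smul c x hx' hx =>
    have hx0 : algebraMap A C x = 0 := by
      change x ∈ RingHom.ker (algebraMap A C); rw [hk]; exact hx'
    rw [smul_eq_mul, Derivation.leibniz, TensorProduct.tmul_add, TensorProduct.tmul_smul, hx,
      smul_zero, zero_add, ← TensorProduct.smul_tmul, Algebra.smul_def, hx0, zero_mul,
      TensorProduct.zero_tmul]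

/-- The differential on the fibre, computed on any lift to `A`. -/
def fibreLogD (h : IsFibreRing B A C) (I : Ideal B) (c : C) : FibreLogForms k A C I :=
  1 ⊗ₜ relLogD k A I (h.surj c).choose

lemma fibreLogD_algebraMap (h : IsFibreRing B A C) (I : Ideal B) (a : A) :
    fibreLogD k h I (algebraMap A C a) = 1 ⊗ₜ relLogD k A I a := by
  rw [fibreLogD, ← sub_eq_zero, ← TensorProduct.tmul_sub, ← map_sub]
  apply tmul_relLogD_eq_zero k h
  rw [map_sub, (h.surj _).choose_spec, sub_self]

lemma fibreLogD_add (h : IsFibreRing B A C) (I : Ideal B) (c c' : C) :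
    fibreLogD k h I (c + c') = fibreLogD k h I c + fibreLogD k h I c' := by
  obtain ⟨a, rfl⟩ := h.surj c
  obtain ⟨a', rfl⟩ := h.surj c'
  rw [← map_add, fibreLogD_algebraMap, fibreLogD_algebraMap, fibreLogD_algebraMap, map_add,
    TensorProduct.tmul_add]

lemma fibreLogD_mul (h : IsFibreRing B A C) (I : Ideal B) (c c' : C) :
    fibreLogD k h I (c * c') = c • fibreLogD k h I c' + c' • fibreLogD k h I c := by
  obtain ⟨a, rfl⟩ := h.surj c
  obtain ⟨a', rfl⟩ := h.surj c'
  rw [← map_mul, fibreLogD_algebraMap, fibreLogD_algebraMap, fibreLogD_algebraMap,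
    Derivation.leibniz, TensorProduct.tmul_add, algebraMap_smul, algebraMap_smul,
    TensorProduct.tmul_smul, TensorProduct.tmul_smul]
end Algebra


lemma stalk_eq_zero_of_field (K : Type) [Field K] (w : Spec (CommRingCat.of K))
    (r : (Spec (CommRingCat.of K)).presheaf.stalk w) (hr : ¬ IsUnit r) : r = 0 := by
  obtain rfl : w = IsLocalRing.closedPoint K := Subsingleton.elim (α := PrimeSpectrum K) _ _
  have e := (stalkClosedPointIso (CommRingCat.of K)).commRingCatIsoToRingEquiv
  by_contra h
  refine hr ((MulEquiv.isUnit_map e).1 ?_)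
  exact IsUnit.mk0 (G₀ := K) (e r) (by simpa using h)

lemma fibre_maximalIdeal {X S : Scheme.{0}} (f : X ⟶ S) (s : S) (z : f.fiber s)
    (b : S.presheaf.stalk (f (f.fiberι s z))) (hb : ¬ IsUnit b) :
    ((f.fiberι s).stalkMap z).hom ((f.stalkMap (f.fiberι s z)).hom b) = 0 := by
  have h1 := Scheme.Hom.stalkMap_comp (f.fiberι s) f z
  have h2 := Scheme.Hom.stalkMap_congr_hom _ _ (f.fiber_fac s) z
  have h3 := Scheme.Hom.stalkMap_comp (f.fiberToSpecResidueField s) (S.fromSpecResidueField s) z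
  rw [h1, h3] at h2
  have h4 := ConcreteCategory.congr_hom h2 b
  simp only [ConcreteCategory.comp_apply] at h4
  refine h4.trans ?_
  refine Eq.trans (congrArg ((f.fiberToSpecResidueField s).stalkMap z).hom ?_) (map_zero _)
  refine stalk_eq_zero_of_field (S.residueField s) _ _ fun hu => hb ?_
  have h5 := isUnit_of_map_unit ((S.fromSpecResidueField s).stalkMap _).hom _ hu
  exact (MulEquiv.isUnit_map (S.presheaf.stalkCongr _).commRingCatIsoToRingEquiv).1 h5

lemma fibre_ker {X S : Scheme.{0}} (f : X ⟶ S) (s : S) (z : f.fiber s)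
    (a : X.presheaf.stalk (f.fiberι s z)) (ha : ((f.fiberι s).stalkMap z).hom a = 0) :
    a ∈ (IsLocalRing.maximalIdeal (S.presheaf.stalk (f (f.fiberι s z)))).map
      (f.stalkMap (f.fiberι s z)).hom := by
  obtain ⟨V, hxV, v, hv⟩ := X.presheaf.exists_germ_eq a
  have hgerm : ∀ z' (_ : z' = z) (hV : f.fiberι s z' ∈ V),
      ((f.fiberι s).stalkMap z').hom (X.presheaf.germ V _ hV v) = 0 := by
    rintro z' rfl hV
    rw [← ha, ← hv]
  have hy : f (f.fiberι s z) = s := by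
    have := congrArg (fun g : f.fiber s ⟶ S => g z) (f.fiber_fac s)
    simpa using this
  set J := (IsLocalRing.maximalIdeal (S.presheaf.stalk (f (f.fiberι s z)))).map
    (f.stalkMap (f.fiberι s z)).hom with hJ
  have hJle : J ≤ IsLocalRing.maximalIdeal (X.presheaf.stalk (f.fiberι s z)) :=
    ((IsLocalRing.local_hom_TFAE (f.stalkMap (f.fiberι s z)).hom).out 0 2).1
      (f.toLRSHom.prop _)
  have hJtop : J ≠ ⊤ := fun h =>
    (IsLocalRing.maximalIdeal.isMaximal (X.presheaf.stalk (f.fiberι s z))).ne_top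
      (top_le_iff.1 (h ▸ hJle))
  have : Nontrivial (X.presheaf.stalk (f.fiberι s z) ⧸ J) := Ideal.Quotient.nontrivial_iff.2 hJtop
  have hloc : IsLocalRing (X.presheaf.stalk (f.fiberι s z) ⧸ J) :=
    IsLocalRing.of_surjective' (Ideal.Quotient.mk J) Ideal.Quotient.mk_surjective
  let R : CommRingCat := CommRingCat.of (X.presheaf.stalk (f.fiberι s z) ⧸ J)
  have : IsLocalRing R := hloc
  let q : X.presheaf.stalk (f.fiberι s z) ⟶ R := CommRingCat.ofHom (Ideal.Quotient.mk J)
  have : IsLocalHom q.hom :=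
    IsLocalHom.of_surjective (Ideal.Quotient.mk J) Ideal.Quotient.mk_surjective
  let r : S.residueField (f (f.fiberι s z)) ⟶ R := CommRingCat.ofHom
    (Ideal.Quotient.lift (IsLocalRing.maximalIdeal (S.presheaf.stalk (f (f.fiberι s z))))
      ((Ideal.Quotient.mk J).comp (f.stalkMap (f.fiberι s z)).hom)
      (fun b hb => Ideal.Quotient.eq_zero_iff_mem.2 (Ideal.mem_map_of_mem _ hb)))
  have hr : S.residue (f (f.fiberι s z)) ≫ r = f.stalkMap (f.fiberι s z) ≫ q := by
    ext b; rfl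
  let g : Spec R ⟶ X := Spec.map q ≫ X.fromSpecStalk (f.fiberι s z)
  let h : Spec R ⟶ Spec (S.residueField s) :=
    Spec.map r ≫ Spec.map (S.residueFieldCongr hy.symm).hom
  have hgh : g ≫ f = h ≫ S.fromSpecResidueField s := by
    simp only [g, h, Category.assoc, Scheme.residueFieldCongr_fromSpecResidueField]
    rw [← Scheme.SpecMap_stalkMap_fromSpecStalk, ← Spec.map_comp_assoc, ← hr,
      Spec.map_comp_assoc]
    rfl
  let l : Spec R ⟶ f.fiber s := Limits.pullback.lift g h hgh
  have hl : l ≫ f.fiberι s = g := Limits.pullback.lift_fst _ _ _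
  let o : Spec R := IsLocalRing.closedPoint R
  have hgx : g o = f.fiberι s z := by
    have h1 : Spec.map q o = IsLocalRing.closedPoint _ := Spec_closedPoint
    rw [Scheme.Hom.comp_apply, h1, Scheme.fromSpecStalk_closedPoint]
  have hlz : l o = z := by
    apply (f.fiberι s).isEmbedding.injective
    rw [← Scheme.Hom.comp_apply, hl, hgx]
  have h1 := ConcreteCategory.congr_hom
    (Scheme.germ_stalkClosedPointTo_Spec_fromSpecStalk q V (hgx.symm ▸ hxV)) v
  have h2 : (Scheme.stalkClosedPointTo (l ≫ f.fiberι s)).hom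
      (X.presheaf.germ V _ (show (l ≫ f.fiberι s) o ∈ V by rw [hl, hgx]; exact hxV) v) = 0 := by
    rw [Scheme.stalkClosedPointTo_comp]
    refine Eq.trans (congrArg (Scheme.stalkClosedPointTo l).hom ?_) (map_zero _)
    exact hgerm _ hlz _
  have h3 : q.hom (X.presheaf.germ V _ hxV v) = 0 := by
    refine Eq.trans h1.symm (Eq.trans ?_ h2)
    have key : ∀ (g' : Spec R ⟶ X) (e : g = g') (p1 : g o ∈ V) (p2 : g' o ∈ V),
        (Scheme.stalkClosedPointTo g).hom (X.presheaf.germ V _ p1 v) =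
          (Scheme.stalkClosedPointTo g').hom (X.presheaf.germ V _ p2 v) := by
      rintro _ rfl _ _; rfl
    exact key _ hl.symm _ _
  rw [← hv]
  exact Ideal.Quotient.eq_zero_iff_mem.1 h3

lemma isFibreRing_stalk {X S : Scheme.{0}} (f : X ⟶ S) (s : S) (z : f.fiber s) :
    letI := (f.stalkMap (f.fiberι s z)).hom.toAlgebra
    letI := ((f.fiberι s).stalkMap z).hom.toAlgebra
    IsFibreRing (S.presheaf.stalk (f (f.fiberι s z))) (X.presheaf.stalk (f.fiberι s z))
      ((f.fiber s).presheaf.stalk z) := by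
  let _ := (f.stalkMap (f.fiberι s z)).hom.toAlgebra
  let _ := ((f.fiberι s).stalkMap z).hom.toAlgebra
  refine ⟨(f.fiberι s).stalkMap_surjective z, le_antisymm (fun a ha => fibre_ker f s z a ha) ?_⟩
  rw [Ideal.map_le_iff_le_comap]
  intro b hb
  exact fibre_maximalIdeal f s z b hb


/-- The local rings `B` of the base, `A` of the total space and `C` of the fibre at a point of the
fibre, with the ideal of the divisor in `B`. It only bundles data; the one used below is
`fibreStalk`, built from a morphism of schemes. -/
structure FibreStalk where
  (B A C : Type)
  [ringB : CommRing B] [ringA : CommRing A] [ringC : CommRing C]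
  [localB : IsLocalRing B]
  [algB : Algebra ℂ B] [algA : Algebra ℂ A] [algBA : Algebra B A] [algAC : Algebra A C]
  [tower : IsScalarTower ℂ B A]
  ideal : Ideal B
  isFibreRing : IsFibreRing B A C

namespace FibreStalk
attribute [instance] ringB ringA ringC localB algB algA algBA algAC tower

/-- The stalk of the logarithmic forms of the fibre. -/
abbrev Forms (R : FibreStalk) : Type := FibreLogForms ℂ R.A R.C R.ideal

/-- The differential at the level of stalks. -/
abbrev d (R : FibreStalk) (c : R.C) : R.Forms := fibreLogD ℂ R.isFibreRing R.ideal c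

/-- The restriction to the fibre of a logarithmic form of the total space. -/
def ofLogForm (R : FibreStalk) (e : logForms ℂ (R.ideal.map (algebraMap R.B R.A))) : R.Forms :=
  1 ⊗ₜ Submodule.Quotient.mk e
end FibreStalk

/-- The stalk at `y` of an ideal sheaf. -/
def stalkIdeal {S : Scheme.{0}} (Δ : S.IdealSheafData) (y : S) : Ideal (S.presheaf.stalk y) :=
  Ideal.span {b | ∃ (U : S.affineOpens) (hy : y ∈ U.1), ∃ g ∈ Δ.ideal U,
    S.presheaf.germ U.1 y hy g = b}

/-- The constants `ℂ → 𝒪_{S,y}` of a scheme over `ℂ`. -/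
def stalkConst {S : Scheme.{0}} (p : S ⟶ Spec (CommRingCat.of ℂ)) (y : S) :
    ℂ →+* S.presheaf.stalk y :=
  ((Scheme.ΓSpecIso (CommRingCat.of ℂ)).inv ≫ p.appTop ≫ S.presheaf.germ ⊤ y trivial).hom

lemma stalkMap_stalkConst {X S : Scheme.{0}} (p : S ⟶ Spec (CommRingCat.of ℂ)) (f : X ⟶ S) (x : X) :
    (f.stalkMap x).hom.comp (stalkConst p (f x)) = stalkConst (f ≫ p) x := by
  rw [stalkConst, stalkConst, ← CommRingCat.hom_comp]
  congr 1
  simp only [Category.assoc, Scheme.Hom.comp_appTop]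
  exact congrArg (fun g => (Scheme.ΓSpecIso (CommRingCat.of ℂ)).inv ≫ p.appTop ≫ g)
    (Scheme.Hom.germ_stalkMap f ⊤ x trivial)

section Sheaf
variable {X S : Scheme.{0}} (p : S ⟶ Spec (CommRingCat.of ℂ)) (f : X ⟶ S)
  (Δ : S.IdealSheafData) (s : S)

/-- The local rings at a point `z` of the fibre of `f` over `s`. -/
def fibreStalk (z : f.fiber s) : FibreStalk :=
  letI := (stalkConst p (f (f.fiberι s z))).toAlgebra
  letI := (stalkConst (f ≫ p) (f.fiberι s z)).toAlgebra
  letI := (f.stalkMap (f.fiberι s z)).hom.toAlgebra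
  letI := ((f.fiberι s).stalkMap z).hom.toAlgebra
  { B := S.presheaf.stalk (f (f.fiberι s z))
    A := X.presheaf.stalk (f.fiberι s z)
    C := (f.fiber s).presheaf.stalk z
    tower := IsScalarTower.of_algebraMap_eq'
      (stalkMap_stalkConst p f (f.fiberι s z)).symm
    ideal := stalkIdeal Δ (f (f.fiberι s z))
    isFibreRing := isFibreRing_stalk f s z }

def germC (U : (f.fiber s).Opens) (z : U) : Γ(f.fiber s, U) →+* (fibreStalk p f Δ s z.1).C :=
  ((f.fiber s).presheaf.germ U z.1 z.2).hom

def germA (V : X.Opens) (z : f.fiber s) (hz : f.fiberι s z ∈ V) :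
    Γ(X, V) →+* (fibreStalk p f Δ s z).A :=
  (X.presheaf.germ V (f.fiberι s z) hz).hom

instance (U : (f.fiber s).Opens) (z : U) :
    Module Γ(f.fiber s, U) (fibreStalk p f Δ s z.1).Forms :=
  Module.compHom _ (germC p f Δ s U z)

lemma smul_def' (U : (f.fiber s).Opens) (z : U) (a : Γ(f.fiber s, U)) (m : (fibreStalk p f Δ s z.1).Forms) :
    a • m = germC p f Δ s U z a • m := rfl

/-- Families of germs of logarithmic forms of the fibre over an open set. -/
abbrev LogFamily (U : (f.fiber s).Opens) : Type := ∀ z : U, (fibreStalk p f Δ s z.1).Forms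

def restrictFamily {U V : (f.fiber s).Opens} (h : V ≤ U) :
    LogFamily p f Δ s U →+ LogFamily p f Δ s V where
  toFun η z := η ⟨z.1, h z.2⟩
  map_zero' := rfl
  map_add' _ _ := rfl

lemma germC_res {U V : (f.fiber s).Opens} (h : V ≤ U) (z : V) (a : Γ(f.fiber s, U)) :
    germC p f Δ s V z ((f.fiber s).presheaf.map (homOfLE h).op a) = germC p f Δ s U ⟨z.1, h z.2⟩ a :=
  TopCat.Presheaf.germ_res_apply _ _ _ _ _

lemma restrictFamily_smul {U V : (f.fiber s).Opens} (h : V ≤ U) (a : Γ(f.fiber s, U))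
    (η : LogFamily p f Δ s U) :
    restrictFamily p f Δ s h (a • η) =
      (f.fiber s).presheaf.map (homOfLE h).op a • restrictFamily p f Δ s h η := by
  funext z
  change germC p f Δ s U ⟨z.1, h z.2⟩ a • η ⟨z.1, h z.2⟩ = germC p f Δ s V z _ • η ⟨z.1, h z.2⟩
  rw [germC_res]

/-- The family of germs comes from one logarithmic form `(∑ b_j d c_j) / t` on an open
neighbourhood in the total space. -/
def IsRational {U : (f.fiber s).Opens} (η : LogFamily p f Δ s U) : Prop :=
  ∃ (V : X.Opens) (hV : U ≤ f.fiberι s ⁻¹ᵁ V) (t : Γ(X, V)) (n : ℕ) (b c : Fin n → Γ(X, V)),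
    ∀ z : U, let g := germA p f Δ s V z.1 (hV z.2)
      g t ∈ nonZeroDivisors (fibreStalk p f Δ s z.1).A ∧
      ∃ e : logForms ℂ ((fibreStalk p f Δ s z.1).ideal.map (algebraMap _ (fibreStalk p f Δ s z.1).A)),
        (g t • (e : Ω[FractionRing (fibreStalk p f Δ s z.1).A⁄ℂ]) =
          ∑ j, g (b j) • KaehlerDifferential.D ℂ _ (algebraMap _ _ (g (c j)))) ∧
        η z = (fibreStalk p f Δ s z.1).ofLogForm e

lemma IsRational.restrict {U V : (f.fiber s).Opens} (h : V ≤ U) {η : LogFamily p f Δ s U}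
    (hη : IsRational p f Δ s η) : IsRational p f Δ s (restrictFamily p f Δ s h η) := by
  obtain ⟨W, hW, t, n, b, c, H⟩ := hη
  exact ⟨W, h.trans hW, t, n, b, c, fun z => H ⟨z.1, h z.2⟩⟩

/-- Combinations, with coefficients functions on the fibre, of restrictions of logarithmic forms. -/
def spanRational (U : (f.fiber s).Opens) : Submodule Γ(f.fiber s, U) (LogFamily p f Δ s U) :=
  Submodule.span _ {η | IsRational p f Δ s η}

lemma restrict_mem_spanRational {U V : (f.fiber s).Opens} (h : V ≤ U) {η : LogFamily p f Δ s U}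
    (hη : η ∈ spanRational p f Δ s U) :
    restrictFamily p f Δ s h η ∈ spanRational p f Δ s V := by
  induction hη using Submodule.span_induction with
  | mem x hx => exact Submodule.subset_span (hx.restrict p f Δ s h)
  | zero => rw [map_zero]; exact zero_mem _
  | add x y _ _ hx hy => rw [map_add]; exact add_mem hx hy
  | smul c x _ hx => rw [restrictFamily_smul]; exact Submodule.smul_mem _ _ hx

/-- Sections over `U` of the sheaf of logarithmic forms of the fibre, that is of the restriction to
the fibre of `Ω¹_X(log Y) / f^* Ω¹_S(log Δ)`, as families of germs that are locally induced by forms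
on the total space. -/
def logSections (U : (f.fiber s).Opens) : Submodule Γ(f.fiber s, U) (LogFamily p f Δ s U) where
  carrier := {η | ∀ z : U, ∃ (W : (f.fiber s).Opens) (h : W ≤ U), z.1 ∈ W ∧
    restrictFamily p f Δ s h η ∈ spanRational p f Δ s W}
  zero_mem' := fun z => ⟨U, le_rfl, z.2, by rw [map_zero]; exact zero_mem _⟩
  add_mem' := by
    intro η η' h h' z
    obtain ⟨W, hW, hz, hη⟩ := h z
    obtain ⟨W', hW', hz', hη'⟩ := h' z
    refine ⟨W ⊓ W', inf_le_left.trans hW, ⟨hz, hz'⟩, ?_⟩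
    rw [map_add]
    exact add_mem (restrict_mem_spanRational p f Δ s inf_le_left hη)
      (restrict_mem_spanRational p f Δ s inf_le_right hη')
  smul_mem' := by
    intro c η h z
    obtain ⟨W, hW, hz, hη⟩ := h z
    refine ⟨W, hW, hz, ?_⟩
    rw [restrictFamily_smul]
    exact Submodule.smul_mem _ _ hη

lemma restrict_mem_logSections {U V : (f.fiber s).Opens} (h : V ≤ U) {η : LogFamily p f Δ s U}
    (hη : η ∈ logSections p f Δ s U) : restrictFamily p f Δ s h η ∈ logSections p f Δ s V := by
  intro z
  obtain ⟨W, hW, hz, hη'⟩ := hη ⟨z.1, h z.2⟩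
  exact ⟨W ⊓ V, inf_le_right, ⟨hz, z.2⟩, restrict_mem_spanRational p f Δ s inf_le_left hη'⟩

/-- The sheaf of logarithmic forms on the fibre, as a presheaf of abelian groups. -/
def logPresheaf : TopCat.Presheaf AddCommGrpCat.{0} (f.fiber s) where
  obj U := AddCommGrpCat.of (logSections p f Δ s U.unop)
  map {U V} h := AddCommGrpCat.ofHom
    { toFun := fun η => ⟨restrictFamily p f Δ s h.unop.le η.1,
        restrict_mem_logSections p f Δ s h.unop.le η.2⟩
      map_zero' := rfl
      map_add' := fun _ _ => rfl }
  map_id _ := rfl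
  map_comp _ _ := rfl

instance (U : (Opens (f.fiber s))ᵒᵖ) : Module ((f.fiber s).ringCatSheaf.obj.obj U) ((logPresheaf p f Δ s).obj U) :=
  inferInstanceAs (Module Γ(f.fiber s, U.unop) (logSections p f Δ s U.unop))

def logLocalPredicate : TopCat.LocalPredicate
    (fun z : f.fiber s => (fibreStalk p f Δ s z).Forms) where
  pred {U} η := η ∈ logSections p f Δ s U
  res {V U} i η h := restrict_mem_logSections p f Δ s i.le h
  locality {U} η h z := by
    obtain ⟨V, hz, i, hV⟩ := h z
    obtain ⟨W, hW, hz', hη⟩ := hV ⟨z.1, hz⟩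
    exact ⟨W, hW.trans i.le, hz', hη⟩

lemma logPresheaf_isSheaf : TopCat.Presheaf.IsSheaf (logPresheaf p f Δ s) := by
  rw [TopCat.Presheaf.isSheaf_iff_isSheaf_comp (CategoryTheory.forget AddCommGrpCat)]
  exact TopCat.subpresheafToTypes.isSheaf (logLocalPredicate p f Δ s)

/-- The sheaf of logarithmic differentials `Ω¹(log)` of the fibre of `f` over `s`, where
`Δ ⊆ S` is the discriminant divisor and `Y = f⁻¹(Δ)`, as a sheaf of modules. -/
def logCotangent : (f.fiber s).Modules where
  val := PresheafOfModules.ofPresheaf (logPresheaf p f Δ s) (by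
    intro U V h r m
    exact Subtype.ext (restrictFamily_smul p f Δ s h.unop.le r m.1))
  isSheaf := logPresheaf_isSheaf p f Δ s

/-- A derivation from the structure sheaf to a sheaf of modules. -/
structure SheafDerivation {Z : Scheme.{0}} (Ω : Z.Modules) where
  d : ∀ U : Z.Opens, Γ(Z, U) →+ Γ(Ω, U)
  leibniz : ∀ (U : Z.Opens) (a b : Γ(Z, U)), d U (a * b) = a • d U b + b • d U a
  natural : ∀ {U V : Z.Opens} (h : V ≤ U) (a : Γ(Z, U)),
    res Ω.presheaf h (d U a) = d V (Z.presheaf.map (homOfLE h).op a)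

lemma fibreStalk_d_mem (U : (f.fiber s).Opens) (a : Γ(f.fiber s, U)) :
    (fun z : U => (fibreStalk p f Δ s z.1).d (germC p f Δ s U z a)) ∈ logSections p f Δ s U := by
  intro z
  obtain ⟨a', ha'⟩ := (f.fiberι s).stalkMap_surjective z.1 ((f.fiber s).presheaf.germ U z.1 z.2 a)
  obtain ⟨V, hV, v, rfl⟩ := X.presheaf.exists_germ_eq a'
  have h0 : ((f.fiber s).presheaf.germ (f.fiberι s ⁻¹ᵁ V) z.1 hV) ((f.fiberι s).app V v) =
      (f.fiber s).presheaf.germ U z.1 z.2 a := by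
    rw [← ha']
    exact (Scheme.Hom.germ_stalkMap_apply _ _ _ _ _).symm
  obtain ⟨W, hzW, i1, i2, hW⟩ := TopCat.Presheaf.germ_eq _ z.1 hV z.2 _ _ h0
  refine ⟨W, i2.le, hzW, Submodule.subset_span
    ⟨V, i1.le, 1, 1, fun _ => 1, fun _ => v, fun w => ?_⟩⟩
  refine ⟨by rw [map_one]; exact one_mem _,
    ⟨_, D_mem_logForms ℂ (fibreStalk p f Δ s w.1).A _ (germA p f Δ s V w.1 (i1.le w.2) v)⟩, by simp, ?_⟩
  have h1 : germC p f Δ s U ⟨w.1, i2.le w.2⟩ a =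
      algebraMap _ (fibreStalk p f Δ s w.1).C (germA p f Δ s V w.1 (i1.le w.2) v) := by
    rw [← germC_res p f Δ s i2.le w]
    have h2 : (f.fiber s).presheaf.map (homOfLE i2.le).op a =
      (f.fiber s).presheaf.map (homOfLE i1.le).op ((f.fiberι s).app V v) := hW.symm
    rw [h2]
    refine (germC_res p f Δ s i1.le w _).trans ?_
    exact (Scheme.Hom.germ_stalkMap_apply (f.fiberι s) V w.1 (i1.le w.2) v).symm
  change (fibreStalk p f Δ s w.1).d (germC p f Δ s U ⟨w.1, i2.le w.2⟩ a) = _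
  rw [h1]
  exact fibreLogD_algebraMap ℂ (fibreStalk p f Δ s w.1).isFibreRing _ _

def dFamily (U : (f.fiber s).Opens) (a : Γ(f.fiber s, U)) : LogFamily p f Δ s U :=
  fun z => (fibreStalk p f Δ s z.1).d (germC p f Δ s U z a)

lemma dFamily_add (U : (f.fiber s).Opens) (a b : Γ(f.fiber s, U)) :
    dFamily p f Δ s U (a + b) = dFamily p f Δ s U a + dFamily p f Δ s U b := by
  funext z
  simp only [dFamily, Pi.add_apply, map_add]
  exact fibreLogD_add ℂ _ _ _ _

lemma dFamily_mul (U : (f.fiber s).Opens) (a b : Γ(f.fiber s, U)) :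
    dFamily p f Δ s U (a * b) = a • dFamily p f Δ s U b + b • dFamily p f Δ s U a := by
  funext z
  simp only [dFamily, Pi.add_apply, Pi.smul_apply, map_mul, smul_def']
  exact fibreLogD_mul ℂ _ _ _ _

lemma dFamily_res {U V : (f.fiber s).Opens} (h : V ≤ U) (a : Γ(f.fiber s, U)) :
    restrictFamily p f Δ s h (dFamily p f Δ s U a) =
      dFamily p f Δ s V ((f.fiber s).presheaf.map (homOfLE h).op a) := by
  funext z
  simp only [dFamily, germC_res]
  rfl

def dSection (U : (f.fiber s).Opens) : Γ(f.fiber s, U) →+ logSections p f Δ s U :=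
  AddMonoidHom.mk' (fun a => ⟨dFamily p f Δ s U a, fibreStalk_d_mem p f Δ s U a⟩)
    fun a b => Subtype.ext (dFamily_add p f Δ s U a b)

lemma dSection_mul (U : (f.fiber s).Opens) (a b : Γ(f.fiber s, U)) :
    dSection p f Δ s U (a * b) = a • dSection p f Δ s U b + b • dSection p f Δ s U a :=
  Subtype.ext (dFamily_mul p f Δ s U a b)

/-- The differential `d : 𝒪 → Ω¹(log)` of the fibre. -/
def logDifferential : SheafDerivation (logCotangent p f Δ s) where
  d U := dSection p f Δ s U
  leibniz U a b := dSection_mul p f Δ s U a b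
  natural {_ _} h a := Subtype.ext (dFamily_res p f Δ s h a)
end Sheaf
section Calculus
variable {Z : Scheme.{0}}

/-- The structure sheaf as a module over itself. -/
def structureModule (Z : Scheme.{0}) : Z.Modules := SheafOfModules.unit Z.ringCatSheaf

def toO (U : Z.Opens) : Γ(Z, U) ≃+ Γ(structureModule Z, U) := AddEquiv.refl _

def resO {U V : Z.Opens} (h : V ≤ U) : Γ(Z, U) →+* Γ(Z, V) := (Z.presheaf.map (homOfLE h).op).hom

def resM (M : Z.Modules) {U V : Z.Opens} (h : V ≤ U) : Γ(M, U) →+ Γ(M, V) := res M.presheaf h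

lemma resM_smul (M : Z.Modules) {U V : Z.Opens} (h : V ≤ U) (a : Γ(Z, U)) (m : Γ(M, U)) :
    resM M h (a • m) = resO h a • resM M h m :=
  Scheme.Modules.map_smul M (homOfLE h) a m

lemma resM_resM (M : Z.Modules) {U V W : Z.Opens} (h : V ≤ U) (h' : W ≤ V) (m : Γ(M, U)) :
    resM M h' (resM M h m) = resM M (h'.trans h) m := res_res _ h h' m

lemma resO_resO {U V W : Z.Opens} (h : V ≤ U) (h' : W ≤ V) (a : Γ(Z, U)) :
    resO h' (resO h a) = resO (h'.trans h) a := by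
  simp only [resO]
  rw [← CommRingCat.comp_apply, ← Functor.map_comp]
  rfl

lemma toO_res {U V : Z.Opens} (h : V ≤ U) (a : Γ(Z, U)) :
    resM (structureModule Z) h (toO U a) = toO V (resO h a) := rfl

abbrev Sub (U : Z.Opens) : Type := {W : Z.Opens // W ≤ U}

/-- Additive endomorphisms of the sheaf `M` over the open set `U`; a (noncommutative) ring. These are
the sections over `U` of the sheaf of additive endomorphisms. -/
def LocalEnd (M : Z.Modules) (U : Z.Opens) :
    Subring (∀ W : Sub U, AddMonoid.End Γ(M, W.1)) where
  carrier := {P | ∀ (W W' : Sub U) (h : W'.1 ≤ W.1) (m : Γ(M, W.1)),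
    resM M h (P W m) = P W' (resM M h m)}
  mul_mem' := by
    intro P Q hP hQ W W' h m
    exact (hP W W' h (Q W m)).trans (congrArg (P W') (hQ W W' h m))
  one_mem' := fun _ _ _ _ => rfl
  add_mem' := by
    intro P Q hP hQ W W' h m
    exact (map_add (resM M h) (P W m) (Q W m)).trans
      (congrArg₂ (· + ·) (hP W W' h m) (hQ W W' h m))
  zero_mem' := fun _ _ h _ => map_zero (resM M h)
  neg_mem' := by
    intro P hP W W' h m
    exact (map_neg (resM M h) (P W m)).trans (congrArg (- ·) (hP W W' h m))

namespace LocalEnd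

def restrict {M : Z.Modules} {U V : Z.Opens} (h : V ≤ U) : LocalEnd M U →+* LocalEnd M V where
  toFun P := ⟨fun W => P.1 ⟨W.1, W.2.trans h⟩,
    fun W W' h' m => P.2 ⟨W.1, W.2.trans h⟩ ⟨W'.1, W'.2.trans h⟩ h' m⟩
  map_one' := rfl
  map_mul' _ _ := rfl
  map_zero' := rfl
  map_add' _ _ := rfl

/-- The action of a local endomorphism on sections over `W ⊆ U`. -/
def act {M : Z.Modules} {U : Z.Opens} (P : LocalEnd M U) (W : Z.Opens) (h : W ≤ U) :
    Γ(M, W) →+ Γ(M, W) := P.1 ⟨W, h⟩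

/-- The same for endomorphisms of the structure sheaf, on functions. -/
def actO {U : Z.Opens} (P : LocalEnd (structureModule Z) U) (W : Z.Opens) (h : W ≤ U)
    (a : Γ(Z, W)) : Γ(Z, W) := (toO W).symm (act P W h (toO W a))

end LocalEnd

/-- Multiplication by a function, a differential operator of order zero. -/
def mulEnd (M : Z.Modules) (U : Z.Opens) : Γ(Z, U) →+* LocalEnd M U where
  toFun a := ⟨fun W => Module.toAddMonoidEnd Γ(Z, W.1) Γ(M, W.1) (resO W.2 a), by
    intro W W' h m
    refine (resM_smul M h (resO W.2 a) m).trans ?_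
    rw [resO_resO]
    rfl⟩
  map_one' := by ext; simp
  map_mul' a b := by ext; simp
  map_zero' := by ext; simp
  map_add' a b := by ext; simp

/-- `𝒪`-linear homomorphisms `Ω → 𝒪` over `U`: the sections of the dual sheaf. -/
def LocalHom (Ω : Z.Modules) (U : Z.Opens) :
    AddSubgroup (∀ W : Sub U, Γ(Ω, W.1) →ₗ[Γ(Z, W.1)] Γ(Z, W.1)) where
  carrier := {u | ∀ (W W' : Sub U) (h : W'.1 ≤ W.1) (η : Γ(Ω, W.1)),
    resO h (u W η) = u W' (resM Ω h η)}
  add_mem' := by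
    intro u v hu hv W W' h m
    simp only [Pi.add_apply, LinearMap.add_apply, map_add]
    rw [hu W W' h, hv W W' h]
  zero_mem' := fun _ _ h _ => map_zero (resO h)
  neg_mem' := by
    intro u hu W W' h m
    simp only [Pi.neg_apply, LinearMap.neg_apply, map_neg]
    rw [hu W W' h]

def LocalHom.restrict {Ω : Z.Modules} {U V : Z.Opens} (h : V ≤ U) (u : LocalHom Ω U) : LocalHom Ω V :=
  ⟨fun W => u.1 ⟨W.1, W.2.trans h⟩,
    fun W W' h' m => u.2 ⟨W.1, W.2.trans h⟩ ⟨W'.1, W'.2.trans h⟩ h' m⟩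

variable {Ω : Z.Modules} (D : SheafDerivation Ω)

lemma SheafDerivation.natural' {U V : Z.Opens} (h : V ≤ U) (a : Γ(Z, U)) :
    resM Ω h (D.d U a) = D.d V (resO h a) := D.natural h a

/-- The derivation `u ∘ d` of the structure sheaf given by `u : Ω → 𝒪`. -/
def derOf (U : Z.Opens) : LocalHom Ω U →+ LocalEnd (structureModule Z) U where
  toFun u := ⟨fun W => (toO W.1).toAddMonoidHom.comp
      ((u.1 W).toAddMonoidHom.comp ((D.d W.1).comp (toO W.1).symm.toAddMonoidHom)), by
    intro W W' h m
    have := u.2 W W' h (D.d W.1 ((toO W.1).symm m))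
    rw [D.natural'] at this
    exact this⟩
  map_zero' := rfl
  map_add' _ _ := rfl

/-- The sections over `U` of `T(log)`, the sheaf of logarithmic derivations: all `u ∘ d` with
`u` in the dual of `Ω¹(log)`. -/
def logDer (U : Z.Opens) : AddSubgroup (LocalEnd (structureModule Z) U) := (derOf D U).range

lemma restrict_mem_logDer {U V : Z.Opens} (h : V ≤ U) {δ : LocalEnd (structureModule Z) U}
    (hδ : δ ∈ logDer D U) : LocalEnd.restrict h δ ∈ logDer D V := by
  obtain ⟨u, rfl⟩ := hδ
  exact ⟨LocalHom.restrict h u, rfl⟩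

/-- The sheaf `T(log)`, as a presheaf of abelian groups. -/
def logDerPresheaf : TopCat.Presheaf AddCommGrpCat.{0} Z where
  obj U := AddCommGrpCat.of (logDer D U.unop)
  map {U V} h := AddCommGrpCat.ofHom
    { toFun := fun δ => ⟨LocalEnd.restrict h.unop.le δ.1, restrict_mem_logDer D h.unop.le δ.2⟩
      map_zero' := rfl
      map_add' := fun _ _ => rfl }
  map_id _ := rfl
  map_comp _ _ := rfl

/-- Logarithmic differential operators over `U`: locally in the ring generated by functions and
logarithmic derivations. -/
def logDiffOp (U : Z.Opens) : Set (LocalEnd (structureModule Z) U) :=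
  {P | ∀ x ∈ U, ∃ (W : Z.Opens) (h : W ≤ U), x ∈ W ∧ LocalEnd.restrict h P ∈
    Subring.closure ((Set.range (mulEnd (structureModule Z) W)) ∪ (logDer D W : Set _))}

/-- Logarithmic differential operators of order at most `k`: order zero means multiplication by a
function, and `P` has order at most `k + 1` if all `[P, a]` have order at most `k`. -/
def logDiffOpOrder : ℕ → ∀ U : Z.Opens, Set (LocalEnd (structureModule Z) U)
  | 0, U => Set.range (mulEnd (structureModule Z) U)
  | k + 1, U => {P | P ∈ logDiffOp D U ∧ ∀ (W : Z.Opens) (h : W ≤ U) (a : Γ(Z, W)),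
      LocalEnd.restrict h P * mulEnd _ W a - mulEnd _ W a * LocalEnd.restrict h P ∈
        logDiffOpOrder k W}

variable (L : Z.Modules)

/-- `e` is a nowhere vanishing section: `a ↦ a e` trivializes `L` over `U`. -/
def IsGenerator (U : Z.Opens) (e : Γ(L, U)) : Prop :=
  ∀ (W : Z.Opens) (h : W ≤ U),
    Function.Bijective fun a : Γ(Z, W) => a • resM L h e

/-- `L` is an invertible sheaf. -/
def IsLineBundle : Prop :=
  ∀ x : Z, ∃ U : Z.Opens, x ∈ U ∧ ∃ e : Γ(L, U), IsGenerator L U e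

variable {L} in
/-- `P (a e) = Q(a) e`: the operator `P` on `L` is `e ⊗ Q ⊗ e⁻¹`. -/
def IsConjugate {U : Z.Opens} (e : Γ(L, U)) (Q : LocalEnd (structureModule Z) U)
    (P : LocalEnd L U) : Prop :=
  ∀ (W : Z.Opens) (h : W ≤ U) (a : Γ(Z, W)),
    LocalEnd.act P W h (a • resM L h e) = LocalEnd.actO Q W h a • resM L h e

/-- `D^k(L) = L ⊗ D^k ⊗ L^*`: logarithmic differential operators of order at most `k` on `L`. -/
def twistedDiffOp (k : ℕ) (U : Z.Opens) : Set (LocalEnd L U) :=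
  {P | ∀ x ∈ U, ∃ (W : Z.Opens) (h : W ≤ U), x ∈ W ∧ ∃ e : Γ(L, W), IsGenerator L W e ∧
    ∃ Q ∈ logDiffOpOrder D k W, IsConjugate e Q (LocalEnd.restrict h P)}

variable {L} in
/-- `δ` is the symbol of the first order operator `P`: `P(a m) - a P(m) = δ(a) m`. -/
def IsSymbolOne {U : Z.Opens} (P : LocalEnd L U) (δ : LocalEnd (structureModule Z) U) : Prop :=
  ∀ (W : Z.Opens) (h : W ≤ U) (a : Γ(Z, W)) (m : Γ(L, W)),
    LocalEnd.act P W h (a • m) - a • LocalEnd.act P W h m = LocalEnd.actO δ W h a • m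

variable (Ω) in
/-- Global sections of `S² T`: symmetric tensors in `T ⊗ T` for `T` the dual of `Ω`, written as
symmetric `𝒪`-bilinear forms on `Ω` (the two agree since `Ω¹(log)` is locally free of finite rank). -/
structure SymTensor where
  app : ∀ W : Z.Opens, Γ(Ω, W) →ₗ[Γ(Z, W)] Γ(Ω, W) →ₗ[Γ(Z, W)] Γ(Z, W)
  symm : ∀ (W : Z.Opens) (η ξ : Γ(Ω, W)), app W η ξ = app W ξ η
  natural : ∀ {W V : Z.Opens} (h : V ≤ W) (η ξ : Γ(Ω, W)),
    resO h (app W η ξ) = app V (resM Ω h η) (resM Ω h ξ)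

variable {L} in
/-- `ω` is the symbol of the second order operator `P` on `L`: locally
`P = e ⊗ (∑ u_k v_k + (order at most 1)) ⊗ e⁻¹` with logarithmic derivations `u_k`, `v_k`, and
`ω = ∑ (u_k ⊗ v_k + v_k ⊗ u_k)`, that is `ω(da, db) = [[P, a], b]`. -/
def IsSymbolTwo {U : Z.Opens} (P : LocalEnd L U) (ω : SymTensor Ω) : Prop :=
  ∀ x ∈ U, ∃ (W : Z.Opens) (h : W ≤ U), x ∈ W ∧ ∃ e : Γ(L, W), IsGenerator L W e ∧
    ∃ (n : ℕ) (u v : Fin n → LocalHom Ω W), ∃ Q ∈ logDiffOpOrder D 1 W,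
      IsConjugate e (Q + ∑ k, derOf D W (u k) * derOf D W (v k)) (LocalEnd.restrict h P) ∧
      ∀ (W' : Z.Opens) (h' : W' ≤ W) (η ξ : Γ(Ω, W')),
        ω.app W' η ξ = ∑ k, ((u k).1 ⟨W', h'⟩ η * (v k).1 ⟨W', h'⟩ ξ +
          (u k).1 ⟨W', h'⟩ ξ * (v k).1 ⟨W', h'⟩ η)

/-- The contraction `η ↦ ω(η, ·)`. -/
def contractSection (ω : SymTensor Ω) (U : Z.Opens) : Γ(Ω, U) →+ LocalHom Ω U where
  toFun η := ⟨fun W => ω.app W.1 (resM Ω W.2 η), by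
    intro W W' h ξ
    rw [ω.natural h, resM_resM]⟩
  map_zero' := by ext; simp
  map_add' a b := by ext; simp

/-- The contraction `Ω¹(log) → T(log)` with `ω`: a form `η` goes to the derivation
`a ↦ ω(η, da)`. -/
def contract (ω : SymTensor Ω) : Ω.presheaf ⟶ logDerPresheaf D where
  app U := AddCommGrpCat.ofHom
    (((derOf D U.unop).rangeRestrict).comp (contractSection ω U.unop))
  naturality U V h := by
    ext η
    have key : contractSection ω V.unop (resM Ω h.unop.le η) =
        LocalHom.restrict h.unop.le (contractSection ω U.unop η) :=
      Subtype.ext (funext fun W => congrArg (ω.app W.1) (resM_resM Ω h.unop.le W.2 η))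
    exact Subtype.ext (congrArg (derOf D V.unop) key)

/-- The sheaf of units `𝒪^*`, written additively. -/
def unitsPresheaf (Z : Scheme.{0}) : TopCat.Presheaf AddCommGrpCat.{0} Z where
  obj U := AddCommGrpCat.of (Additive Γ(Z, U.unop)ˣ)
  map h := AddCommGrpCat.ofHom (Units.map (Z.presheaf.map h).hom.toMonoidHom).toAdditive
  map_id U := by
    ext a
    refine Additive.toMul.injective (Units.ext ?_)
    change Z.presheaf.map (𝟙 U) _ = _
    rw [Z.presheaf.map_id]; rfl
  map_comp g h := by
    ext a
    refine Additive.toMul.injective (Units.ext ?_)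
    change Z.presheaf.map (g ≫ h) _ = _
    rw [Z.presheaf.map_comp]; rfl

/-- `u ↦ du / u`. -/
def dlogSection (U : Z.Opens) : Additive Γ(Z, U)ˣ →+ Γ(Ω, U) :=
  AddMonoidHom.mk' (fun u => (↑(u.toMul)⁻¹ : Γ(Z, U)) • D.d U (u.toMul : Γ(Z, U))) fun u v => by
    obtain ⟨u, rfl⟩ := Additive.ofMul.surjective u
    obtain ⟨v, rfl⟩ := Additive.ofMul.surjective v
    have h₁ : ((u * v)⁻¹ : Γ(Z, U)ˣ).val * u.val = (v⁻¹ : Γ(Z, U)ˣ).val := by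
      rw [mul_inv, Units.val_mul, mul_right_comm, Units.inv_mul, one_mul]
    have h₂ : ((u * v)⁻¹ : Γ(Z, U)ˣ).val * v.val = (u⁻¹ : Γ(Z, U)ˣ).val := by
      rw [mul_inv, Units.val_mul, mul_assoc, Units.inv_mul, mul_one]
    change ((u * v)⁻¹ : Γ(Z, U)ˣ).val • D.d U (u.val * v.val) =
      (u⁻¹ : Γ(Z, U)ˣ).val • D.d U u.val + (v⁻¹ : Γ(Z, U)ˣ).val • D.d U v.val
    rw [D.leibniz, smul_add, smul_smul, smul_smul, h₁, h₂, add_comm]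

/-- The logarithmic derivative `𝒪^* → Ω¹(log)`. -/
def dlog : unitsPresheaf Z ⟶ Ω.presheaf where
  app U := AddCommGrpCat.ofHom (dlogSection D U.unop)
  naturality U V h := by
    ext u
    symm
    refine (resM_smul Ω h.unop.le _ _).trans ?_
    rw [D.natural']
    rfl

/-- Nowhere vanishing local sections `e_x` of `L` around all points. -/
structure LocalTrivialization where
  cover : PointCover Z
  gen : ∀ x, Γ(L, cover.nbhd x)
  isGenerator : ∀ x, IsGenerator L (cover.nbhd x) (gen x)

variable {L}

/-- A chosen family of local trivializations. -/
def IsLineBundle.trivialization (hL : IsLineBundle L) : LocalTrivialization L where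
  cover := ⟨fun x => (hL x).choose, fun x => (hL x).choose_spec.1⟩
  gen x := (hL x).choose_spec.2.choose
  isGenerator x := (hL x).choose_spec.2.choose_spec

namespace LocalTrivialization
variable (t : LocalTrivialization L)

lemma exists_unit (x y : Z) : ∃ u : Γ(Z, t.cover.nbhd x ⊓ t.cover.nbhd y)ˣ,
    u.val • resM L inf_le_left (t.gen x) = resM L inf_le_right (t.gen y) := by
  obtain ⟨u, hu⟩ := (t.isGenerator x _ inf_le_left).2
    (resM L (inf_le_right : t.cover.nbhd x ⊓ t.cover.nbhd y ≤ _) (t.gen y))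
  obtain ⟨v, hv⟩ := (t.isGenerator y _ inf_le_right).2
    (resM L (inf_le_left : t.cover.nbhd x ⊓ t.cover.nbhd y ≤ _) (t.gen x))
  simp only at hu hv
  have h : v * u = 1 := (t.isGenerator x _ inf_le_left).1 (by
    simp only [mul_smul, one_smul, hu, hv])
  exact ⟨⟨u, v, by rw [mul_comm]; exact h, h⟩, hu⟩

/-- The transition functions: `e_y = u_{xy} e_x`. -/
def unit (x y : Z) : Γ(Z, t.cover.nbhd x ⊓ t.cover.nbhd y)ˣ := (t.exists_unit x y).choose

lemma unit_smul (x y : Z) : (t.unit x y).val • resM L inf_le_left (t.gen x) =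
    resM L inf_le_right (t.gen y) := (t.exists_unit x y).choose_spec

lemma unit_smul_res (x y : Z) {W : Z.Opens} (h : W ≤ t.cover.nbhd x ⊓ t.cover.nbhd y) :
    resO h (t.unit x y).val • resM L (h.trans inf_le_left) (t.gen x) =
      resM L (h.trans inf_le_right) (t.gen y) := by
  have := congrArg (resM L h) (t.unit_smul x y)
  rwa [resM_smul, resM_resM, resM_resM] at this

/-- The cocycle `(u_{xy})` of units. -/
def unitCocycle : cocycles (unitsPresheaf Z) t.cover :=
  ⟨fun x y => Additive.ofMul (t.unit x y), by
    intro x y z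
    refine Additive.toMul.injective (Units.ext ?_)
    have hx : t.cover.nbhd x ⊓ t.cover.nbhd y ⊓ t.cover.nbhd z ≤ t.cover.nbhd x :=
      inf_le_left.trans inf_le_left
    apply (t.isGenerator x _ hx).1
    have h1 := t.unit_smul_res x y
      (inf_le_left : t.cover.nbhd x ⊓ t.cover.nbhd y ⊓ t.cover.nbhd z ≤ _)
    have h2 := t.unit_smul_res y z
      (inf_le_inf_right _ inf_le_right : t.cover.nbhd x ⊓ t.cover.nbhd y ⊓ t.cover.nbhd z ≤ _)
    have h3 := t.unit_smul_res x z
      (le_inf hx inf_le_right : t.cover.nbhd x ⊓ t.cover.nbhd y ⊓ t.cover.nbhd z ≤ _)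
    refine h3.trans (h2.symm.trans ?_)
    rw [← h1, smul_smul, mul_comm]
    rfl⟩

end LocalTrivialization

/-- The class of the line bundle in `H¹(𝒪^*)`. -/
def picClass (hL : IsLineBundle L) : HOne (unitsPresheaf Z) :=
  HOne.mk _ hL.trivialization.cover hL.trivialization.unitCocycle

/-- The logarithmic first Chern class: the image of the class of `L` under `d log`, represented by
`du_{xy} / u_{xy}`. -/
def chernClass (hL : IsLineBundle L) : HOne Ω.presheaf := HOne.map (dlog D) (picClass hL)

variable (L)

/-- Exactness of `0 → 𝒪 → D¹(L) → T(log) → 0` as a sequence of sheaves: functions act by first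
order operators, injectively; every first order operator has a unique symbol in `T(log)`; the
operators with symbol zero are the functions; symbols are locally onto. -/
structure IsExactOne : Prop where
  mulEnd_mem : ∀ (U : Z.Opens) (a : Γ(Z, U)), mulEnd L U a ∈ twistedDiffOp D L 1 U
  mulEnd_injective : ∀ U : Z.Opens, Function.Injective (mulEnd L U)
  exists_symbol : ∀ (U : Z.Opens), ∀ P ∈ twistedDiffOp D L 1 U,
    ∃! δ : LocalEnd (structureModule Z) U, δ ∈ logDer D U ∧ IsSymbolOne P δ
  kernel : ∀ (U : Z.Opens), ∀ P ∈ twistedDiffOp D L 1 U,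
    IsSymbolOne P 0 → P ∈ Set.range (mulEnd L U)
  surjective : ∀ (U : Z.Opens), ∀ δ ∈ logDer D U, ∀ x ∈ U, ∃ (W : Z.Opens) (h : W ≤ U), x ∈ W ∧
    ∃ P ∈ twistedDiffOp D L 1 W, IsSymbolOne P (LocalEnd.restrict h δ)

/-- An `𝒪`-linear splitting over `U` of the symbol map `D¹(L) → T(log)`. -/
structure LocalSplitting (U : Z.Opens) where
  app : ∀ W : Sub U, logDer D W.1 →+ LocalEnd L W.1
  mem : ∀ (W : Sub U) (δ : logDer D W.1), app W δ ∈ twistedDiffOp D L 1 W.1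
  smul : ∀ (W : Sub U) (a : Γ(Z, W.1)) (δ δ' : logDer D W.1),
    (δ' : LocalEnd (structureModule Z) W.1) = mulEnd _ W.1 a * δ.1 →
      app W δ' = mulEnd L W.1 a * app W δ
  natural : ∀ (W W' : Sub U) (h : W'.1 ≤ W.1) (δ : logDer D W.1),
    LocalEnd.restrict h (app W δ) =
      app W' ⟨LocalEnd.restrict h δ.1, restrict_mem_logDer D h δ.2⟩
  symbol : ∀ (W : Sub U) (δ : logDer D W.1), IsSymbolOne (app W δ) δ.1

/-- `c` is the class of the extension `0 → 𝒪 → D¹(L) → T(log) → 0` in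
`Ext¹(T(log), 𝒪) = H¹(Ω¹(log))`: for local splittings `ρ_x`, the differences
`ρ_x - ρ_y : T(log) → 𝒪` are the pairings with forms `η_{xy}`, and `c` is the class of `(η_{xy})`. -/
def IsExtensionClass (c : HOne Ω.presheaf) : Prop :=
  ∃ (U : PointCover Z) (ρ : ∀ x : Z, LocalSplitting D L (U.nbhd x))
    (η : cocycles Ω.presheaf U),
    (∀ (x y : Z) (W : Z.Opens) (hx : W ≤ U.nbhd x) (hy : W ≤ U.nbhd y) (u : LocalHom Ω W),
      (ρ x).app ⟨W, hx⟩ ⟨derOf D W u, u, rfl⟩ - (ρ y).app ⟨W, hy⟩ ⟨derOf D W u, u, rfl⟩ =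
        mulEnd L W (u.1 ⟨W, le_rfl⟩ (resM Ω (le_inf hx hy) (η.1 x y)))) ∧
    c = HOne.mk _ U η

/-- `c` is the image of `ω` under the connecting map `μ_L : H⁰(S²T(log)) → H¹(T(log))` of
`0 → T(log) → D²(L)/𝒪 → S²T(log) → 0`, where `T(log) = D¹(L)/𝒪`: lift `ω` locally to second order
operators `P_x` on `L`; then `c` is the class of the symbols of `P_y - P_x`. -/
def IsMu (ω : SymTensor Ω) (c : HOne (logDerPresheaf D)) : Prop :=
  ∃ (U : PointCover Z) (P : ∀ x : Z, LocalEnd L (U.nbhd x))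
    (v : cocycles (logDerPresheaf D) U),
    (∀ x, P x ∈ twistedDiffOp D L 2 (U.nbhd x) ∧ IsSymbolTwo D (P x) ω) ∧
    (∀ x y, LocalEnd.restrict inf_le_right (P y) - LocalEnd.restrict inf_le_left (P x) ∈
        twistedDiffOp D L 1 (U.nbhd x ⊓ U.nbhd y) ∧
      IsSymbolOne (LocalEnd.restrict inf_le_right (P y) - LocalEnd.restrict inf_le_left (P x))
        (v.1 x y : logDer D (U.nbhd x ⊓ U.nbhd y)).1) ∧
    c = HOne.mk _ U v

/-- The cup product with `ω`, followed by the contraction: `H¹(Ω¹(log)) → H¹(T(log))`. -/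
def cup (ω : SymTensor Ω) (c : HOne Ω.presheaf) : HOne (logDerPresheaf D) :=
  HOne.map (contract D ω) c

end Calculus

section Family
variable {X S : Scheme.{0}}

/-- The functions `x` define an etale map from `V` to affine space over `ℂ`. -/
def IsEtaleCoordinates {V : Scheme.{0}} (p : V ⟶ Spec (CommRingCat.of ℂ)) {n : Type}
    (x : n → Γ(V, ⊤)) : Prop :=
  Etale (AffineSpace.homOfVector p x)

/-- The ideal sheaf `I` is generated by the function `t`. -/
def IsGeneratedBy {V : Scheme.{0}} (I : V.IdealSheafData) (t : Γ(V, ⊤)) : Prop :=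
  ∀ U : V.affineOpens, I.ideal U = Ideal.span {resO le_top t}

/-- Etale locally around `y`, the divisor `Δ` is given by a product of distinct coordinates
(possibly none of them). -/
def HasNormalCrossingChart (p : S ⟶ Spec (CommRingCat.of ℂ)) (Δ : S.IdealSheafData) (y : S) :
    Prop :=
  ∃ (V : Scheme.{0}) (v : V ⟶ S) (m : ℕ) (π : Fin m → Γ(V, ⊤)) (J : Finset (Fin m)),
    Etale v ∧ y ∈ Set.range v ∧ IsEtaleCoordinates (v ≫ p) π ∧
    IsGeneratedBy (Δ.comap v) (∏ j ∈ J, π j)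

/-- Etale locally around `x`, the map `f` has the form `π_i = ∏_{k ∈ I} ξ_k` where the `ξ` and the
`π_j`, `j ≠ i`, are coordinates upstairs, the `π` are coordinates downstairs, and `Δ` is given by the
product of some of the `π`, among them `π_i`. -/
def HasSemistableChart (p : S ⟶ Spec (CommRingCat.of ℂ)) (f : X ⟶ S) (Δ : S.IdealSheafData)
    (d : ℕ) (x : X) : Prop :=
  ∃ (V U : Scheme.{0}) (v : V ⟶ S) (u : U ⟶ X) (g : U ⟶ V) (m : ℕ) (π : Fin m → Γ(V, ⊤))
    (i : Fin m) (J : Finset (Fin m)) (ξ : Fin (d + 1) → Γ(U, ⊤)) (I : Finset (Fin (d + 1))),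
    Etale v ∧ Etale u ∧ x ∈ Set.range u ∧ u ≫ f = g ≫ v ∧
    IsEtaleCoordinates (v ≫ p) π ∧
    i ∈ J ∧ IsGeneratedBy (Δ.comap v) (∏ j ∈ J, π j) ∧
    IsEtaleCoordinates (u ≫ f ≫ p)
      (Sum.elim ξ fun j : {j : Fin m // j ≠ i} => g.appTop (π j)) ∧
    I.Nonempty ∧ g.appTop (π i) = ∏ k ∈ I, ξ k

/-- The map `f` is smooth of relative dimension `d` around `x`. -/
def IsSmoothAt (f : X ⟶ S) (d : ℕ) (x : X) : Prop :=
  ∃ U : X.Opens, x ∈ U ∧ SmoothOfRelativeDimension d (U.ι ≫ f)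

/-- A log smooth family of relative dimension `d` over `ℂ`: smooth total space and base, `f` flat,
`Δ` a reduced normal crossing divisor, and `f` locally either smooth or a product of coordinates.
Then `Y = f⁻¹(Δ)` is a reduced normal crossing divisor and the fibres have normal crossings. -/
structure IsLogSmoothFamily (p : S ⟶ Spec (CommRingCat.of ℂ)) (f : X ⟶ S)
    (Δ : S.IdealSheafData) (d : ℕ) : Prop where
  smooth_base : Smooth p
  smooth_total : Smooth (f ≫ p)
  flat : Flat f
  normalCrossing_base : ∀ y : S, HasNormalCrossingChart p Δ y
  chart : ∀ x : X, IsSmoothAt f d x ∨ HasSemistableChart p f Δ d x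

end Family
end LogHeat
end

open LogHeat

/-!
Both statements are formal consequences of four properties of the differential `d̄ : 𝒪 → Ω¹(log)` on
the fibre, collected in `IsLogCalculus`: `Ω¹(log)` is locally free, a homomorphism `u : Ω¹(log) → 𝒪`
is determined by the derivation `u ∘ d̄`, the logarithmic derivations are closed under brackets, and
positive integers are invertible.

The formal part. Locally, in dual frames of forms and derivations, an operator is a polynomial in
logarithmic derivations, and its leading part is recovered from its commutators with functions: up
to lower degree, `k P` is `∑ Q_i ∂_i`, where the `∂_i` are the derivations of the frame and `Q_i` is
read off from the commutators of `P` (`IsPolar`). So an operator of degree `k` whose `k`-fold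
commutators vanish has degree less than `k` (`mem_opLT_of_isOrderLT`). Hence `𝒟¹ = 𝒪 ⊕ T(log)` and
the kernel of `σ₂` on `𝒟²` is `𝒟¹`. A local generator of `L` turns operators on `L` into operators
on `𝒪`, and changing the generator by a unit `u` conjugates them by `u`. Conjugation changes a
derivation `∂` by the function `∂(u)/u`, which is why the extension class is that of `d̄u/u`; it
changes an operator with second order symbol `ω` by a first order operator whose symbol is the
contraction of `ω` with `d̄u/u` (`HasSymbolTwo.conj_unit`), which is why `μ_L` and `μ_𝒪` differ by
the cup product with `c₁(L)`.

The geometric part (`isLogCalculus_logDifferential`). If `t` is a local equation of the divisor,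
logarithmic forms are the quotients `ω/t` with `dt ∧ ω` divisible by `t` (`mem_logForms_iff`); this
condition on `ω` is linear and involves regular forms only, so it descends along flat homomorphisms
and can be tested in étale coordinates. There the `dx/x` of the components of the divisor and the
`dx` of the other coordinates are a basis, and dividing by the forms of the base leaves the relation
that the forms `dξ_k/ξ_k` of the branches have sum zero. This makes the relative logarithmic forms
of the local rings free, first on the chart and then, by descent, below it. Functionals on them are
determined by their values on differentials because, on the branches `ξ_1 ⋯ ξ_r = 0` of the fibre,
functions `a_k` with `ξ_k a_k = 0` and `∑ a_k = 0` vanish (`IsLogChart.mem_of_branches`), and they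
lift from the fibre to logarithmic derivations of the total space, whose brackets are logarithmic.
Bases and identities found at one local ring extend to a neighbourhood, as a form is given by
finitely many functions; for the bracket this uses that a derivation over `ℂ` which kills generators
of a finitely generated algebra vanishes.
-/

noncomputable section
namespace LogHeat

section
/-! ### Gluing sections and homomorphisms -/

variable {Z : Scheme.{0}}

lemma function_ext {U : Z.Opens} {a b : Γ(Z, U)}
    (h : ∀ x ∈ U, ∃ (W : Z.Opens) (hW : W ≤ U), x ∈ W ∧ resO hW a = resO hW b) : a = b := by
  choose W hW hx hab using h
  refine TopCat.Sheaf.eq_of_locally_eq' Z.sheaf (fun x : U => W x.1 x.2) U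
    (fun x => homOfLE (hW x.1 x.2)) ?_ a b fun x => hab x.1 x.2
  intro x hxU
  exact Opens.mem_iSup.2 ⟨⟨x, hxU⟩, hx x hxU⟩

lemma section_ext (M : Z.Modules) {U : Z.Opens} {a b : Γ(M, U)}
    (h : ∀ x ∈ U, ∃ (W : Z.Opens) (hW : W ≤ U), x ∈ W ∧ resM M hW a = resM M hW b) : a = b := by
  choose W hW hx hab using h
  refine TopCat.Sheaf.eq_of_locally_eq' ⟨M.presheaf, M.isSheaf⟩ (fun x : U => W x.1 x.2) U
    (fun x => homOfLE (hW x.1 x.2)) ?_ a b fun x => hab x.1 x.2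
  intro x hxU
  exact Opens.mem_iSup.2 ⟨⟨x, hxU⟩, hx x hxU⟩

lemma function_glue {ι : Type} {U : Z.Opens} (W : ι → Z.Opens) (hW : ∀ i, W i ≤ U)
    (hU : ∀ x ∈ U, ∃ i, x ∈ W i) (a : ∀ i, Γ(Z, W i))
    (ha : ∀ i j, resO (inf_le_left : W i ⊓ W j ≤ W i) (a i) = resO inf_le_right (a j)) :
    ∃ b : Γ(Z, U), ∀ i, resO (hW i) b = a i := by
  obtain ⟨b, hb, -⟩ := TopCat.Sheaf.existsUnique_gluing' Z.sheaf W U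
    (fun i => homOfLE (hW i)) (fun x hx => Opens.mem_iSup.2 (hU x hx)) a
    (fun i j => ha i j)
  exact ⟨b, hb⟩

lemma LocalHom.natural {Ω : Z.Modules} {U W W' : Z.Opens} (u : LocalHom Ω U) (hW : W ≤ U)
    (h : W' ≤ W) (η : Γ(Ω, W)) :
    resO h (u.1 ⟨W, hW⟩ η) = u.1 ⟨W', h.trans hW⟩ (resM Ω h η) := u.2 ⟨W, hW⟩ ⟨W', h.trans hW⟩ h η

lemma LocalHom.ext_sub {Ω : Z.Modules} {U : Z.Opens} {u v : LocalHom Ω U}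
    (h : ∀ (W : Z.Opens) (hW : W ≤ U) (η : Γ(Ω, W)), u.1 ⟨W, hW⟩ η = v.1 ⟨W, hW⟩ η) : u = v :=
  Subtype.ext (funext fun W => LinearMap.ext fun η => h W.1 W.2 η)

lemma LocalHom.glue {Ω : Z.Modules} {ι : Type} {U : Z.Opens} (W : ι → Z.Opens) (hW : ∀ i, W i ≤ U)
    (hU : ∀ x ∈ U, ∃ i, x ∈ W i) (u : ∀ i, LocalHom Ω (W i))
    (hu : ∀ i j, LocalHom.restrict (inf_le_left : W i ⊓ W j ≤ W i) (u i) =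
      LocalHom.restrict inf_le_right (u j)) :
    ∃ v : LocalHom Ω U, ∀ i, LocalHom.restrict (hW i) v = u i := by
  have key : ∀ (V : Z.Opens) (hV : V ≤ U) (η : Γ(Ω, V)), ∃ b : Γ(Z, V),
      ∀ i (V' : Z.Opens) (h : V' ≤ V) (h' : V' ≤ W i), resO h b = (u i).1 ⟨V', h'⟩ (resM Ω h η) := by
    intro V hV η
    obtain ⟨b, hb⟩ := function_glue (U := V) (fun i => V ⊓ W i) (fun i => inf_le_left)
      (fun x hx => by obtain ⟨i, hi⟩ := hU x (hV hx); exact ⟨i, hx, hi⟩)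
      (fun i => (u i).1 ⟨V ⊓ W i, inf_le_right⟩ (resM Ω inf_le_left η)) (by
        intro i j
        rw [LocalHom.natural, LocalHom.natural, resM_resM, resM_resM]
        have := congrArg (fun v : LocalHom Ω (W i ⊓ W j) =>
          v.1 ⟨(V ⊓ W i) ⊓ (V ⊓ W j), inf_le_inf inf_le_right inf_le_right⟩
            (resM Ω (inf_le_left.trans inf_le_left) η)) (hu i j)
        exact this)
    refine ⟨b, fun i V' h h' => ?_⟩
    have := congrArg (resO (le_inf h h' : V' ≤ V ⊓ W i)) (hb i)
    rw [resO_resO, LocalHom.natural, resM_resM] at this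
    exact this
  choose b hb using key
  have huniq : ∀ (V : Z.Opens) (hV : V ≤ U) (η : Γ(Ω, V)) (c : Γ(Z, V)),
      (∀ i (V' : Z.Opens) (h : V' ≤ V) (h' : V' ≤ W i), resO h c = (u i).1 ⟨V', h'⟩ (resM Ω h η)) →
        b V hV η = c := by
    intro V hV η c hc
    refine function_ext fun x hx => ?_
    obtain ⟨i, hi⟩ := hU x (hV hx)
    exact ⟨V ⊓ W i, inf_le_left, ⟨hx, hi⟩, by
      rw [hb V hV η i _ inf_le_left inf_le_right, hc i _ inf_le_left inf_le_right]⟩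
  refine ⟨⟨fun V => { toFun := b V.1 V.2, map_add' := ?_, map_smul' := ?_ }, ?_⟩, ?_⟩
  · intro η ξ
    refine huniq _ _ _ _ fun i V' h h' => ?_
    rw [map_add, map_add, map_add, hb, hb]
  · intro c η
    refine huniq _ _ _ _ fun i V' h h' => ?_
    rw [RingHom.id_apply, smul_eq_mul, map_mul, resM_smul, map_smul, smul_eq_mul, hb _ _ _ i V' h h']
  · intro V V' h η
    symm
    refine huniq _ _ _ _ fun i V'' h' h'' => ?_
    rw [resO_resO, resM_resM]
    exact hb _ _ _ i _ (h'.trans h) h''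
  · intro i
    refine LocalHom.ext_sub fun V hV η => ?_
    have := hb V (hV.trans (hW i)) η i V le_rfl hV
    simp only [resO, resM, res_self, homOfLE_refl, op_id, CategoryTheory.Functor.map_id,
      CommRingCat.hom_id, RingHom.id_apply] at this
    exact this
end

section
/-! ### Operators on a line bundle -/

variable {Z : Scheme.{0}}

@[simp] lemma resO_self {U : Z.Opens} (h : U ≤ U) (a : Γ(Z, U)) : resO h a = a := by
  simp [resO]

@[simp] lemma resM_self (M : Z.Modules) {U : Z.Opens} (h : U ≤ U) (a : Γ(M, U)) :
    resM M h a = a := res_self _ h a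

namespace LocalEnd
variable {M : Z.Modules} {U : Z.Opens}

lemma ext_act {P Q : LocalEnd M U}
    (h : ∀ (W : Z.Opens) (hW : W ≤ U) (m : Γ(M, W)), act P W hW m = act Q W hW m) : P = Q :=
  Subtype.ext (funext fun W => AddMonoidHom.ext fun m => h W.1 W.2 m)

lemma resM_act (P : LocalEnd M U) {W W' : Z.Opens} (hW : W ≤ U) (h : W' ≤ W) (m : Γ(M, W)) :
    resM M h (act P W hW m) = act P W' (h.trans hW) (resM M h m) :=
  P.2 ⟨W, hW⟩ ⟨W', h.trans hW⟩ h m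

lemma resO_actO (P : LocalEnd (structureModule Z) U) {W W' : Z.Opens} (hW : W ≤ U) (h : W' ≤ W)
    (a : Γ(Z, W)) : resO h (actO P W hW a) = actO P W' (h.trans hW) (resO h a) :=
  P.2 ⟨W, hW⟩ ⟨W', h.trans hW⟩ h a

@[simp] lemma act_restrict {V W : Z.Opens} (h : V ≤ U) (hW : W ≤ V) (P : LocalEnd M U) :
    act (restrict h P) W hW = act P W (hW.trans h) := rfl
@[simp] lemma restrict_self (h : U ≤ U) (P : LocalEnd M U) : restrict h P = P := rfl
@[simp] lemma restrict_restrict {V W : Z.Opens} (h : V ≤ U) (h' : W ≤ V) (P : LocalEnd M U) :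
    restrict h' (restrict h P) = restrict (h'.trans h) P := rfl
@[simp] lemma act_add (P Q : LocalEnd M U) (W : Z.Opens) (h : W ≤ U) (m : Γ(M, W)) :
    act (P + Q) W h m = act P W h m + act Q W h m := rfl
@[simp] lemma act_neg (P : LocalEnd M U) (W : Z.Opens) (h : W ≤ U) (m : Γ(M, W)) :
    act (-P) W h m = -act P W h m := rfl
@[simp] lemma act_sub (P Q : LocalEnd M U) (W : Z.Opens) (h : W ≤ U) (m : Γ(M, W)) :
    act (P - Q) W h m = act P W h m - act Q W h m := by
  rw [sub_eq_add_neg, act_add, act_neg, sub_eq_add_neg]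
@[simp] lemma act_mulEnd (a : Γ(Z, U)) (W : Z.Opens) (h : W ≤ U) (m : Γ(M, W)) :
    act (mulEnd M U a) W h m = resO h a • m := rfl
@[simp] lemma actO_restrict {V W : Z.Opens} (h : V ≤ U) (hW : W ≤ V)
    (P : LocalEnd (structureModule Z) U) :
    actO (restrict h P) W hW = actO P W (hW.trans h) := rfl
@[simp] lemma actO_mul (P Q : LocalEnd (structureModule Z) U) (W : Z.Opens) (h : W ≤ U)
    (m : Γ(Z, W)) : actO (P * Q) W h m = actO P W h (actO Q W h m) := rfl
@[simp] lemma actO_add (P Q : LocalEnd (structureModule Z) U) (W : Z.Opens) (h : W ≤ U)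
    (m : Γ(Z, W)) : actO (P + Q) W h m = actO P W h m + actO Q W h m := rfl
@[simp] lemma actO_zero (W : Z.Opens) (h : W ≤ U) (m : Γ(Z, W)) :
    actO (0 : LocalEnd (structureModule Z) U) W h m = 0 := rfl
@[simp] lemma actO_neg (P : LocalEnd (structureModule Z) U) (W : Z.Opens) (h : W ≤ U)
    (m : Γ(Z, W)) : actO (-P) W h m = -actO P W h m := rfl
@[simp] lemma actO_sub (P Q : LocalEnd (structureModule Z) U) (W : Z.Opens) (h : W ≤ U)
    (m : Γ(Z, W)) : actO (P - Q) W h m = actO P W h m - actO Q W h m := by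
  rw [sub_eq_add_neg, actO_add, actO_neg, sub_eq_add_neg]
@[simp] lemma actO_mulEnd (a : Γ(Z, U)) (W : Z.Opens) (h : W ≤ U) (m : Γ(Z, W)) :
    actO (mulEnd (structureModule Z) U a) W h m = resO h a * m := rfl

lemma ext_actO {P Q : LocalEnd (structureModule Z) U}
    (h : ∀ (W : Z.Opens) (hW : W ≤ U) (m : Γ(Z, W)), actO P W hW m = actO Q W hW m) : P = Q :=
  ext_act h

lemma restrict_mulEnd {V : Z.Opens} (h : V ≤ U) (a : Γ(Z, U)) :
    restrict h (mulEnd M U a) = mulEnd M V (resO h a) := by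
  refine ext_act fun W hW m => ?_
  simp [resO_resO]

lemma ext_locally {P Q : LocalEnd M U} (h : ∀ x ∈ U, ∃ (W : Z.Opens) (hW : W ≤ U), x ∈ W ∧
    restrict hW P = restrict hW Q) : P = Q := by
  refine ext_act fun V hV m => section_ext M fun x hx => ?_
  obtain ⟨W, hW, hxW, hPQ⟩ := h x (hV hx)
  refine ⟨V ⊓ W, inf_le_left, ⟨hx, hxW⟩, ?_⟩
  rw [resM_act, resM_act]
  exact congrArg (fun P : LocalEnd M W => act P (V ⊓ W) inf_le_right (resM M inf_le_left m)) hPQ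
end LocalEnd

variable {L : Z.Modules} {U : Z.Opens} {e : Γ(L, U)}

lemma IsGenerator.restrict (he : IsGenerator L U e) {V : Z.Opens} (h : V ≤ U) :
    IsGenerator L V (resM L h e) := by
  intro W hW
  simp only [resM_resM]
  exact he W (hW.trans h)

lemma IsGenerator.smul_injective (he : IsGenerator L U e) {W : Z.Opens} (h : W ≤ U)
    {a b : Γ(Z, W)} (hab : a • resM L h e = b • resM L h e) : a = b := (he W h).1 hab

lemma IsGenerator.exists_smul (he : IsGenerator L U e) {W : Z.Opens} (h : W ≤ U) (m : Γ(L, W)) :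
    ∃ a : Γ(Z, W), a • resM L h e = m := (he W h).2 m

/-- The trivialization `m ↦ m / e` of `L` by the generator `e`. -/
def IsGenerator.equiv (he : IsGenerator L U e) {W : Z.Opens} (h : W ≤ U) :
    Γ(Z, W) ≃+ Γ(L, W) :=
  AddEquiv.ofBijective (AddMonoidHom.mk' (fun a : Γ(Z, W) => a • resM L h e)
    fun _ _ => add_smul _ _ _) (he W h)

lemma IsGenerator.equiv_apply (he : IsGenerator L U e) {W : Z.Opens} (h : W ≤ U) (a : Γ(Z, W)) :
    he.equiv h a = a • resM L h e := rfl

lemma IsGenerator.resM_equiv (he : IsGenerator L U e) {W W' : Z.Opens} (h : W ≤ U) (h' : W' ≤ W)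
    (a : Γ(Z, W)) : resM L h' (he.equiv h a) = he.equiv (h'.trans h) (resO h' a) := by
  rw [he.equiv_apply, he.equiv_apply, resM_smul, resM_resM]

lemma IsGenerator.resO_equiv_symm (he : IsGenerator L U e) {W W' : Z.Opens} (h : W ≤ U)
    (h' : W' ≤ W) (m : Γ(L, W)) :
    resO h' ((he.equiv h).symm m) = (he.equiv (h'.trans h)).symm (resM L h' m) := by
  rw [AddEquiv.eq_symm_apply, ← he.resM_equiv h h', AddEquiv.apply_symm_apply]

/-- Transport of operators on functions to operators on `L` by a generator `e`: the operator
`e ⊗ Q ⊗ e⁻¹`. -/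
def IsGenerator.conj (he : IsGenerator L U e) :
    LocalEnd (structureModule Z) U ≃+* LocalEnd L U where
  toFun Q := ⟨fun W => (he.equiv W.2).toAddMonoidHom.comp
      ((Q.1 W).comp (he.equiv W.2).symm.toAddMonoidHom), by
    intro W W' h m
    refine (he.resM_equiv W.2 h _).trans ?_
    refine congrArg (he.equiv W'.2) ?_
    refine (LocalEnd.resO_actO Q W.2 h _).trans ?_
    exact congrArg (LocalEnd.actO Q W'.1 W'.2) (he.resO_equiv_symm W.2 h m)⟩
  invFun P := ⟨fun W => (he.equiv W.2).symm.toAddMonoidHom.comp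
      ((P.1 W).comp (he.equiv W.2).toAddMonoidHom), by
    intro W W' h m
    refine (he.resO_equiv_symm W.2 h _).trans ?_
    refine congrArg (he.equiv W'.2).symm ?_
    refine (LocalEnd.resM_act P W.2 h _).trans ?_
    exact congrArg (LocalEnd.act P W'.1 W'.2) (he.resM_equiv W.2 h m)⟩
  left_inv Q := Subtype.ext (funext fun W => AddMonoidHom.ext fun m =>
    ((he.equiv W.2).symm_apply_apply _).trans
      (congrArg (Q.1 W) ((he.equiv W.2).symm_apply_apply _)))
  right_inv P := Subtype.ext (funext fun W => AddMonoidHom.ext fun m =>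
    ((he.equiv W.2).apply_symm_apply _).trans
      (congrArg (P.1 W) ((he.equiv W.2).apply_symm_apply _)))
  map_mul' P Q := Subtype.ext (funext fun W => AddMonoidHom.ext fun m =>
    congrArg (he.equiv W.2) (congrArg (P.1 W) ((he.equiv W.2).symm_apply_apply _).symm))
  map_add' P Q := Subtype.ext (funext fun W => AddMonoidHom.ext fun m =>
    map_add (he.equiv W.2) _ _)

lemma IsGenerator.act_conj (he : IsGenerator L U e) (Q : LocalEnd (structureModule Z) U)
    (W : Z.Opens) (h : W ≤ U) (a : Γ(Z, W)) :
    LocalEnd.act (he.conj Q) W h (a • resM L h e) = LocalEnd.actO Q W h a • resM L h e :=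
  congrArg (he.equiv h) (congrArg (LocalEnd.actO Q W h) ((he.equiv h).symm_apply_apply a))

lemma IsGenerator.ext_act (he : IsGenerator L U e) {P Q : LocalEnd L U}
    (h : ∀ (W : Z.Opens) (hW : W ≤ U) (a : Γ(Z, W)), LocalEnd.act P W hW (a • resM L hW e) =
      LocalEnd.act Q W hW (a • resM L hW e)) : P = Q := by
  refine LocalEnd.ext_act fun W hW m => ?_
  obtain ⟨a, rfl⟩ := he.exists_smul hW m
  exact h W hW a

lemma IsGenerator.isConjugate_iff (he : IsGenerator L U e) {Q : LocalEnd (structureModule Z) U}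
    {P : LocalEnd L U} : IsConjugate e Q P ↔ P = he.conj Q := by
  constructor
  · intro h
    exact he.ext_act fun W hW a => (h W hW a).trans (he.act_conj Q W hW a).symm
  · rintro rfl W hW a
    exact he.act_conj Q W hW a

lemma IsGenerator.restrict_conj (he : IsGenerator L U e) {V : Z.Opens} (h : V ≤ U)
    (Q : LocalEnd (structureModule Z) U) :
    LocalEnd.restrict h (he.conj Q) = (he.restrict h).conj (LocalEnd.restrict h Q) := by
  refine (he.restrict h).isConjugate_iff.1 fun W hW a => ?_
  rw [resM_resM]
  exact he.act_conj Q W (hW.trans h) a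

@[simp] lemma IsGenerator.conj_mulEnd (he : IsGenerator L U e) (a : Γ(Z, U)) :
    he.conj (mulEnd _ U a) = mulEnd L U a := by
  symm
  refine he.isConjugate_iff.1 fun W hW b => ?_
  rw [LocalEnd.act_mulEnd, LocalEnd.actO_mulEnd, smul_smul]

/-- Change of generator. -/
lemma IsGenerator.conj_eq_of_smul {e' : Γ(L, U)} (he : IsGenerator L U e)
    (he' : IsGenerator L U e') (g : Γ(Z, U)ˣ) (hg : g.val • e = e')
    (Q : LocalEnd (structureModule Z) U) :
    he'.conj Q = he.conj (mulEnd _ U g.val * Q * mulEnd _ U (g⁻¹).val) := by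
  refine he.isConjugate_iff.1 fun W hW a => ?_
  have h1 : resM L hW e' = resO hW g.val • resM L hW e := by rw [← hg, resM_smul]
  have h2 : a • resM L hW e = (resO hW (g⁻¹).val * a) • resM L hW e' := by
    rw [h1, smul_smul, mul_right_comm, ← map_mul, Units.inv_mul, map_one, one_mul]
  rw [h2, he'.act_conj, h1, smul_smul]
  simp [mul_comm]

lemma IsGenerator.exists_unit {e' : Γ(L, U)} (he : IsGenerator L U e) (he' : IsGenerator L U e') :
    ∃ g : Γ(Z, U)ˣ, g.val • e = e' := by
  obtain ⟨u, hu⟩ := he.exists_smul le_rfl e'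
  obtain ⟨v, hv⟩ := he'.exists_smul le_rfl e
  rw [resM_self] at hu hv
  have h : v * u = 1 := he.smul_injective le_rfl (by
    rw [resM_self, mul_smul, one_smul, hu, hv])
  exact ⟨⟨u, v, by rw [mul_comm]; exact h, h⟩, hu⟩

lemma IsLineBundle.smul_injective (hL : IsLineBundle L) {W : Z.Opens} {a b : Γ(Z, W)}
    (h : ∀ (V : Z.Opens) (hV : V ≤ W) (m : Γ(L, V)), resO hV a • m = resO hV b • m) : a = b := by
  refine function_ext fun x hx => ?_
  obtain ⟨V, hxV, e, he⟩ := hL x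
  refine ⟨W ⊓ V, inf_le_left, ⟨hx, hxV⟩, he.smul_injective inf_le_right (h _ _ _)⟩

lemma isGenerator_one (U : Z.Opens) : IsGenerator (structureModule Z) U (toO U 1) := by
  intro W h
  have : ∀ a : Γ(Z, W), a • resM (structureModule Z) h (toO U 1) = toO W a := by
    intro a
    rw [toO_res, map_one]
    exact mul_one a
  simp only [this]
  exact (toO W).bijective

lemma isLineBundle_structureModule : IsLineBundle (structureModule Z) :=
  fun _ => ⟨⊤, trivial, _, isGenerator_one ⊤⟩

lemma conj_one (Q : LocalEnd (structureModule Z) U) : (isGenerator_one U).conj Q = Q := by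
  symm
  refine (isGenerator_one U).isConjugate_iff.1 fun W h a => ?_
  have : ∀ a : Γ(Z, W), a • resM (structureModule Z) h (toO U 1) = toO W a := by
    intro a
    rw [toO_res, map_one]
    exact mul_one a
  rw [this, this]
  rfl
end

section
/-! ### The order filtration on logarithmic operators -/

variable {Z : Scheme.{0}} {Ω : Z.Modules} (D : SheafDerivation Ω) {U : Z.Opens}

lemma actO_derOf (u : LocalHom Ω U) (W : Z.Opens) (h : W ≤ U) (a : Γ(Z, W)) :
    LocalEnd.actO (derOf D U u) W h a = u.1 ⟨W, h⟩ (D.d W a) := rfl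

lemma restrict_derOf {V : Z.Opens} (h : V ≤ U) (u : LocalHom Ω U) :
    LocalEnd.restrict h (derOf D U u) = derOf D V (LocalHom.restrict h u) := rfl

lemma actO_derOf_mul (u : LocalHom Ω U) (W : Z.Opens) (h : W ≤ U) (a b : Γ(Z, W)) :
    LocalEnd.actO (derOf D U u) W h (a * b) =
      a * LocalEnd.actO (derOf D U u) W h b + LocalEnd.actO (derOf D U u) W h a * b := by
  simp only [actO_derOf, D.leibniz, map_add, map_smul, smul_eq_mul]
  ring

instance : SMul Γ(Z, U) (LocalHom Ω U) where
  smul a u := ⟨fun W => resO W.2 a • u.1 W, by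
    intro W W' h η
    simp only [LinearMap.smul_apply, smul_eq_mul, map_mul, resO_resO]
    rw [LocalHom.natural u W.2 h]⟩

lemma LocalHom.smul_apply (a : Γ(Z, U)) (u : LocalHom Ω U) (W : Z.Opens) (h : W ≤ U)
    (η : Γ(Ω, W)) : (a • u).1 ⟨W, h⟩ η = resO h a * u.1 ⟨W, h⟩ η := rfl

lemma derOf_smul (a : Γ(Z, U)) (u : LocalHom Ω U) :
    derOf D U (a • u) = mulEnd _ U a * derOf D U u := rfl

variable {D}
lemma mulEnd_mul_mem_logDer (a : Γ(Z, U)) {δ : LocalEnd (structureModule Z) U}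
    (hδ : δ ∈ logDer D U) : mulEnd _ U a * δ ∈ logDer D U := by
  obtain ⟨u, rfl⟩ := hδ
  exact ⟨a • u, rfl⟩

lemma actO_logDer_mul {δ : LocalEnd (structureModule Z) U} (hδ : δ ∈ logDer D U)
    (W : Z.Opens) (h : W ≤ U) (a b : Γ(Z, W)) : LocalEnd.actO δ W h (a * b) =
      a * LocalEnd.actO δ W h b + LocalEnd.actO δ W h a * b := by
  obtain ⟨u, rfl⟩ := hδ
  exact actO_derOf_mul D u W h a b

lemma actO_logDer_one {δ : LocalEnd (structureModule Z) U} (hδ : δ ∈ logDer D U)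
    (W : Z.Opens) (h : W ≤ U) : LocalEnd.actO δ W h 1 = 0 := by
  simpa using actO_logDer_mul hδ W h 1 1

lemma logDer_comm_mulEnd {δ : LocalEnd (structureModule Z) U} (hδ : δ ∈ logDer D U)
    (a : Γ(Z, U)) : δ * mulEnd _ U a - mulEnd _ U a * δ =
      mulEnd _ U (LocalEnd.actO δ U le_rfl a) := by
  refine LocalEnd.ext_actO fun W h m => ?_
  simp only [LocalEnd.actO_sub, LocalEnd.actO_mul, LocalEnd.actO_mulEnd, actO_logDer_mul hδ,
    LocalEnd.resO_actO]
  ring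

lemma mulEnd_commute (M : Z.Modules) (a b : Γ(Z, U)) :
    mulEnd M U a * mulEnd M U b = mulEnd M U b * mulEnd M U a := by
  rw [← map_mul, mul_comm, map_mul]

variable (D)
/-- The ring generated over `U` by functions and logarithmic derivations. -/
abbrev logGenRing (U : Z.Opens) : Subring (LocalEnd (structureModule Z) U) :=
  Subring.closure ((Set.range (mulEnd (structureModule Z) U)) ∪ (logDer D U : Set _))

variable {D}
lemma restrict_mem_logGenRing {V : Z.Opens} (h : V ≤ U) {P : LocalEnd (structureModule Z) U}
    (hP : P ∈ logGenRing D U) : LocalEnd.restrict h P ∈ logGenRing D V := by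
  have : logGenRing D U ≤ (logGenRing D V).comap (LocalEnd.restrict h) := by
    refine Subring.closure_le.2 ?_
    rintro _ (⟨a, rfl⟩ | hδ)
    · exact Subring.subset_closure (Or.inl ⟨resO h a, (LocalEnd.restrict_mulEnd h a).symm⟩)
    · exact Subring.subset_closure (Or.inr (restrict_mem_logDer D h hδ))
  exact this hP

variable (D)
/-- Logarithmic differential operators form a ring. -/
def logDiffOpRing (U : Z.Opens) : Subring (LocalEnd (structureModule Z) U) where
  carrier := logDiffOp D U
  mul_mem' {P Q} hP hQ x hx := by
    obtain ⟨W, h, hxW, hP'⟩ := hP x hx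
    obtain ⟨W', h', hxW', hQ'⟩ := hQ x hx
    refine ⟨W ⊓ W', inf_le_left.trans h, ⟨hxW, hxW'⟩, ?_⟩
    rw [map_mul]
    exact mul_mem (restrict_mem_logGenRing (inf_le_left : W ⊓ W' ≤ W) hP')
      (restrict_mem_logGenRing (inf_le_right : W ⊓ W' ≤ W') hQ')
  one_mem' x hx := ⟨U, le_rfl, hx, one_mem _⟩
  add_mem' {P Q} hP hQ x hx := by
    obtain ⟨W, h, hxW, hP'⟩ := hP x hx
    obtain ⟨W', h', hxW', hQ'⟩ := hQ x hx
    refine ⟨W ⊓ W', inf_le_left.trans h, ⟨hxW, hxW'⟩, ?_⟩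
    rw [map_add]
    exact add_mem (restrict_mem_logGenRing (inf_le_left : W ⊓ W' ≤ W) hP')
      (restrict_mem_logGenRing (inf_le_right : W ⊓ W' ≤ W') hQ')
  zero_mem' x hx := ⟨U, le_rfl, hx, zero_mem _⟩
  neg_mem' {P} hP x hx := by
    obtain ⟨W, h, hxW, hP'⟩ := hP x hx
    exact ⟨W, h, hxW, by rw [map_neg]; exact neg_mem hP'⟩

variable {D}
lemma mulEnd_mem_logDiffOpRing (a : Γ(Z, U)) : mulEnd _ U a ∈ logDiffOpRing D U :=
  fun _ hx => ⟨U, le_rfl, hx, Subring.subset_closure (Or.inl ⟨a, rfl⟩)⟩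

lemma logDer_mem_logDiffOpRing {δ : LocalEnd (structureModule Z) U} (hδ : δ ∈ logDer D U) :
    δ ∈ logDiffOpRing D U :=
  fun _ hx => ⟨U, le_rfl, hx, Subring.subset_closure (Or.inr hδ)⟩

lemma restrict_mem_logDiffOpRing {V : Z.Opens} (h : V ≤ U) {P : LocalEnd (structureModule Z) U}
    (hP : P ∈ logDiffOpRing D U) : LocalEnd.restrict h P ∈ logDiffOpRing D V := by
  intro x hx
  obtain ⟨W, h', hxW, hP'⟩ := hP x (h hx)
  exact ⟨V ⊓ W, inf_le_left, ⟨hx, hxW⟩,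
    restrict_mem_logGenRing (inf_le_right : V ⊓ W ≤ W) hP'⟩

lemma mulEnd_mem_order (k : ℕ) (a : Γ(Z, U)) : mulEnd _ U a ∈ logDiffOpOrder D k U := by
  induction k generalizing U with
  | zero => exact ⟨a, rfl⟩
  | succ k ih =>
    refine ⟨mulEnd_mem_logDiffOpRing a, fun W h b => ?_⟩
    rw [LocalEnd.restrict_mulEnd, mulEnd_commute, sub_self, ← map_zero (mulEnd _ W)]
    exact ih _

lemma restrict_mem_order {k : ℕ} {V : Z.Opens} (h : V ≤ U) {P : LocalEnd (structureModule Z) U}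
    (hP : P ∈ logDiffOpOrder D k U) : LocalEnd.restrict h P ∈ logDiffOpOrder D k V := by
  cases k with
  | zero =>
    obtain ⟨a, rfl⟩ := hP
    exact ⟨resO h a, (LocalEnd.restrict_mulEnd h a).symm⟩
  | succ k => exact ⟨restrict_mem_logDiffOpRing h hP.1, fun W h' b => hP.2 W (h'.trans h) b⟩

lemma add_mem_order {k : ℕ} {P Q : LocalEnd (structureModule Z) U}
    (hP : P ∈ logDiffOpOrder D k U) (hQ : Q ∈ logDiffOpOrder D k U) :
    P + Q ∈ logDiffOpOrder D k U := by
  induction k generalizing U with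
  | zero =>
    obtain ⟨a, rfl⟩ := hP
    obtain ⟨b, rfl⟩ := hQ
    exact ⟨a + b, map_add _ _ _⟩
  | succ k ih =>
    refine ⟨(logDiffOpRing D U).add_mem hP.1 hQ.1, fun W h b => ?_⟩
    have := ih (hP.2 W h b) (hQ.2 W h b)
    convert this using 1
    rw [map_add, add_mul, mul_add]
    abel

lemma neg_mem_order {k : ℕ} {P : LocalEnd (structureModule Z) U}
    (hP : P ∈ logDiffOpOrder D k U) : -P ∈ logDiffOpOrder D k U := by
  induction k generalizing U with
  | zero =>
    obtain ⟨a, rfl⟩ := hP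
    exact ⟨-a, map_neg _ _⟩
  | succ k ih =>
    refine ⟨(logDiffOpRing D U).neg_mem hP.1, fun W h b => ?_⟩
    have := ih (hP.2 W h b)
    convert this using 1
    rw [map_neg, neg_mul, mul_neg]
    abel

lemma sub_mem_order {k : ℕ} {P Q : LocalEnd (structureModule Z) U}
    (hP : P ∈ logDiffOpOrder D k U) (hQ : Q ∈ logDiffOpOrder D k U) :
    P - Q ∈ logDiffOpOrder D k U := by
  rw [sub_eq_add_neg]
  exact add_mem_order hP (neg_mem_order hQ)

lemma order_succ {k : ℕ} {P : LocalEnd (structureModule Z) U}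
    (hP : P ∈ logDiffOpOrder D k U) : P ∈ logDiffOpOrder D (k + 1) U := by
  induction k generalizing U with
  | zero =>
    obtain ⟨a, rfl⟩ := hP
    exact mulEnd_mem_order 1 a
  | succ k ih => exact ⟨hP.1, fun W h b => ih (hP.2 W h b)⟩

lemma mulEnd_mul_mem_order {k : ℕ} (a : Γ(Z, U)) {P : LocalEnd (structureModule Z) U}
    (hP : P ∈ logDiffOpOrder D k U) : mulEnd _ U a * P ∈ logDiffOpOrder D k U := by
  induction k generalizing U with
  | zero =>
    obtain ⟨b, rfl⟩ := hP
    exact ⟨a * b, map_mul _ _ _⟩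
  | succ k ih =>
    refine ⟨(logDiffOpRing D U).mul_mem (mulEnd_mem_logDiffOpRing a) hP.1, fun W h b => ?_⟩
    have := ih (resO h a) (hP.2 W h b)
    convert this using 1
    rw [map_mul, LocalEnd.restrict_mulEnd, mul_sub, ← mul_assoc (mulEnd _ W b),
      mulEnd_commute _ b, mul_assoc, mul_assoc]

lemma mul_mulEnd_mem_order {k : ℕ} (a : Γ(Z, U)) {P : LocalEnd (structureModule Z) U}
    (hP : P ∈ logDiffOpOrder D k U) : P * mulEnd _ U a ∈ logDiffOpOrder D k U := by
  cases k with
  | zero =>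
    obtain ⟨b, rfl⟩ := hP
    exact ⟨b * a, map_mul _ _ _⟩
  | succ k =>
    have := add_mem_order (order_succ (hP.2 U le_rfl a)) (mulEnd_mul_mem_order a hP)
    simpa using this

/-- Conjugation by a unit preserves the order filtration. -/
lemma conj_unit_mem_order {k : ℕ} (g : Γ(Z, U)ˣ) {P : LocalEnd (structureModule Z) U}
    (hP : P ∈ logDiffOpOrder D k U) :
    mulEnd _ U g.val * P * mulEnd _ U (g⁻¹).val ∈ logDiffOpOrder D k U :=
  mul_mulEnd_mem_order _ (mulEnd_mul_mem_order _ hP)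

lemma logDer_mem_order {δ : LocalEnd (structureModule Z) U} (hδ : δ ∈ logDer D U) :
    δ ∈ logDiffOpOrder D 1 U :=
  ⟨logDer_mem_logDiffOpRing hδ, fun _ h a =>
    ⟨_, (logDer_comm_mulEnd (restrict_mem_logDer D h hδ) a).symm⟩⟩

lemma logDer_mul_comm_mulEnd {δ δ' : LocalEnd (structureModule Z) U} (hδ : δ ∈ logDer D U)
    (hδ' : δ' ∈ logDer D U) (a : Γ(Z, U)) :
    δ * δ' * mulEnd _ U a - mulEnd _ U a * (δ * δ') =
      mulEnd _ U (LocalEnd.actO δ U le_rfl a) * δ' +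
        mulEnd _ U (LocalEnd.actO δ' U le_rfl a) * δ +
        mulEnd _ U (LocalEnd.actO δ U le_rfl (LocalEnd.actO δ' U le_rfl a)) := by
  rw [← logDer_comm_mulEnd hδ, ← logDer_comm_mulEnd hδ (LocalEnd.actO δ' U le_rfl a),
    ← logDer_comm_mulEnd hδ']
  noncomm_ring

lemma logDer_mul_mem_order {δ δ' : LocalEnd (structureModule Z) U} (hδ : δ ∈ logDer D U)
    (hδ' : δ' ∈ logDer D U) : δ * δ' ∈ logDiffOpOrder D 2 U := by
  refine ⟨(logDiffOpRing D U).mul_mem (logDer_mem_logDiffOpRing hδ)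
    (logDer_mem_logDiffOpRing hδ'), fun W h a => ?_⟩
  rw [map_mul, logDer_mul_comm_mulEnd (restrict_mem_logDer D h hδ) (restrict_mem_logDer D h hδ')]
  exact add_mem_order (add_mem_order
    (mulEnd_mul_mem_order _ (logDer_mem_order (restrict_mem_logDer D h hδ')))
    (mulEnd_mul_mem_order _ (logDer_mem_order (restrict_mem_logDer D h hδ))))
    (mulEnd_mem_order 1 _)

/-- An operator that is locally multiplication by a function is so globally. -/
lemma mem_order_zero_of_locally {P : LocalEnd (structureModule Z) U}
    (h : ∀ x ∈ U, ∃ (W : Z.Opens) (hW : W ≤ U), x ∈ W ∧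
      LocalEnd.restrict hW P ∈ logDiffOpOrder D 0 W) : P ∈ logDiffOpOrder D 0 U := by
  refine ⟨LocalEnd.actO P U le_rfl 1, ?_⟩
  refine LocalEnd.ext_locally fun x hx => ?_
  obtain ⟨W, hW, hxW, a, ha⟩ := h x hx
  refine ⟨W, hW, hxW, ?_⟩
  rw [LocalEnd.restrict_mulEnd, ← ha, LocalEnd.resO_actO]
  congr 1
  rw [← LocalEnd.actO_restrict hW le_rfl, ← ha]
  simp

lemma mem_order_of_locally {k : ℕ} {P : LocalEnd (structureModule Z) U}
    (h : ∀ x ∈ U, ∃ (W : Z.Opens) (hW : W ≤ U), x ∈ W ∧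
      LocalEnd.restrict hW P ∈ logDiffOpOrder D k W) : P ∈ logDiffOpOrder D k U := by
  induction k generalizing U with
  | zero => exact mem_order_zero_of_locally h
  | succ k ih =>
    refine ⟨fun x hx => ?_, fun V hV a => ih fun x hx => ?_⟩
    · obtain ⟨W, hW, hxW, hP⟩ := h x hx
      obtain ⟨W', hW', hx', hP'⟩ := hP.1 x hxW
      exact ⟨W', hW'.trans hW, hx', hP'⟩
    · obtain ⟨W, hW, hxW, hP⟩ := h x (hV hx)
      refine ⟨V ⊓ W, inf_le_left, ⟨hx, hxW⟩, ?_⟩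
      have := hP.2 (V ⊓ W) inf_le_right (resO inf_le_left a)
      rw [map_sub, map_mul, map_mul, LocalEnd.restrict_mulEnd]
      exact this
end

section
/-! ### Frames of forms and the degree filtration -/

variable {Z : Scheme.{0}} {Ω : Z.Modules} {U : Z.Opens}

/-- The sections `e` form a basis of `Ω` over every open subset of `U`. -/
def IsFrame {n : ℕ} (e : Fin n → Γ(Ω, U)) : Prop :=
  ∀ (W : Z.Opens) (h : W ≤ U),
    Function.Bijective fun c : Fin n → Γ(Z, W) => ∑ i, c i • resM Ω h (e i)

namespace IsFrame
variable {n : ℕ} {e : Fin n → Γ(Ω, U)}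

lemma restrict (he : IsFrame e) {V : Z.Opens} (h : V ≤ U) :
    IsFrame fun i => resM Ω h (e i) := by
  intro W hW
  simp only [resM_resM]
  exact he W (hW.trans h)

lemma existsUnique (he : IsFrame e) {W : Z.Opens} (h : W ≤ U) (η : Γ(Ω, W)) :
    ∃! c : Fin n → Γ(Z, W), ∑ i, c i • resM Ω h (e i) = η :=
  (he W h).existsUnique η

/-- The coordinates of a section with respect to a frame. -/
def repr (he : IsFrame e) {W : Z.Opens} (h : W ≤ U) (η : Γ(Ω, W)) :
    Fin n → Γ(Z, W) := (he.existsUnique h η).choose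

lemma sum_repr (he : IsFrame e) {W : Z.Opens} (h : W ≤ U) (η : Γ(Ω, W)) :
    ∑ i, he.repr h η i • resM Ω h (e i) = η := (he.existsUnique h η).choose_spec.1

lemma repr_eq (he : IsFrame e) {W : Z.Opens} (h : W ≤ U) {η : Γ(Ω, W)} {c : Fin n → Γ(Z, W)}
    (hc : ∑ i, c i • resM Ω h (e i) = η) : he.repr h η = c :=
  ((he.existsUnique h η).choose_spec.2 c hc).symm

lemma resO_repr (he : IsFrame e) {W W' : Z.Opens} (h : W ≤ U) (h' : W' ≤ W) (η : Γ(Ω, W))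
    (i : Fin n) : resO h' (he.repr h η i) = he.repr (h'.trans h) (resM Ω h' η) i := by
  have : he.repr (h'.trans h) (resM Ω h' η) = fun i => resO h' (he.repr h η i) := by
    apply he.repr_eq
    conv_rhs => rw [← he.sum_repr h η, map_sum]
    simp only [resM_smul, resM_resM]
  rw [this]

/-- The dual frame. -/
def coord (he : IsFrame e) (i : Fin n) : LocalHom Ω U :=
  ⟨fun W =>
    { toFun := fun η => he.repr W.2 η i
      map_add' := fun η ξ => by
        rw [he.repr_eq W.2 (c := fun i => he.repr W.2 η i + he.repr W.2 ξ i)]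
        simp only [add_smul, Finset.sum_add_distrib, he.sum_repr]
      map_smul' := fun a η => by
        rw [he.repr_eq W.2 (c := fun i => a * he.repr W.2 η i)]
        · rfl
        · simp only [mul_smul, ← Finset.smul_sum, he.sum_repr] },
    fun W W' h η => he.resO_repr W.2 h η i⟩

lemma sum_coord (he : IsFrame e) {W : Z.Opens} (h : W ≤ U) (η : Γ(Ω, W)) :
    ∑ i, (he.coord i).1 ⟨W, h⟩ η • resM Ω h (e i) = η := he.sum_repr h η

lemma coord_apply (he : IsFrame e) {W : Z.Opens} (h : W ≤ U) (i j : Fin n) :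
    (he.coord i).1 ⟨W, h⟩ (resM Ω h (e j)) = if i = j then 1 else 0 := by
  change he.repr h _ i = _
  rw [he.repr_eq h (c := fun i => if i = j then 1 else 0)]
  simp [ite_smul]

lemma eq_sum_coord (he : IsFrame e) {V : Z.Opens} (hV : V ≤ U) (u : LocalHom Ω V)
    {W : Z.Opens} (h : W ≤ V) (η : Γ(Ω, W)) :
    u.1 ⟨W, h⟩ η = ∑ i, resO h (u.1 ⟨V, le_rfl⟩ (resM Ω hV (e i))) *
      (he.coord i).1 ⟨W, h.trans hV⟩ η := by
  conv_lhs => rw [← he.sum_coord (h.trans hV) η]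
  rw [map_sum]
  refine Finset.sum_congr rfl fun i _ => ?_
  rw [map_smul, smul_eq_mul, mul_comm, LocalHom.natural, resM_resM]

end IsFrame

/-- The properties of the sheaf of logarithmic differentials on which the calculus of logarithmic
differential operators rests: local freeness, perfectness of the pairing between logarithmic
derivations and logarithmic forms, involutivity of the logarithmic derivations, and
characteristic zero. -/
structure IsLogCalculus (D : SheafDerivation Ω) : Prop where
  exists_frame : ∀ x : Z, ∃ (W : Z.Opens) (n : ℕ) (e : Fin n → Γ(Ω, W)), x ∈ W ∧ IsFrame e
  derOf_injective : ∀ (U : Z.Opens) (u : LocalHom Ω U), derOf D U u = 0 → u = 0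
  bracket : ∀ (U : Z.Opens), ∀ δ ∈ logDer D U, ∀ δ' ∈ logDer D U, ∀ x ∈ U,
    ∃ (W : Z.Opens) (h : W ≤ U), x ∈ W ∧ LocalEnd.restrict h (δ * δ' - δ' * δ) ∈ logDer D W
  isUnit_natCast : ∀ (U : Z.Opens) (n : ℕ), n ≠ 0 → IsUnit (n : Γ(Z, U))

variable {D : SheafDerivation Ω}

namespace IsLogCalculus
variable (hD : IsLogCalculus D)
include hD

lemma derOf_inj {u v : LocalHom Ω U} (h : derOf D U u = derOf D U v) : u = v := by
  rw [← sub_eq_zero]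
  exact hD.derOf_injective U _ (by rw [map_sub, h, sub_self])

lemma exists_frame_le (x : Z) {V : Z.Opens} (hx : x ∈ V) :
    ∃ (W : Z.Opens) (_ : W ≤ V) (n : ℕ) (e : Fin n → Γ(Ω, W)), x ∈ W ∧ IsFrame e := by
  obtain ⟨W, n, e, hxW, he⟩ := hD.exists_frame x
  exact ⟨V ⊓ W, inf_le_left, n, _, ⟨hx, hxW⟩, he.restrict inf_le_right⟩

/-- Logarithmic derivations form a sheaf. -/
lemma mem_logDer_of_locally {P : LocalEnd (structureModule Z) U}
    (h : ∀ x ∈ U, ∃ (W : Z.Opens) (hW : W ≤ U), x ∈ W ∧ LocalEnd.restrict hW P ∈ logDer D W) :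
    P ∈ logDer D U := by
  choose W hW hxW u hu using h
  obtain ⟨v, hv⟩ := LocalHom.glue (fun x : U => W x.1 x.2) (fun x => hW x.1 x.2)
    (fun x hx => ⟨⟨x, hx⟩, hxW x hx⟩) (fun x => u x.1 x.2) (by
      intro x y
      refine hD.derOf_inj ?_
      rw [← restrict_derOf, ← restrict_derOf, hu, hu]
      rfl)
  refine ⟨v, LocalEnd.ext_locally fun x hx => ⟨W x hx, hW x hx, hxW x hx, ?_⟩⟩
  rw [restrict_derOf, hv ⟨x, hx⟩, hu]

lemma bracket_mem {δ δ' : LocalEnd (structureModule Z) U} (hδ : δ ∈ logDer D U)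
    (hδ' : δ' ∈ logDer D U) : δ * δ' - δ' * δ ∈ logDer D U :=
  hD.mem_logDer_of_locally (hD.bracket U δ hδ δ' hδ')
end IsLogCalculus

section RingFiltration
variable {R : Type} [Ring R] {O V : Submodule ℤ R}

lemma pow_mul_le_mul_pow (h1 : 1 ≤ O) (hVO : V * O ≤ V) (k : ℕ) : V ^ k * O ≤ O * V ^ k := by
  cases k with
  | zero => rw [pow_zero, one_mul, mul_one]
  | succ k =>
    calc V ^ (k + 1) * O = V ^ k * (V * O) := by rw [pow_succ, mul_assoc]
      _ ≤ V ^ k * V := mul_le_mul_right hVO _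
      _ = 1 * V ^ (k + 1) := by rw [one_mul, pow_succ]
      _ ≤ _ := mul_le_mul_left h1 _

lemma mul_pow_mul_mul_pow_le (h1 : 1 ≤ O) (hOO : O * O ≤ O) (hVO : V * O ≤ V) (j k : ℕ) :
    O * V ^ j * (O * V ^ k) ≤ O * V ^ (j + k) := by
  calc O * V ^ j * (O * V ^ k) = O * (V ^ j * O) * V ^ k := by simp only [mul_assoc]
    _ ≤ O * (O * V ^ j) * V ^ k :=
        mul_le_mul_left (mul_le_mul_right (pow_mul_le_mul_pow h1 hVO j) _) _
    _ = (O * O) * V ^ (j + k) := by simp only [pow_add, mul_assoc]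
    _ ≤ _ := mul_le_mul_left hOO _

lemma mul_pow_le_mul_pow_succ (h1 : 1 ≤ V) (k : ℕ) : O * V ^ k ≤ O * V ^ (k + 1) := by
  rw [pow_succ]
  refine mul_le_mul_right ?_ _
  calc V ^ k = V ^ k * 1 := (mul_one _).symm
    _ ≤ _ := mul_le_mul_right h1 _

lemma le_mul_of_one_le (h1 : 1 ≤ O) : V ≤ O * V := by
  calc V = 1 * V := (one_mul _).symm
    _ ≤ _ := mul_le_mul_left h1 _

lemma mul_pow_succ_le_mul_pow (hOV : O * V ≤ V) (k : ℕ) : O * V ^ (k + 1) ≤ V * V ^ k := by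
  rw [pow_succ', ← mul_assoc]
  exact mul_le_mul_left hOV _
end RingFiltration

section Filtration
variable (D)

/-- The operators of order zero over `U`. -/
def opZero (U : Z.Opens) : Submodule ℤ (LocalEnd (structureModule Z) U) :=
  AddSubgroup.toIntSubmodule (mulEnd (structureModule Z) U).range.toAddSubgroup

/-- Sums of a function and a logarithmic derivation. -/
def opOne (U : Z.Opens) : Submodule ℤ (LocalEnd (structureModule Z) U) :=
  opZero U ⊔ AddSubgroup.toIntSubmodule (logDer D U)

/-- Sums of products of at most `k` logarithmic derivations with functions as coefficients. -/
def opDeg (U : Z.Opens) (k : ℕ) : Submodule ℤ (LocalEnd (structureModule Z) U) :=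
  opZero U * opOne D U ^ k

/-- The filtration `opDeg`, shifted by one so that it starts with zero. -/
def opLT (U : Z.Opens) : ℕ → Submodule ℤ (LocalEnd (structureModule Z) U)
  | 0 => ⊥
  | k + 1 => opDeg D U k

variable {D}

lemma mem_opZero {P : LocalEnd (structureModule Z) U} :
    P ∈ opZero U ↔ ∃ a, mulEnd _ U a = P := Iff.rfl

lemma mem_opOne {P : LocalEnd (structureModule Z) U} :
    P ∈ opOne D U ↔ ∃ a, ∃ δ ∈ logDer D U, mulEnd _ U a + δ = P := by
  rw [opOne, Submodule.mem_sup]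
  constructor
  · rintro ⟨_, ⟨a, rfl⟩, δ, hδ, h⟩
    exact ⟨a, δ, hδ, h⟩
  · rintro ⟨a, δ, hδ, h⟩
    exact ⟨_, ⟨a, rfl⟩, δ, hδ, h⟩

lemma one_le_opZero : 1 ≤ opZero U := by
  rw [Submodule.one_le]; exact ⟨1, map_one _⟩

lemma opZero_le_opOne : opZero U ≤ opOne D U := le_sup_left

lemma mulEnd_mem_opOne (a : Γ(Z, U)) : mulEnd _ U a ∈ opOne D U := opZero_le_opOne ⟨a, rfl⟩

lemma logDer_mem_opOne {δ : LocalEnd (structureModule Z) U} (hδ : δ ∈ logDer D U) :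
    δ ∈ opOne D U := (le_sup_right : _ ≤ opOne D U) hδ

lemma opZero_mul_opZero : opZero U * opZero U ≤ opZero U := by
  rw [Submodule.mul_le]
  rintro _ ⟨a, rfl⟩ _ ⟨b, rfl⟩
  exact ⟨a * b, map_mul _ _ _⟩

lemma opZero_mul_opOne : opZero U * opOne D U ≤ opOne D U := by
  rw [Submodule.mul_le]
  rintro _ ⟨a, rfl⟩ Q hQ
  obtain ⟨b, δ, hδ, rfl⟩ := mem_opOne.1 hQ
  exact mem_opOne.2 ⟨a * b, _, mulEnd_mul_mem_logDer a hδ, by rw [map_mul]; exact (mul_add _ _ _).symm⟩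

lemma opOne_mul_opZero : opOne D U * opZero U ≤ opOne D U := by
  rw [Submodule.mul_le]
  rintro Q hQ _ ⟨a, rfl⟩
  obtain ⟨b, δ, hδ, rfl⟩ := mem_opOne.1 hQ
  have := logDer_comm_mulEnd hδ a
  rw [sub_eq_iff_eq_add] at this
  refine mem_opOne.2 ⟨b * a + LocalEnd.actO δ U le_rfl a, _, mulEnd_mul_mem_logDer a hδ, ?_⟩
  refine Eq.trans ?_ (add_mul _ _ _).symm
  refine Eq.trans ?_ (congrArg (mulEnd _ U b * mulEnd _ U a + ·) this.symm)
  rw [map_add, map_mul, add_assoc]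

lemma opDeg_mul {P Q : LocalEnd (structureModule Z) U} {j k : ℕ} (hP : P ∈ opDeg D U j)
    (hQ : Q ∈ opDeg D U k) : P * Q ∈ opDeg D U (j + k) :=
  mul_pow_mul_mul_pow_le one_le_opZero opZero_mul_opZero opOne_mul_opZero j k
    (Submodule.mul_mem_mul hP hQ)

lemma opDeg_succ_le (k : ℕ) : opDeg D U k ≤ opDeg D U (k + 1) :=
  mul_pow_le_mul_pow_succ (one_le_opZero.trans opZero_le_opOne) k

lemma opDeg_zero : opDeg D U 0 = opZero U := by rw [opDeg, pow_zero, mul_one]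

lemma opDeg_one : opDeg D U 1 = opOne D U := by
  rw [opDeg, pow_one]
  exact le_antisymm opZero_mul_opOne (le_mul_of_one_le one_le_opZero)

lemma opOne_mul_opDeg {P Q : LocalEnd (structureModule Z) U} {k : ℕ} (hP : P ∈ opOne D U)
    (hQ : Q ∈ opDeg D U k) : P * Q ∈ opDeg D U (k + 1) := by
  rw [← opDeg_one] at hP
  rw [add_comm]
  exact opDeg_mul hP hQ

lemma opDeg_mul_opOne {P Q : LocalEnd (structureModule Z) U} {k : ℕ} (hP : P ∈ opDeg D U k)
    (hQ : Q ∈ opOne D U) : P * Q ∈ opDeg D U (k + 1) := by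
  rw [← opDeg_one] at hQ
  exact opDeg_mul hP hQ

lemma mulEnd_mul_opDeg (a : Γ(Z, U)) {Q : LocalEnd (structureModule Z) U} {k : ℕ}
    (hQ : Q ∈ opDeg D U k) : mulEnd _ U a * Q ∈ opDeg D U k := by
  have h0 : mulEnd _ U a ∈ opDeg D U 0 := by rw [opDeg_zero]; exact ⟨a, rfl⟩
  have := opDeg_mul h0 hQ
  rwa [zero_add] at this

lemma mulEnd_mul_opLT (a : Γ(Z, U)) {Q : LocalEnd (structureModule Z) U} {k : ℕ}
    (hQ : Q ∈ opLT D U k) : mulEnd _ U a * Q ∈ opLT D U k := by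
  cases k with
  | zero => rw [(Submodule.mem_bot ℤ).1 hQ, mul_zero]; exact zero_mem _
  | succ k => exact mulEnd_mul_opDeg a hQ

lemma opOne_mul_opLT {P Q : LocalEnd (structureModule Z) U} {k : ℕ} (hP : P ∈ opOne D U)
    (hQ : Q ∈ opLT D U k) : P * Q ∈ opLT D U (k + 1) := by
  cases k with
  | zero => rw [(Submodule.mem_bot ℤ).1 hQ, mul_zero]; exact zero_mem _
  | succ k => exact opOne_mul_opDeg hP hQ

lemma opOne_mul_opLT_pred {P Q : LocalEnd (structureModule Z) U} {k : ℕ} (hP : P ∈ opOne D U)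
    (hQ : Q ∈ opLT D U (k - 1)) : P * Q ∈ opLT D U k := by
  cases k with
  | zero => rw [(Submodule.mem_bot ℤ).1 hQ, mul_zero]; exact zero_mem _
  | succ k => exact opOne_mul_opLT hP hQ

lemma opLT_mul_opOne {P Q : LocalEnd (structureModule Z) U} {k : ℕ} (hP : P ∈ opLT D U k)
    (hQ : Q ∈ opOne D U) : P * Q ∈ opLT D U (k + 1) := by
  cases k with
  | zero => rw [(Submodule.mem_bot ℤ).1 hP, zero_mul]; exact zero_mem _
  | succ k => exact opDeg_mul_opOne hP hQ

/-- Induction on the degree: every operator of degree at most `k + 1` is a sum of products `v Q`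
with `v` of degree one and `Q` of degree `k`. -/
lemma opDeg_succ_induction {k : ℕ} {p : LocalEnd (structureModule Z) U → Prop}
    (hmul : ∀ v ∈ opOne D U, ∀ Q ∈ opDeg D U k, p (v * Q))
    (hadd : ∀ P Q, p P → p Q → p (P + Q)) {P : LocalEnd (structureModule Z) U}
    (hP : P ∈ opDeg D U (k + 1)) : p P := by
  refine Submodule.mul_induction_on (mul_pow_succ_le_mul_pow opZero_mul_opOne k hP)
    (fun v hv Q hQ => hmul v hv Q ?_) hadd
  exact le_mul_of_one_le one_le_opZero hQ

lemma opOne_comm_mulEnd {v : LocalEnd (structureModule Z) U} (hv : v ∈ opOne D U)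
    (a : Γ(Z, U)) : ∃ b, v * mulEnd _ U a - mulEnd _ U a * v = mulEnd _ U b := by
  obtain ⟨c, δ, hδ, rfl⟩ := mem_opOne.1 hv
  refine ⟨LocalEnd.actO δ U le_rfl a, ?_⟩
  rw [← logDer_comm_mulEnd hδ, add_mul, mul_add, mulEnd_commute _ c a]
  abel

/-- A commutator with a function lowers the degree. -/
lemma opDeg_comm_mulEnd {k : ℕ} {P : LocalEnd (structureModule Z) U} (hP : P ∈ opDeg D U k)
    (a : Γ(Z, U)) : P * mulEnd _ U a - mulEnd _ U a * P ∈ opLT D U k := by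
  induction k generalizing P with
  | zero =>
    rw [opDeg_zero] at hP
    obtain ⟨b, rfl⟩ := hP
    rw [mulEnd_commute, sub_self]
    exact zero_mem _
  | succ k ih =>
    refine opDeg_succ_induction (p := fun P => P * mulEnd _ U a - mulEnd _ U a * P ∈
      opLT D U (k + 1)) (fun v hv Q hQ => ?_) (fun P Q hP hQ => ?_) hP
    · obtain ⟨b, hb⟩ := opOne_comm_mulEnd hv a
      have : v * Q * mulEnd _ U a - mulEnd _ U a * (v * Q) =
          v * (Q * mulEnd _ U a - mulEnd _ U a * Q) + mulEnd _ U b * Q := by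
        rw [← hb]; noncomm_ring
      rw [this]
      exact add_mem (opOne_mul_opLT hv (ih hQ)) (mulEnd_mul_opDeg b hQ)
    · have : (P + Q) * mulEnd _ U a - mulEnd _ U a * (P + Q) =
          (P * mulEnd _ U a - mulEnd _ U a * P) + (Q * mulEnd _ U a - mulEnd _ U a * Q) := by
        noncomm_ring
      rw [this]
      exact add_mem hP hQ

lemma restrict_mem_opOne {V : Z.Opens} (h : V ≤ U) {P : LocalEnd (structureModule Z) U}
    (hP : P ∈ opOne D U) : LocalEnd.restrict h P ∈ opOne D V := by
  obtain ⟨a, δ, hδ, rfl⟩ := mem_opOne.1 hP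
  exact mem_opOne.2 ⟨resO h a, _, restrict_mem_logDer D h hδ, by
    rw [map_add, LocalEnd.restrict_mulEnd h a]⟩

lemma restrict_mem_opDeg {k : ℕ} {V : Z.Opens} (h : V ≤ U) {P : LocalEnd (structureModule Z) U}
    (hP : P ∈ opDeg D U k) : LocalEnd.restrict h P ∈ opDeg D V k := by
  induction k generalizing P with
  | zero =>
    rw [opDeg_zero] at hP ⊢
    obtain ⟨b, rfl⟩ := hP
    exact ⟨_, (LocalEnd.restrict_mulEnd h b).symm⟩
  | succ k ih =>
    refine opDeg_succ_induction (p := fun P => LocalEnd.restrict h P ∈ opDeg D V (k + 1))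
      (fun v hv Q hQ => ?_) (fun P Q hP hQ => ?_) hP
    · rw [map_mul]
      exact opOne_mul_opDeg (restrict_mem_opOne h hv) (ih hQ)
    · rw [map_add]
      exact add_mem hP hQ

lemma restrict_mem_opLT {k : ℕ} {V : Z.Opens} (h : V ≤ U) {P : LocalEnd (structureModule Z) U}
    (hP : P ∈ opLT D U k) : LocalEnd.restrict h P ∈ opLT D V k := by
  cases k with
  | zero => rw [(Submodule.mem_bot ℤ).1 hP, map_zero]; exact zero_mem _
  | succ k => exact restrict_mem_opDeg h hP

lemma exists_mem_opDeg_of_mem_logGenRing {P : LocalEnd (structureModule Z) U}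
    (hP : P ∈ logGenRing D U) : ∃ k, P ∈ opDeg D U k := by
  have mono : ∀ {j k : ℕ}, j ≤ k → opDeg D U j ≤ opDeg D U k :=
    fun h => monotone_nat_of_le_succ (fun k => opDeg_succ_le (D := D) (U := U) k) h
  induction hP using Subring.closure_induction with
  | mem x hx =>
    refine ⟨1, ?_⟩
    rw [opDeg_one]
    rcases hx with ⟨a, rfl⟩ | hx
    · exact mulEnd_mem_opOne a
    · exact logDer_mem_opOne hx
  | zero => exact ⟨0, zero_mem _⟩
  | one => exact ⟨0, by rw [opDeg_zero]; exact ⟨1, map_one _⟩⟩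
  | add x y _ _ hx hy =>
    obtain ⟨j, hj⟩ := hx
    obtain ⟨k, hk⟩ := hy
    exact ⟨max j k, add_mem (mono (le_max_left _ _) hj) (mono (le_max_right _ _) hk)⟩
  | neg x _ hx =>
    obtain ⟨j, hj⟩ := hx
    exact ⟨j, neg_mem hj⟩
  | mul x y _ _ hx hy =>
    obtain ⟨j, hj⟩ := hx
    obtain ⟨k, hk⟩ := hy
    exact ⟨j + k, opDeg_mul hj hk⟩
end Filtration
end

section
/-! ### Symbols are determined by commutators -/

variable {Z : Scheme.{0}} {Ω : Z.Modules} {U : Z.Opens} {D : SheafDerivation Ω}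

/-- Operators all of whose `k`-fold commutators with functions vanish. -/
def IsOrderLT : ℕ → ∀ U : Z.Opens, LocalEnd (structureModule Z) U → Prop
  | 0, _, P => P = 0
  | k + 1, U, P => ∀ (W : Z.Opens) (h : W ≤ U) (a : Γ(Z, W)),
      IsOrderLT k W (LocalEnd.restrict h P * mulEnd _ W a - mulEnd _ W a * LocalEnd.restrict h P)

namespace IsOrderLT

lemma add {k : ℕ} {P Q : LocalEnd (structureModule Z) U}
    (hP : IsOrderLT k U P) (hQ : IsOrderLT k U Q) : IsOrderLT k U (P + Q) := by
  induction k generalizing U with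
  | zero =>
    rw [show P = 0 from hP, show Q = 0 from hQ, add_zero]
    rfl
  | succ k ih =>
    intro W h b
    have := ih (hP W h b) (hQ W h b)
    convert this using 1
    rw [map_add, add_mul, mul_add]
    abel

lemma neg {k : ℕ} {P : LocalEnd (structureModule Z) U}
    (hP : IsOrderLT k U P) : IsOrderLT k U (-P) := by
  induction k generalizing U with
  | zero =>
    rw [show P = 0 from hP, neg_zero]
    rfl
  | succ k ih =>
    intro W h b
    have := ih (hP W h b)
    convert this using 1
    rw [map_neg, neg_mul, mul_neg]
    abel

lemma zero (k : ℕ) : IsOrderLT k U (0 : LocalEnd (structureModule Z) U) := by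
  induction k generalizing U with
  | zero => rfl
  | succ k ih =>
    intro W h b
    rw [map_zero, zero_mul, mul_zero, sub_zero]
    exact ih

lemma succ {k : ℕ} {P : LocalEnd (structureModule Z) U}
    (hP : IsOrderLT k U P) : IsOrderLT (k + 1) U P := by
  induction k generalizing U with
  | zero =>
    rw [show P = 0 from hP]
    exact zero 1
  | succ k ih => exact fun W h b => ih (hP W h b)

lemma mono {j k : ℕ} (h : j ≤ k) {P : LocalEnd (structureModule Z) U}
    (hP : IsOrderLT j U P) : IsOrderLT k U P := by
  induction h with
  | refl => exact hP
  | step _ ih => exact ih.succ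

end IsOrderLT

lemma isOrderLT_of_mem_order {k : ℕ} {P : LocalEnd (structureModule Z) U}
    (hP : P ∈ logDiffOpOrder D k U) : IsOrderLT (k + 1) U P := by
  induction k generalizing U with
  | zero =>
    obtain ⟨b, rfl⟩ := hP
    intro W h a
    rw [LocalEnd.restrict_mulEnd, mulEnd_commute, sub_self]
    rfl
  | succ k ih => exact fun W h a => ih (hP.2 W h a)

lemma isOrderLT_of_mem_opLT {k : ℕ} {P : LocalEnd (structureModule Z) U}
    (hP : P ∈ opLT D U k) : IsOrderLT k U P := by
  induction k generalizing U with
  | zero => exact (Submodule.mem_bot ℤ).1 hP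
  | succ k ih => exact fun W h a => ih (opDeg_comm_mulEnd (restrict_mem_opDeg h hP) a)

lemma opDeg_bracket (hD : IsLogCalculus D) {k : ℕ} {P δ : LocalEnd (structureModule Z) U}
    (hP : P ∈ opDeg D U k) (hδ : δ ∈ logDer D U) : P * δ - δ * P ∈ opDeg D U k := by
  induction k generalizing P with
  | zero =>
    rw [opDeg_zero] at hP ⊢
    obtain ⟨b, rfl⟩ := hP
    refine ⟨-LocalEnd.actO δ U le_rfl b, ?_⟩
    rw [← neg_sub (δ * _), logDer_comm_mulEnd hδ]
    exact map_neg _ _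
  | succ k ih =>
    refine opDeg_succ_induction (p := fun P => P * δ - δ * P ∈ opDeg D U (k + 1))
      (fun v hv Q hQ => ?_) (fun P Q hP hQ => ?_) hP
    · have h1 : v * δ - δ * v ∈ opOne D U := by
        obtain ⟨c, δ', hδ', rfl⟩ := mem_opOne.1 hv
        have : (mulEnd _ U c + δ') * δ - δ * (mulEnd _ U c + δ') =
            -(δ * mulEnd _ U c - mulEnd _ U c * δ) + (δ' * δ - δ * δ') := by noncomm_ring
        rw [this, logDer_comm_mulEnd hδ]
        exact add_mem (neg_mem (mulEnd_mem_opOne _))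
          (logDer_mem_opOne (hD.bracket_mem hδ' hδ))
      have : v * Q * δ - δ * (v * Q) = v * (Q * δ - δ * Q) + (v * δ - δ * v) * Q := by
        noncomm_ring
      rw [this]
      exact add_mem (opOne_mul_opDeg hv (ih hQ)) (opOne_mul_opDeg h1 hQ)
    · have : (P + Q) * δ - δ * (P + Q) = (P * δ - δ * P) + (Q * δ - δ * Q) := by
        noncomm_ring
      rw [this]
      exact add_mem hP hQ

section RingIdentities
variable {R ι : Type} [Ring R] [Fintype ι] (x Q : ι → R)

lemma commutator_sub_sum_mul_left (c a P : R) (ha : c * a = a * c)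
    (hx : ∀ i, c * x i = x i * c) :
    c * P * a - a * (c * P) - ∑ i, x i * (c * Q i) = c * (P * a - a * P - ∑ i, x i * Q i) := by
  have h1 : ∑ i, x i * (c * Q i) = c * ∑ i, x i * Q i := by
    rw [Finset.mul_sum]
    exact Finset.sum_congr rfl fun i _ => by rw [← mul_assoc, ← hx, mul_assoc]
  rw [h1, mul_sub, mul_sub, ← mul_assoc a, ← ha, mul_assoc, mul_assoc]

lemma sum_mul_sub_nsmul_mul_left (c P : R) (k : ℕ) :
    ∑ i, c * Q i * x i - k • (c * P) = c * (∑ i, Q i * x i - k • P) := by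
  rw [mul_sub, Finset.mul_sum, mul_smul_comm]
  simp only [mul_assoc]

lemma sum_commutator (b : R) (hx : ∀ i, x i * b = b * x i) :
    ∑ i, x i * (Q i * b - b * Q i) = (∑ i, x i * Q i) * b - b * ∑ i, x i * Q i := by
  rw [Finset.sum_mul, Finset.mul_sum, ← Finset.sum_sub_distrib]
  exact Finset.sum_congr rfl fun i _ => by rw [mul_sub, ← mul_assoc b, ← hx, mul_assoc, mul_assoc]

variable [DecidableEq ι] (j : ι)

lemma commutator_sub_sum_der_mul (d a P : R) (y : ι → R) (hda : d * a - a * d = x j)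
    (hdx : ∀ i, d * x i - x i * d = y i) :
    d * P * a - a * (d * P) - ∑ i, x i * (d * Q i + if i = j then P else 0) =
      d * (P * a - a * P - ∑ i, x i * Q i) + ∑ i, y i * Q i := by
  have h1 : ∀ i, x i * (d * Q i + if i = j then P else 0) =
      d * (x i * Q i) - y i * Q i + if i = j then x j * P else 0 := by
    intro i
    rw [← hdx]
    split_ifs with h
    · rw [h]; noncomm_ring
    · noncomm_ring
  simp only [h1, Finset.sum_add_distrib, Finset.sum_sub_distrib, Finset.sum_ite_eq',
    Finset.mem_univ, if_true, ← hda, ← Finset.mul_sum]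
  noncomm_ring

lemma sum_der_mul_sub_nsmul (P : R) (k : ℕ) :
    ∑ i, (x j * Q i + if i = j then P else 0) * x i - (k + 1) • (x j * P) =
      x j * (∑ i, Q i * x i - k • P) + (P * x j - x j * P) := by
  have h1 : ∀ i, (x j * Q i + if i = j then P else 0) * x i =
      x j * (Q i * x i) + if i = j then P * x j else 0 := by
    intro i
    rw [add_mul, mul_assoc]
    split_ifs with h
    · rw [h]
    · rw [zero_mul]
  simp only [h1, Finset.sum_add_distrib, Finset.sum_ite_eq', Finset.mem_univ, if_true]
  rw [mul_sub, Finset.mul_sum, mul_smul_comm, succ_nsmul]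
  abel
end RingIdentities

section Frame
variable {n : ℕ} {e : Fin n → Γ(Ω, U)}

/-- The logarithmic derivations dual to a frame. -/
def IsFrame.der (D : SheafDerivation Ω) (he : IsFrame e) (i : Fin n) :
    LocalEnd (structureModule Z) U := derOf D U (he.coord i)

lemma IsFrame.der_mem (he : IsFrame e) (i : Fin n) : he.der D i ∈ logDer D U := ⟨_, rfl⟩

lemma IsFrame.derOf_eq_sum (he : IsFrame e) {V : Z.Opens} (hV : V ≤ U) (u : LocalHom Ω V) :
    derOf D V u = ∑ i, mulEnd _ V (u.1 ⟨V, le_rfl⟩ (resM Ω hV (e i))) *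
      LocalEnd.restrict hV (he.der D i) := by
  refine LocalEnd.ext_actO fun W h a => ?_
  rw [actO_derOf, he.eq_sum_coord hV]
  have : ∀ (s : Finset (Fin n)) (P : Fin n → LocalEnd (structureModule Z) V),
      LocalEnd.actO (∑ i ∈ s, P i) W h a = ∑ i ∈ s, LocalEnd.actO (P i) W h a := by
    intro s P
    induction s using Finset.cons_induction with
    | empty => rfl
    | cons i s hi ih => rw [Finset.sum_cons, Finset.sum_cons, LocalEnd.actO_add, ih]
  rw [this]
  rfl

lemma IsFrame.logDer_eq_sum (he : IsFrame e) {δ : LocalEnd (structureModule Z) U}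
    (hδ : δ ∈ logDer D U) : ∃ c : Fin n → Γ(Z, U), δ = ∑ i, mulEnd _ U (c i) * he.der D i := by
  obtain ⟨u, rfl⟩ := hδ
  exact ⟨_, he.derOf_eq_sum le_rfl u⟩

/-- The operators `Q i` are the partial derivatives of the symbol of `P`: commutators with functions
are computed by them, up to lower order, and Euler's formula holds. -/
def IsPolar (he : IsFrame e) (D : SheafDerivation Ω) (k : ℕ) (P : LocalEnd (structureModule Z) U)
    (Q : Fin n → LocalEnd (structureModule Z) U) : Prop :=
  (∀ i, Q i ∈ opLT D U k) ∧
  (∀ (W : Z.Opens) (h : W ≤ U) (a : Γ(Z, W)),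
    LocalEnd.restrict h P * mulEnd _ W a - mulEnd _ W a * LocalEnd.restrict h P -
      ∑ i, mulEnd _ W (LocalEnd.actO (he.der D i) W h a) * LocalEnd.restrict h (Q i) ∈
        opLT D W (k - 1)) ∧
  ∑ i, Q i * he.der D i - k • P ∈ opLT D U k

lemma IsPolar.add {he : IsFrame e} {k : ℕ} {P P' : LocalEnd (structureModule Z) U}
    {Q Q' : Fin n → LocalEnd (structureModule Z) U} (h : IsPolar he D k P Q)
    (h' : IsPolar he D k P' Q') : IsPolar he D k (P + P') fun i => Q i + Q' i := by
  refine ⟨fun i => add_mem (h.1 i) (h'.1 i), fun W hW a => ?_, ?_⟩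
  · convert add_mem (h.2.1 W hW a) (h'.2.1 W hW a) using 1
    simp only [map_add, mul_add, add_mul, Finset.sum_add_distrib]
    abel
  · convert add_mem h.2.2 h'.2.2 using 1
    simp only [add_mul, Finset.sum_add_distrib, smul_add]
    abel

lemma isPolar_zero_of_mem_opLT {he : IsFrame e} {k : ℕ} {P : LocalEnd (structureModule Z) U}
    (hP : P ∈ opLT D U k) : IsPolar he D k P 0 := by
  refine ⟨fun i => zero_mem _, fun W hW a => ?_, ?_⟩
  · simp only [Pi.zero_apply, map_zero, mul_zero, Finset.sum_const_zero, sub_zero]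
    cases k with
    | zero =>
      rw [(Submodule.mem_bot ℤ).1 hP, map_zero, zero_mul, mul_zero, sub_zero]
      exact zero_mem _
    | succ k => exact opDeg_comm_mulEnd (restrict_mem_opDeg hW hP) a
  · simp only [Pi.zero_apply, zero_mul, Finset.sum_const_zero, zero_sub]
    exact neg_mem (nsmul_mem hP k)

lemma IsPolar.mulEnd_mul {he : IsFrame e} {k : ℕ} {P : LocalEnd (structureModule Z) U}
    {Q : Fin n → LocalEnd (structureModule Z) U} (h : IsPolar he D k P Q) (c : Γ(Z, U)) :
    IsPolar he D k (mulEnd _ U c * P) fun i => mulEnd _ U c * Q i := by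
  refine ⟨fun i => mulEnd_mul_opLT c (h.1 i), fun W hW a => ?_, ?_⟩
  · have h1 := mulEnd_mul_opLT (resO hW c) (h.2.1 W hW a)
    rw [← commutator_sub_sum_mul_left _ _ _ _ _ (mulEnd_commute _ _ _)
      (fun i => mulEnd_commute _ _ _)] at h1
    have h2 : LocalEnd.restrict hW (mulEnd (structureModule Z) U c) = mulEnd _ W (resO hW c) :=
      LocalEnd.restrict_mulEnd hW c
    simp only [map_mul, h2]
    exact h1
  · rw [sum_mul_sub_nsmul_mul_left]
    exact mulEnd_mul_opLT c h.2.2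

lemma IsPolar.der_mul (hD : IsLogCalculus D) {he : IsFrame e} {k : ℕ}
    {P : LocalEnd (structureModule Z) U} (hP : P ∈ opDeg D U k)
    {Q : Fin n → LocalEnd (structureModule Z) U} (h : IsPolar he D k P Q) (j : Fin n) :
    IsPolar he D (k + 1) (he.der D j * P)
      fun i => he.der D j * Q i + if i = j then P else 0 := by
  have hj : he.der D j ∈ opOne D U := logDer_mem_opOne (he.der_mem j)
  refine ⟨fun i => add_mem (opOne_mul_opLT hj (h.1 i)) ?_, fun W hW a => ?_, ?_⟩
  · split_ifs
    · exact hP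
    · exact zero_mem _
  · have h1 := opOne_mul_opLT_pred (restrict_mem_opOne hW hj) (h.2.1 W hW a)
    have h2 : ∑ i, mulEnd _ W (LocalEnd.actO (he.der D j) W hW
        (LocalEnd.actO (he.der D i) W hW a)) * LocalEnd.restrict hW (Q i) ∈ opLT D W k :=
      sum_mem fun i _ => mulEnd_mul_opLT _ (restrict_mem_opLT hW (h.1 i))
    have hd : ∀ b : Γ(Z, W), LocalEnd.restrict hW (he.der D j) * mulEnd _ W b -
        mulEnd _ W b * LocalEnd.restrict hW (he.der D j) =
          mulEnd _ W (LocalEnd.actO (he.der D j) W hW b) :=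
      logDer_comm_mulEnd (restrict_mem_logDer D hW (he.der_mem (D := D) j))
    have h3 := commutator_sub_sum_der_mul
      (fun i => mulEnd (structureModule Z) W (LocalEnd.actO (he.der D i) W hW a))
      (fun i => LocalEnd.restrict hW (Q i)) j (LocalEnd.restrict hW (he.der D j)) (mulEnd _ W a)
      (LocalEnd.restrict hW P) _ (hd a) (fun i => hd _)
    have h4 : ∀ i, LocalEnd.restrict hW (he.der D j * Q i + if i = j then P else 0) =
        LocalEnd.restrict hW (he.der D j) * LocalEnd.restrict hW (Q i) +
          if i = j then LocalEnd.restrict hW P else 0 := by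
      intro i
      split_ifs
      · rfl
      · rw [add_zero, add_zero]; rfl
    have h5 : LocalEnd.restrict hW (he.der D j * P) =
        LocalEnd.restrict hW (he.der D j) * LocalEnd.restrict hW P := rfl
    simp only [h4, h5, Nat.add_sub_cancel]
    rw [h3]
    exact add_mem h1 h2
  · rw [sum_der_mul_sub_nsmul]
    exact add_mem (opOne_mul_opLT hj h.2.2) (opDeg_bracket hD hP (he.der_mem (D := D) j))

lemma exists_isPolar (hD : IsLogCalculus D) (he : IsFrame e) {k : ℕ}
    {P : LocalEnd (structureModule Z) U} (hP : P ∈ opDeg D U k) : ∃ Q, IsPolar he D k P Q := by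
  induction k generalizing P with
  | zero =>
    refine ⟨0, fun i => zero_mem _, fun W hW a => ?_, ?_⟩
    · rw [opDeg_zero] at hP
      obtain ⟨b, rfl⟩ := hP
      rw [show LocalEnd.restrict hW (mulEnd _ U b) = mulEnd _ W (resO hW b) from
        LocalEnd.restrict_mulEnd hW b, mulEnd_commute, sub_self]
      simp
    · simp
  | succ k ih =>
    refine opDeg_succ_induction (p := fun P => ∃ Q, IsPolar he D (k + 1) P Q)
      (fun v hv P hP => ?_) (fun P P' hP hP' => ?_) hP
    · obtain ⟨Q, hQ⟩ := ih hP
      obtain ⟨b, δ, hδ, rfl⟩ := mem_opOne.1 hv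
      obtain ⟨c, rfl⟩ := he.logDer_eq_sum hδ
      have hfin : ∀ s : Finset (Fin n), ∃ Q, IsPolar he D (k + 1)
          (∑ i ∈ s, mulEnd _ U (c i) * (he.der D i * P)) Q := by
        intro s
        induction s using Finset.cons_induction with
        | empty =>
          exact ⟨0, isPolar_zero_of_mem_opLT (by rw [Finset.sum_empty]; exact zero_mem _)⟩
        | cons i s hi ih =>
          obtain ⟨Q', hQ'⟩ := ih
          rw [Finset.sum_cons]
          exact ⟨_, ((hQ.der_mul hD hP i).mulEnd_mul (c i)).add hQ'⟩
      obtain ⟨Q', hQ'⟩ := hfin Finset.univ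
      have h0 : IsPolar he D (k + 1) (mulEnd _ U b * P) 0 :=
        isPolar_zero_of_mem_opLT (mulEnd_mul_opDeg b hP)
      have h1 : (mulEnd _ U b + ∑ i, mulEnd _ U (c i) * he.der D i) * P =
          mulEnd _ U b * P + ∑ i, mulEnd _ U (c i) * (he.der D i * P) := by
        rw [add_mul, Finset.sum_mul]
        simp only [mul_assoc]
      rw [h1]
      exact ⟨_, h0.add hQ'⟩
    · obtain ⟨Q, hQ⟩ := hP
      obtain ⟨Q', hQ'⟩ := hP'
      exact ⟨_, hQ.add hQ'⟩

/-- Nondegeneracy of the pairing between forms and derivations, for operator valued forms. -/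
lemma isOrderLT_of_sum (hD : IsLogCalculus D) {k : ℕ} {V : Z.Opens} (hV : V ≤ U) (he : IsFrame e)
    {Q : Fin n → LocalEnd (structureModule Z) V} (hQ : ∀ i, Q i ∈ opDeg D V k)
    (h : ∀ (W : Z.Opens) (hW : W ≤ V) (a : Γ(Z, W)), IsOrderLT k W
      (∑ i, mulEnd _ W (LocalEnd.actO (he.der D i) W (hW.trans hV) a) *
        LocalEnd.restrict hW (Q i))) (i : Fin n) : IsOrderLT k V (Q i) := by
  induction k generalizing V with
  | zero =>
    simp only [opDeg_zero] at hQ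
    choose q hq using fun i => mem_opZero.1 (hQ i)
    have hu : ∑ i, q i • LocalHom.restrict hV (he.coord i) = 0 := by
      refine hD.derOf_injective V _ ?_
      rw [map_sum]
      refine LocalEnd.ext_actO fun W hW a => ?_
      have h0 : (∑ i, mulEnd _ W (LocalEnd.actO (he.der D i) W (hW.trans hV) a) *
        LocalEnd.restrict hW (Q i)) = 0 := h W hW a
      have h1 := congrArg (fun P => LocalEnd.actO P W le_rfl 1) h0
      have hsum : ∀ {V' : Z.Opens} (s : Finset (Fin n))
          (P : Fin n → LocalEnd (structureModule Z) V') (hW' : W ≤ V') (b : Γ(Z, W)),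
          LocalEnd.actO (∑ i ∈ s, P i) W hW' b = ∑ i ∈ s, LocalEnd.actO (P i) W hW' b := by
        intro V' s P hW' b
        induction s using Finset.cons_induction with
        | empty => rfl
        | cons i s hi ih => rw [Finset.sum_cons, Finset.sum_cons, LocalEnd.actO_add, ih]
      simp only [hsum, ← hq, LocalEnd.actO_mul, LocalEnd.actO_restrict, LocalEnd.actO_mulEnd,
        LocalEnd.actO_zero, mul_one, resO_self] at h1 ⊢
      rw [← h1]
      refine Finset.sum_congr rfl fun i _ => ?_
      rw [derOf_smul, LocalEnd.actO_mul, LocalEnd.actO_mulEnd, mul_comm]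
      rfl
    have h2 := congrArg (fun u : LocalHom Ω V => u.1 ⟨V, le_rfl⟩ (resM Ω hV (e i))) hu
    have hsum : ∀ (s : Finset (Fin n)) (u : Fin n → LocalHom Ω V) (η : Γ(Ω, V)),
        (∑ i ∈ s, u i).1 ⟨V, le_rfl⟩ η = ∑ i ∈ s, (u i).1 ⟨V, le_rfl⟩ η := by
      intro s u η
      induction s using Finset.cons_induction with
      | empty => rfl
      | cons i s hi ih => rw [Finset.sum_cons, Finset.sum_cons, ← ih]; rfl
    have h3 : q i = 0 := by
      have h5 : ∀ j, (q j • LocalHom.restrict hV (he.coord j)).1 ⟨V, le_rfl⟩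
          (resM Ω hV (e i)) = q j * (LocalHom.restrict hV (he.coord j)).1 ⟨V, le_rfl⟩
          (resM Ω hV (e i)) := fun j => by rw [LocalHom.smul_apply, resO_self]
      simp only [hsum, h5] at h2
      have h4 : ∀ j, (LocalHom.restrict hV (he.coord j)).1 ⟨V, le_rfl⟩ (resM Ω hV (e i)) =
        if j = i then 1 else 0 := fun j => he.coord_apply hV j i
      simp only [h4, mul_ite, mul_one, mul_zero, Finset.sum_ite_eq', Finset.mem_univ, if_true] at h2
      exact h2
    change Q i = 0
    rw [← hq, h3, map_zero]
  | succ k ih =>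
    intro W hW b
    refine ih (hW.trans hV) (Q := fun i => LocalEnd.restrict hW (Q i) * mulEnd _ W b -
      mulEnd _ W b * LocalEnd.restrict hW (Q i))
      (fun i => opDeg_comm_mulEnd (restrict_mem_opDeg hW (hQ i)) b) fun W' hW' a => ?_
    convert h W' (hW'.trans hW) a W' le_rfl (resO hW' b) using 1
    rw [LocalEnd.restrict_self, ← sum_commutator _ _ _ fun i => mulEnd_commute _ _ _]
    refine Finset.sum_congr rfl fun i _ => ?_
    rw [← LocalEnd.restrict_mulEnd hW' b]
    rfl

/-- An operator of degree at most `k` whose `k`-fold commutators with functions vanish has degree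
less than `k`: symbols are determined by commutators. -/
lemma mem_opLT_of_isOrderLT (hD : IsLogCalculus D) (he : IsFrame e) {k : ℕ}
    {P : LocalEnd (structureModule Z) U} (hP : P ∈ opDeg D U k) (h : IsOrderLT k U P) :
    P ∈ opLT D U k := by
  induction k generalizing P with
  | zero => exact (Submodule.mem_bot ℤ).2 h
  | succ k ih =>
    obtain ⟨Q, hQ, hQ1, hQ2⟩ := exists_isPolar hD he hP
    have hord : ∀ i, IsOrderLT k U (Q i) := by
      refine isOrderLT_of_sum hD le_rfl he hQ fun W hW a => ?_
      have h1 := isOrderLT_of_mem_opLT (hQ1 W hW a)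
      have h2 := (h W hW a).add h1.neg
      convert h2 using 1
      abel
    have h3 : ∑ i, Q i * he.der D i ∈ opLT D U (k + 1) :=
      sum_mem fun i _ => opLT_mul_opOne (ih (hQ i) (hord i)) (logDer_mem_opOne (he.der_mem i))
    have h4 : (k + 1) • P ∈ opLT D U (k + 1) := by
      have := sub_mem h3 hQ2
      rwa [sub_sub_cancel] at this
    obtain ⟨b, hb⟩ := (hD.isUnit_natCast U (k + 1) k.succ_ne_zero).exists_left_inv
    have h5 := mulEnd_mul_opLT b h4
    convert h5 using 1
    rw [nsmul_eq_mul, ← map_natCast (mulEnd (structureModule Z) U), ← mul_assoc, ← map_mul, hb,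
      map_one, one_mul]

lemma mem_opOne_of_mem_order (hD : IsLogCalculus D) (he : IsFrame e)
    {P : LocalEnd (structureModule Z) U} (hP : P ∈ logGenRing D U)
    (h : P ∈ logDiffOpOrder D 1 U) : P ∈ opOne D U := by
  obtain ⟨k, hk⟩ := exists_mem_opDeg_of_mem_logGenRing hP
  induction k with
  | zero => rw [← opDeg_one]; exact opDeg_succ_le 0 hk
  | succ k ih =>
    rcases Nat.eq_zero_or_pos k with rfl | hpos
    · rwa [zero_add, opDeg_one] at hk
    · exact ih (mem_opLT_of_isOrderLT hD he hk
        ((isOrderLT_of_mem_order h).mono (by omega)))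
end Frame

/-- A logarithmic differential operator of order at most one is locally, hence globally, the sum of
a function and a logarithmic derivation. -/
lemma IsLogCalculus.sub_mulEnd_mem_logDer (hD : IsLogCalculus D)
    {P : LocalEnd (structureModule Z) U} (hP : P ∈ logDiffOpOrder D 1 U) :
    P - mulEnd _ U (LocalEnd.actO P U le_rfl 1) ∈ logDer D U := by
  refine hD.mem_logDer_of_locally fun x hx => ?_
  obtain ⟨V, hV, hxV, hPV⟩ := hP.1 x hx
  obtain ⟨W, hW, n, e, hxW, he⟩ := hD.exists_frame_le x hxV
  refine ⟨W, hW.trans hV, hxW, ?_⟩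
  obtain ⟨b, δ, hδ, hb⟩ := mem_opOne.1 (mem_opOne_of_mem_order hD he
    (restrict_mem_logGenRing hW hPV) (restrict_mem_order (hW.trans hV) hP))
  rw [LocalEnd.restrict_restrict] at hb
  rw [map_sub, LocalEnd.restrict_mulEnd, LocalEnd.resO_actO, map_one,
    ← LocalEnd.actO_restrict (hW.trans hV) le_rfl, ← hb, LocalEnd.actO_add, LocalEnd.actO_mulEnd,
    actO_logDer_one hδ, resO_self, mul_one, add_zero, add_sub_cancel_left]
  exact hδ
end

section
/-! ### Exactness of the first order symbol sequence -/

variable {Z : Scheme.{0}} {Ω : Z.Modules} {U : Z.Opens} {D : SheafDerivation Ω} {L : Z.Modules}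

section Symbols

lemma mulEnd_injective (hL : IsLineBundle L) (U : Z.Opens) :
    Function.Injective (mulEnd L U) := by
  intro a b h
  refine hL.smul_injective fun V hV m => ?_
  exact congrArg (fun P : LocalEnd L U => LocalEnd.act P V hV m) h

lemma IsSymbolOne.restrict {P : LocalEnd L U} {δ : LocalEnd (structureModule Z) U}
    (h : IsSymbolOne P δ) {V : Z.Opens} (hV : V ≤ U) :
    IsSymbolOne (LocalEnd.restrict hV P) (LocalEnd.restrict hV δ) :=
  fun W hW a m => h W (hW.trans hV) a m

lemma IsSymbolOne.unique (hL : IsLineBundle L) {P : LocalEnd L U}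
    {δ δ' : LocalEnd (structureModule Z) U} (h : IsSymbolOne P δ) (h' : IsSymbolOne P δ') :
    δ = δ' := by
  refine LocalEnd.ext_actO fun W hW a => hL.smul_injective fun V hV m => ?_
  rw [LocalEnd.resO_actO, LocalEnd.resO_actO, ← h, ← h']

lemma IsSymbolOne.sub {P P' : LocalEnd L U} {δ δ' : LocalEnd (structureModule Z) U}
    (h : IsSymbolOne P δ) (h' : IsSymbolOne P' δ') : IsSymbolOne (P - P') (δ - δ') := by
  intro W hW a m
  rw [LocalEnd.act_sub, LocalEnd.act_sub, LocalEnd.actO_sub, sub_smul, ← h, ← h', smul_sub]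
  abel

lemma IsSymbolOne.add {P P' : LocalEnd L U} {δ δ' : LocalEnd (structureModule Z) U}
    (h : IsSymbolOne P δ) (h' : IsSymbolOne P' δ') : IsSymbolOne (P + P') (δ + δ') := by
  intro W hW a m
  rw [LocalEnd.act_add, LocalEnd.act_add, LocalEnd.actO_add, add_smul, ← h, ← h', smul_add]
  abel

lemma IsSymbolOne.of_locally {P : LocalEnd L U} {δ : LocalEnd (structureModule Z) U}
    (h : ∀ x ∈ U, ∃ (W : Z.Opens) (hW : W ≤ U), x ∈ W ∧
      IsSymbolOne (LocalEnd.restrict hW P) (LocalEnd.restrict hW δ)) : IsSymbolOne P δ := by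
  intro V hV a m
  refine section_ext L fun x hx => ?_
  obtain ⟨W, hW, hxW, hP⟩ := h x (hV hx)
  refine ⟨V ⊓ W, inf_le_left, ⟨hx, hxW⟩, ?_⟩
  have := hP (V ⊓ W) inf_le_right (resO inf_le_left a) (resM L inf_le_left m)
  rw [map_sub, resM_smul, resM_smul, LocalEnd.resM_act, LocalEnd.resM_act, LocalEnd.resO_actO,
    resM_smul]
  exact this

lemma isSymbolOne_mulEnd (a : Γ(Z, U)) : IsSymbolOne (mulEnd L U a) 0 := by
  intro W h b m
  rw [LocalEnd.act_mulEnd, LocalEnd.act_mulEnd, LocalEnd.actO_zero, zero_smul, smul_smul,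
    smul_smul, mul_comm, sub_self]

lemma IsGenerator.isSymbolOne_conj {e : Γ(L, U)} (he : IsGenerator L U e)
    {δ : LocalEnd (structureModule Z) U} (hδ : δ ∈ logDer D U) : IsSymbolOne (he.conj δ) δ := by
  intro W h a m
  obtain ⟨b, rfl⟩ := he.exists_smul h m
  rw [smul_smul, he.act_conj, he.act_conj, actO_logDer_mul hδ, smul_smul, smul_smul, ← sub_smul,
    add_sub_cancel_left]

/-- An operator with vanishing symbol is multiplication by a function. -/
lemma exists_mulEnd_of_isSymbolOne_zero (hL : IsLineBundle L) {P : LocalEnd L U}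
    (h : IsSymbolOne P 0) : ∃ a, mulEnd L U a = P := by
  have hloc : ∀ x : U, ∃ (W : Z.Opens) (hW : W ≤ U) (a : Γ(Z, W)), x.1 ∈ W ∧
      mulEnd L W a = LocalEnd.restrict hW P := by
    intro x
    obtain ⟨W, hxW, e, he⟩ := hL x.1
    have he' := he.restrict (inf_le_right : U ⊓ W ≤ W)
    obtain ⟨a, ha⟩ := he'.exists_smul le_rfl
      (LocalEnd.act P (U ⊓ W) inf_le_left (resM L inf_le_right e))
    refine ⟨U ⊓ W, inf_le_left, a, ⟨x.2, hxW⟩, he'.ext_act fun V hV b => ?_⟩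
    have h1 := h V (hV.trans inf_le_left) b (resM L hV (resM L inf_le_right e))
    rw [LocalEnd.actO_zero, zero_smul, sub_eq_zero, ← LocalEnd.resM_act P inf_le_left hV, ← ha,
      resM_smul, resM_self] at h1
    rw [LocalEnd.act_restrict, h1, LocalEnd.act_mulEnd, smul_comm]
  choose W hW a hxW ha using hloc
  obtain ⟨b, hb⟩ := function_glue W hW (fun x hx => ⟨⟨x, hx⟩, hxW _⟩) a fun x y => by
    apply mulEnd_injective hL
    rw [← LocalEnd.restrict_mulEnd, ← LocalEnd.restrict_mulEnd, ha, ha]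
    rfl
  refine ⟨b, LocalEnd.ext_locally fun x hx => ⟨W ⟨x, hx⟩, hW _, hxW _, ?_⟩⟩
  rw [LocalEnd.restrict_mulEnd, hb, ha]

end Symbols

section Twisted

lemma IsGenerator.mem_twistedDiffOp_iff {e : Γ(L, U)} (he : IsGenerator L U e) {k : ℕ}
    {P : LocalEnd L U} :
    P ∈ twistedDiffOp D L k U ↔ he.conj.symm P ∈ logDiffOpOrder D k U := by
  constructor
  · intro h
    refine mem_order_of_locally fun x hx => ?_
    obtain ⟨W, hW, hxW, e', he', Q, hQ, hP⟩ := h x hx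
    refine ⟨W, hW, hxW, ?_⟩
    obtain ⟨g, hg⟩ := (he.restrict hW).exists_unit he'
    rw [he'.isConjugate_iff, (he.restrict hW).conj_eq_of_smul he' g hg] at hP
    have h1 := he.restrict_conj hW (he.conj.symm P)
    rw [RingEquiv.apply_symm_apply, hP] at h1
    rw [← (he.restrict hW).conj.injective h1]
    exact conj_unit_mem_order g hQ
  · intro h x hx
    refine ⟨U, le_rfl, hx, e, he, _, h, he.isConjugate_iff.2 ?_⟩
    rw [RingEquiv.apply_symm_apply]
    rfl

lemma restrict_mem_twistedDiffOp {k : ℕ} {P : LocalEnd L U} (hP : P ∈ twistedDiffOp D L k U)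
    {V : Z.Opens} (h : V ≤ U) : LocalEnd.restrict h P ∈ twistedDiffOp D L k V := by
  intro x hx
  obtain ⟨W, hW, hxW, e, he, Q, hQ, hPQ⟩ := hP x (h hx)
  refine ⟨V ⊓ W, inf_le_left, ⟨hx, hxW⟩, _, he.restrict inf_le_right, _,
    restrict_mem_order inf_le_right hQ, (he.restrict _).isConjugate_iff.2 ?_⟩
  rw [← he.restrict_conj inf_le_right, ← he.isConjugate_iff.1 hPQ]
  rfl

lemma mem_twistedDiffOp_of_locally {k : ℕ} {P : LocalEnd L U}
    (h : ∀ x ∈ U, ∃ (W : Z.Opens) (hW : W ≤ U), x ∈ W ∧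
      LocalEnd.restrict hW P ∈ twistedDiffOp D L k W) : P ∈ twistedDiffOp D L k U := by
  intro x hx
  obtain ⟨W, hW, hxW, hP⟩ := h x hx
  obtain ⟨V, hV, hxV, H⟩ := hP x hxW
  exact ⟨V, hV.trans hW, hxV, H⟩

lemma mulEnd_mem_twistedDiffOp (hL : IsLineBundle L) (k : ℕ) (a : Γ(Z, U)) :
    mulEnd L U a ∈ twistedDiffOp D L k U := by
  intro x hx
  obtain ⟨W, hxW, e, he⟩ := hL x
  have he' := he.restrict (inf_le_right : U ⊓ W ≤ W)
  refine ⟨U ⊓ W, inf_le_left, ⟨hx, hxW⟩, _, he', _, mulEnd_mem_order k (resO inf_le_left a),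
    he'.isConjugate_iff.2 ?_⟩
  rw [he'.conj_mulEnd, LocalEnd.restrict_mulEnd]

/-- A first order operator is conjugate to the sum of a function and its symbol. -/
lemma IsGenerator.exists_eq_conj (hD : IsLogCalculus D) {e : Γ(L, U)} (he : IsGenerator L U e)
    {P : LocalEnd L U} (hP : P ∈ twistedDiffOp D L 1 U) :
    ∃ a, ∃ δ ∈ logDer D U, P = he.conj (mulEnd _ U a + δ) := by
  have h := hD.sub_mulEnd_mem_logDer (he.mem_twistedDiffOp_iff.1 hP)
  refine ⟨LocalEnd.actO (he.conj.symm P) U le_rfl 1, _, h, ?_⟩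
  rw [add_sub_cancel, RingEquiv.apply_symm_apply]

lemma IsGenerator.isSymbolOne_conj_add {e : Γ(L, U)} (he : IsGenerator L U e) (a : Γ(Z, U))
    {δ : LocalEnd (structureModule Z) U} (hδ : δ ∈ logDer D U) :
    IsSymbolOne (he.conj (mulEnd _ U a + δ)) δ := by
  have := (isSymbolOne_mulEnd (L := L) a).add (he.isSymbolOne_conj hδ)
  rwa [zero_add, ← he.conj_mulEnd, ← map_add] at this

lemma IsGenerator.conj_mem_twistedDiffOp {e : Γ(L, U)} (he : IsGenerator L U e) {k : ℕ}
    {Q : LocalEnd (structureModule Z) U} (hQ : Q ∈ logDiffOpOrder D k U) :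
    he.conj Q ∈ twistedDiffOp D L k U := by
  rw [he.mem_twistedDiffOp_iff, RingEquiv.symm_apply_apply]
  exact hQ

/-- First order operators have a symbol. -/
lemma IsLogCalculus.exists_symbol (hD : IsLogCalculus D) (hL : IsLineBundle L) {P : LocalEnd L U}
    (hP : P ∈ twistedDiffOp D L 1 U) : ∃ δ ∈ logDer D U, IsSymbolOne P δ := by
  have hloc : ∀ x : U, ∃ (W : Z.Opens) (hW : W ≤ U) (u : LocalHom Ω W), x.1 ∈ W ∧
      IsSymbolOne (LocalEnd.restrict hW P) (derOf D W u) := by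
    intro x
    obtain ⟨W, hxW, e, he⟩ := hL x.1
    have he' := he.restrict (inf_le_right : U ⊓ W ≤ W)
    obtain ⟨a, δ, ⟨u, rfl⟩, h⟩ := he'.exists_eq_conj hD
      (restrict_mem_twistedDiffOp hP (inf_le_left : U ⊓ W ≤ U))
    refine ⟨U ⊓ W, inf_le_left, u, ⟨x.2, hxW⟩, ?_⟩
    rw [h]
    exact he'.isSymbolOne_conj_add a ⟨u, rfl⟩
  choose W hW u hxW hu using hloc
  obtain ⟨v, hv⟩ := LocalHom.glue W hW (fun x hx => ⟨⟨x, hx⟩, hxW _⟩) u fun x y => by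
    apply hD.derOf_inj
    rw [← restrict_derOf, ← restrict_derOf]
    exact IsSymbolOne.unique hL ((hu x).restrict inf_le_left) ((hu y).restrict inf_le_right)
  refine ⟨derOf D U v, ⟨v, rfl⟩, IsSymbolOne.of_locally fun x hx =>
    ⟨W ⟨x, hx⟩, hW _, hxW _, ?_⟩⟩
  rw [restrict_derOf, hv]
  exact hu _

lemma IsLogCalculus.isExactOne (hD : IsLogCalculus D) (hL : IsLineBundle L) : IsExactOne D L where
  mulEnd_mem _ a := mulEnd_mem_twistedDiffOp hL 1 a
  mulEnd_injective := mulEnd_injective hL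
  exists_symbol _ P hP := by
    obtain ⟨δ, hδ, h⟩ := hD.exists_symbol hL hP
    exact ⟨δ, ⟨hδ, h⟩, fun δ' h' => IsSymbolOne.unique hL h'.2 h⟩
  kernel _ _ _ h := exists_mulEnd_of_isSymbolOne_zero hL h
  surjective U δ hδ x hx := by
    obtain ⟨W, hxW, e, he⟩ := hL x
    have he' := he.restrict (inf_le_right : U ⊓ W ≤ W)
    have hδ' := restrict_mem_logDer D (inf_le_left : U ⊓ W ≤ U) hδ
    exact ⟨U ⊓ W, inf_le_left, ⟨hx, hxW⟩, _,
      he'.conj_mem_twistedDiffOp (logDer_mem_order hδ'), he'.isSymbolOne_conj hδ'⟩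

/-- Conjugation of a derivation by a unit adds a logarithmic derivative. -/
lemma logDer_conj_unit {δ : LocalEnd (structureModule Z) U} (hδ : δ ∈ logDer D U)
    (g : Γ(Z, U)ˣ) : mulEnd _ U g.val * δ * mulEnd _ U (g⁻¹).val =
      δ - mulEnd _ U ((g⁻¹).val * LocalEnd.actO δ U le_rfl g.val) := by
  have h1 := logDer_comm_mulEnd hδ g.val
  have h2 : mulEnd (structureModule Z) U g.val * mulEnd _ U (g⁻¹).val = 1 := by
    rw [← map_mul, Units.mul_inv, map_one]
  rw [mul_comm (g⁻¹).val, map_mul, ← h1, sub_mul, mul_assoc δ, h2]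
  noncomm_ring

end Twisted
end

section
/-! ### The extension class and second order symbols -/

set_option maxHeartbeats 1000000
set_option synthInstance.maxHeartbeats 200000
section CechClasses
variable {X : TopCat.{0}} {F : TopCat.Presheaf AddCommGrpCat.{0} X}

lemma HOne.mk_refine {U V : PointCover X} (h : U ≤ V) (c : cocycles F U) :
    HOne.mk F V (refineCocycle F U V h c) = HOne.mk F U c := by
  classical
  exact AddCommGroup.DirectLimit.of_f (G := CechOne F) (f := refine F) (i := U) (j := V) (hij := h)
    (x := QuotientAddGroup.mk c)

lemma HOne.mk_sub (U : PointCover X) (c c' : cocycles F U) :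
    HOne.mk F U (c - c') = HOne.mk F U c - HOne.mk F U c' := by
  simp [HOne.mk]

lemma HOne.mk_coboundary (U : PointCover X) (b : ∀ x : X, F.obj (op (U.nbhd x))) :
    HOne.mk F U (coboundary F U b) = 0 := by
  have : (QuotientAddGroup.mk (coboundary F U b) : CechOne F U) = 0 :=
    (QuotientAddGroup.eq_zero_iff _).2 ⟨b, rfl⟩
  rw [HOne.mk, this, map_zero]

/-- Two cocycles define the same class if they differ by a coboundary on a common refinement. -/
lemma HOne.mk_eq_mk {U U' V : PointCover X} (h : U ≤ V) (h' : U' ≤ V) (c : cocycles F U)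
    (c' : cocycles F U') (b : ∀ x : X, F.obj (op (V.nbhd x)))
    (hb : ∀ x y, res F (inf_le_inf (h' x) (h' y)) (c'.1 x y) -
      res F (inf_le_inf (h x) (h y)) (c.1 x y) =
        res F inf_le_right (b y) - res F inf_le_left (b x)) :
    HOne.mk F U c = HOne.mk F U' c' := by
  have : coboundary F V b = refineCocycle F U' V h' c' - refineCocycle F U V h c := by
    ext x y
    exact (hb x y).symm
  rw [← HOne.mk_refine h, ← HOne.mk_refine h', eq_comm, ← sub_eq_zero, ← HOne.mk_sub, ← this,
    HOne.mk_coboundary]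
end CechClasses

variable {Z : Scheme.{0}} {Ω : Z.Modules} {U : Z.Opens} {D : SheafDerivation Ω} {L : Z.Modules}

section Extension

lemma LocalSplitting.app_derOf (ρ : LocalSplitting D L U) {W : Z.Opens} (hW : W ≤ U) {n : ℕ}
    {e : Fin n → Γ(Ω, W)} (he : IsFrame e) {V : Z.Opens} (hV : V ≤ W) (u : LocalHom Ω V) :
    ρ.app ⟨V, hV.trans hW⟩ ⟨derOf D V u, u, rfl⟩ =
      ∑ i, mulEnd L V (u.1 ⟨V, le_rfl⟩ (resM Ω hV (e i))) *
        LocalEnd.restrict hV (ρ.app ⟨W, hW⟩ ⟨he.der D i, he.der_mem i⟩) := by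
  have h1 : (⟨derOf D V u, u, rfl⟩ : logDer D V) =
      ∑ i, ⟨mulEnd _ V (u.1 ⟨V, le_rfl⟩ (resM Ω hV (e i))) * LocalEnd.restrict hV (he.der D i),
        mulEnd_mul_mem_logDer _ (restrict_mem_logDer D hV (he.der_mem i))⟩ := by
    refine Subtype.ext ?_
    rw [AddSubgroup.val_finsetSum]
    exact he.derOf_eq_sum hV u
  rw [h1, map_sum]
  refine Finset.sum_congr rfl fun i _ => ?_
  rw [ρ.smul ⟨V, hV.trans hW⟩ _ ⟨_, restrict_mem_logDer D hV (he.der_mem i)⟩ _ rfl,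
    ρ.natural ⟨W, hW⟩ ⟨V, hV.trans hW⟩ hV]

/-- The difference of two splittings is the pairing with a form. -/
lemma LocalSplitting.exists_form (hL : IsLineBundle L) {U' : Z.Opens}
    (ρ : LocalSplitting D L U) (ρ' : LocalSplitting D L U') {W : Z.Opens} (hW : W ≤ U)
    (hW' : W ≤ U') {n : ℕ} {e : Fin n → Γ(Ω, W)} (he : IsFrame e) :
    ∃ θ : Γ(Ω, W), ∀ (V : Z.Opens) (hV : V ≤ W) (u : LocalHom Ω V),
      ρ.app ⟨V, hV.trans hW⟩ ⟨derOf D V u, u, rfl⟩ -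
        ρ'.app ⟨V, hV.trans hW'⟩ ⟨derOf D V u, u, rfl⟩ =
          mulEnd L V (u.1 ⟨V, le_rfl⟩ (resM Ω hV θ)) := by
  have h1 : ∀ i, ∃ b, mulEnd L W b = ρ.app ⟨W, hW⟩ ⟨he.der D i, he.der_mem i⟩ -
      ρ'.app ⟨W, hW'⟩ ⟨he.der D i, he.der_mem i⟩ := by
    intro i
    refine exists_mulEnd_of_isSymbolOne_zero hL ?_
    have := (ρ.symbol ⟨W, hW⟩ ⟨he.der D i, he.der_mem i⟩).sub
      (ρ'.symbol ⟨W, hW'⟩ ⟨he.der D i, he.der_mem i⟩)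
    rwa [sub_self] at this
  choose b hb using h1
  refine ⟨∑ i, b i • e i, fun V hV u => ?_⟩
  rw [ρ.app_derOf hW he hV, ρ'.app_derOf hW' he hV, ← Finset.sum_sub_distrib]
  simp only [← mul_sub, ← map_sub, ← hb]
  rw [map_sum, map_sum, map_sum]
  refine Finset.sum_congr rfl fun i _ => ?_
  rw [resM_smul, map_smul, smul_eq_mul, mul_comm, map_mul, LocalEnd.restrict_mulEnd]

lemma map_sub_eq_of_differences {G H : Type*} [AddCommGroup G] [AddCommGroup H] (φ : G →+ H)
    {a a' b b' : H} {r s η η' : G} (h₁ : a - a' = φ r) (h₂ : b - b' = φ s) (h₃ : a - b = φ η)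
    (h₄ : a' - b' = φ η') : φ (η' - η) = φ (s - r) := by
  rw [map_sub, map_sub, ← h₁, ← h₂, ← h₃, ← h₄]
  abel

/-- The extension class does not depend on the choice of the splittings. -/
lemma IsExtensionClass.unique (hD : IsLogCalculus D) (hL : IsLineBundle L)
    {c c' : HOne Ω.presheaf} (h : IsExtensionClass D L c) (h' : IsExtensionClass D L c') :
    c = c' := by
  obtain ⟨U, ρ, η, hη, rfl⟩ := h
  obtain ⟨U', ρ', η', hη', rfl⟩ := h'
  have hW : ∀ x : Z, ∃ (W : Z.Opens) (_ : W ≤ U.nbhd x ⊓ U'.nbhd x) (n : ℕ)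
      (e : Fin n → Γ(Ω, W)), x ∈ W ∧ IsFrame e :=
    fun x => hD.exists_frame_le x ⟨U.mem x, U'.mem x⟩
  choose W hWle n e hxW he using hW
  choose θ hθ using fun x => LocalSplitting.exists_form hL (ρ x) (ρ' x)
    ((hWle x).trans inf_le_left) ((hWle x).trans inf_le_right) (he x)
  let V : PointCover Z := ⟨W, hxW⟩
  have hUV : U ≤ V := fun x => (hWle x).trans inf_le_left
  have hUV' : U' ≤ V := fun x => (hWle x).trans inf_le_right
  refine HOne.mk_eq_mk hUV hUV' η η' θ fun x y => ?_
  have he' := (he x).restrict (inf_le_left : W x ⊓ W y ≤ W x)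
  have key : ∀ u : LocalHom Ω (W x ⊓ W y),
      u.1 ⟨_, le_rfl⟩ (resM Ω (inf_le_inf (hUV' x) (hUV' y)) (η'.1 x y) -
        resM Ω (inf_le_inf (hUV x) (hUV y)) (η.1 x y)) =
      u.1 ⟨_, le_rfl⟩ (resM Ω inf_le_right (θ y) - resM Ω inf_le_left (θ x)) := by
    intro u
    apply mulEnd_injective hL
    exact map_sub_eq_of_differences ((mulEnd L _).toAddMonoidHom.comp
      (u.1 ⟨W x ⊓ W y, le_rfl⟩).toAddMonoidHom) (hθ x _ inf_le_left u) (hθ y _ inf_le_right u)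
      (hη x y _ (inf_le_left.trans (hUV x)) (inf_le_right.trans (hUV y)) u)
      (hη' x y _ (inf_le_left.trans (hUV' x)) (inf_le_right.trans (hUV' y)) u)
  have h1 := he'.sum_coord le_rfl (resM Ω (inf_le_inf (hUV' x) (hUV' y)) (η'.1 x y) -
        resM Ω (inf_le_inf (hUV x) (hUV y)) (η.1 x y))
  simp only [key] at h1
  exact h1.symm.trans (he'.sum_coord le_rfl _)

lemma IsGenerator.conj_congr {e e' : Γ(L, U)} (he : IsGenerator L U e) (he' : IsGenerator L U e')
    (h : e = e') (Q : LocalEnd (structureModule Z) U) : he.conj Q = he'.conj Q := by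
  subst h
  rfl

/-- The splitting defined by a generator of `L`: derivations act on coordinates. -/
def IsGenerator.splitting (D : SheafDerivation Ω) {e : Γ(L, U)} (he : IsGenerator L U e) :
    LocalSplitting D L U where
  app W := (he.restrict W.2).conj.toRingHom.toAddMonoidHom.comp (logDer D W.1).subtype
  mem W δ := (he.restrict W.2).conj_mem_twistedDiffOp (logDer_mem_order δ.2)
  smul W a δ δ' h := by
    change (he.restrict W.2).conj δ'.1 = mulEnd L W.1 a * (he.restrict W.2).conj δ.1
    rw [h, map_mul, IsGenerator.conj_mulEnd]
  natural W W' h δ := by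
    refine ((he.restrict W.2).restrict_conj h δ.1).trans ?_
    exact IsGenerator.conj_congr _ _ (resM_resM L W.2 h e) _
  symbol W δ := (he.restrict W.2).isSymbolOne_conj δ.2

/-- The logarithmic Chern class is the extension class. -/
lemma isExtensionClass_chernClass (hL : IsLineBundle L) :
    IsExtensionClass D L (chernClass D hL) := by
  refine ⟨hL.trivialization.cover, fun x => (hL.trivialization.isGenerator x).splitting D,
    mapCocycle (dlog D) _ hL.trivialization.unitCocycle, fun x y W hx hy u => ?_,
    HOne.map_mk _ _ _⟩
  set t := hL.trivialization
  let g : Γ(Z, W)ˣ := Units.map (resO (le_inf hx hy)).toMonoidHom (t.unit x y)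
  have hgx := (t.isGenerator x).restrict hx
  have hgy := (t.isGenerator y).restrict hy
  have hg : g.val • resM L hx (t.gen x) = resM L hy (t.gen y) := t.unit_smul_res x y (le_inf hx hy)
  have h1 : resM Ω (le_inf hx hy) ((mapCocycle (dlog D) _ t.unitCocycle).1 x y) =
      (g⁻¹).val • D.d W g.val := by
    change resM Ω (le_inf hx hy) (((t.unit x y)⁻¹).val • D.d _ (t.unit x y).val) = _
    rw [resM_smul, D.natural']
    rfl
  rw [h1, map_smul, smul_eq_mul]
  change hgx.conj (derOf D W u) - hgy.conj (derOf D W u) = _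
  rw [hgx.conj_eq_of_smul hgy g hg, ← map_sub, logDer_conj_unit (D := D) ⟨u, rfl⟩, sub_sub_cancel,
    hgx.conj_mulEnd, actO_derOf]

end Extension

section SecondOrder

/-- `ω(da, db) = [[S, a], b]`, in the form: the commutator with a function `a` is, up to a function,
the contraction of `ω` with `da`. -/
def HasSymbolTwo (D : SheafDerivation Ω) (S : LocalEnd (structureModule Z) U) (ω : SymTensor Ω) :
    Prop :=
  ∀ (W : Z.Opens) (h : W ≤ U) (a : Γ(Z, W)), ∃ c,
    LocalEnd.restrict h S * mulEnd _ W a - mulEnd _ W a * LocalEnd.restrict h S =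
      mulEnd _ W c + derOf D W (contractSection ω W (D.d W a))

lemma contractSection_apply (ω : SymTensor Ω) (η : Γ(Ω, U)) (W : Z.Opens) (h : W ≤ U)
    (ξ : Γ(Ω, W)) : (contractSection ω U η).1 ⟨W, h⟩ ξ = ω.app W (resM Ω h η) ξ := rfl

lemma restrict_contractSection (ω : SymTensor Ω) (η : Γ(Ω, U)) {V : Z.Opens} (h : V ≤ U) :
    LocalHom.restrict h (contractSection ω U η) = contractSection ω V (resM Ω h η) := by
  refine LocalHom.ext_sub fun W hW ξ => ?_
  rw [contractSection_apply, resM_resM]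
  rfl

lemma contractSection_smul (ω : SymTensor Ω) (a : Γ(Z, U)) (η : Γ(Ω, U)) :
    contractSection ω U (a • η) = a • contractSection ω U η := by
  refine LocalHom.ext_sub fun W hW ξ => ?_
  rw [contractSection_apply, resM_smul, map_smul, LinearMap.smul_apply, LocalHom.smul_apply]
  rfl

/-- The commutator with a unit, divided by the unit. -/
lemma HasSymbolTwo.conj_unit {S : LocalEnd (structureModule Z) U} {ω : SymTensor Ω}
    (h : HasSymbolTwo D S ω) (g : Γ(Z, U)ˣ) : ∃ c,
    mulEnd _ U g.val * S * mulEnd _ U (g⁻¹).val =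
      S - mulEnd _ U c - derOf D U (contractSection ω U ((g⁻¹).val • D.d U g.val)) := by
  obtain ⟨c, hc⟩ := h U le_rfl g.val
  rw [LocalEnd.restrict_self] at hc
  have h2 : mulEnd (structureModule Z) U g.val * mulEnd _ U (g⁻¹).val = 1 := by
    rw [← map_mul, Units.mul_inv, map_one]
  set δ := derOf D U (contractSection ω U (D.d U g.val)) with hδ
  have hδm : δ ∈ logDer D U := ⟨_, rfl⟩
  have h3 : mulEnd _ U g.val * S = S * mulEnd _ U g.val - (mulEnd _ U c + δ) := by
    rw [← hc]; abel
  have h4 := logDer_comm_mulEnd hδm (g⁻¹).val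
  refine ⟨c * (g⁻¹).val + LocalEnd.actO δ U le_rfl (g⁻¹).val, ?_⟩
  rw [h3, contractSection_smul, derOf_smul, ← hδ, sub_mul, mul_assoc S, h2, mul_one, add_mul,
    map_add, map_mul, ← h4]
  abel

lemma HasSymbolTwo.conj {S : LocalEnd (structureModule Z) U} {ω : SymTensor Ω}
    (h : HasSymbolTwo D S ω) (g : Γ(Z, U)ˣ) :
    HasSymbolTwo D (mulEnd _ U g.val * S * mulEnd _ U (g⁻¹).val) ω := by
  intro W hW a
  obtain ⟨c, hc⟩ := h.conj_unit g
  obtain ⟨b, hb⟩ := h W hW a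
  have hδ : derOf D U (contractSection ω U ((g⁻¹).val • D.d U g.val)) ∈ logDer D U := ⟨_, rfl⟩
  set δ := derOf D U (contractSection ω U ((g⁻¹).val • D.d U g.val))
  have h4 := logDer_comm_mulEnd (restrict_mem_logDer D hW hδ) a
  have h5 := mulEnd_commute (structureModule Z) (resO hW c) a
  refine ⟨b - LocalEnd.actO δ W hW a, ?_⟩
  rw [LocalEnd.actO_restrict] at h4
  rw [hc, map_sub, map_sub, map_sub, LocalEnd.restrict_mulEnd hW c, ← h4]
  rw [sub_mul, sub_mul, mul_sub, mul_sub, h5, sub_add_eq_add_sub, ← hb]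
  abel

lemma HasSymbolTwo.of_locally {S : LocalEnd (structureModule Z) U} {ω : SymTensor Ω}
    (h : ∀ x ∈ U, ∃ (W : Z.Opens) (hW : W ≤ U), x ∈ W ∧
      HasSymbolTwo D (LocalEnd.restrict hW S) ω) : HasSymbolTwo D S ω := by
  intro V hV a
  have : LocalEnd.restrict hV S * mulEnd _ V a - mulEnd _ V a * LocalEnd.restrict hV S -
      derOf D V (contractSection ω V (D.d V a)) ∈ logDiffOpOrder D 0 V := by
    refine mem_order_zero_of_locally fun x hx => ?_
    obtain ⟨W, hW, hxW, H⟩ := h x (hV hx)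
    obtain ⟨c, hc⟩ := H (V ⊓ W) inf_le_right (resO inf_le_left a)
    refine ⟨V ⊓ W, inf_le_left, ⟨hx, hxW⟩, c, ?_⟩
    rw [map_sub, map_sub, map_mul, map_mul, restrict_derOf, restrict_contractSection, D.natural',
      LocalEnd.restrict_mulEnd _ a, eq_sub_iff_add_eq, ← hc]
    rfl
  obtain ⟨c, hc⟩ := this
  exact ⟨c, by rw [hc, sub_add_cancel]⟩

lemma hasSymbolTwo_add_sum {W : Z.Opens} {n : ℕ} {u v : Fin n → LocalHom Ω W}
    {Q : LocalEnd (structureModule Z) W} (hQ : Q ∈ logDiffOpOrder D 1 W) {ω : SymTensor Ω}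
    (hω : ∀ (W' : Z.Opens) (h' : W' ≤ W) (η ξ : Γ(Ω, W')),
        ω.app W' η ξ = ∑ k, ((u k).1 ⟨W', h'⟩ η * (v k).1 ⟨W', h'⟩ ξ +
          (u k).1 ⟨W', h'⟩ ξ * (v k).1 ⟨W', h'⟩ η)) :
    HasSymbolTwo D (Q + ∑ k, derOf D W (u k) * derOf D W (v k)) ω := by
  intro V hV a
  obtain ⟨q, hq⟩ := hQ.2 V hV a
  have hk : ∀ k, LocalEnd.restrict hV (derOf D W (u k) * derOf D W (v k)) * mulEnd _ V a -
      mulEnd _ V a * LocalEnd.restrict hV (derOf D W (u k) * derOf D W (v k)) = _ := fun k =>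
    logDer_mul_comm_mulEnd (D := D) (δ := LocalEnd.restrict hV (derOf D W (u k)))
      (δ' := LocalEnd.restrict hV (derOf D W (v k))) ⟨LocalHom.restrict hV (u k), rfl⟩
      ⟨LocalHom.restrict hV (v k), rfl⟩ a
  have hder : derOf D V (contractSection ω V (D.d V a)) =
      ∑ k, (mulEnd _ V ((u k).1 ⟨V, hV⟩ (D.d V a)) * LocalEnd.restrict hV (derOf D W (v k)) +
        mulEnd _ V ((v k).1 ⟨V, hV⟩ (D.d V a)) * LocalEnd.restrict hV (derOf D W (u k))) := by
    have : contractSection ω V (D.d V a) =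
        ∑ k, ((u k).1 ⟨V, hV⟩ (D.d V a) • LocalHom.restrict hV (v k) +
          (v k).1 ⟨V, hV⟩ (D.d V a) • LocalHom.restrict hV (u k)) := by
      refine LocalHom.ext_sub fun V' hV' ξ => ?_
      have hsum : ∀ (s : Finset (Fin n)) (w : Fin n → LocalHom Ω V),
          (∑ i ∈ s, w i).1 ⟨V', hV'⟩ ξ = ∑ i ∈ s, (w i).1 ⟨V', hV'⟩ ξ := by
        intro s w
        induction s using Finset.cons_induction with
        | empty => rfl
        | cons i s hi ih => rw [Finset.sum_cons, Finset.sum_cons, ← ih]; rfl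
      rw [contractSection_apply, hω V' (hV'.trans hV), hsum]
      refine Finset.sum_congr rfl fun k _ => ?_
      rw [← LocalHom.natural (u k) hV hV', ← LocalHom.natural (v k) hV hV', mul_comm
        ((u k).1 ⟨V', hV'.trans hV⟩ ξ)]
      rfl
    rw [this, map_sum]
    rfl
  refine ⟨q + ∑ k, LocalEnd.actO (derOf D W (u k)) V hV (LocalEnd.actO (derOf D W (v k)) V hV a),
    ?_⟩
  rw [hder, map_add, map_sum, map_add, map_sum, add_mul, mul_add,
    Finset.sum_mul, Finset.mul_sum, add_sub_add_comm, ← Finset.sum_sub_distrib, ← hq, add_assoc,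
    ← Finset.sum_add_distrib]
  congr 1
  refine Finset.sum_congr rfl fun k _ => ?_
  rw [hk, add_comm]
  rfl

lemma IsSymbolTwo.hasSymbolTwo {P : LocalEnd L U} {ω : SymTensor Ω} (h : IsSymbolTwo D P ω)
    {e : Γ(L, U)} (he : IsGenerator L U e) : HasSymbolTwo D (he.conj.symm P) ω := by
  refine HasSymbolTwo.of_locally fun x hx => ?_
  obtain ⟨W, hW, hxW, e', he', n, u, v, Q, hQ, hP, hω⟩ := h x hx
  refine ⟨W, hW, hxW, ?_⟩
  obtain ⟨g, hg⟩ := (he.restrict hW).exists_unit he'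
  rw [he'.isConjugate_iff, (he.restrict hW).conj_eq_of_smul he' g hg] at hP
  have h1 := he.restrict_conj hW (he.conj.symm P)
  rw [RingEquiv.apply_symm_apply, hP] at h1
  rw [← (he.restrict hW).conj.injective h1]
  exact (hasSymbolTwo_add_sum hQ hω).conj g

lemma IsSymbolTwo.restrict {P : LocalEnd L U} {ω : SymTensor Ω} (h : IsSymbolTwo D P ω)
    {V : Z.Opens} (hV : V ≤ U) : IsSymbolTwo D (LocalEnd.restrict hV P) ω := by
  intro x hx
  obtain ⟨W, hW, hxW, e, he, n, u, v, Q, hQ, hP, hω⟩ := h x (hV hx)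
  refine ⟨V ⊓ W, inf_le_left, ⟨hx, hxW⟩, _, he.restrict inf_le_right, n,
    fun k => LocalHom.restrict inf_le_right (u k), fun k => LocalHom.restrict inf_le_right (v k),
    _, restrict_mem_order inf_le_right hQ, (he.restrict inf_le_right).isConjugate_iff.2 ?_,
    fun W' h' η ξ => hω W' (h'.trans inf_le_right) η ξ⟩
  have h1 : LocalEnd.restrict inf_le_right Q + ∑ k,
      derOf D (V ⊓ W) (LocalHom.restrict inf_le_right (u k)) *
        derOf D (V ⊓ W) (LocalHom.restrict inf_le_right (v k)) =
      LocalEnd.restrict (inf_le_right : V ⊓ W ≤ W)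
        (Q + ∑ k, derOf D W (u k) * derOf D W (v k)) := by
    rw [map_add, map_sum]
    rfl
  rw [h1, ← he.restrict_conj inf_le_right, ← he.isConjugate_iff.1 hP]
  rfl

lemma HasSymbolTwo.sub_mem {S S' : LocalEnd (structureModule Z) U} {ω : SymTensor Ω}
    (h : HasSymbolTwo D S ω) (h' : HasSymbolTwo D S' ω) (hS : S ∈ logDiffOpOrder D 2 U)
    (hS' : S' ∈ logDiffOpOrder D 2 U) : S - S' ∈ logDiffOpOrder D 1 U := by
  refine ⟨(sub_mem_order hS hS').1, fun W hW a => ?_⟩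
  obtain ⟨c, hc⟩ := h W hW a
  obtain ⟨c', hc'⟩ := h' W hW a
  refine ⟨c - c', ?_⟩
  rw [map_sub, map_sub, sub_mul, mul_sub, sub_sub_sub_comm, hc, hc']
  abel

/-- Operators of order two with the same symbol differ by an operator of order one. -/
lemma sub_mem_of_isSymbolTwo (hL : IsLineBundle L) {P P' : LocalEnd L U} {ω : SymTensor Ω}
    (hP : P ∈ twistedDiffOp D L 2 U) (hP' : P' ∈ twistedDiffOp D L 2 U)
    (h : IsSymbolTwo D P ω) (h' : IsSymbolTwo D P' ω) : P - P' ∈ twistedDiffOp D L 1 U := by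
  refine mem_twistedDiffOp_of_locally fun x hx => ?_
  obtain ⟨W, hxW, e, he⟩ := hL x
  have he' := he.restrict (inf_le_right : U ⊓ W ≤ W)
  refine ⟨U ⊓ W, inf_le_left, ⟨hx, hxW⟩, ?_⟩
  rw [he'.mem_twistedDiffOp_iff, map_sub, map_sub]
  exact ((h.restrict inf_le_left).hasSymbolTwo he').sub_mem
    ((h'.restrict inf_le_left).hasSymbolTwo he')
    (he'.mem_twistedDiffOp_iff.1 (restrict_mem_twistedDiffOp hP inf_le_left))
    (he'.mem_twistedDiffOp_iff.1 (restrict_mem_twistedDiffOp hP' inf_le_left))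

/-- Over a frame, every symmetric tensor is the symbol of a second order operator. -/
lemma IsFrame.exists_operator (hD : IsLogCalculus D) {n : ℕ} {e : Fin n → Γ(Ω, U)}
    (he : IsFrame e) (ω : SymTensor Ω) : ∃ u v : Fin n → LocalHom Ω U,
      ∀ (W' : Z.Opens) (h' : W' ≤ U) (η ξ : Γ(Ω, W')),
        ω.app W' η ξ = ∑ k, ((u k).1 ⟨W', h'⟩ η * (v k).1 ⟨W', h'⟩ ξ +
          (u k).1 ⟨W', h'⟩ ξ * (v k).1 ⟨W', h'⟩ η) := by
  obtain ⟨half, hhalf⟩ := (hD.isUnit_natCast U 2 two_ne_zero).exists_left_inv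
  refine ⟨fun k => half • contractSection ω U (e k), he.coord, fun W' h' η ξ => ?_⟩
  have h2 : resO h' half * 2 = 1 := by
    have := congrArg (resO h') hhalf
    rwa [map_mul, map_natCast, map_one] at this
  have h3 : ∀ η ξ : Γ(Ω, W'), ω.app W' η ξ =
      ∑ k, ω.app W' (resM Ω h' (e k)) η * (he.coord k).1 ⟨W', h'⟩ ξ := by
    intro η ξ
    conv_lhs => rw [← he.sum_coord h' ξ]
    rw [map_sum]
    refine Finset.sum_congr rfl fun k _ => ?_
    rw [map_smul, smul_eq_mul, mul_comm, ω.symm]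
  have h4 : ∀ k (η : Γ(Ω, W')), (half • contractSection ω U (e k)).1 ⟨W', h'⟩ η =
      resO h' half * ω.app W' (resM Ω h' (e k)) η := fun k η =>
    LocalHom.smul_apply _ _ _ _ _
  simp_rw [h4, mul_assoc]
  rw [Finset.sum_add_distrib, ← Finset.mul_sum, ← Finset.mul_sum, ← h3, ← h3, ω.symm W' ξ η,
    ← two_mul, mul_left_comm, ← mul_assoc, h2, one_mul]

end SecondOrder
end

section
/-! ### The connecting map -/

set_option maxHeartbeats 1000000
set_option synthInstance.maxHeartbeats 200000

variable {Z : Scheme.{0}} {Ω : Z.Modules} {U : Z.Opens} {D : SheafDerivation Ω} {L : Z.Modules}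

section ConnectingMap

/-- The operator `∑ u_k v_k`. -/
def sumDer (D : SheafDerivation Ω) {n : ℕ} (u v : Fin n → LocalHom Ω U) :
    LocalEnd (structureModule Z) U := ∑ k, derOf D U (u k) * derOf D U (v k)

lemma sumDer_mem_order {n : ℕ} (u v : Fin n → LocalHom Ω U) :
    sumDer D u v ∈ logDiffOpOrder D 2 U := by
  have : ∀ s : Finset (Fin n), ∑ k ∈ s, derOf D U (u k) * derOf D U (v k) ∈
      logDiffOpOrder D 2 U := by
    intro s
    induction s using Finset.cons_induction with
    | empty =>
      have := mulEnd_mem_order (D := D) 2 (0 : Γ(Z, U))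
      rwa [map_zero] at this
    | cons i s hi ih =>
      rw [Finset.sum_cons]
      exact add_mem_order (logDer_mul_mem_order ⟨u i, rfl⟩ ⟨v i, rfl⟩) ih
  exact this Finset.univ

/-- A second order operator `P` on `L` whose symbol is `ω`. -/
def IsLift (D : SheafDerivation Ω) (P : LocalEnd L U) (ω : SymTensor Ω) : Prop :=
  P ∈ twistedDiffOp D L 2 U ∧ IsSymbolTwo D P ω

lemma IsLift.restrict {P : LocalEnd L U} {ω : SymTensor Ω} (h : IsLift D P ω) {V : Z.Opens}
    (hV : V ≤ U) : IsLift D (LocalEnd.restrict hV P) ω :=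
  ⟨restrict_mem_twistedDiffOp h.1 hV, h.2.restrict hV⟩

lemma IsLift.sub_mem (hL : IsLineBundle L) {P P' : LocalEnd L U} {ω : SymTensor Ω}
    (h : IsLift D P ω) (h' : IsLift D P' ω) : P - P' ∈ twistedDiffOp D L 1 U :=
  sub_mem_of_isSymbolTwo hL h.1 h'.1 h.2 h'.2

lemma IsGenerator.isLift_conj {e : Γ(L, U)} (he : IsGenerator L U e) {ω : SymTensor Ω} {n : ℕ}
    {u v : Fin n → LocalHom Ω U}
    (hω : ∀ (W' : Z.Opens) (h' : W' ≤ U) (η ξ : Γ(Ω, W')),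
        ω.app W' η ξ = ∑ k, ((u k).1 ⟨W', h'⟩ η * (v k).1 ⟨W', h'⟩ ξ +
          (u k).1 ⟨W', h'⟩ ξ * (v k).1 ⟨W', h'⟩ η)) :
    IsLift D (he.conj (sumDer D u v)) ω := by
  refine ⟨he.conj_mem_twistedDiffOp (sumDer_mem_order u v), fun x hx =>
    ⟨U, le_rfl, hx, e, he, n, u, v, 0, ?_, ?_, hω⟩⟩
  · have := mulEnd_mem_order (D := D) 1 (0 : Γ(Z, U))
    rwa [map_zero] at this
  · rw [zero_add, LocalEnd.restrict_self, he.isConjugate_iff]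
    rfl

/-- The symbols of the differences of local lifts form a cocycle. -/
lemma exists_cocycle_of_isLift (hD : IsLogCalculus D) (hL : IsLineBundle L) {ω : SymTensor Ω}
    (U : PointCover Z) (P : ∀ x : Z, LocalEnd L (U.nbhd x)) (hP : ∀ x, IsLift D (P x) ω) :
    ∃ v : cocycles (logDerPresheaf D) U, ∀ x y,
      IsSymbolOne (LocalEnd.restrict inf_le_right (P y) - LocalEnd.restrict inf_le_left (P x))
        (v.1 x y : logDer D (U.nbhd x ⊓ U.nbhd y)).1 := by
  have h : ∀ x y, ∃ δ ∈ logDer D (U.nbhd x ⊓ U.nbhd y), IsSymbolOne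
      (LocalEnd.restrict inf_le_right (P y) - LocalEnd.restrict inf_le_left (P x)) δ := fun x y =>
    hD.exists_symbol hL (((hP y).restrict _).sub_mem hL ((hP x).restrict _))
  choose δ hδ hs using h
  refine ⟨⟨fun x y => (⟨δ x y, hδ x y⟩ : logDer D _), fun x y z => Subtype.ext ?_⟩, hs⟩
  have h1 := (hs x z).restrict (show U.nbhd x ⊓ U.nbhd y ⊓ U.nbhd z ≤ U.nbhd x ⊓ U.nbhd z from
    le_inf (inf_le_left.trans inf_le_left) inf_le_right)
  have h2 := (hs x y).restrict (show U.nbhd x ⊓ U.nbhd y ⊓ U.nbhd z ≤ U.nbhd x ⊓ U.nbhd y from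
    inf_le_left)
  have h3 := (hs y z).restrict (show U.nbhd x ⊓ U.nbhd y ⊓ U.nbhd z ≤ U.nbhd y ⊓ U.nbhd z from
    inf_le_inf_right _ inf_le_right)
  refine h1.unique hL ?_
  have h4 := h2.add h3
  rw [map_sub, map_sub, LocalEnd.restrict_restrict, LocalEnd.restrict_restrict,
    LocalEnd.restrict_restrict, LocalEnd.restrict_restrict, sub_add_sub_cancel'] at h4
  rw [map_sub, LocalEnd.restrict_restrict, LocalEnd.restrict_restrict]
  exact h4

lemma isMu_iff (hL : IsLineBundle L) {ω : SymTensor Ω} {c : HOne (logDerPresheaf D)} :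
    IsMu D L ω c ↔ ∃ (U : PointCover Z) (P : ∀ x : Z, LocalEnd L (U.nbhd x))
      (v : cocycles (logDerPresheaf D) U), (∀ x, IsLift D (P x) ω) ∧
      (∀ x y, IsSymbolOne
        (LocalEnd.restrict inf_le_right (P y) - LocalEnd.restrict inf_le_left (P x))
        (v.1 x y : logDer D (U.nbhd x ⊓ U.nbhd y)).1) ∧ c = HOne.mk _ U v := by
  constructor
  · rintro ⟨U, P, v, hP, hv, rfl⟩
    exact ⟨U, P, v, hP, fun x y => (hv x y).2, rfl⟩
  · rintro ⟨U, P, v, hP, hv, rfl⟩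
    exact ⟨U, P, v, hP, fun x y =>
      ⟨((hP y).restrict _).sub_mem hL ((hP x).restrict _), hv x y⟩, rfl⟩

/-- The class `μ_L(ω)` does not depend on the local lifts. -/
lemma IsMu.unique (hD : IsLogCalculus D) (hL : IsLineBundle L) {ω : SymTensor Ω}
    {c c' : HOne (logDerPresheaf D)} (h : IsMu D L ω c) (h' : IsMu D L ω c') : c = c' := by
  rw [isMu_iff hL] at h h'
  obtain ⟨U, P, v, hP, hv, rfl⟩ := h
  obtain ⟨U', P', v', hP', hv', rfl⟩ := h'
  let V : PointCover Z := ⟨fun x => U.nbhd x ⊓ U'.nbhd x, fun x => ⟨U.mem x, U'.mem x⟩⟩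
  have hUV : U ≤ V := fun x => inf_le_left
  have hUV' : U' ≤ V := fun x => inf_le_right
  have hb : ∀ x, ∃ δ ∈ logDer D (V.nbhd x), IsSymbolOne
      (LocalEnd.restrict (hUV' x) (P' x) - LocalEnd.restrict (hUV x) (P x)) δ := fun x =>
    hD.exists_symbol hL (((hP' x).restrict _).sub_mem hL ((hP x).restrict _))
  choose b hbm hb using hb
  refine HOne.mk_eq_mk hUV hUV' v v' (fun x => (⟨b x, hbm x⟩ : logDer D _))
    fun x y => Subtype.ext ?_
  have h1 := (hv x y).restrict (inf_le_inf (hUV x) (hUV y))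
  have h2 := (hv' x y).restrict (inf_le_inf (hUV' x) (hUV' y))
  have h3 := (hb x).restrict (inf_le_left : V.nbhd x ⊓ V.nbhd y ≤ _)
  have h4 := (hb y).restrict (inf_le_right : V.nbhd x ⊓ V.nbhd y ≤ _)
  have h5 := h2.sub h1
  have h6 := h4.sub h3
  simp only [map_sub, LocalEnd.restrict_restrict] at h5 h6
  rw [sub_sub_sub_comm] at h6
  exact h5.unique hL h6

/-- `μ_L(ω) = -ω ∪ c₁(L) + μ_𝒪(ω)`, computed on local lifts `∑ u_k v_k` transported to `L` by
generators. -/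
lemma exists_isMu (hD : IsLogCalculus D) (hL : IsLineBundle L) (ω : SymTensor Ω) :
    ∃ μL μO : HOne (logDerPresheaf D), IsMu D L ω μL ∧ IsMu D (structureModule Z) ω μO ∧
      μL = -cup D ω (chernClass D hL) + μO := by
  set t := hL.trivialization with ht
  have hW : ∀ x : Z, ∃ (W : Z.Opens) (_ : W ≤ t.cover.nbhd x) (n : ℕ)
      (u v : Fin n → LocalHom Ω W), x ∈ W ∧
      ∀ (W' : Z.Opens) (h' : W' ≤ W) (η ξ : Γ(Ω, W')),
        ω.app W' η ξ = ∑ k, ((u k).1 ⟨W', h'⟩ η * (v k).1 ⟨W', h'⟩ ξ +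
          (u k).1 ⟨W', h'⟩ ξ * (v k).1 ⟨W', h'⟩ η) := by
    intro x
    obtain ⟨W, hW, n, e, hx, he⟩ := hD.exists_frame_le x (t.cover.mem x)
    obtain ⟨u, v, h⟩ := he.exists_operator hD ω
    exact ⟨W, hW, n, u, v, hx, h⟩
  choose W hWle n u v hxW hω using hW
  let V : PointCover Z := ⟨W, hxW⟩
  have hV : t.cover ≤ V := hWle
  have hg : ∀ x, IsGenerator L (V.nbhd x) (resM L (hV x) (t.gen x)) := fun x =>
    (t.isGenerator x).restrict (hV x)
  let Q : ∀ x, LocalEnd (structureModule Z) (V.nbhd x) := fun x => sumDer D (u x) (v x)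
  let P : ∀ x, LocalEnd L (V.nbhd x) := fun x => (hg x).conj (Q x)
  have hQ : ∀ x, IsLift D (Q x) ω := by
    intro x
    have := (isGenerator_one (V.nbhd x)).isLift_conj (D := D) (hω x)
    rwa [conj_one] at this
  have hP : ∀ x, IsLift D (P x) ω := fun x => (hg x).isLift_conj (hω x)
  obtain ⟨vO, hvO⟩ := exists_cocycle_of_isLift hD isLineBundle_structureModule V Q hQ
  obtain ⟨vL, hvL⟩ := exists_cocycle_of_isLift hD hL V P hP
  refine ⟨HOne.mk _ V vL, HOne.mk _ V vO, (isMu_iff hL).2 ⟨V, P, vL, hP, hvL, rfl⟩,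
    (isMu_iff isLineBundle_structureModule).2 ⟨V, Q, vO, hQ, hvO, rfl⟩, ?_⟩
  have hcup : cup D ω (chernClass D hL) = HOne.mk _ V (refineCocycle _ t.cover V hV
      (mapCocycle (contract D ω) _ (mapCocycle (dlog D) _ t.unitCocycle))) := by
    rw [HOne.mk_refine, ← HOne.map_mk, ← HOne.map_mk]
    rfl
  rw [hcup, neg_add_eq_sub, ← HOne.mk_sub]
  congr 1
  refine Subtype.ext (funext fun x => funext fun y => Subtype.ext ?_)
  set Y : Z.Opens := V.nbhd x ⊓ V.nbhd y
  have hxy : Y ≤ t.cover.nbhd x ⊓ t.cover.nbhd y := inf_le_inf (hV x) (hV y)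
  let g : Γ(Z, Y)ˣ := Units.map (resO hxy).toMonoidHom (t.unit x y)
  have hgx := (t.isGenerator x).restrict (hxy.trans inf_le_left)
  have hgy := (t.isGenerator y).restrict (hxy.trans inf_le_right)
  have hgg : g.val • resM L (hxy.trans inf_le_left) (t.gen x) =
    resM L (hxy.trans inf_le_right) (t.gen y) := t.unit_smul_res x y hxy
  have hPx : LocalEnd.restrict inf_le_left (P x) =
      hgx.conj (LocalEnd.restrict (inf_le_left : Y ≤ _) (Q x)) :=
    ((hg x).restrict_conj inf_le_left (Q x)).trans
      (IsGenerator.conj_congr _ _ (resM_resM _ _ _ _) _)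
  have hPy : LocalEnd.restrict inf_le_right (P y) =
      hgy.conj (LocalEnd.restrict (inf_le_right : Y ≤ _) (Q y)) :=
    ((hg y).restrict_conj inf_le_right (Q y)).trans
      (IsGenerator.conj_congr _ _ (resM_resM _ _ _ _) _)
  have hQy : HasSymbolTwo D (LocalEnd.restrict (inf_le_right : Y ≤ _) (Q y)) ω := by
    have := ((hQ y).2.restrict (inf_le_right : Y ≤ _)).hasSymbolTwo (isGenerator_one Y)
    have h1 := (isGenerator_one Y).conj.symm_apply_eq.2
      (conj_one (LocalEnd.restrict (inf_le_right : Y ≤ _) (Q y))).symm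
    rwa [h1] at this
  obtain ⟨c, hc⟩ := hQy.conj_unit g
  obtain ⟨a, δ, hδ, hQQ⟩ := (isGenerator_one Y).exists_eq_conj hD
    (((hQ y).restrict (inf_le_right : Y ≤ _)).sub_mem isLineBundle_structureModule
      ((hQ x).restrict inf_le_left))
  have hδ' : δ = (vO.1 x y : logDer D Y).1 := by
    refine IsSymbolOne.unique isLineBundle_structureModule ?_ (hvO x y)
    rw [hQQ]
    exact (isGenerator_one Y).isSymbolOne_conj_add a hδ
  rw [conj_one] at hQQ
  have hdlog : (mapCocycle (contract D ω) _ (mapCocycle (dlog D) _ t.unitCocycle)).1 x y =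
      (⟨derOf D _ (contractSection ω _ (((t.unit x y)⁻¹).val • D.d _ (t.unit x y).val)), _, rfl⟩ :
        logDer D _) := rfl
  have hdlog' : LocalEnd.restrict hxy (derOf D _ (contractSection ω _
      (((t.unit x y)⁻¹).val • D.d _ (t.unit x y).val))) =
      derOf D Y (contractSection ω Y ((g⁻¹).val • D.d Y g.val)) := by
    rw [restrict_derOf, restrict_contractSection, resM_smul, D.natural']
    rfl
  set ε := derOf D Y (contractSection ω Y ((g⁻¹).val • D.d Y g.val)) with hε
  have hεm : ε ∈ logDer D Y := ⟨_, rfl⟩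
  have hdiff : LocalEnd.restrict inf_le_right (P y) - LocalEnd.restrict inf_le_left (P x) =
      hgx.conj (mulEnd _ Y (a - c) + (δ - ε)) := by
    rw [hPx, hPy, hgx.conj_eq_of_smul hgy g hgg, ← map_sub, hc]
    refine congrArg hgx.conj ?_
    rw [map_sub, sub_right_comm, sub_right_comm _ (mulEnd _ Y c), hQQ]
    abel
  have hfin := hgx.isSymbolOne_conj_add (a - c) (sub_mem hδ hεm)
  rw [← hdiff] at hfin
  refine ((hvL x y).unique hL hfin).trans ?_
  rw [hδ', ← hdlog']
  rfl

end ConnectingMap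

/-- The comparison of the extension class and of the connecting maps, for a calculus of logarithmic
forms with local frames. -/
theorem IsLogCalculus.comparison (hD : IsLogCalculus D) (hL : IsLineBundle L) :
    IsExactOne D L ∧ (∀ c : HOne Ω.presheaf, IsExtensionClass D L c ↔ c = chernClass D hL) ∧
    ∀ ω : SymTensor Ω, ∃ μL μO : HOne (logDerPresheaf D),
      (∀ c, IsMu D L ω c ↔ c = μL) ∧ (∀ c, IsMu D (structureModule Z) ω c ↔ c = μO) ∧
      μL = -cup D ω (chernClass D hL) + μO := by
  refine ⟨hD.isExactOne hL, fun c => ⟨fun h => h.unique hD hL (isExtensionClass_chernClass hL), ?_⟩,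
    fun ω => ?_⟩
  · rintro rfl
    exact isExtensionClass_chernClass hL
  · obtain ⟨μL, μO, h1, h2, h3⟩ := exists_isMu hD hL ω
    refine ⟨μL, μO, fun c => ⟨fun h => h.unique hD hL h1, ?_⟩,
      fun c => ⟨fun h => h.unique hD isLineBundle_structureModule h2, ?_⟩, h3⟩ <;>
    · rintro rfl; assumption
end

section
/-! ### Descent of linear conditions along flat homomorphisms -/

section FlatAlgebra

/-- Solutions in a flat module of a homogeneous linear system with coefficients in the base ring
are combinations of solutions in the base ring. -/
lemma exists_solutions_of_flat {A E : Type} [CommRing A] [AddCommGroup E] [Module A E]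
    [Module.Flat A E] {m n : Type} [Finite m] [Fintype n] (M : m → n → A) (v : n → E)
    (h : ∀ i, ∑ j, M i j • v j = 0) :
    ∃ (r : ℕ) (c : n → Fin r → A) (y : Fin r → E),
      (∀ i s, ∑ j, M i j * c j s = 0) ∧ ∀ j, v j = ∑ s, c j s • y s := by
  classical
  cases nonempty_fintype m
  let f : (m → A) →ₗ[A] (n → A) := Fintype.linearCombination A M
  let x : (n → A) →ₗ[A] E := Fintype.linearCombination A v
  have hf : ∀ i, f (Pi.single i 1) = M i := fun i => by
    simp [f, Fintype.linearCombination_apply_single]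
  have hxf : x ∘ₗ f = 0 := by
    refine LinearMap.pi_ext' fun i => LinearMap.ext_ring ?_
    change x (f (Pi.single i 1)) = 0
    rw [hf, Fintype.linearCombination_apply, h]
  obtain ⟨r, a, y, hya, haf⟩ := Module.Flat.exists_factorization_of_comp_eq_zero_of_free hxf
  refine ⟨r, fun j s => a (Pi.single j 1) s, fun s => y (Finsupp.single s 1), fun i s => ?_,
    fun j => ?_⟩
  · have h1 : a (f (Pi.single i 1)) s = 0 := by
      rw [← LinearMap.comp_apply, haf]; rfl
    rw [hf] at h1
    have h2 : M i = ∑ j, M i j • (Pi.single j 1 : n → A) := by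
      ext j; simp [Finset.sum_apply, Pi.single_apply]
    rw [h2, map_sum, Finsupp.finsetSum_apply] at h1
    rw [← h1]
    exact Finset.sum_congr rfl fun j _ => by rw [map_smul]; rfl
  · have h1 : v j = x (Pi.single j 1) := by
      simp [x, Fintype.linearCombination_apply_single]
    rw [h1, hya, LinearMap.comp_apply]
    conv_lhs => rw [← Finsupp.sum_single (a (Pi.single j 1)), Finsupp.sum_fintype _ _ (by simp)]
    rw [map_sum]
    refine Finset.sum_congr rfl fun s _ => ?_
    rw [← map_smul, Finsupp.smul_single, smul_eq_mul, mul_one]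

variable {A A' : Type} [CommRing A] [CommRing A'] [Algebra A A']

/-- Divisibility properties of the form "`x` divides `w` if it divides `y w`" pass to flat
algebras. -/
lemma dvd_of_dvd_mul_of_flat [Module.Flat A A'] {x y : A} (h : ∀ w, x ∣ y * w → x ∣ w) {w : A'}
    (hw : algebraMap A A' x ∣ algebraMap A A' y * w) : algebraMap A A' x ∣ w := by
  obtain ⟨v, hv⟩ := hw
  obtain ⟨r, c, z, h1, h2⟩ := exists_solutions_of_flat (A := A) (E := A') (m := Unit) (n := Fin 2)
    (fun _ => ![y, -x]) ![w, v] (fun _ => by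
      simp [Fin.sum_univ_two, Algebra.smul_def, hv])
  have h3 := h2 0
  simp only [Matrix.cons_val_zero] at h3
  rw [h3]
  refine Finset.dvd_sum fun s _ => ?_
  have h4 := h1 () s
  simp only [Fin.sum_univ_two, Matrix.cons_val_zero, Matrix.cons_val_one] at h4
  obtain ⟨b, hb⟩ := h (c 0 s) ⟨c 1 s, by linear_combination h4⟩
  rw [hb, Algebra.smul_def, map_mul, mul_assoc]
  exact dvd_mul_right _ _

lemma mem_nonZeroDivisors_of_flat [Module.Flat A A'] {x : A} (h : x ∈ nonZeroDivisors A) :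
    algebraMap A A' x ∈ nonZeroDivisors A' := by
  rw [mem_nonZeroDivisors_iff_right]
  intro w hw
  obtain ⟨r, c, z, h1, h2⟩ := exists_solutions_of_flat (A := A) (E := A') (m := Unit) (n := Unit)
    (fun _ _ => x) (fun _ => w) (fun _ => by simp [Algebra.smul_def, mul_comm, hw])
  rw [h2 ()]
  refine Finset.sum_eq_zero fun s _ => ?_
  have h3 := h1 () s
  simp only [Finset.univ_unique, Finset.sum_singleton, mul_comm x] at h3
  rw [(mem_nonZeroDivisors_iff_right.1 h) _ h3, zero_smul]

lemma dvd_of_algebraMap_dvd [Module.FaithfullyFlat A A'] {a b : A}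
    (h : algebraMap A A' a ∣ algebraMap A A' b) : a ∣ b := by
  rw [← Ideal.mem_span_singleton, ← Ideal.comap_map_eq_self_of_faithfullyFlat (B := A')
    (Ideal.span {a}), Ideal.mem_comap, Ideal.map_span, Set.image_singleton,
    Ideal.mem_span_singleton]
  exact h

lemma algebraMap_injective_of_faithfullyFlat [Module.FaithfullyFlat A A'] :
    Function.Injective (algebraMap A A') := by
  rw [injective_iff_map_eq_zero]
  intro a ha
  rw [← zero_dvd_iff]
  refine dvd_of_algebraMap_dvd (A' := A') ?_
  rw [ha]
  exact dvd_zero _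

lemma mem_nonZeroDivisors_of_algebraMap [Module.FaithfullyFlat A A'] {a : A}
    (h : algebraMap A A' a ∈ nonZeroDivisors A') : a ∈ nonZeroDivisors A := by
  rw [mem_nonZeroDivisors_iff_right]
  intro w hw
  refine algebraMap_injective_of_faithfullyFlat (A' := A') ?_
  rw [map_zero]
  refine (mem_nonZeroDivisors_iff_right.1 h) _ ?_
  rw [← map_mul, hw, map_zero]

/-- Faithfully flat descent of membership in a submodule. -/
lemma mem_of_mem_span_image [Module.FaithfullyFlat A A'] {E E' : Type} [AddCommGroup E]
    [Module A E] [AddCommGroup E'] [Module A E'] [Module A' E'] [IsScalarTower A A' E']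
    {f : E →ₗ[A] E'} (hf : IsBaseChange A' f) {N : Submodule A E} {e : E}
    (he : f e ∈ Submodule.span A' (f '' N)) : e ∈ N := by
  let q : E →ₗ[A] A' ⊗[A] (E ⧸ N) := (TensorProduct.mk A A' (E ⧸ N) 1).comp N.mkQ
  have hq : ∀ n ∈ N, q n = 0 := by
    intro n hn
    simp only [q, LinearMap.comp_apply, Submodule.mkQ_apply, (Submodule.Quotient.mk_eq_zero N).2 hn,
      map_zero]
  have h1 : ∀ x ∈ Submodule.span A' (f '' N), hf.lift q x = 0 := by
    intro x hx
    induction hx using Submodule.span_induction with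
    | mem x hx =>
      obtain ⟨n, hn, rfl⟩ := hx
      rw [hf.lift_eq, hq n hn]
    | zero => rw [map_zero]
    | add x y _ _ hx hy => rw [map_add, hx, hy, add_zero]
    | smul c x _ hx => rw [map_smul, hx, smul_zero]
  replace h1 := h1 _ he
  rw [hf.lift_eq] at h1
  have h2 : N.mkQ e = 0 := by
    refine Module.FaithfullyFlat.tensorProduct_mk_injective (A := A) (B := A') (E ⧸ N) ?_
    rw [map_zero]
    exact h1
  exact (Submodule.Quotient.mk_eq_zero N).1 h2

/-- An ideal which becomes principal over a local faithfully flat algebra, with a generator which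
is not a zero divisor, is principal. -/
lemma exists_generator_of_map_eq_span [Module.FaithfullyFlat A A'] [IsLocalRing A'] {I : Ideal A}
    {T : A'} (hT : T ∈ nonZeroDivisors A') (h : I.map (algebraMap A A') = Ideal.span {T}) :
    ∃ t ∈ I, I = Ideal.span {t} ∧ Ideal.span {algebraMap A A' t} = Ideal.span {T} := by
  have hmem : ∀ t ∈ I, T ∣ algebraMap A A' t := fun t ht => by
    rw [← Ideal.mem_span_singleton, ← h]
    exact Ideal.mem_map_of_mem _ ht
  have key : ∃ t ∈ I, ∃ u : A', IsUnit u ∧ algebraMap A A' t = T * u := by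
    by_contra! hcon
    have h1 : I.map (algebraMap A A') ≤
        Ideal.span {T} * IsLocalRing.maximalIdeal A' := by
      rw [Ideal.map_le_iff_le_comap]
      intro t ht
      obtain ⟨u, hu⟩ := hmem t ht
      rw [Ideal.mem_comap, hu]
      exact Ideal.mul_mem_mul (Ideal.mem_span_singleton_self _)
        ((IsLocalRing.mem_maximalIdeal _).2 fun hu' => hcon t ht u hu' hu)
    rw [h] at h1
    have h2 : T ∈ Ideal.span {T} * IsLocalRing.maximalIdeal A' :=
      h1 (Ideal.mem_span_singleton_self _)
    obtain ⟨z, hz, hz'⟩ := Ideal.mem_span_singleton_mul.1 h2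
    have h3 : (z - 1) * T = 0 := by linear_combination hz'
    have h4 : z = 1 := sub_eq_zero.1 ((mem_nonZeroDivisors_iff_right.1 hT) _ h3)
    rw [h4] at hz
    exact (IsLocalRing.mem_maximalIdeal _).1 hz isUnit_one
  obtain ⟨t, ht, u, hu, htu⟩ := key
  have h1 : Ideal.span {algebraMap A A' t} = Ideal.span {T} := by
    rw [htu]
    exact Ideal.span_singleton_mul_right_unit hu T
  refine ⟨t, ht, le_antisymm (fun y hy => ?_) ((Ideal.span_singleton_le_iff_mem _).2 ht), h1⟩
  rw [Ideal.mem_span_singleton]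
  refine dvd_of_algebraMap_dvd (A' := A') ?_
  rw [← Ideal.mem_span_singleton, h1, Ideal.mem_span_singleton]
  exact hmem y hy

end FlatAlgebra
end

section
/-! ### Polar forms -/

section Polar
variable (k : Type) {A : Type} [CommRing k] [CommRing A] [Algebra k A]

/-- The forms `ω` with `dt ∧ ω` divisible by `t`: all contractions of `dt ∧ ω` with two vector
fields are divisible by `t`. For a local equation `t` of a divisor these are the products `t η` with
`η` a logarithmic form. -/
def polarForms (t : A) : Submodule A (Ω[A⁄k]) where
  carrier := {ω | ∀ θ θ' : Ω[A⁄k] →ₗ[A] A,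
    t ∣ θ (KaehlerDifferential.D k A t) * θ' ω - θ' (KaehlerDifferential.D k A t) * θ ω}
  zero_mem' := by intro θ θ'; simp
  add_mem' := by
    intro x y hx hy θ θ'
    have := dvd_add (hx θ θ') (hy θ θ')
    rw [map_add, map_add]
    convert! this using 1
    ring
  smul_mem' := by
    intro c x hx θ θ'
    have := (hx θ θ').mul_left c
    rw [map_smul, map_smul, smul_eq_mul, smul_eq_mul]
    convert! this using 1
    ring

variable {k}

lemma smul_mem_polarForms (t : A) (ω : Ω[A⁄k]) : t • ω ∈ polarForms k t := by
  intro θ θ'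
  rw [map_smul, map_smul, smul_eq_mul, smul_eq_mul]
  exact ⟨θ (KaehlerDifferential.D k A t) * θ' ω - θ' (KaehlerDifferential.D k A t) * θ ω, by ring⟩

lemma polarForms_mul_unit (t : A) (u : Aˣ) : polarForms k (t * u) = polarForms k t := by
  have key : ∀ (t : A) (u : Aˣ), polarForms k t ≤ polarForms k (t * u) := by
    intro t u ω hω θ θ'
    obtain ⟨c, hc⟩ := hω θ θ'
    rw [Units.mul_right_dvd]
    rw [Derivation.leibniz, map_add, map_add, map_smul, map_smul, map_smul, map_smul]
    simp only [smul_eq_mul]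
    refine ⟨(θ (KaehlerDifferential.D k A u.val) * θ' ω -
      θ' (KaehlerDifferential.D k A u.val) * θ ω) + u * c, ?_⟩
    linear_combination u.val * hc
  refine le_antisymm ?_ (key t u)
  have := key (t * u) u⁻¹
  rwa [mul_assoc, Units.mul_inv, mul_one] at this

lemma mem_polarForms_iff {ι : Type} [Finite ι] (ε : Module.Basis ι A (Ω[A⁄k])) {t : A}
    {ω : Ω[A⁄k]} : ω ∈ polarForms k t ↔ ∀ i j,
      t ∣ ε.repr (KaehlerDifferential.D k A t) i * ε.repr ω j -
        ε.repr (KaehlerDifferential.D k A t) j * ε.repr ω i := by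
  cases nonempty_fintype ι
  refine ⟨fun h i j => h (ε.coord i) (ε.coord j), fun h θ θ' => ?_⟩
  have h1 : ∀ (θ : Ω[A⁄k] →ₗ[A] A) ω, θ ω = ∑ i, ε.repr ω i * θ (ε i) := by
    intro θ ω
    conv_lhs => rw [← ε.sum_repr ω]
    rw [map_sum]
    exact Finset.sum_congr rfl fun i _ => by rw [map_smul, smul_eq_mul]
  rw [h1 θ, h1 θ', h1 θ, h1 θ', Finset.sum_mul_sum, Finset.sum_mul_sum, Finset.sum_comm,
    ← Finset.sum_sub_distrib]
  refine Finset.dvd_sum fun j _ => ?_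
  rw [← Finset.sum_sub_distrib]
  refine Finset.dvd_sum fun i _ => ?_
  convert! (h i j).mul_left (θ (ε i) * θ' (ε j)) using 1
  ring

section BaseChange
variable {A' : Type} [CommRing A'] [Algebra k A'] [Algebra A A'] [IsScalarTower k A A']

/-- The basis of the forms of a formally étale algebra given by a basis of the forms of the base. -/
def baseChangeBasis [Algebra.FormallyEtale A A'] {ι : Type} (ε : Module.Basis ι A (Ω[A⁄k])) :
    Module.Basis ι A' (Ω[A'⁄k]) :=
  (KaehlerDifferential.isBaseChange_of_formallyEtale k A A').basis ε

lemma repr_baseChangeBasis [Algebra.FormallyEtale A A'] {ι : Type}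
    (ε : Module.Basis ι A (Ω[A⁄k])) (ω : Ω[A⁄k]) (i : ι) :
    (baseChangeBasis ε).repr (KaehlerDifferential.map k k A A' ω) i =
      algebraMap A A' (ε.repr ω i) := by
  exact IsBaseChange.basis_repr_comp_apply _ _ _ _

lemma map_mem_polarForms_iff [Algebra.FormallyEtale A A'] [Module.FaithfullyFlat A A']
    {ι : Type} [Finite ι] (ε : Module.Basis ι A (Ω[A⁄k])) {t : A} {ω : Ω[A⁄k]} :
    KaehlerDifferential.map k k A A' ω ∈ polarForms k (algebraMap A A' t) ↔ ω ∈ polarForms k t := by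
  rw [mem_polarForms_iff (baseChangeBasis ε), mem_polarForms_iff ε,
    ← KaehlerDifferential.map_D k k A A']
  simp only [repr_baseChangeBasis, ← map_mul, ← map_sub]
  exact forall₂_congr fun i j => ⟨fun h => dvd_of_algebraMap_dvd h, fun h => map_dvd _ h⟩

/-- The formation of the module of polar forms commutes with étale localization. -/
lemma mem_span_map_polarForms [Algebra.FormallyEtale A A'] [Module.Flat A A'] {ι : Type} [Finite ι]
    (ε : Module.Basis ι A (Ω[A⁄k])) {t : A} {ω : Ω[A'⁄k]}
    (hω : ω ∈ polarForms k (algebraMap A A' t)) :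
    ω ∈ Submodule.span A' (KaehlerDifferential.map k k A A' '' polarForms k t) := by
  classical
  cases nonempty_fintype ι
  let ε' := baseChangeBasis (A' := A') ε
  let p := ε.repr (KaehlerDifferential.D k A t)
  have hp : ∀ i, ε'.repr (KaehlerDifferential.D k A' (algebraMap A A' t)) i =
      algebraMap A A' (p i) := fun i => by
    rw [← KaehlerDifferential.map_D k k A A']
    exact repr_baseChangeBasis ε _ i
  have hω' := (mem_polarForms_iff ε').1 hω
  simp only [hp] at hω'
  choose c hc using hω'
  let M : ι × ι → ι ⊕ ι × ι → A := fun a => Sum.elim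
    (fun j => (if a.2 = j then p a.1 else 0) - if a.1 = j then p a.2 else 0)
    (fun b => if a = b then -t else 0)
  obtain ⟨r, z, y, h1, h2⟩ := exists_solutions_of_flat (E := A') M
    (Sum.elim (fun j => ε'.repr ω j) fun b => c b.1 b.2) (fun a => by
      simp only [M, Fintype.sum_sum_type, Sum.elim_inl, Sum.elim_inr, sub_smul, ite_smul, zero_smul,
        Finset.sum_sub_distrib, Finset.sum_ite_eq, Finset.mem_univ, if_true, neg_smul]
      simp only [Algebra.smul_def]
      rw [hc, add_neg_cancel])
  have h3 : ω = ∑ s, y s • KaehlerDifferential.map k k A A' (∑ j, z (Sum.inl j) s • ε j) := by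
    conv_lhs => rw [← ε'.sum_repr ω]
    have : ∀ j, ε' j = KaehlerDifferential.map k k A A' (ε j) := fun j =>
      IsBaseChange.basis_apply _ _ _
    simp only [map_sum, Finset.smul_sum]
    rw [Finset.sum_comm]
    refine Finset.sum_congr rfl fun j _ => ?_
    have h4 := h2 (Sum.inl j)
    simp only [Sum.elim_inl] at h4
    rw [h4, Finset.sum_smul]
    refine Finset.sum_congr rfl fun s _ => ?_
    rw [map_smul, this, Algebra.smul_def, mul_comm, mul_smul, algebraMap_smul]
  rw [h3]
  refine Submodule.sum_mem _ fun s _ => Submodule.smul_mem _ _ (Submodule.subset_span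
    ⟨_, (mem_polarForms_iff ε).2 fun i j => ?_, rfl⟩)
  have h5 : ∀ j, ε.repr (∑ j, z (Sum.inl j) s • ε j) j = z (Sum.inl j) s := fun j => by
    rw [ε.repr_sum_self]
  rw [h5, h5]
  have h6 := h1 (i, j) s
  simp only [M, Fintype.sum_sum_type, Sum.elim_inl, Sum.elim_inr, sub_mul, ite_mul, zero_mul,
    Finset.sum_sub_distrib, Finset.sum_ite_eq, Finset.mem_univ, if_true] at h6
  exact ⟨z (Sum.inr (i, j)) s, by linear_combination h6⟩

/-- A basis of the forms of an étale algebra yields one for the forms of the base. -/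
lemma exists_basis_of_etale [IsLocalRing A] [Algebra.FormallyEtale A A']
    [Module.FaithfullyFlat A A'] [Nontrivial A'] {ι : Type} [Finite ι]
    (ε' : Module.Basis ι A' (Ω[A'⁄k])) :
    ∃ n, Nonempty (Module.Basis (Fin n) A (Ω[A⁄k])) := by
  let e := KaehlerDifferential.tensorKaehlerEquivOfFormallyEtale k A A'
  have : Module.Finite A' (Ω[A'⁄k]) := Module.Finite.of_basis ε'
  have : Module.Free A' (Ω[A'⁄k]) := Module.Free.of_basis ε'
  have : Module.Finite A' (A' ⊗[A] Ω[A⁄k]) := Module.Finite.equiv e.symm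
  have : Module.Free A' (A' ⊗[A] Ω[A⁄k]) := Module.Free.of_equiv e.symm
  have : Module.Finite A (Ω[A⁄k]) := Module.Finite.of_finite_tensorProduct_of_faithfullyFlat A'
  have : Module.Flat A (Ω[A⁄k]) := Module.Flat.of_flat_tensorProduct A _ A'
  have : Module.Free A (Ω[A⁄k]) := Module.free_of_flat_of_isLocalRing
  exact ⟨_, ⟨Module.finBasis A _⟩⟩

end BaseChange
end Polar
end

section
/-! ### Rational forms with logarithmic poles -/

section Rational
variable (k : Type) {A : Type} [CommRing k] [CommRing A] [Algebra k A]

/-- The rational form defined by a regular form. -/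
def toRational (A : Type) [CommRing A] [Algebra k A] : Ω[A⁄k] →ₗ[A] Ω[FractionRing A⁄k] :=
  KaehlerDifferential.map k k A (FractionRing A)

variable {k}
lemma toRational_D (a : A) : toRational k A (KaehlerDifferential.D k A a) =
    KaehlerDifferential.D k (FractionRing A) (algebraMap A _ a) :=
  KaehlerDifferential.map_D k k A (FractionRing A) a

lemma isBaseChange_toRational : IsBaseChange (FractionRing A) (toRational k A) :=
  have := Algebra.FormallyEtale.of_isLocalization (Rₘ := FractionRing A) (nonZeroDivisors A)
  KaehlerDifferential.isBaseChange_of_formallyEtale k A (FractionRing A)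

lemma toRational_injective {ι : Type} (ε : Module.Basis ι A (Ω[A⁄k])) :
    Function.Injective (toRational k A) := by
  rw [injective_iff_map_eq_zero]
  intro ω hω
  refine ε.repr.map_eq_zero_iff.1 (Finsupp.ext fun i => ?_)
  have h1 := isBaseChange_toRational.basis_repr_comp_apply ε ω i
  rw [hω, map_zero, Finsupp.zero_apply] at h1
  refine IsFractionRing.injective A (FractionRing A) ?_
  rw [← h1, Finsupp.zero_apply, map_zero]

lemma regularForms_eq : regularForms k A = LinearMap.range (toRational k A) := by
  refine le_antisymm (Submodule.span_le.2 ?_) ?_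
  · rintro _ ⟨a, rfl⟩
    exact ⟨_, toRational_D a⟩
  · rw [LinearMap.range_eq_map, ← KaehlerDifferential.span_range_derivation k A, Submodule.map_span,
      Submodule.span_le]
    rintro _ ⟨_, ⟨a, rfl⟩, rfl⟩
    rw [toRational_D]
    exact Submodule.subset_span ⟨a, rfl⟩

lemma smul_rational_injective {b : A} (hb : b ∈ nonZeroDivisors A) {η η' : Ω[FractionRing A⁄k]}
    (h : b • η = b • η') : η = η' := by
  have hu : IsUnit (algebraMap A (FractionRing A) b) := IsLocalization.map_units (FractionRing A) ⟨b, hb⟩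
  rw [← algebraMap_smul (FractionRing A) b η, ← algebraMap_smul (FractionRing A) b η'] at h
  exact hu.smul_left_cancel.1 h

lemma exists_smul_eq {b : A} (hb : b ∈ nonZeroDivisors A) (η : Ω[FractionRing A⁄k]) : ∃ η', b • η' = η := by
  obtain ⟨u, hu⟩ : IsUnit (algebraMap A (FractionRing A) b) := IsLocalization.map_units (FractionRing A) ⟨b, hb⟩
  refine ⟨u⁻¹.val • η, ?_⟩
  rw [← algebraMap_smul (FractionRing A) b, ← hu, smul_smul, Units.mul_inv, one_smul]

/-- The contraction of 2-forms with a pair of vector fields. -/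
def contractTwo (θ θ' : Ω[FractionRing A⁄k] →ₗ[FractionRing A] FractionRing A) :
    ExteriorAlgebra (FractionRing A) (Ω[FractionRing A⁄k]) →ₗ[FractionRing A] FractionRing A :=
  ExteriorAlgebra.liftAlternating fun n => match n with
    | 2 => Matrix.detRowAlternating.compLinearMap (LinearMap.pi ![θ, θ'])
    | _ => 0

open ExteriorAlgebra in
lemma contractTwo_apply (θ θ' : Ω[FractionRing A⁄k] →ₗ[FractionRing A] FractionRing A)
    (ω ω' : Ω[FractionRing A⁄k]) :
    contractTwo θ θ' (ι (FractionRing A) ω * ι (FractionRing A) ω') =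
      θ ω * θ' ω' - θ' ω * θ ω' := by
  rw [contractTwo, liftAlternating_ι_mul, liftAlternating_ι, AlternatingMap.curryLeft_apply_apply]
  refine (Matrix.det_fin_two _).trans ?_
  simp

open ExteriorAlgebra in
lemma ι_mul_ι_mem_regularTwoForms (ω ω' : Ω[A⁄k]) :
    ι (FractionRing A) (toRational k A ω) * ι (FractionRing A) (toRational k A ω') ∈
      regularTwoForms k A := by
  have hs : ∀ (a : A) (η : Ω[FractionRing A⁄k]),
      ι (FractionRing A) (a • η) = a • ι (FractionRing A) η := fun a η => by
    rw [← algebraMap_smul (FractionRing A) a η, map_smul, algebraMap_smul]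
  have h : ∀ ω : Ω[A⁄k], ω ∈ Submodule.span A (Set.range (KaehlerDifferential.D k A)) := fun ω => by
    rw [KaehlerDifferential.span_range_derivation]; trivial
  induction h ω using Submodule.span_induction with
  | mem x hx =>
    obtain ⟨a, rfl⟩ := hx
    induction h ω' using Submodule.span_induction with
    | mem y hy =>
      obtain ⟨b, rfl⟩ := hy
      rw [toRational_D, toRational_D]
      exact Submodule.subset_span ⟨(a, b), rfl⟩
    | zero => rw [map_zero, map_zero, mul_zero]; exact zero_mem _
    | add y z _ _ hy hz => rw [map_add, map_add, mul_add]; exact add_mem hy hz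
    | smul c y _ hy =>
      rw [map_smul, hs, mul_smul_comm]
      exact Submodule.smul_mem _ _ hy
  | zero => rw [map_zero, map_zero, zero_mul]; exact zero_mem _
  | add y z _ _ hy hz => rw [map_add, map_add, add_mul]; exact add_mem hy hz
  | smul c y _ hy =>
    rw [map_smul, hs, smul_mul_assoc]
    exact Submodule.smul_mem _ _ hy

/-- The extension of a functional on regular forms to rational forms. -/
def extendRational (θ : Ω[A⁄k] →ₗ[A] A) :
    Ω[FractionRing A⁄k] →ₗ[FractionRing A] FractionRing A :=
  isBaseChange_toRational.lift ((Algebra.linearMap A (FractionRing A)).comp θ)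

lemma extendRational_toRational (θ : Ω[A⁄k] →ₗ[A] A) (ω : Ω[A⁄k]) :
    extendRational θ (toRational k A ω) = algebraMap A (FractionRing A) (θ ω) :=
  isBaseChange_toRational.lift_eq _ ω

lemma contractTwo_mem (θ θ' : Ω[A⁄k] →ₗ[A] A)
    {x : ExteriorAlgebra (FractionRing A) (Ω[FractionRing A⁄k])} (hx : x ∈ regularTwoForms k A) :
    ∃ a : A, contractTwo (extendRational θ) (extendRational θ') x =
      algebraMap A (FractionRing A) a := by
  induction hx using Submodule.span_induction with
  | mem x hx =>
    obtain ⟨⟨a, b⟩, rfl⟩ := hx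
    refine ⟨θ (KaehlerDifferential.D k A a) * θ' (KaehlerDifferential.D k A b) -
      θ' (KaehlerDifferential.D k A a) * θ (KaehlerDifferential.D k A b), ?_⟩
    simp only [contractTwo_apply, ← toRational_D, extendRational_toRational, map_sub, map_mul]
  | zero => exact ⟨0, by rw [map_zero, map_zero]⟩
  | add x y _ _ hx hy =>
    obtain ⟨a, ha⟩ := hx
    obtain ⟨b, hb⟩ := hy
    exact ⟨a + b, by rw [map_add, map_add, ha, hb]⟩
  | smul c x _ hx =>
    obtain ⟨a, ha⟩ := hx
    refine ⟨c * a, ?_⟩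
    rw [← algebraMap_smul (FractionRing A) c x, map_smul, ha, map_mul, smul_eq_mul]

open ExteriorAlgebra in
/-- The logarithmic forms along the divisor of `t` are the quotients by `t` of the polar forms. -/
lemma mem_logForms_iff {ι' : Type} [Finite ι'] (ε : Module.Basis ι' A (Ω[A⁄k]))
    (h2 : IsUnit (2 : A)) {t : A} (ht : t ∈ nonZeroDivisors A) {e : Ω[FractionRing A⁄k]} :
    e ∈ logForms k (Ideal.span {t}) ↔ ∃ ω ∈ polarForms k t, t • e = toRational k A ω := by
  have hs : ∀ (a : A) (η : Ω[FractionRing A⁄k]),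
      ι (FractionRing A) (a • η) = a • ι (FractionRing A) η := fun a η => by
    rw [← algebraMap_smul (FractionRing A) a η, map_smul, algebraMap_smul]
  constructor
  · intro he
    obtain ⟨h1, h3⟩ := he t (Ideal.mem_span_singleton_self t)
    rw [regularForms_eq] at h1
    obtain ⟨ω, hω⟩ := h1
    refine ⟨ω, fun θ θ' => ?_, hω.symm⟩
    obtain ⟨a, ha⟩ := contractTwo_mem θ θ' h3
    refine ⟨a, IsFractionRing.injective A (FractionRing A) ?_⟩
    have h4 : ∀ θ : Ω[A⁄k] →ₗ[A] A, algebraMap A (FractionRing A) t * extendRational θ e =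
        algebraMap A (FractionRing A) (θ ω) := fun θ => by
      rw [← extendRational_toRational, hω, ← algebraMap_smul (FractionRing A) t e, map_smul,
        smul_eq_mul]
    rw [contractTwo_apply, ← toRational_D, extendRational_toRational,
      extendRational_toRational] at ha
    rw [map_mul, ← ha, map_sub, map_mul, map_mul, ← h4, ← h4]
    ring
  · rintro ⟨ω, hω, he⟩ y hy
    obtain ⟨c, rfl⟩ := Ideal.mem_span_singleton'.1 hy
    cases nonempty_fintype ι'
    refine ⟨?_, ?_⟩
    · rw [mul_smul, he, regularForms_eq]
      exact Submodule.smul_mem _ _ ⟨ω, rfl⟩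
    · have key : ι (FractionRing A) (KaehlerDifferential.D k (FractionRing A) (algebraMap A _ t)) *
          ι (FractionRing A) e ∈ regularTwoForms k A := by
        let p := ε.repr (KaehlerDifferential.D k A t)
        let q := ε.repr ω
        have hpq := (mem_polarForms_iff ε).1 hω
        choose z hz using hpq
        let w := fun i j => ι (FractionRing A) (toRational k A (ε i)) *
          ι (FractionRing A) (toRational k A (ε j))
        have hw : ∀ i j, w i j = -w j i := fun i j => by
          rw [eq_neg_iff_add_eq_zero]
          exact ι_add_mul_swap _ _
        have hexp : ∀ ω : Ω[A⁄k], toRational k A ω = ∑ i, ε.repr ω i • toRational k A (ε i) := by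
          intro ω
          conv_lhs => rw [← ε.sum_repr ω]
          simp only [map_sum, map_smul]
        have h5 : t • (ι (FractionRing A)
            (KaehlerDifferential.D k (FractionRing A) (algebraMap A _ t)) *
              ι (FractionRing A) e) = ∑ i, ∑ j, (p i * q j) • w i j := by
          rw [← mul_smul_comm, ← hs, he, ← toRational_D, hexp (KaehlerDifferential.D k A t), hexp ω,
            map_sum, map_sum, Finset.sum_mul_sum]
          refine Finset.sum_congr rfl fun i _ => Finset.sum_congr rfl fun j _ => ?_
          rw [hs, hs, smul_mul_smul_comm]
        have h6 : t • ((2 : A) • (ι (FractionRing A)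
            (KaehlerDifferential.D k (FractionRing A) (algebraMap A _ t)) *
              ι (FractionRing A) e)) = t • ∑ i, ∑ j, z i j • w i j := by
          rw [smul_comm, h5, two_smul]
          conv_lhs => arg 2; rw [Finset.sum_comm]
          rw [← Finset.sum_add_distrib, Finset.smul_sum]
          refine Finset.sum_congr rfl fun i _ => ?_
          rw [← Finset.sum_add_distrib, Finset.smul_sum]
          refine Finset.sum_congr rfl fun j _ => ?_
          rw [smul_smul, ← hz, hw j i, smul_neg, ← sub_eq_add_neg, ← sub_smul]
        obtain ⟨h, hh⟩ := h2
        have h7 : (2 : A) • (ι (FractionRing A)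
            (KaehlerDifferential.D k (FractionRing A) (algebraMap A _ t)) *
              ι (FractionRing A) e) = ∑ i, ∑ j, z i j • w i j := by
          have hu : IsUnit (algebraMap A (FractionRing A) t) :=
            IsLocalization.map_units (FractionRing A) ⟨t, ht⟩
          rw [← algebraMap_smul (FractionRing A) t, ← algebraMap_smul (FractionRing A) t] at h6
          exact hu.smul_left_cancel.1 h6
        have h8 : ι (FractionRing A)
            (KaehlerDifferential.D k (FractionRing A) (algebraMap A _ t)) *
              ι (FractionRing A) e = h⁻¹.val • ∑ i, ∑ j, z i j • w i j := by
          rw [← h7, ← hh, smul_smul, Units.inv_mul, one_smul]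
        rw [h8]
        exact Submodule.smul_mem _ _ (Submodule.sum_mem _ fun i _ => Submodule.sum_mem _ fun j _ =>
          Submodule.smul_mem _ _ (ι_mul_ι_mem_regularTwoForms _ _))
      have h9 : KaehlerDifferential.D k (FractionRing A) (algebraMap A _ (c * t)) =
          c • KaehlerDifferential.D k (FractionRing A) (algebraMap A _ t) +
            t • toRational k A (KaehlerDifferential.D k A c) := by
        rw [← toRational_D, Derivation.leibniz, map_add, map_smul, map_smul, toRational_D]
      rw [h9, map_add, add_mul, hs, hs, smul_mul_assoc, smul_mul_assoc, ← mul_smul_comm t, ← hs, he]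
      exact add_mem (Submodule.smul_mem _ _ key) (ι_mul_ι_mem_regularTwoForms _ _)

end Rational
end

section
/-! ### Relative logarithmic forms -/

section Relative
variable (k : Type) {B : Type} (A : Type) [CommRing k] [CommRing B] [CommRing A] [Algebra k B]
  [Algebra k A] [Algebra B A] [IsScalarTower k B A]

/-- The ideal `I` is generated by `t`, a local equation of the divisor in `B` and in `A`, and the
differential forms of `A` and `B` are free of finite rank. -/
structure IsLogPair (I : Ideal B) (t : B) : Prop where
  eq_span : I = Ideal.span {t}
  mem_base : t ∈ nonZeroDivisors B
  mem_total : algebraMap B A t ∈ nonZeroDivisors A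
  free_base : ∃ n, Nonempty (Module.Basis (Fin n) B (Ω[B⁄k]))
  free_total : ∃ n, Nonempty (Module.Basis (Fin n) A (Ω[A⁄k]))
  two : IsUnit (2 : B)

/-- The `A`-module generated by the polar forms of `B`. -/
def pulledPolar (t : B) : Submodule A (Ω[A⁄k]) :=
  Submodule.span A (KaehlerDifferential.map k k B A '' polarForms k t)

variable {k A} {I : Ideal B} {t : B}

lemma IsLogPair.two_total (h : IsLogPair k A I t) : IsUnit (2 : A) := by
  have := h.two.map (algebraMap B A)
  rwa [map_ofNat] at this

lemma IsLogPair.map_eq (h : IsLogPair k A I t) :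
    I.map (algebraMap B A) = Ideal.span {algebraMap B A t} := by
  rw [h.eq_span, Ideal.map_span, Set.image_singleton]

lemma IsLogPair.mem_logForms_iff (h : IsLogPair k A I t) {e : Ω[FractionRing A⁄k]} :
    e ∈ logForms k (I.map (algebraMap B A)) ↔
      ∃ ω ∈ polarForms k (algebraMap B A t), algebraMap B A t • e = toRational k A ω := by
  obtain ⟨n, ⟨ε⟩⟩ := h.free_total
  rw [h.map_eq, LogHeat.mem_logForms_iff ε h.two_total h.mem_total]

lemma IsLogPair.mem_pulledBackForms_iff (h : IsLogPair k A I t) {η : Ω[FractionRing A⁄k]} :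
    η ∈ pulledBackForms k A I ↔
      ∃ ω ∈ pulledPolar k A t, algebraMap B A t • η = toRational k A ω := by
  obtain ⟨n, ⟨ε⟩⟩ := h.free_base
  constructor
  · intro hη
    induction hη using Submodule.span_induction with
    | mem η hη =>
      obtain ⟨ξ, hξ, b, hb, ω, hbA, h1, h2⟩ := hη
      rw [h.eq_span, LogHeat.mem_logForms_iff ε h.two h.mem_base] at hξ
      obtain ⟨ω₀, hω₀, h3⟩ := hξ
      refine ⟨KaehlerDifferential.map k k B A ω₀, Submodule.subset_span ⟨ω₀, hω₀, rfl⟩, ?_⟩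
      have h4 : b • ω₀ = t • ω := by
        refine toRational_injective ε ?_
        rw [map_smul, map_smul, ← h3, smul_comm, h1]
        rfl
      have h5 := congrArg (KaehlerDifferential.map k k B A) h4
      rw [map_smul, map_smul, ← algebraMap_smul A b, ← algebraMap_smul A t] at h5
      refine smul_rational_injective hbA ?_
      rw [smul_comm, h2, ← map_smul (toRational k A), h5, map_smul]
      rfl
    | zero => exact ⟨0, zero_mem _, by rw [smul_zero, map_zero]⟩
    | add x y _ _ hx hy =>
      obtain ⟨a, ha, ha'⟩ := hx
      obtain ⟨b, hb, hb'⟩ := hy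
      exact ⟨a + b, add_mem ha hb, by rw [smul_add, map_add, ha', hb']⟩
    | smul c x _ hx =>
      obtain ⟨a, ha, ha'⟩ := hx
      exact ⟨c • a, Submodule.smul_mem _ _ ha, by rw [smul_comm, map_smul, ha']⟩
  · rintro ⟨ω, hω, hη⟩
    induction hω using Submodule.span_induction generalizing η with
    | mem ω hω =>
      obtain ⟨ω₀, hω₀, rfl⟩ := hω
      obtain ⟨ξ, hξ⟩ := exists_smul_eq h.mem_base (toRational k B ω₀)
      refine Submodule.subset_span ⟨ξ, ?_, t, h.mem_base, ω₀, h.mem_total, hξ, hη⟩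
      rw [h.eq_span, LogHeat.mem_logForms_iff ε h.two h.mem_base]
      exact ⟨ω₀, hω₀, hξ⟩
    | zero =>
      have : η = 0 := smul_rational_injective h.mem_total (by rw [hη, map_zero, smul_zero])
      rw [this]
      exact zero_mem _
    | add x y _ _ hx hy =>
      obtain ⟨a, ha⟩ := exists_smul_eq h.mem_total (toRational k A x)
      obtain ⟨b, hb⟩ := exists_smul_eq h.mem_total (toRational k A y)
      have : η = a + b :=
        smul_rational_injective h.mem_total (by rw [hη, map_add, smul_add, ha, hb])
      rw [this]
      exact add_mem (hx ha) (hy hb)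
    | smul c x _ hx =>
      obtain ⟨a, ha⟩ := exists_smul_eq h.mem_total (toRational k A x)
      have : η = c • a :=
        smul_rational_injective h.mem_total (by rw [hη, map_smul, smul_comm, ha])
      rw [this]
      exact Submodule.smul_mem _ _ (hx ha)

/-- The quotient by `t` of a polar form, as a relative logarithmic form. -/
def IsLogPair.toRel (h : IsLogPair k A I t) :
    polarForms k (algebraMap B A t) →ₗ[A] RelLogForms k A I :=
  (Submodule.mkQ _).comp
    { toFun := fun ω => ⟨(exists_smul_eq h.mem_total (toRational k A ω)).choose,
        h.mem_logForms_iff.2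
          ⟨ω, ω.2, (exists_smul_eq h.mem_total (toRational k A ω)).choose_spec⟩⟩
      map_add' := fun ω ω' => Subtype.ext <| smul_rational_injective h.mem_total <| by
        rw [(exists_smul_eq h.mem_total _).choose_spec, Submodule.coe_add, Submodule.coe_add,
          map_add, smul_add]
        exact (congrArg₂ (· + ·) (exists_smul_eq h.mem_total _).choose_spec
          (exists_smul_eq h.mem_total _).choose_spec).symm
      map_smul' := fun c ω => Subtype.ext <| smul_rational_injective h.mem_total <| by
        rw [(exists_smul_eq h.mem_total _).choose_spec, Submodule.coe_smul, map_smul]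
        rw [RingHom.id_apply, Submodule.coe_smul, smul_comm]
        exact congrArg (c • ·) (exists_smul_eq h.mem_total _).choose_spec.symm }

lemma IsLogPair.toRel_eq_mk (h : IsLogPair k A I t) (ω : polarForms k (algebraMap B A t))
    (e : logForms k (I.map (algebraMap B A)))
    (he : algebraMap B A t • e.1 = toRational k A ω.1) :
    h.toRel ω = Submodule.Quotient.mk e := by
  refine congrArg Submodule.Quotient.mk (Subtype.ext (smul_rational_injective h.mem_total ?_))
  rw [he]
  exact (exists_smul_eq h.mem_total _).choose_spec

lemma IsLogPair.exists_polar (h : IsLogPair k A I t) (e : logForms k (I.map (algebraMap B A))) :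
    ∃ ω : polarForms k (algebraMap B A t), algebraMap B A t • e.1 = toRational k A ω.1 := by
  obtain ⟨ω, hω, he⟩ := h.mem_logForms_iff.1 e.2
  exact ⟨⟨ω, hω⟩, he⟩

lemma IsLogPair.toRel_surjective (h : IsLogPair k A I t) : Function.Surjective h.toRel := by
  intro x
  obtain ⟨e, rfl⟩ := Submodule.Quotient.mk_surjective _ x
  obtain ⟨ω, hω⟩ := h.exists_polar e
  exact ⟨ω, h.toRel_eq_mk ω e hω⟩

lemma IsLogPair.toRel_eq_zero_iff (h : IsLogPair k A I t)
    {ω : polarForms k (algebraMap B A t)} : h.toRel ω = 0 ↔ ω.1 ∈ pulledPolar k A t := by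
  obtain ⟨n, ⟨ε⟩⟩ := h.free_total
  have hspec := (exists_smul_eq h.mem_total (toRational k A ω)).choose_spec
  refine (Submodule.Quotient.mk_eq_zero _).trans ?_
  refine h.mem_pulledBackForms_iff.trans ⟨?_, fun h' => ⟨ω, h', hspec⟩⟩
  rintro ⟨ω', h', h''⟩
  have : ω' = ω.1 := toRational_injective ε (h''.symm.trans hspec)
  rwa [← this]

lemma IsLogPair.relLogD_eq (h : IsLogPair k A I t) (a : A) :
    relLogD k A I a = h.toRel ⟨algebraMap B A t • KaehlerDifferential.D k A a,
      smul_mem_polarForms _ _⟩ := by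
  symm
  refine h.toRel_eq_mk _ ⟨_, D_mem_logForms k A (I.map (algebraMap B A)) a⟩ ?_
  rw [map_smul, toRational_D]

end Relative
end

section
/-! ### Étale coordinates -/

section Coordinates
variable (k : Type) {A : Type} [Field k] [CommRing A] [Algebra k A] {σ : Type}

/-- The functions `x` are étale coordinates on the ring `A`, in the local sense: `A` is flat,
formally étale and essentially of finite type over the polynomial ring. -/
structure IsCoordinates (x : σ → A) : Prop where
  flat : letI := (MvPolynomial.aeval (R := k) x).toRingHom.toAlgebra
    Module.Flat (MvPolynomial σ k) A
  formallyEtale : letI := (MvPolynomial.aeval (R := k) x).toRingHom.toAlgebra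
    Algebra.FormallyEtale (MvPolynomial σ k) A
  essFiniteType : letI := (MvPolynomial.aeval (R := k) x).toRingHom.toAlgebra
    Algebra.EssFiniteType (MvPolynomial σ k) A

variable {k} {x : σ → A}

lemma X_dvd_of_dvd_mul {R : Type} [CommRing R] [IsDomain R] {i j : σ} (h : i ≠ j)
    {w : MvPolynomial σ R}
    (hw : MvPolynomial.X i ∣ MvPolynomial.X j * w) : MvPolynomial.X i ∣ w :=
  ((MvPolynomial.X_prime.dvd_or_dvd hw).resolve_left fun h' => h (MvPolynomial.X_dvd_X.1 h'))

namespace IsCoordinates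
variable (hx : IsCoordinates k x)
include hx

lemma exists_basis : ∃ b : Module.Basis σ A (Ω[A⁄k]), ∀ i, b i = KaehlerDifferential.D k A (x i) := by
  let _ := (MvPolynomial.aeval (R := k) x).toRingHom.toAlgebra
  have := hx.formallyEtale
  have : IsScalarTower k (MvPolynomial σ k) A :=
    IsScalarTower.of_algebraMap_eq fun c => ((MvPolynomial.aeval x).commutes c).symm
  refine ⟨baseChangeBasis (KaehlerDifferential.mvPolynomialBasis k σ), fun i => ?_⟩
  refine (IsBaseChange.basis_apply _ _ _).trans ?_
  rw [KaehlerDifferential.mvPolynomialBasis_apply, KaehlerDifferential.map_D]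
  exact congrArg _ (MvPolynomial.aeval_X x i)

lemma mem_nonZeroDivisors (i : σ) : x i ∈ nonZeroDivisors A := by
  let _ := (MvPolynomial.aeval (R := k) x).toRingHom.toAlgebra
  have := hx.flat
  have h := mem_nonZeroDivisors_of_flat (A' := A) (x := (MvPolynomial.X i : MvPolynomial σ k))
    (mem_nonZeroDivisors_of_ne_zero (MvPolynomial.X_ne_zero i))
  have h1 : algebraMap (MvPolynomial σ k) A (MvPolynomial.X i) = x i := MvPolynomial.aeval_X x i
  rwa [h1] at h

lemma dvd_of_dvd_mul {i j : σ} (hij : i ≠ j) {w : A} (hw : x i ∣ x j * w) : x i ∣ w := by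
  let _ := (MvPolynomial.aeval (R := k) x).toRingHom.toAlgebra
  have := hx.flat
  have h1 : ∀ i, algebraMap (MvPolynomial σ k) A (MvPolynomial.X i) = x i :=
    fun i => MvPolynomial.aeval_X x i
  rw [← h1] at hw ⊢
  rw [← h1] at hw
  exact dvd_of_dvd_mul_of_flat (fun w => X_dvd_of_dvd_mul hij) hw

lemma prod_mem_nonZeroDivisors (K : Finset σ) : ∏ i ∈ K, x i ∈ nonZeroDivisors A :=
  prod_mem fun i _ => hx.mem_nonZeroDivisors i

lemma dvd_of_dvd_prod_mul {K : Finset σ} {i : σ} (hi : i ∉ K) {w : A}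
    (hw : x i ∣ (∏ j ∈ K, x j) * w) : x i ∣ w := by
  induction K using Finset.cons_induction generalizing w with
  | empty => simpa using hw
  | cons j K hj ih =>
    rw [Finset.prod_cons, mul_assoc] at hw
    rw [Finset.mem_cons, not_or] at hi
    exact ih hi.2 (hx.dvd_of_dvd_mul hi.1 hw)

lemma prod_dvd {K : Finset σ} {w : A} (hw : ∀ i ∈ K, x i ∣ w) : ∏ i ∈ K, x i ∣ w := by
  induction K using Finset.cons_induction generalizing w with
  | empty => simp
  | cons j K hj ih =>
    obtain ⟨v, hv⟩ := ih fun i hi => hw i (Finset.mem_cons_of_mem hi)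
    have h1 := hw j (Finset.mem_cons_self _ _)
    rw [hv] at h1
    obtain ⟨u, hu⟩ := hx.dvd_of_dvd_prod_mul hj h1
    exact ⟨u, by rw [hv, hu, Finset.prod_cons]; ring⟩

end IsCoordinates

lemma D_prod [DecidableEq σ] (K : Finset σ) (x : σ → A) :
    KaehlerDifferential.D k A (∏ i ∈ K, x i) =
      ∑ i ∈ K, (∏ j ∈ K.erase i, x j) • KaehlerDifferential.D k A (x i) := by
  induction K using Finset.cons_induction with
  | empty => simp
  | cons j K hj ih =>
    rw [Finset.prod_cons, Derivation.leibniz, ih, Finset.sum_cons, Finset.erase_cons, add_comm]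
    congr 1
    rw [Finset.smul_sum]
    refine Finset.sum_congr rfl fun i hi => ?_
    have hij : j ≠ i := fun h => hj (h ▸ hi)
    rw [smul_smul, Finset.erase_cons_of_ne _ hij, Finset.prod_cons]

/-- The polar forms along a product of coordinates `∏_K x` are the combinations of the
`(∏_{K ∖ i} x) dx_i`. -/
lemma IsCoordinates.mem_polarForms_iff [DecidableEq σ] [Finite σ] (hx : IsCoordinates k x)
    {b : Module.Basis σ A (Ω[A⁄k])} (hb : ∀ i, b i = KaehlerDifferential.D k A (x i))
    (K : Finset σ) {ω : Ω[A⁄k]} :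
    ω ∈ polarForms k (∏ i ∈ K, x i) ↔ ∀ i, ∏ j ∈ K.erase i, x j ∣ b.repr ω i := by
  cases nonempty_fintype σ
  have hp : ∀ i, b.repr (KaehlerDifferential.D k A (∏ i ∈ K, x i)) i =
      if i ∈ K then ∏ j ∈ K.erase i, x j else 0 := by
    intro i
    have : KaehlerDifferential.D k A (∏ i ∈ K, x i) =
        ∑ i, (if i ∈ K then ∏ j ∈ K.erase i, x j else 0) • b i := by
      rw [D_prod]
      simp [hb, ite_smul, Finset.sum_ite_mem]
    rw [this, b.repr_sum_self]
  rw [LogHeat.mem_polarForms_iff b]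
  simp only [hp]
  constructor
  · intro h j
    refine hx.prod_dvd fun i hi => ?_
    obtain ⟨hij, hiK⟩ := Finset.mem_erase.1 hi
    have h1 := h i j
    rw [if_pos hiK] at h1
    by_cases hjK : j ∈ K
    · rw [if_pos hjK] at h1
      have hji : j ∈ K.erase i := Finset.mem_erase.2 ⟨hij.symm, hjK⟩
      have e1 : ∏ l ∈ K.erase i, x l = x j * ∏ l ∈ (K.erase i).erase j, x l :=
        (Finset.mul_prod_erase _ _ hji).symm
      have e2 : ∏ l ∈ K.erase j, x l = x i * ∏ l ∈ (K.erase i).erase j, x l := by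
        rw [Finset.erase_right_comm]
        exact (Finset.mul_prod_erase _ _ (Finset.mem_erase.2 ⟨hij, hiK⟩)).symm
      have e3 : ∏ l ∈ K, x l = x i * ∏ l ∈ K.erase i, x l := (Finset.mul_prod_erase _ _ hiK).symm
      rw [e3, e1, e2] at h1
      obtain ⟨z, hz⟩ := h1
      have h2 : x j * b.repr ω j = x i * (b.repr ω i + x j * z) := by
        refine (mul_cancel_right_mem_nonZeroDivisors
          (hx.prod_mem_nonZeroDivisors ((K.erase i).erase j))).1 ?_
        linear_combination hz
      exact hx.dvd_of_dvd_mul hij ⟨_, h2⟩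
    · rw [if_neg hjK, zero_mul, sub_zero, ← Finset.mul_prod_erase _ _ hiK, mul_comm (x i)] at h1
      obtain ⟨z, hz⟩ := h1
      refine ⟨z, (mul_cancel_right_mem_nonZeroDivisors
        (hx.prod_mem_nonZeroDivisors (K.erase i))).1 ?_⟩
      linear_combination hz
  · intro h i j
    have key : ∀ i j, i ≠ j → ∏ l ∈ K, x l ∣
        (if i ∈ K then ∏ l ∈ K.erase i, x l else 0) * b.repr ω j := by
      intro i j hij
      split_ifs with hi
      · rw [← Finset.mul_prod_erase _ _ hi, mul_comm]
        refine mul_dvd_mul_left _ ?_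
        exact (Finset.dvd_prod_of_mem _ (Finset.mem_erase.2 ⟨hij, hi⟩)).trans (h j)
      · rw [zero_mul]; exact dvd_zero _
    by_cases hij : i = j
    · rw [hij, sub_self]; exact dvd_zero _
    · exact dvd_sub (key i j hij) (key j i (Ne.symm hij))

end Coordinates
end

section
/-! ### Semistable charts of local rings -/

set_option linter.unusedSectionVars false

/-- The combinatorial shape of a semistable chart: fibre coordinates `ξ_k`, `k ∈ ι`, base
coordinates `π_j`, `j ∈ κ`, the divisor `∏_J π_j = 0`, and the relation `π_{i₀} = ∏_I ξ_k` with
`i₀ ∈ J`. A branch `k₀ ∈ I` is singled out. -/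
structure ChartShape where
  (ι κ : Type)
  [fintypeι : Fintype ι] [fintypeκ : Fintype κ]
  [decEqι : DecidableEq ι] [decEqκ : DecidableEq κ]
  base : κ
  divisor : Finset κ
  base_mem : base ∈ divisor
  branches : Finset ι
  branch : ι
  branch_mem : branch ∈ branches

namespace ChartShape
attribute [instance] fintypeι fintypeκ decEqι decEqκ
variable (S : ChartShape)

/-- The indices of the coordinates of the total space: the `ξ_k` and the `π_j`, `j ≠ i₀`. -/
abbrev Coord : Type := S.ι ⊕ {j : S.κ // j ≠ S.base}

/-- The indices of a basis of the relative logarithmic forms. -/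
abbrev Vert : Type := {i : S.ι // i ≠ S.branch}

/-- The coordinates whose product is the equation of the divisor of the total space. -/
def log : Finset S.Coord := S.branches.disjSum (S.divisor.subtype (· ≠ S.base))

variable (k : Type) {B A : Type} [Field k] [CommRing B] [CommRing A] [Algebra k B]
  [Algebra k A] [Algebra B A]

/-- The coordinates of the total space. -/
def coord (ξ : S.ι → A) (π : S.κ → B) : S.Coord → A :=
  Sum.elim ξ fun j => algebraMap B A (π j)

/-- The polar form `∑ a_k (∏_{l ≠ k} x_l) dx_k`, the product running over the logarithmic
coordinates; it is the product of the equation of the divisor by a logarithmic form. -/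
def form (x : S.Coord → A) : (S.Coord → A) →ₗ[A] Ω[A⁄k] :=
  Fintype.linearCombination A fun i => (∏ j ∈ S.log.erase i, x j) • KaehlerDifferential.D k A (x i)

lemma form_apply (x a : S.Coord → A) : S.form k x a =
    ∑ i, a i • (∏ j ∈ S.log.erase i, x j) • KaehlerDifferential.D k A (x i) := rfl

/-- The relative coordinates of a logarithmic form: those on the branches are taken modulo the
diagonal, which comes from the base. -/
def vert : (S.Coord → A) →ₗ[A] (S.Vert → A) where
  toFun a i := a (Sum.inl i.1) - if i.1 ∈ S.branches then a (Sum.inl S.branch) else 0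
  map_add' a b := by
    ext i
    simp only [Pi.add_apply]
    split_ifs <;> ring
  map_smul' c a := by
    ext i
    simp only [Pi.smul_apply, smul_eq_mul, RingHom.id_apply]
    split_ifs <;> ring

lemma vert_apply (a : S.Coord → A) (i : S.Vert) : S.vert a i =
    a (Sum.inl i.1) - if i.1 ∈ S.branches then a (Sum.inl S.branch) else 0 := rfl

lemma vert_surjective : Function.Surjective (S.vert : (S.Coord → A) →ₗ[A] (S.Vert → A)) := by
  intro v
  refine ⟨Sum.elim (fun i => if h : i = S.branch then 0 else v ⟨i, h⟩) 0, ?_⟩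
  ext i
  rw [vert_apply]
  simp [i.2]

end ChartShape

section Chart
variable (k : Type) {B A B' A' : Type} [Field k] [CharZero k] [CommRing B] [CommRing A]
  [CommRing B'] [CommRing A']
  [Algebra k B] [Algebra k A] [Algebra k B'] [Algebra k A'] [Algebra B A] [Algebra B B']
  [Algebra A A'] [Algebra B' A'] [Algebra B A'] [IsScalarTower k B A] [IsScalarTower k B B']
  [IsScalarTower k A A'] [IsScalarTower k B' A'] [IsScalarTower B A A'] [IsScalarTower B B' A']
  [IsLocalRing B] [IsLocalRing A] [IsLocalRing B'] [IsLocalRing A']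
  [Algebra.FormallyEtale A A'] [Module.FaithfullyFlat A A']
  [Algebra.FormallyEtale B B'] [Module.FaithfullyFlat B B']

variable (B A) in
/-- A semistable chart of the local homomorphism `B → A`, on the étale neighbourhoods `B'` of `B`
and `A'` of `A`. The ideal `I` of `B` defines the divisor. -/
structure IsLogChart (S : ChartShape) (I : Ideal B) (ξ : S.ι → A') (π : S.κ → B') : Prop where
  base : IsCoordinates k π
  total : IsCoordinates k (S.coord ξ π)
  prod_eq : algebraMap B' A' (π S.base) = ∏ i ∈ S.branches, ξ i
  ideal : I.map (algebraMap B B') = Ideal.span {∏ j ∈ S.divisor, π j}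

variable {k} {S : ChartShape} {I : Ideal B} {ξ : S.ι → A'} {π : S.κ → B'}

namespace IsLogChart
variable (h : IsLogChart k B (A' := A') S I ξ π)
include h

lemma prod_log : ∏ i ∈ S.log, S.coord ξ π i = algebraMap B' A' (∏ j ∈ S.divisor, π j) := by
  rw [ChartShape.log, Finset.prod_disjSum, ← Finset.mul_prod_erase _ _ S.base_mem, map_mul,
    h.prod_eq, map_prod]
  congr 1
  rw [← Finset.filter_ne' S.divisor S.base, ← Finset.subtype_map, Finset.prod_map]
  rfl

lemma mem_polarForms_iff {ω : Ω[A'⁄k]} :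
    ω ∈ polarForms k (∏ i ∈ S.log, S.coord ξ π i) ↔ ∃ a, S.form k (S.coord ξ π) a = ω := by
  obtain ⟨b, hb⟩ := h.total.exists_basis
  rw [h.total.mem_polarForms_iff hb]
  constructor
  · intro h1
    choose a ha using h1
    refine ⟨a, ?_⟩
    rw [ChartShape.form_apply, ← b.sum_repr ω]
    refine Finset.sum_congr rfl fun i _ => ?_
    rw [ha, hb, smul_smul, mul_comm]
  · rintro ⟨a, rfl⟩ i
    have : S.form k (S.coord ξ π) a =
        ∑ i, (a i * ∏ j ∈ S.log.erase i, S.coord ξ π j) • b i := by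
      rw [ChartShape.form_apply]
      simp only [hb, smul_smul]
    rw [this, b.repr_sum_self]
    exact dvd_mul_left _ _

lemma form_injective : Function.Injective (S.form k (S.coord ξ π)) := by
  obtain ⟨b, hb⟩ := h.total.exists_basis
  rw [injective_iff_map_eq_zero]
  intro a ha
  ext i
  have h1 : S.form k (S.coord ξ π) a =
      ∑ i, (a i * ∏ j ∈ S.log.erase i, S.coord ξ π j) • b i := by
    rw [ChartShape.form_apply]
    simp only [hb, smul_smul]
  have h2 : b.repr (S.form k (S.coord ξ π) a) i = a i * ∏ j ∈ S.log.erase i, S.coord ξ π j := by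
    rw [h1, b.repr_sum_self]
  rw [ha, map_zero, Finsupp.zero_apply] at h2
  exact (mem_nonZeroDivisors_iff_right.1
    (h.total.prod_mem_nonZeroDivisors (S.log.erase i))) _ h2.symm

lemma prod_mem_nonZeroDivisors : ∏ i ∈ S.log, S.coord ξ π i ∈ nonZeroDivisors A' :=
  h.total.prod_mem_nonZeroDivisors _

lemma exists_eq_span : ∃ t, I = Ideal.span {t} := by
  obtain ⟨t, -, h1, -⟩ := exists_generator_of_map_eq_span
    (h.base.prod_mem_nonZeroDivisors S.divisor) h.ideal
  exact ⟨t, h1⟩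

section Generator
variable {t : B} (ht : I = Ideal.span {t})
include ht

lemma exists_unit_base : ∃ u : B'ˣ, algebraMap B B' t = (∏ j ∈ S.divisor, π j) * u := by
  have h1 := h.ideal
  rw [ht, Ideal.map_span, Set.image_singleton] at h1
  have h2 : ∏ j ∈ S.divisor, π j ∣ algebraMap B B' t := by
    rw [← Ideal.mem_span_singleton, ← h1]; exact Ideal.mem_span_singleton_self _
  have h3 : algebraMap B B' t ∣ ∏ j ∈ S.divisor, π j := by
    rw [← Ideal.mem_span_singleton, h1]; exact Ideal.mem_span_singleton_self _
  obtain ⟨a, ha⟩ := h2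
  obtain ⟨b, hb⟩ := h3
  have h4 : a * b = 1 := by
    refine (mul_cancel_left_mem_nonZeroDivisors
      (h.base.prod_mem_nonZeroDivisors S.divisor)).1 ?_
    rw [← mul_assoc, ← ha, ← hb, mul_one]
  exact ⟨⟨a, b, h4, by rw [mul_comm, h4]⟩, ha⟩

lemma exists_unit : ∃ u : A'ˣ,
    algebraMap A A' (algebraMap B A t) = (∏ i ∈ S.log, S.coord ξ π i) * u := by
  obtain ⟨u, hu⟩ := h.exists_unit_base ht
  refine ⟨Units.map (algebraMap B' A').toMonoidHom u, ?_⟩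
  rw [← IsScalarTower.algebraMap_apply B A A', IsScalarTower.algebraMap_apply B B' A', hu, map_mul,
    h.prod_log]
  rfl

lemma polarForms_eq : polarForms k (algebraMap A A' (algebraMap B A t)) =
    polarForms k (∏ i ∈ S.log, S.coord ξ π i) := by
  obtain ⟨u, hu⟩ := h.exists_unit (A := A) ht
  rw [hu, polarForms_mul_unit]

lemma isLogPair : IsLogPair k A I t where
  eq_span := ht
  mem_base := by
    refine mem_nonZeroDivisors_of_algebraMap (A' := B') ?_
    obtain ⟨u, hu⟩ := h.exists_unit_base ht
    rw [hu]
    exact mul_mem (h.base.prod_mem_nonZeroDivisors _) u.isUnit.mem_nonZeroDivisors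
  mem_total := by
    refine mem_nonZeroDivisors_of_algebraMap (A' := A') ?_
    obtain ⟨u, hu⟩ := h.exists_unit (A := A) ht
    rw [hu]
    exact mul_mem h.prod_mem_nonZeroDivisors u.isUnit.mem_nonZeroDivisors
  free_base := by
    obtain ⟨b, -⟩ := h.base.exists_basis
    exact exists_basis_of_etale b
  free_total := by
    obtain ⟨b, -⟩ := h.total.exists_basis
    exact exists_basis_of_etale b
  two := by
    have : IsUnit (2 : k) := isUnit_iff_ne_zero.2 two_ne_zero
    have := this.map (algebraMap k B)
    rwa [map_ofNat] at this

/-- The polar forms of `A` are those which have logarithmic coordinates on the chart. -/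
lemma mem_polarForms_iff_exists {ω : Ω[A⁄k]} : ω ∈ polarForms k (algebraMap B A t) ↔
    ∃ a, S.form k (S.coord ξ π) a = KaehlerDifferential.map k k A A' ω := by
  obtain ⟨n, ⟨ε⟩⟩ := (h.isLogPair (A := A) ht).free_total
  rw [← map_mem_polarForms_iff (A' := A') ε, h.polarForms_eq ht, h.mem_polarForms_iff]

lemma form_mem_span (a : S.Coord → A') : S.form k (S.coord ξ π) a ∈
    Submodule.span A' (KaehlerDifferential.map k k A A' '' polarForms k (algebraMap B A t)) := by
  obtain ⟨n, ⟨ε⟩⟩ := (h.isLogPair (A := A) ht).free_total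
  refine mem_span_map_polarForms ε ?_
  rw [h.polarForms_eq ht, h.mem_polarForms_iff]
  exact ⟨a, rfl⟩

end Generator
end IsLogChart
end Chart
end

section
/-! ### Relative coordinates of logarithmic forms -/

set_option linter.unusedSectionVars false

section Chart
variable {k : Type} {B A B' A' : Type} [Field k] [CharZero k] [CommRing B] [CommRing A]
  [CommRing B'] [CommRing A']
  [Algebra k B] [Algebra k A] [Algebra k B'] [Algebra k A'] [Algebra B A] [Algebra B B']
  [Algebra A A'] [Algebra B' A'] [Algebra B A'] [IsScalarTower k B A] [IsScalarTower k B B']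
  [IsScalarTower k A A'] [IsScalarTower k B' A'] [IsScalarTower B A A'] [IsScalarTower B B' A']
  [IsLocalRing B] [IsLocalRing A] [IsLocalRing B'] [IsLocalRing A']
  [Algebra.FormallyEtale A A'] [Module.FaithfullyFlat A A']
  [Algebra.FormallyEtale B B'] [Module.FaithfullyFlat B B']
  {S : ChartShape} {I : Ideal B} {ξ : S.ι → A'} {π : S.κ → B'}

namespace IsLogChart
variable (h : IsLogChart k B (A' := A') S I ξ π)
include h

/-- The pull-back of the form `c_{i₀} dπ_{i₀}` of the base: its coordinates are one on all
branches. -/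
lemma map_base_form : KaehlerDifferential.map k k B' A'
      ((∏ j ∈ S.divisor.erase S.base, π j) • KaehlerDifferential.D k B' (π S.base)) =
    S.form k (S.coord ξ π) (Sum.elim (fun i => if i ∈ S.branches then 1 else 0) 0) := by
  rw [map_smul, KaehlerDifferential.map_D, h.prod_eq, D_prod, ChartShape.form_apply,
    Fintype.sum_sum_type]
  simp only [Sum.elim_inl, Sum.elim_inr, Pi.zero_apply, zero_smul, Finset.sum_const_zero, add_zero,
    ite_smul, one_smul, Finset.sum_ite_mem, Finset.univ_inter, ← algebraMap_smul A'
    (∏ j ∈ S.divisor.erase S.base, π j), Finset.smul_sum]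
  refine Finset.sum_congr rfl fun i hi => ?_
  rw [smul_smul]
  have e1 : S.log.erase (Sum.inl i) =
      (S.branches.erase i).disjSum (S.divisor.subtype (· ≠ S.base)) := by
    ext (j | j) <;> simp [ChartShape.log]
  rw [e1, Finset.prod_disjSum, mul_comm]
  congr 2
  rw [map_prod, ← Finset.filter_ne' S.divisor S.base, ← Finset.subtype_map, Finset.prod_map]
  rfl

lemma map_other_form (j : {j : S.κ // j ≠ S.base}) : KaehlerDifferential.map k k B' A'
      ((∏ l ∈ S.divisor.erase j.1, π l) • KaehlerDifferential.D k B' (π j.1)) =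
    S.form k (S.coord ξ π) (Pi.single (Sum.inr j) 1) := by
  rw [map_smul, KaehlerDifferential.map_D, ChartShape.form_apply,
    Finset.sum_eq_single (Sum.inr j) (fun i _ hi => by rw [Pi.single_eq_of_ne hi, zero_smul])
      (fun hi => absurd (Finset.mem_univ _) hi), Pi.single_eq_same, one_smul, ← algebraMap_smul A'
    (∏ l ∈ S.divisor.erase j.1, π l)]
  congr 1
  have e1 : S.log.erase (Sum.inr j) =
      S.branches.disjSum ((S.divisor.erase j.1).subtype (· ≠ S.base)) := by
    ext (i | i)
    · simp [ChartShape.log]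
    · simp only [ChartShape.log, Finset.mem_erase, Finset.inr_mem_disjSum, Finset.mem_subtype, ne_eq,
        Sum.inr.injEq, Subtype.ext_iff]
  rw [e1, Finset.prod_disjSum, ← Finset.mul_prod_erase _ _
    (Finset.mem_erase.2 ⟨Ne.symm j.2, S.base_mem⟩), map_mul, h.prod_eq, map_prod]
  congr 1
  rw [← Finset.filter_ne' (S.divisor.erase j.1) S.base, ← Finset.subtype_map, Finset.prod_map]
  rfl

/-- The forms with vanishing relative coordinates are spanned by the forms of the base. -/
lemma vert_eq_zero_iff {a : S.Coord → A'} : S.vert a = 0 ↔ S.form k (S.coord ξ π) a ∈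
    Submodule.span A' (KaehlerDifferential.map k k B' A' ''
      polarForms k (∏ j ∈ S.divisor, π j)) := by
  obtain ⟨b, hb⟩ := h.base.exists_basis
  have hmem : ∀ j, (∏ l ∈ S.divisor.erase j, π l) • KaehlerDifferential.D k B' (π j) ∈
      polarForms k (∏ j ∈ S.divisor, π j) := by
    intro j
    rw [h.base.mem_polarForms_iff hb]
    intro i
    rw [← hb, map_smul, b.repr_self, Finsupp.smul_single, Finsupp.single_apply]
    split_ifs with hij
    · rw [hij, smul_eq_mul, mul_one]
    · exact dvd_zero _
  constructor
  · intro ha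
    have e1 : a = a (Sum.inl S.branch) • (Sum.elim (fun i => if i ∈ S.branches then 1 else 0) 0) +
        ∑ j, a (Sum.inr j) • (Pi.single (Sum.inr j) 1 : S.Coord → A') := by
      ext (i | j)
      · have h1 : a (Sum.inl i) = if i ∈ S.branches then a (Sum.inl S.branch) else 0 := by
          by_cases hi : i = S.branch
          · rw [hi, if_pos S.branch_mem]
          · have := congrFun ha ⟨i, hi⟩
            rw [ChartShape.vert_apply] at this
            exact sub_eq_zero.1 this
        rw [h1]
        simp [Finset.sum_apply]
      · simp [Finset.sum_apply, Pi.single_apply]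
    rw [e1, map_add, map_smul, map_sum, ← h.map_base_form]
    refine add_mem (Submodule.smul_mem _ _ (Submodule.subset_span ⟨_, hmem _, rfl⟩))
      (Submodule.sum_mem _ fun j _ => ?_)
    rw [map_smul, ← h.map_other_form]
    exact Submodule.smul_mem _ _ (Submodule.subset_span ⟨_, hmem _, rfl⟩)
  · intro ha
    have key : ∀ ω ∈ Submodule.span A' (KaehlerDifferential.map k k B' A' ''
        polarForms k (∏ j ∈ S.divisor, π j)), ∃ a, S.form k (S.coord ξ π) a = ω ∧ S.vert a = 0 := by
      intro ω hω
      induction hω using Submodule.span_induction with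
      | mem ω hω =>
        obtain ⟨η, hη, rfl⟩ := hω
        rw [SetLike.mem_coe, h.base.mem_polarForms_iff hb] at hη
        choose c hc using hη
        refine ⟨algebraMap B' A' (c S.base) •
          (Sum.elim (fun i => if i ∈ S.branches then 1 else 0) 0) +
          ∑ j : {j : S.κ // j ≠ S.base}, algebraMap B' A' (c j.1) •
            (Pi.single (Sum.inr j) 1 : S.Coord → A'), ?_, ?_⟩
        · rw [map_add, map_smul, map_sum, ← h.map_base_form]
          simp only [map_smul, ← h.map_other_form]
          have e2 : η = ∑ j, c j • (∏ l ∈ S.divisor.erase j, π l) •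
              KaehlerDifferential.D k B' (π j) := by
            conv_lhs => rw [← b.sum_repr η]
            refine Finset.sum_congr rfl fun j _ => ?_
            rw [hc, hb, smul_smul, mul_comm]
          conv_rhs => rw [e2]
          rw [map_sum, ← Finset.add_sum_erase _ _ (Finset.mem_univ S.base)]
          simp only [map_smul, algebraMap_smul]
          congr 1
          rw [← Finset.filter_ne' Finset.univ S.base, ← Finset.subtype_map, Finset.sum_map]
          simp only [Finset.subtype_univ, Function.Embedding.subtype_apply]
        · ext i
          rw [ChartShape.vert_apply]
          simp [Finset.sum_apply, S.branch_mem]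
      | zero => exact ⟨0, map_zero _, map_zero _⟩
      | add x y _ _ hx hy =>
        obtain ⟨a, ha, ha'⟩ := hx
        obtain ⟨b, hb, hb'⟩ := hy
        exact ⟨a + b, by rw [map_add, ha, hb], by rw [map_add, ha', hb', add_zero]⟩
      | smul c x _ hx =>
        obtain ⟨a, ha, ha'⟩ := hx
        exact ⟨c • a, by rw [map_smul, ha], by rw [map_smul, ha', smul_zero]⟩
    obtain ⟨a', h1, h2⟩ := key _ ha
    rwa [← h.form_injective h1]

section Generator
variable {t : B} (ht : I = Ideal.span {t})
include ht

/-- After étale base change, the pulled back polar forms of `B` span the same module as those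
of `B'`. -/
lemma span_pulledPolar : Submodule.span A' (KaehlerDifferential.map k k A A' '' pulledPolar k A t) =
    Submodule.span A' (KaehlerDifferential.map k k B' A' ''
      polarForms k (∏ j ∈ S.divisor, π j)) := by
  obtain ⟨u, hu⟩ := h.exists_unit_base ht
  have hpol : polarForms k (algebraMap B B' t) = polarForms k (∏ j ∈ S.divisor, π j) := by
    rw [hu, polarForms_mul_unit]
  obtain ⟨n, ⟨ε⟩⟩ := (h.isLogPair (A := A) ht).free_base
  have hcomm : ∀ ω : Ω[B⁄k], KaehlerDifferential.map k k A A' (KaehlerDifferential.map k k B A ω) =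
      KaehlerDifferential.map k k B' A' (KaehlerDifferential.map k k B B' ω) := by
    intro ω
    have : ω ∈ Submodule.span B (Set.range (KaehlerDifferential.D k B)) := by
      rw [KaehlerDifferential.span_range_derivation]; trivial
    induction this using Submodule.span_induction with
    | mem x hx =>
      obtain ⟨b, rfl⟩ := hx
      simp only [KaehlerDifferential.map_D]
      rw [← IsScalarTower.algebraMap_apply B A A', ← IsScalarTower.algebraMap_apply B B' A']
    | zero => simp only [map_zero]
    | add x y _ _ hx hy => simp only [map_add, hx, hy]
    | smul c x _ hx =>
      have e1 : KaehlerDifferential.map k k B A (c • x) =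
          algebraMap B A c • KaehlerDifferential.map k k B A x := by rw [map_smul, algebraMap_smul]
      have e2 : KaehlerDifferential.map k k B B' (c • x) =
          algebraMap B B' c • KaehlerDifferential.map k k B B' x := by
        rw [map_smul, algebraMap_smul]
      rw [e1, e2, map_smul, map_smul, hx,
        ← algebraMap_smul A' (algebraMap B A c), ← algebraMap_smul A' (algebraMap B B' c),
        ← IsScalarTower.algebraMap_apply B A A', ← IsScalarTower.algebraMap_apply B B' A']
  refine le_antisymm (Submodule.span_le.2 ?_) (Submodule.span_le.2 ?_)
  · rintro _ ⟨ω, hω, rfl⟩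
    rw [SetLike.mem_coe]
    induction hω using Submodule.span_induction with
    | mem x hx =>
      obtain ⟨η, hη, rfl⟩ := hx
      rw [hcomm]
      refine Submodule.subset_span ⟨_, ?_, rfl⟩
      rw [SetLike.mem_coe, ← hpol]
      exact (map_mem_polarForms_iff ε).2 hη
    | zero => rw [map_zero]; exact zero_mem _
    | add x y _ _ hx hy => rw [map_add]; exact add_mem hx hy
    | smul c x _ hx =>
      rw [map_smul, ← algebraMap_smul A' c]
      exact Submodule.smul_mem _ _ hx
  · rintro _ ⟨ω, hω, rfl⟩
    rw [SetLike.mem_coe, ← hpol] at hω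
    rw [SetLike.mem_coe]
    have h1 := mem_span_map_polarForms ε hω
    clear hω
    induction h1 using Submodule.span_induction with
    | mem x hx =>
      obtain ⟨η, hη, rfl⟩ := hx
      rw [← hcomm]
      exact Submodule.subset_span ⟨_, Submodule.subset_span ⟨η, hη, rfl⟩, rfl⟩
    | zero => rw [map_zero]; exact zero_mem _
    | add x y _ _ hx hy => rw [map_add]; exact add_mem hx hy
    | smul c x _ hx =>
      rw [map_smul, ← algebraMap_smul A' c]
      exact Submodule.smul_mem _ _ hx

/-- The relative coordinates detect the forms pulled back from the base. -/
lemma mem_pulledPolar_iff {ω : Ω[A⁄k]} {a : S.Coord → A'}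
    (ha : S.form k (S.coord ξ π) a = KaehlerDifferential.map k k A A' ω) :
    ω ∈ pulledPolar k A t ↔ S.vert a = 0 := by
  rw [h.vert_eq_zero_iff, ← h.span_pulledPolar (A := A) ht, ha]
  constructor
  · intro hω
    exact Submodule.subset_span ⟨ω, hω, rfl⟩
  · intro hω
    exact mem_of_mem_span_image (KaehlerDifferential.isBaseChange_of_formallyEtale k A A') hω

end Generator
end IsLogChart
end Chart
end

section
/-! ### A basis of the relative logarithmic forms -/

set_option linter.unusedSectionVars false

section Chart
variable {k : Type} {B A B' A' : Type} [Field k] [CharZero k] [CommRing B] [CommRing A]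
  [CommRing B'] [CommRing A']
  [Algebra k B] [Algebra k A] [Algebra k B'] [Algebra k A'] [Algebra B A] [Algebra B B']
  [Algebra A A'] [Algebra B' A'] [Algebra B A'] [IsScalarTower k B A] [IsScalarTower k B B']
  [IsScalarTower k A A'] [IsScalarTower k B' A'] [IsScalarTower B A A'] [IsScalarTower B B' A']
  [IsLocalRing B] [IsLocalRing A] [IsLocalRing B'] [IsLocalRing A']
  [Algebra.FormallyEtale A A'] [Module.FaithfullyFlat A A']
  [Algebra.FormallyEtale B B'] [Module.FaithfullyFlat B B']
  {S : ChartShape} {I : Ideal B} {ξ : S.ι → A'} {π : S.κ → B'}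

namespace IsLogChart
variable (h : IsLogChart k B (A' := A') S I ξ π) {t : B} (ht : I = Ideal.span {t})

/-- The relative coordinates on the chart of a polar form. -/
def relCoord : polarForms k (algebraMap B A t) →ₗ[A] (S.Vert → A') where
  toFun ω := S.vert ((h.mem_polarForms_iff_exists ht).1 ω.2).choose
  map_add' ω ω' := by
    have h1 := ((h.mem_polarForms_iff_exists ht).1 ω.2).choose_spec
    have h2 := ((h.mem_polarForms_iff_exists ht).1 ω'.2).choose_spec
    have h3 := ((h.mem_polarForms_iff_exists ht).1 (ω + ω').2).choose_spec
    have h4 := h3.trans ((map_add (KaehlerDifferential.map k k A A') ω.1 ω'.1).trans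
      ((congrArg₂ (· + ·) h1.symm h2.symm).trans (map_add (S.form k (S.coord ξ π)) _ _).symm))
    rw [h.form_injective h4, map_add]
  map_smul' c ω := by
    have h1 := ((h.mem_polarForms_iff_exists ht).1 ω.2).choose_spec
    have h3 := ((h.mem_polarForms_iff_exists ht).1 (c • ω).2).choose_spec
    have h4 := h3.trans ((map_smul (KaehlerDifferential.map k k A A') c ω.1).trans
      ((congrArg (c • ·) h1.symm).trans ((algebraMap_smul A' c _).symm.trans
        (map_smul (S.form k (S.coord ξ π)) _ _).symm)))
    rw [h.form_injective h4, map_smul, algebraMap_smul]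
    rfl

lemma relCoord_eq {ω : polarForms k (algebraMap B A t)} {a : S.Coord → A'}
    (ha : S.form k (S.coord ξ π) a = KaehlerDifferential.map k k A A' ω) :
    h.relCoord ht ω = S.vert a := by
  have : ((h.mem_polarForms_iff_exists ht).1 ω.2).choose = a :=
    h.form_injective ((((h.mem_polarForms_iff_exists ht).1 ω.2).choose_spec).trans ha.symm)
  rw [← this]
  rfl

lemma relCoord_eq_zero_iff {ω : polarForms k (algebraMap B A t)} :
    h.relCoord ht ω = 0 ↔ (h.isLogPair (A := A) ht).toRel ω = 0 := by
  obtain ⟨a, ha⟩ := (h.mem_polarForms_iff_exists ht).1 ω.2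
  rw [h.relCoord_eq ht ha, IsLogPair.toRel_eq_zero_iff, h.mem_pulledPolar_iff ht ha]

lemma span_relCoord : Submodule.span A'
    (Set.range (h.relCoord ht : polarForms k (algebraMap B A t) → S.Vert → A')) = ⊤ := by
  rw [eq_top_iff]
  rintro v -
  obtain ⟨a, rfl⟩ := S.vert_surjective v
  have h1 := h.form_mem_span (A := A) ht a
  have key : ∀ ω ∈ Submodule.span A'
      (KaehlerDifferential.map k k A A' '' polarForms k (algebraMap B A t)),
      ∃ a, S.form k (S.coord ξ π) a = ω ∧ S.vert a ∈ Submodule.span A'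
        (Set.range (h.relCoord ht : polarForms k (algebraMap B A t) → S.Vert → A')) := by
    intro ω hω
    induction hω using Submodule.span_induction with
    | mem x hx =>
      obtain ⟨ω, hω, rfl⟩ := hx
      obtain ⟨a, ha⟩ := (h.mem_polarForms_iff_exists ht).1 hω
      exact ⟨a, ha, Submodule.subset_span ⟨⟨ω, hω⟩, h.relCoord_eq ht ha⟩⟩
    | zero => exact ⟨0, map_zero _, by rw [map_zero]; exact zero_mem _⟩
    | add x y _ _ hx hy =>
      obtain ⟨a, ha, ha'⟩ := hx
      obtain ⟨b, hb, hb'⟩ := hy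
      exact ⟨a + b, by rw [map_add, ha, hb], by rw [map_add]; exact add_mem ha' hb'⟩
    | smul c x _ hx =>
      obtain ⟨a, ha, ha'⟩ := hx
      exact ⟨c • a, by rw [map_smul, ha], by rw [map_smul]; exact Submodule.smul_mem _ _ ha'⟩
  obtain ⟨a', h2, h3⟩ := key _ h1
  rwa [h.form_injective h2] at h3

/-- Polar forms whose relative coordinates form a basis give a basis of the relative logarithmic
forms. -/
lemma exists_basis_of_basis {ι : Type} [Finite ι] (e : ι → polarForms k (algebraMap B A t))
    (b : Module.Basis ι A' (S.Vert → A')) (hb : ∀ i, b i = h.relCoord ht (e i)) :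
    ∃ b₀ : Module.Basis ι A (RelLogForms k A I),
      ∀ i, b₀ i = (h.isLogPair (A := A) ht).toRel (e i) := by
  cases nonempty_fintype ι
  have hli : LinearIndependent A fun i => (h.isLogPair (A := A) ht).toRel (e i) := by
    rw [Fintype.linearIndependent_iff]
    intro g hg i
    simp only [← map_smul, ← map_sum] at hg
    rw [← h.relCoord_eq_zero_iff ht, map_sum] at hg
    simp only [map_smul, ← hb] at hg
    have h1 := Fintype.linearIndependent_iff.1 b.linearIndependent (fun i => algebraMap A A' (g i))
      (by simpa only [algebraMap_smul] using hg) i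
    exact algebraMap_injective_of_faithfullyFlat (A' := A') (by rw [h1, map_zero])
  refine ⟨Module.Basis.mk hli ?_, fun i => Module.Basis.mk_apply _ _ _⟩
  rintro x -
  obtain ⟨ω, rfl⟩ := (h.isLogPair (A := A) ht).toRel_surjective x
  have hω : ω.1 ∈ Submodule.span A (Set.range fun i => (e i).1) ⊔ pulledPolar k A t := by
    refine mem_of_mem_span_image (KaehlerDifferential.isBaseChange_of_formallyEtale k A A') ?_
    obtain ⟨a, ha⟩ := (h.mem_polarForms_iff_exists ht).1 ω.2
    choose c hc using fun i => (h.mem_polarForms_iff_exists ht).1 (e i).2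
    have h1 : S.vert (a - ∑ i, b.repr (S.vert a) i • c i) = 0 := by
      have h2 : ∀ i, S.vert (c i) = b i := fun i => by rw [hb, h.relCoord_eq ht (hc i)]
      rw [map_sub, map_sum]
      simp only [map_smul, h2, b.sum_repr, sub_self]
    rw [h.vert_eq_zero_iff, ← h.span_pulledPolar (A := A) ht] at h1
    have h3 : KaehlerDifferential.map k k A A' ω.1 =
        S.form k (S.coord ξ π) (a - ∑ i, b.repr (S.vert a) i • c i) +
          ∑ i, b.repr (S.vert a) i • KaehlerDifferential.map k k A A' (e i).1 := by
      rw [map_sub, map_sum, ha]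
      simp only [map_smul, hc, sub_add_cancel]
    rw [h3]
    refine add_mem (Submodule.span_mono (Set.image_mono ?_) h1)
      (Submodule.sum_mem _ fun i _ => Submodule.smul_mem _ _ (Submodule.subset_span ⟨_, ?_, rfl⟩))
    · exact SetLike.coe_subset_coe.2 le_sup_right
    · exact Submodule.mem_sup_left (Submodule.subset_span ⟨i, rfl⟩)
  obtain ⟨ω₁, h1, ω₂, h2, h3⟩ := Submodule.mem_sup.1 hω
  obtain ⟨c, rfl⟩ := (Submodule.mem_span_range_iff_exists_fun A).1 h1
  have h4 : (h.isLogPair (A := A) ht).toRel (ω - ∑ i, c i • e i) = 0 := by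
    rw [IsLogPair.toRel_eq_zero_iff, Submodule.coe_sub, ← h3]
    simpa using h2
  rw [map_sub, sub_eq_zero] at h4
  rw [h4, map_sum]
  simp only [map_smul]
  exact Submodule.sum_mem _ fun i _ => Submodule.smul_mem _ _ (Submodule.subset_span ⟨i, rfl⟩)

lemma exists_basis_relCoord : ∃ (e : S.Vert → polarForms k (algebraMap B A t))
    (b : Module.Basis S.Vert A' (S.Vert → A')), ∀ i, b i = h.relCoord ht (e i) := by
  obtain ⟨κ, a, b, hb⟩ := Module.exists_basis_of_span_of_flat _ (h.span_relCoord (A := A) ht)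
  have : Finite κ := Module.Finite.finite_basis b
  have hcard : Nat.card κ = Nat.card S.Vert := by
    rw [← Module.finrank_eq_nat_card_basis b, Module.finrank_fintype_fun_eq_card,
      Nat.card_eq_fintype_card]
  let ε : κ ≃ S.Vert := (Finite.card_eq.1 hcard).some
  exact ⟨fun i => a (ε.symm i), b.reindex ε, fun i => by rw [b.reindex_apply, hb]⟩

end IsLogChart
end Chart
end

section
/-! ### Functions on the branches of the fibre -/

set_option linter.unusedSectionVars false

section Branches
variable {R ι : Type} [CommRing R] [DecidableEq ι]

/-- The ring `R[X] / (∏_K X - r)`. -/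
abbrev BranchRing (K : Finset ι) (r : R) : Type :=
  MvPolynomial ι R ⧸ Ideal.span {(∏ i ∈ K, MvPolynomial.X i) - (MvPolynomial.C r : MvPolynomial ι R)}

variable [IsLocalRing R] {K : Finset ι} {r : R}

lemma mk_mem_map_maximalIdeal_iff (hr : r ∈ IsLocalRing.maximalIdeal R) {q : MvPolynomial ι R} :
    (Ideal.Quotient.mk _ q : BranchRing K r) ∈
        (IsLocalRing.maximalIdeal R).map (algebraMap R (BranchRing K r)) ↔
      ∏ i ∈ K, MvPolynomial.X i ∣ MvPolynomial.map (IsLocalRing.residue R) q := by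
  have hres : IsLocalRing.residue R r = 0 := (IsLocalRing.residue_eq_zero_iff r).2 hr
  have hker : ∀ w : MvPolynomial ι R, MvPolynomial.map (IsLocalRing.residue R) w = 0 ↔
      w ∈ (IsLocalRing.maximalIdeal R).map (MvPolynomial.C : R →+* MvPolynomial ι R) := by
    intro w
    rw [← RingHom.mem_ker, MvPolynomial.ker_map, IsLocalRing.ker_residue]
  have h1 : (IsLocalRing.maximalIdeal R).map (algebraMap R (BranchRing K r)) =
      ((IsLocalRing.maximalIdeal R).map (MvPolynomial.C : R →+* MvPolynomial ι R)).map
        (Ideal.Quotient.mk (Ideal.span {(∏ i ∈ K, MvPolynomial.X i) -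
          (MvPolynomial.C r : MvPolynomial ι R)})) := by
    rw [Ideal.map_map]
    rfl
  rw [h1, ← Ideal.mem_comap, Ideal.comap_map_of_surjective' _ Ideal.Quotient.mk_surjective,
    Ideal.mk_ker, Submodule.mem_sup]
  constructor
  · rintro ⟨a, ha, b, hb, rfl⟩
    obtain ⟨w, rfl⟩ := Ideal.mem_span_singleton'.1 hb
    rw [map_add, (hker a).2 ha, zero_add, map_mul, map_sub, MvPolynomial.map_C, hres, map_zero,
      sub_zero, map_prod]
    simp only [MvPolynomial.map_X]
    exact dvd_mul_left _ _
  · rintro ⟨w, hw⟩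
    obtain ⟨w, rfl⟩ := MvPolynomial.map_surjective _ IsLocalRing.residue_surjective w
    refine ⟨q - ((∏ i ∈ K, MvPolynomial.X i) - MvPolynomial.C r) * w, ?_,
      ((∏ i ∈ K, MvPolynomial.X i) - MvPolynomial.C r) * w,
      Ideal.mul_mem_right _ _ (Ideal.mem_span_singleton_self _), sub_add_cancel _ _⟩
    rw [← hker, map_sub, hw, map_mul, map_sub, MvPolynomial.map_C, hres, map_zero,
      sub_zero, map_prod]
    simp only [MvPolynomial.map_X, sub_self]

/-- Over the branches of a node, functions `c_k` killed by `X_k` and with sum zero all vanish. -/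
lemma mem_map_maximalIdeal_of_branches (hr : r ∈ IsLocalRing.maximalIdeal R)
    {c : ι → BranchRing K r}
    (hc : ∀ k ∈ K, Ideal.Quotient.mk _ (MvPolynomial.X k) * c k ∈
      (IsLocalRing.maximalIdeal R).map (algebraMap R (BranchRing K r)))
    (hs : ∑ k ∈ K, c k ∈ (IsLocalRing.maximalIdeal R).map (algebraMap R (BranchRing K r)))
    {k : ι} (hk : k ∈ K) :
    c k ∈ (IsLocalRing.maximalIdeal R).map (algebraMap R (BranchRing K r)) := by
  choose q hq using fun k => Ideal.Quotient.mk_surjective (c k)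
  simp only [← hq, ← map_mul, ← map_sum, mk_mem_map_maximalIdeal_iff hr] at hc hs ⊢
  simp only [map_mul, MvPolynomial.map_X, map_sum] at hc hs
  have h1 : ∀ l ∈ K, ∏ i ∈ K.erase l, MvPolynomial.X i ∣
      MvPolynomial.map (IsLocalRing.residue R) (q l) := by
    intro l hl
    have := hc l hl
    rw [← Finset.mul_prod_erase _ _ hl] at this
    exact (mul_dvd_mul_iff_left (MvPolynomial.X_ne_zero l)).1 this
  have h2 : MvPolynomial.X k ∣ MvPolynomial.map (IsLocalRing.residue R) (q k) := by
    rw [← Finset.add_sum_erase _ _ hk] at hs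
    refine (dvd_add_left (Finset.dvd_sum fun l hl => ?_)).1
      ((Finset.dvd_prod_of_mem _ hk).trans hs)
    rw [Finset.mem_erase] at hl
    exact (Finset.dvd_prod_of_mem _ (Finset.mem_erase.2 ⟨Ne.symm hl.1, hk⟩)).trans (h1 l hl.2)
  obtain ⟨w, hw⟩ := h1 k hk
  rw [hw] at h2 ⊢
  rw [← Finset.prod_erase_mul _ _ hk]
  refine mul_dvd_mul_left _ ((MvPolynomial.X_prime.dvd_or_dvd h2).resolve_left fun h3 => ?_)
  obtain ⟨j, hj, hj'⟩ := (MvPolynomial.X_prime.dvd_finsetProd_iff _).1 h3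
  rw [MvPolynomial.X_dvd_X] at hj'
  exact (Finset.mem_erase.1 hj).1 hj'.symm

/-- If the vanishing modulo `J` of functions `c_k` with `x_k c_k = 0` and `∑ c_k = 0` holds over `P`,
it holds over every flat `P`-algebra. -/
lemma mem_map_of_flat {B P A : Type} [CommRing B] [CommRing P] [CommRing A] [Algebra B P]
    [Algebra P A] [Algebra B A] [IsScalarTower B P A] [Module.Flat P A] {J : Ideal B} (hJ : J.FG)
    {K : Finset ι} {x : ι → P}
    (hP : ∀ c : ι → P, (∀ k ∈ K, x k * c k ∈ J.map (algebraMap B P)) →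
      ∑ k ∈ K, c k ∈ J.map (algebraMap B P) → ∀ k ∈ K, c k ∈ J.map (algebraMap B P))
    {a : ι → A} (ha : ∀ k ∈ K, algebraMap P A (x k) * a k ∈ J.map (algebraMap B A))
    (hs : ∑ k ∈ K, a k ∈ J.map (algebraMap B A)) {k : ι} (hk : k ∈ K) :
    a k ∈ J.map (algebraMap B A) := by
  obtain ⟨n, r, hr⟩ := Submodule.fg_iff_exists_fin_generating_family.1 hJ
  have hrA : ∀ {y : A}, y ∈ J.map (algebraMap B A) →
      ∃ c : Fin n → A, ∑ s, algebraMap B A (r s) * c s = y := by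
    intro y hy
    rw [← hr] at hy
    change y ∈ (Ideal.span (Set.range r)).map (algebraMap B A) at hy
    rw [Ideal.map_span, ← Set.range_comp] at hy
    obtain ⟨c, hc⟩ := Ideal.mem_span_range_iff_exists_fun.1 hy
    exact ⟨c, by simpa only [mul_comm, Function.comp_apply] using hc⟩
  have hrm : ∀ s (c : P), -algebraMap B P (r s) * c ∈ J.map (algebraMap B P) := fun s c => by
    refine Ideal.mul_mem_right _ _ (neg_mem (Ideal.mem_map_of_mem _ ?_))
    rw [← hr]
    exact Submodule.subset_span ⟨s, rfl⟩
  choose g hg using fun i : K => hrA (ha i.1 i.2)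
  obtain ⟨g₀, hg₀⟩ := hrA hs
  -- the linear system over `P` satisfied by the `a_i` and the coefficients `g`
  let M : Option K → (K ⊕ (Option K × Fin n)) → P :=
    fun l => Sum.elim (fun i => l.elim 1 fun l => if i = l then x l.1 else 0)
      (fun q => if q.1 = l then -algebraMap B P (r q.2) else 0)
  let v : (K ⊕ (Option K × Fin n)) → A :=
    Sum.elim (fun i => a i.1) (fun q => q.1.elim (g₀ q.2) fun l => g l q.2)
  have hM : ∀ l, ∑ j, M l j • v j = 0 := by
    intro l
    rw [Fintype.sum_sum_type, Fintype.sum_prod_type]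
    simp only [M, v, Sum.elim_inl, Sum.elim_inr, ite_smul, zero_smul, neg_smul]
    rw [Finset.sum_comm (γ := Option K)]
    simp only [Finset.sum_ite_eq', Finset.mem_univ, if_true, Algebra.smul_def,
      ← IsScalarTower.algebraMap_apply B P A, Finset.sum_neg_distrib]
    rcases l with _ | l
    · simp only [Option.elim, map_one, one_mul]
      rw [Finset.sum_coe_sort K a, ← hg₀, add_neg_cancel]
    · simp only [Option.elim, apply_ite (algebraMap P A), map_zero, ite_mul, zero_mul,
        Finset.sum_ite_eq', Finset.mem_univ, if_true]
      rw [← hg l, add_neg_cancel]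
  obtain ⟨N, c, y, hc, hy⟩ := exists_solutions_of_flat M v hM
  have h1 := hy (Sum.inl ⟨k, hk⟩)
  change a k = _ at h1
  rw [h1]
  refine Ideal.sum_mem _ fun s _ => ?_
  rw [Algebra.smul_def]
  refine Ideal.mul_mem_right _ _ ?_
  rw [IsScalarTower.algebraMap_eq B P A, ← Ideal.map_map]
  refine Ideal.mem_map_of_mem _ ?_
  have key := hP (fun i => if hi : i ∈ K then c (Sum.inl ⟨i, hi⟩) s else 0) ?_ ?_ k hk
  · simpa only [dif_pos hk] using key
  · intro l hl
    have h2 := hc (some ⟨l, hl⟩) s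
    rw [Fintype.sum_sum_type, Fintype.sum_prod_type, Finset.sum_comm (γ := Option K)] at h2
    simp only [M, Sum.elim_inl, Sum.elim_inr, Option.elim, ite_mul, zero_mul, Finset.sum_ite_eq',
      Finset.mem_univ, if_true] at h2
    rw [dif_pos hl, eq_neg_of_add_eq_zero_left h2]
    exact neg_mem (Ideal.sum_mem _ fun s _ => hrm _ _)
  · have h2 := hc none s
    rw [Fintype.sum_sum_type, Fintype.sum_prod_type, Finset.sum_comm (γ := Option K)] at h2
    simp only [M, Sum.elim_inl, Sum.elim_inr, Option.elim, ite_mul, zero_mul, Finset.sum_ite_eq',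
      Finset.mem_univ, if_true, one_mul] at h2
    rw [← Finset.sum_coe_sort]
    simp only [Finset.coe_mem, dif_pos]
    rw [eq_neg_of_add_eq_zero_left h2]
    exact neg_mem (Ideal.sum_mem _ fun s _ => hrm _ _)

end Branches

section Chart
variable {k : Type} {B A B' A' : Type} [Field k] [CharZero k] [CommRing B] [CommRing A]
  [CommRing B'] [CommRing A']
  [Algebra k B] [Algebra k A] [Algebra k B'] [Algebra k A'] [Algebra B A] [Algebra B B']
  [Algebra A A'] [Algebra B' A'] [Algebra B A'] [IsScalarTower k B A] [IsScalarTower k B B']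
  [IsScalarTower k A A'] [IsScalarTower k B' A'] [IsScalarTower B A A'] [IsScalarTower B B' A']
  [IsLocalRing B] [IsLocalRing A] [IsLocalRing B'] [IsLocalRing A']
  [Algebra.FormallyEtale A A'] [Module.FaithfullyFlat A A']
  [Algebra.FormallyEtale B B'] [Module.FaithfullyFlat B B']
  {S : ChartShape} {I : Ideal B} {ξ : S.ι → A'} {π : S.κ → B'}

lemma IsCoordinates.isNoetherianRing {σ : Type} [Finite σ] {x : σ → A}
    (hx : IsCoordinates k x) : IsNoetherianRing A := by
  let _ := (MvPolynomial.aeval (R := k) x).toRingHom.toAlgebra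
  have := hx.essFiniteType
  exact Algebra.EssFiniteType.isNoetherianRing (MvPolynomial σ k) A

lemma IsCoordinates.essFiniteType_field {σ : Type} [Finite σ] {x : σ → A}
    (hx : IsCoordinates k x) : Algebra.EssFiniteType k A := by
  let _ := (MvPolynomial.aeval (R := k) x).toRingHom.toAlgebra
  have := hx.essFiniteType
  have : IsScalarTower k (MvPolynomial σ k) A :=
    IsScalarTower.of_algebraMap_eq fun c => ((MvPolynomial.aeval x).commutes c).symm
  exact Algebra.EssFiniteType.comp k (MvPolynomial σ k) A

namespace IsLogChart
variable (h : IsLogChart k B (A' := A') S I ξ π)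
include h

section Flat
variable {P : Type} [CommRing P] [Algebra k P] [Algebra B' P] [IsScalarTower k B' P]
  {x : S.ι → P} (hx : algebraMap B' P (π S.base) = ∏ i ∈ S.branches, x i)
  (hgen : Algebra.adjoin B' (Set.range x) = ⊤)
include hx hgen

/-- The scheme `∏_I x_k = π_{i₀}` over the base is unramified over the affine space of the
coordinates. -/
lemma formallyUnramified_of_adjoin :
    letI := (MvPolynomial.aeval (R := k) (S.coord x π)).toRingHom.toAlgebra
    Algebra.FormallyUnramified (MvPolynomial S.Coord k) P := by
  let Q := MvPolynomial S.Coord k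
  let _ : Algebra Q P := (MvPolynomial.aeval (R := k) (S.coord x π)).toRingHom.toAlgebra
  have : IsScalarTower k Q P :=
    IsScalarTower.of_algebraMap_eq fun c => ((MvPolynomial.aeval (S.coord x π)).commutes c).symm
  have hy : ∀ i, algebraMap Q P (MvPolynomial.X i) = S.coord x π i :=
    fun i => MvPolynomial.aeval_X _ i
  have hD : ∀ q : Q, KaehlerDifferential.D Q P (algebraMap Q P q) = 0 :=
    fun q => Derivation.map_algebraMap _ q
  have hX : ∀ i, KaehlerDifferential.D Q P (x i) = 0 := by
    intro i
    have := hD (MvPolynomial.X (Sum.inl i))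
    rwa [hy] at this
  obtain ⟨b, hb⟩ := h.base.exists_basis
  have hB : KaehlerDifferential.map k Q B' P = 0 := by
    refine b.ext fun j => ?_
    rw [hb, KaehlerDifferential.map_D, LinearMap.zero_apply]
    by_cases hj : j = S.base
    · have h2 : algebraMap B' P (π j) = algebraMap Q P
          (∏ i ∈ S.branches, MvPolynomial.X (Sum.inl i)) := by
        rw [map_prod]
        simp only [hy]
        rw [hj]
        exact hx
      rw [h2, hD]
    · have := hD (MvPolynomial.X (Sum.inr ⟨j, hj⟩))
      rwa [hy] at this
  have hP : ∀ y : P, KaehlerDifferential.D Q P y = 0 := by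
    intro y
    have hmem : y ∈ Algebra.adjoin B' (Set.range x) := by rw [hgen]; trivial
    induction hmem using Algebra.adjoin_induction with
    | mem y hy => obtain ⟨i, rfl⟩ := hy; exact hX i
    | algebraMap b => rw [← KaehlerDifferential.map_D k Q B' P, hB, LinearMap.zero_apply]
    | add x y _ _ hx hy => rw [map_add, hx, hy, add_zero]
    | mul x y _ _ hx hy => rw [Derivation.leibniz, hx, hy, smul_zero, smul_zero, add_zero]
  rw [Algebra.formallyUnramified_iff]
  refine subsingleton_of_forall_eq 0 fun y => ?_
  have : y ∈ Submodule.span P (Set.range (KaehlerDifferential.D Q P)) := by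
    rw [KaehlerDifferential.span_range_derivation]; trivial
  induction this using Submodule.span_induction with
  | mem y hy => obtain ⟨z, rfl⟩ := hy; exact hP z
  | zero => rfl
  | add y z _ _ hy hz => rw [hy, hz, add_zero]
  | smul c y _ hy => rw [hy, smul_zero]

/-- The total space is flat over the scheme `∏_I x_k = π_{i₀}` over the base: it is flat over the
affine space of the coordinates, over which that scheme is unramified. -/
lemma flat_of_adjoin [Algebra P A'] [IsScalarTower B' P A']
    (hxA : ∀ i, algebraMap P A' (x i) = ξ i) : Module.Flat P A' := by
  let Q := MvPolynomial S.Coord k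
  let _ : Algebra Q P := (MvPolynomial.aeval (R := k) (S.coord x π)).toRingHom.toAlgebra
  have : IsScalarTower k Q P :=
    IsScalarTower.of_algebraMap_eq fun c => ((MvPolynomial.aeval (S.coord x π)).commutes c).symm
  let _ : Algebra Q A' := (MvPolynomial.aeval (R := k) (S.coord ξ π)).toRingHom.toAlgebra
  have : Module.Flat Q A' := h.total.flat
  have : Algebra.FormallyUnramified Q P := h.formallyUnramified_of_adjoin hx hgen
  have : IsScalarTower k P A' := .to₁₃₄ k B' P A'
  have : IsScalarTower Q P A' := by
    refine IsScalarTower.of_algebraMap_eq fun q => ?_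
    have h1 : (MvPolynomial.aeval (R := k) (S.coord ξ π)) =
        (IsScalarTower.toAlgHom k P A').comp (MvPolynomial.aeval (R := k) (S.coord x π)) := by
      refine MvPolynomial.algHom_ext fun i => ?_
      rw [MvPolynomial.aeval_X, AlgHom.comp_apply, MvPolynomial.aeval_X]
      rcases i with i | j
      · exact (hxA i).symm
      · exact IsScalarTower.algebraMap_apply B' P A' _
    exact DFunLike.congr_fun h1 q
  have : Algebra.EssFiniteType k B' := h.base.essFiniteType_field
  have : Algebra.FiniteType B' P := ⟨Subalgebra.fg_def.2 ⟨_, Set.finite_range x, hgen⟩⟩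
  have : Algebra.EssFiniteType k P := Algebra.EssFiniteType.comp k B' P
  have : Algebra.EssFiniteType Q P := Algebra.EssFiniteType.of_comp k Q P
  exact Algebra.FormallyUnramified.flat_of_restrictScalars Q P A'

end Flat

/-- On the fibre, functions `a_k` killed by the branch coordinates `ξ_k` and with sum zero vanish. -/
lemma mem_of_branches {a : S.ι → A'}
    (ha : ∀ i ∈ S.branches, ξ i * a i ∈ (IsLocalRing.maximalIdeal B').map (algebraMap B' A'))
    (hs : ∑ i ∈ S.branches, a i ∈ (IsLocalRing.maximalIdeal B').map (algebraMap B' A'))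
    {i : S.ι} (hi : i ∈ S.branches) :
    a i ∈ (IsLocalRing.maximalIdeal B').map (algebraMap B' A') := by
  by_cases hπ : π S.base ∈ IsLocalRing.maximalIdeal B'
  swap
  · rw [IsLocalRing.mem_maximalIdeal, mem_nonunits_iff, not_not] at hπ
    have h1 := hπ.map (algebraMap B' A')
    rw [h.prod_eq] at h1
    have h2 : IsUnit (ξ i) := isUnit_of_dvd_unit (Finset.dvd_prod_of_mem _ hi) h1
    exact (Ideal.unit_mul_mem_iff_mem _ h2).1 (ha i hi)
  let φ : BranchRing S.branches (π S.base) →ₐ[B'] A' :=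
    Ideal.Quotient.liftₐ _ (MvPolynomial.aeval ξ) (by
      intro a ha
      obtain ⟨w, rfl⟩ := Ideal.mem_span_singleton'.1 ha
      simp [h.prod_eq])
  have hφ : ∀ i, φ (Ideal.Quotient.mk _ (MvPolynomial.X i)) = ξ i := fun i =>
    MvPolynomial.aeval_X ξ i
  let _ : Algebra (BranchRing S.branches (π S.base)) A' := φ.toRingHom.toAlgebra
  have : IsScalarTower B' (BranchRing S.branches (π S.base)) A' :=
    IsScalarTower.of_algebraMap_eq fun c => (φ.commutes c).symm
  have hx : algebraMap B' (BranchRing S.branches (π S.base)) (π S.base) =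
      ∏ i ∈ S.branches, Ideal.Quotient.mk _ (MvPolynomial.X i) := by
    have h3 := (Ideal.Quotient.eq (I := Ideal.span {(∏ i ∈ S.branches, MvPolynomial.X i) -
      (MvPolynomial.C (π S.base) : MvPolynomial S.ι B')})).2
      (Ideal.mem_span_singleton_self _)
    rw [map_prod] at h3
    exact h3.symm
  have hgen : Algebra.adjoin B' (Set.range fun i => (Ideal.Quotient.mk _ (MvPolynomial.X i) :
      BranchRing S.branches (π S.base))) = ⊤ := by
    have h1 := congrArg (Subalgebra.map (Ideal.Quotient.mkₐ B' (Ideal.span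
      {(∏ i ∈ S.branches, MvPolynomial.X i) - (MvPolynomial.C (π S.base) : MvPolynomial S.ι B')})))
      (MvPolynomial.adjoin_range_X (R := B') (σ := S.ι))
    rw [AlgHom.map_adjoin, ← Set.range_comp, Algebra.map_top,
      (AlgHom.range_eq_top _).2 (Ideal.Quotient.mkₐ_surjective _ _)] at h1
    exact h1
  have : Module.Flat (BranchRing S.branches (π S.base)) A' := h.flat_of_adjoin hx hgen hφ
  have : IsNoetherianRing B' := h.base.isNoetherianRing
  refine mem_map_of_flat (P := BranchRing S.branches (π S.base)) (IsNoetherian.noetherian _)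
    (x := fun i => Ideal.Quotient.mk _ (MvPolynomial.X i))
    (fun c h1 h2 k hk => mem_map_maximalIdeal_of_branches hπ h1 h2 hk) (fun k hk => ?_) hs hi
  exact (congrArg (· * a k) (hφ k)).symm ▸ ha k hk

end IsLogChart
end Chart
end

section
/-! ### Functionals on the logarithmic forms of the fibre -/

set_option linter.unusedSectionVars false

section Chart
variable {k : Type} {B A B' A' : Type} [Field k] [CharZero k] [CommRing B] [CommRing A]
  [CommRing B'] [CommRing A']
  [Algebra k B] [Algebra k A] [Algebra k B'] [Algebra k A'] [Algebra B A] [Algebra B B']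
  [Algebra A A'] [Algebra B' A'] [Algebra B A'] [IsScalarTower k B A] [IsScalarTower k B B']
  [IsScalarTower k A A'] [IsScalarTower k B' A'] [IsScalarTower B A A'] [IsScalarTower B B' A']
  [IsLocalRing B] [IsLocalRing A] [IsLocalRing B'] [IsLocalRing A']
  [Algebra.FormallyEtale A A'] [Module.FaithfullyFlat A A']
  [Algebra.FormallyEtale B B'] [Module.FaithfullyFlat B B']
  {S : ChartShape} {I : Ideal B} {ξ : S.ι → A'} {π : S.κ → B'}

namespace ChartShape

lemma vert_single_inr (j : {j : S.κ // j ≠ S.base}) (c : A) :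
    S.vert (Pi.single (Sum.inr j) c : S.Coord → A) = 0 := by
  ext i
  simp [vert_apply]

lemma sum_vert_single : ∑ i ∈ S.branches, S.vert (Pi.single (Sum.inl i) 1 : S.Coord → A) = 0 := by
  ext i
  simp [vert_apply, Finset.sum_apply, Pi.single_apply, S.branch_mem]

lemma form_single (x : S.Coord → A) (i : S.Coord) (c : A) :
    S.form k x (Pi.single i c) =
      c • (∏ j ∈ S.log.erase i, x j) • KaehlerDifferential.D k A (x i) := by
  rw [form_apply, Finset.sum_eq_single i (fun j _ hj => by rw [Pi.single_eq_of_ne hj, zero_smul])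
    (fun hi => absurd (Finset.mem_univ _) hi), Pi.single_eq_same]

lemma form_single_log {x : S.Coord → A} {i : S.Coord} (hi : i ∈ S.log) :
    S.form k x (Pi.single i (x i)) = (∏ j ∈ S.log, x j) • KaehlerDifferential.D k A (x i) := by
  rw [form_single, smul_smul, Finset.mul_prod_erase _ _ hi]

lemma form_single_of_notMem {x : S.Coord → A} {i : S.Coord} (hi : i ∉ S.log) :
    S.form k x (Pi.single i 1) = (∏ j ∈ S.log, x j) • KaehlerDifferential.D k A (x i) := by
  rw [form_single, one_smul, Finset.erase_eq_of_notMem hi]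

end ChartShape

namespace IsLogChart
variable (h : IsLogChart k B (A' := A') S I ξ π) {t : B} (ht : I = Ideal.span {t})
include h

lemma exists_basis_relLogForms : ∃ (e : S.Vert → polarForms k (algebraMap B A t))
    (b : Module.Basis S.Vert A' (S.Vert → A')) (b₀ : Module.Basis S.Vert A (RelLogForms k A I)),
    (∀ i, b i = h.relCoord ht (e i)) ∧ ∀ i, b₀ i = (h.isLogPair (A := A) ht).toRel (e i) := by
  obtain ⟨e, b, hb⟩ := h.exists_basis_relCoord (A := A) ht
  obtain ⟨b₀, hb₀⟩ := h.exists_basis_of_basis ht e b hb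
  exact ⟨e, b, b₀, hb, hb₀⟩

/-- A linear functional on the relative logarithmic forms is a functional of the relative
coordinates on the chart. -/
lemma exists_functional (φ : RelLogForms k A I →ₗ[A] A) : ∃ φ' : (S.Vert → A') →ₗ[A'] A',
    ∀ ω, φ' (h.relCoord ht ω) = algebraMap A A' (φ ((h.isLogPair (A := A) ht).toRel ω)) := by
  obtain ⟨e, b, b₀, hb, hb₀⟩ := h.exists_basis_relLogForms (A := A) ht
  let φ' := b.constr A' fun i => algebraMap A A' (φ (b₀ i))
  have hφ' : ∀ i, φ' (b i) = algebraMap A A' (φ (b₀ i)) := fun i => b.constr_basis _ _ i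
  refine ⟨φ', fun ω => ?_⟩
  have h1 : (h.isLogPair (A := A) ht).toRel
      (ω - ∑ i, b₀.repr ((h.isLogPair (A := A) ht).toRel ω) i • e i) = 0 := by
    rw [map_sub, map_sum]
    simp only [map_smul, ← hb₀]
    rw [b₀.sum_repr, sub_self]
  have h2 := (h.relCoord_eq_zero_iff ht).2 h1
  rw [map_sub, sub_eq_zero] at h2
  rw [h2, map_sum]
  conv_rhs => rw [← b₀.sum_repr ((h.isLogPair (A := A) ht).toRel ω)]
  simp only [map_sum, map_smul, ← hb, hφ', ← algebraMap_smul A' (_ : A), smul_eq_mul, map_mul]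

section Fibre
variable {C : Type} [CommRing C] [Algebra A C] (hC : IsFibreRing B A C)
  [Algebra.EssFiniteType B B'] [IsLocalHom (algebraMap B B')]
include hC

lemma map_maximalIdeal_eq : ((IsLocalRing.maximalIdeal B).map (algebraMap B A)).map
    (algebraMap A A') = (IsLocalRing.maximalIdeal B').map (algebraMap B' A') := by
  rw [← Algebra.FormallyUnramified.map_maximalIdeal (R := B) (S := B'), Ideal.map_map,
    Ideal.map_map, ← IsScalarTower.algebraMap_eq, ← IsScalarTower.algebraMap_eq]

include ht in
/-- The differentials of functions generate the dual of the dual of the logarithmic forms of the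
fibre: a functional that vanishes on them is zero. -/
lemma eq_zero_of_apply_d {θ : FibreLogForms k A C I →ₗ[C] C}
    (hθ : ∀ c, θ (fibreLogD k hC I c) = 0) : θ = 0 := by
  obtain ⟨e, b, b₀, hb, hb₀⟩ := h.exists_basis_relLogForms (A := A) ht
  choose l hl using fun i => hC.surj (θ (1 ⊗ₜ b₀ i))
  let φ : RelLogForms k A I →ₗ[A] A := b₀.constr A l
  have hφ : ∀ r, algebraMap A C (φ r) = θ (1 ⊗ₜ r) := by
    have : (Algebra.linearMap A C).comp φ =
        (θ.restrictScalars A).comp (TensorProduct.mk A C _ 1) := by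
      refine b₀.ext fun i => ?_
      rw [LinearMap.comp_apply, LinearMap.comp_apply]
      have : φ (b₀ i) = l i := b₀.constr_basis _ _ i
      rw [this]
      exact hl i
    exact fun r => LinearMap.congr_fun this r
  obtain ⟨φ', hφ'⟩ := h.exists_functional ht φ
  set J := (IsLocalRing.maximalIdeal B).map (algebraMap B A) with hJ
  have hJ' : J.map (algebraMap A A') = (IsLocalRing.maximalIdeal B').map (algebraMap B' A') :=
    h.map_maximalIdeal_eq hC
  have hφd : ∀ a, φ (relLogD k A I a) ∈ J := by
    intro a
    rw [hJ, ← hC.ker, RingHom.mem_ker, hφ, ← fibreLogD_algebraMap k hC, hθ]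
  obtain ⟨u, hu⟩ := h.exists_unit (A := A) ht
  -- `φ'` of the relative coordinates of `t ω` is in `J A'`, for every form `ω` of `A'`
  have key : ∀ ω : Ω[A'⁄k], ∃ a, S.form k (S.coord ξ π) a = algebraMap A A' (algebraMap B A t) • ω ∧
      φ' (S.vert a) ∈ J.map (algebraMap A A') := by
    intro ω
    induction ω using
      (KaehlerDifferential.isBaseChange_of_formallyEtale k A A').inductionOn with
    | zero => exact ⟨0, by simp, by simp⟩
    | tmul ω =>
      have : ω ∈ Submodule.span A (Set.range (KaehlerDifferential.D k A)) := by
        rw [KaehlerDifferential.span_range_derivation]; trivial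
      induction this using Submodule.span_induction with
      | mem ω hω =>
        obtain ⟨a, rfl⟩ := hω
        let ω : polarForms k (algebraMap B A t) :=
          ⟨algebraMap B A t • KaehlerDifferential.D k A a, smul_mem_polarForms _ _⟩
        obtain ⟨c, hc⟩ := (h.mem_polarForms_iff_exists ht).1 ω.2
        refine ⟨c, ?_, ?_⟩
        · exact hc.trans ((map_smul (KaehlerDifferential.map k k A A') _ _).trans
            (algebraMap_smul A' (algebraMap B A t) _).symm)
        · rw [← h.relCoord_eq ht hc, hφ', ← IsLogPair.relLogD_eq]
          exact Ideal.mem_map_of_mem _ (hφd a)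
      | zero => exact ⟨0, by simp, by simp⟩
      | add x y _ _ hx hy =>
        obtain ⟨a, ha, ha'⟩ := hx
        obtain ⟨c, hc, hc'⟩ := hy
        exact ⟨a + c, by rw [map_add, ha, hc, map_add, smul_add],
          by rw [map_add, map_add]; exact add_mem ha' hc'⟩
      | smul r x _ hx =>
        obtain ⟨a, ha, ha'⟩ := hx
        exact ⟨algebraMap A A' r • a, by
          rw [map_smul, ha, map_smul (KaehlerDifferential.map k k A A'), ← algebraMap_smul A' r,
            smul_comm],
          by rw [map_smul, map_smul]; exact Ideal.mul_mem_left _ _ ha'⟩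
    | smul r x hx =>
      obtain ⟨a, ha, ha'⟩ := hx
      exact ⟨r • a, by rw [map_smul, ha, smul_comm],
        by rw [map_smul, map_smul]; exact Ideal.mul_mem_left _ _ ha'⟩
    | add x y hx hy =>
      obtain ⟨a, ha, ha'⟩ := hx
      obtain ⟨c, hc, hc'⟩ := hy
      exact ⟨a + c, by rw [map_add, ha, hc, smul_add],
        by rw [map_add, map_add]; exact add_mem ha' hc'⟩
  have key' : ∀ (i : S.Coord) (c : A'), S.form k (S.coord ξ π) (Pi.single i c) =
      (∏ j ∈ S.log, S.coord ξ π j) • KaehlerDifferential.D k A' (S.coord ξ π i) →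
      φ' (S.vert (Pi.single i c)) ∈ J.map (algebraMap A A') := by
    intro i c hic
    obtain ⟨a, ha, ha'⟩ := key (KaehlerDifferential.D k A' (S.coord ξ π i))
    rw [hu, mul_comm, mul_smul, ← hic, ← map_smul] at ha
    rw [h.form_injective ha, map_smul, map_smul, smul_eq_mul] at ha'
    exact (Ideal.unit_mul_mem_iff_mem _ u.isUnit).1 ha'
  have hinl : ∀ i : S.ι, (Sum.inl i : S.Coord) ∈ S.log ↔ i ∈ S.branches := fun i => by
    simp [ChartShape.log]
  have hα : ∀ i : S.ι, φ' (S.vert (Pi.single (Sum.inl i) 1)) ∈ J.map (algebraMap A A') := by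
    intro i
    by_cases hi : i ∈ S.branches
    · rw [hJ']
      refine h.mem_of_branches (a := fun i => φ' (S.vert (Pi.single (Sum.inl i) 1))) ?_ ?_ hi
      · intro l hl
        have h1 := key' _ _ (ChartShape.form_single_log (k := k) (x := S.coord ξ π) ((hinl l).2 hl))
        have h2 : (Pi.single (Sum.inl l) (S.coord ξ π (Sum.inl l)) : S.Coord → A') =
            S.coord ξ π (Sum.inl l) • Pi.single (Sum.inl l) 1 := by
          rw [← Pi.single_smul, smul_eq_mul, mul_one]
        rw [h2, map_smul, map_smul, smul_eq_mul, hJ'] at h1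
        exact h1
      · rw [← map_sum, ChartShape.sum_vert_single, map_zero]
        exact zero_mem _
    · exact key' _ _ (ChartShape.form_single_of_notMem fun h' => hi ((hinl i).1 h'))
  have hall : ∀ a : S.Coord → A', φ' (S.vert a) ∈ J.map (algebraMap A A') := by
    intro a
    have h1 : a = ∑ i, a i • (Pi.single i 1 : S.Coord → A') := by
      ext j
      simp [Finset.sum_apply, Pi.single_apply]
    rw [h1, map_sum, map_sum]
    refine Ideal.sum_mem _ fun i _ => ?_
    rw [map_smul, map_smul]
    refine Ideal.mul_mem_left _ _ ?_
    rcases i with i | j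
    · exact hα i
    · rw [ChartShape.vert_single_inr, map_zero]
      exact zero_mem _
  have hfin : ∀ r, θ (1 ⊗ₜ r) = 0 := by
    intro r
    obtain ⟨ω, rfl⟩ := (h.isLogPair (A := A) ht).toRel_surjective r
    obtain ⟨a, ha⟩ := (h.mem_polarForms_iff_exists ht).1 ω.2
    have h1 := hall a
    rw [← h.relCoord_eq ht ha, hφ', ← Ideal.mem_comap,
      Ideal.comap_map_eq_self_of_faithfullyFlat, hJ, ← hC.ker, RingHom.mem_ker, hφ] at h1
    exact h1
  refine LinearMap.ext fun y => ?_
  induction y using TensorProduct.induction_on with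
  | zero => simp
  | tmul c r =>
    rw [← mul_one c, ← smul_eq_mul, ← TensorProduct.smul_tmul', map_smul, hfin, smul_zero]
    rfl
  | add x y hx hy => rw [map_add, hx, hy, map_add]

end Fibre
end IsLogChart
end Chart
end

section
/-! ### Brackets of logarithmic derivations of local rings -/

set_option linter.unusedSectionVars false

section Chart
variable {k : Type} {B A B' A' : Type} [Field k] [CharZero k] [CommRing B] [CommRing A]
  [CommRing B'] [CommRing A']
  [Algebra k B] [Algebra k A] [Algebra k B'] [Algebra k A'] [Algebra B A] [Algebra B B']
  [Algebra A A'] [Algebra B' A'] [Algebra B A'] [IsScalarTower k B A] [IsScalarTower k B B']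
  [IsScalarTower k A A'] [IsScalarTower k B' A'] [IsScalarTower B A A'] [IsScalarTower B B' A']
  [IsLocalRing B] [IsLocalRing A] [IsLocalRing B'] [IsLocalRing A']
  [Algebra.FormallyEtale A A'] [Module.FaithfullyFlat A A']
  [Algebra.FormallyEtale B B'] [Module.FaithfullyFlat B B']
  {S : ChartShape} {I : Ideal B} {ξ : S.ι → A'} {π : S.κ → B'}

/-- Derivations extend along étale homomorphisms. -/
lemma exists_derivation_extension (Δ : Derivation k A A) :
    ∃ Δ' : Derivation k A' A', ∀ a, Δ' (algebraMap A A' a) = algebraMap A A' (Δ a) := by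
  let ψ := (KaehlerDifferential.isBaseChange_of_formallyEtale k A A').lift
    ((Algebra.linearMap A A').comp Δ.liftKaehlerDifferential)
  refine ⟨ψ.compDer (KaehlerDifferential.D k A'), fun a => ?_⟩
  have h1 := (KaehlerDifferential.isBaseChange_of_formallyEtale k A A').lift_eq
    ((Algebra.linearMap A A').comp Δ.liftKaehlerDifferential) (KaehlerDifferential.D k A a)
  rw [KaehlerDifferential.map_D] at h1
  refine h1.trans ?_
  rw [LinearMap.comp_apply, Derivation.liftKaehlerDifferential_comp_D]
  rfl

lemma lift_map_of_extension {Δ : Derivation k A A} {Δ' : Derivation k A' A'}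
    (hΔ : ∀ a, Δ' (algebraMap A A' a) = algebraMap A A' (Δ a)) (ω : Ω[A⁄k]) :
    Δ'.liftKaehlerDifferential (KaehlerDifferential.map k k A A' ω) =
      algebraMap A A' (Δ.liftKaehlerDifferential ω) := by
  have : ω ∈ Submodule.span A (Set.range (KaehlerDifferential.D k A)) := by
    rw [KaehlerDifferential.span_range_derivation]; trivial
  induction this using Submodule.span_induction with
  | mem x hx =>
    obtain ⟨a, rfl⟩ := hx
    rw [KaehlerDifferential.map_D, Derivation.liftKaehlerDifferential_comp_D,
      Derivation.liftKaehlerDifferential_comp_D, hΔ]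
  | zero => simp only [map_zero]
  | add x y _ _ hx hy => simp only [map_add, hx, hy]
  | smul c x _ hx =>
    rw [map_smul, ← algebraMap_smul A' c, map_smul, hx, map_smul, smul_eq_mul, smul_eq_mul, map_mul]

namespace IsLogChart
variable (h : IsLogChart k B (A' := A') S I ξ π) {t : B} (ht : I = Ideal.span {t})
include h ht

/-- A derivation preserves the equation of the divisor up to multiples, in terms of polar forms
and in terms of the coordinates of the chart. -/
lemma dvd_lift_iff {Δ : Derivation k A A} {Δ' : Derivation k A' A'}
    (hΔ : ∀ a, Δ' (algebraMap A A' a) = algebraMap A A' (Δ a)) :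
    (∀ ω ∈ polarForms k (algebraMap B A t), algebraMap B A t ∣ Δ.liftKaehlerDifferential ω) ↔
      ∀ i ∈ S.log, S.coord ξ π i ∣ Δ' (S.coord ξ π i) := by
  obtain ⟨u, hu⟩ := h.exists_unit (A := A) ht
  constructor
  · intro hd i hi
    have h1 := h.form_mem_span (A := A) ht (Pi.single i 1)
    have h2 : ∀ ω ∈ Submodule.span A'
        (KaehlerDifferential.map k k A A' '' polarForms k (algebraMap B A t)),
        algebraMap A A' (algebraMap B A t) ∣ Δ'.liftKaehlerDifferential ω := by
      intro ω hω
      induction hω using Submodule.span_induction with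
      | mem x hx =>
        obtain ⟨η, hη, rfl⟩ := hx
        rw [lift_map_of_extension hΔ]
        exact map_dvd _ (hd η hη)
      | zero => rw [map_zero]; exact dvd_zero _
      | add x y _ _ hx hy => rw [map_add]; exact dvd_add hx hy
      | smul c x _ hx => rw [map_smul]; exact hx.mul_left c
    have h3 := h2 _ h1
    rw [ChartShape.form_single, one_smul, map_smul, Derivation.liftKaehlerDifferential_comp_D, hu,
      smul_eq_mul, ← Finset.mul_prod_erase _ _ hi] at h3
    obtain ⟨c, hc⟩ := h3
    refine ⟨u * c, ?_⟩
    refine (mul_cancel_left_mem_nonZeroDivisors (h.total.prod_mem_nonZeroDivisors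
      (S.log.erase i))).1 ?_
    rw [hc]
    ring
  · intro hd ω hω
    obtain ⟨a, ha⟩ := (h.mem_polarForms_iff_exists ht).1 hω
    refine dvd_of_algebraMap_dvd (A' := A') ?_
    rw [← lift_map_of_extension hΔ, ← ha, ChartShape.form_apply, map_sum, hu,
      Units.mul_right_dvd]
    refine Finset.dvd_sum fun i _ => ?_
    rw [map_smul, map_smul, Derivation.liftKaehlerDifferential_comp_D]
    refine Dvd.dvd.mul_left ?_ _
    by_cases hi : i ∈ S.log
    · rw [← Finset.prod_erase_mul _ _ hi]
      exact mul_dvd_mul_left _ (hd i hi)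
    · rw [Finset.erase_eq_of_notMem hi]
      exact dvd_mul_right _ _

/-- The bracket of logarithmic derivations is logarithmic. -/
lemma dvd_lift_lie {Δ₁ Δ₂ : Derivation k A A}
    (h₁ : ∀ ω ∈ polarForms k (algebraMap B A t), algebraMap B A t ∣ Δ₁.liftKaehlerDifferential ω)
    (h₂ : ∀ ω ∈ polarForms k (algebraMap B A t), algebraMap B A t ∣ Δ₂.liftKaehlerDifferential ω) :
    ∀ ω ∈ polarForms k (algebraMap B A t),
      algebraMap B A t ∣ (⁅Δ₁, Δ₂⁆ : Derivation k A A).liftKaehlerDifferential ω := by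
  obtain ⟨Δ₁', hΔ₁⟩ := exists_derivation_extension (A' := A') Δ₁
  obtain ⟨Δ₂', hΔ₂⟩ := exists_derivation_extension (A' := A') Δ₂
  have hΔ : ∀ a, (⁅Δ₁', Δ₂'⁆ : Derivation k A' A') (algebraMap A A' a) =
      algebraMap A A' ((⁅Δ₁, Δ₂⁆ : Derivation k A A) a) := by
    intro a
    rw [Derivation.commutator_apply, Derivation.commutator_apply, hΔ₁, hΔ₂, hΔ₁, hΔ₂, map_sub]
  rw [h.dvd_lift_iff ht hΔ₁] at h₁
  rw [h.dvd_lift_iff ht hΔ₂] at h₂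
  rw [h.dvd_lift_iff ht hΔ]
  intro i hi
  obtain ⟨c₁, hc₁⟩ := h₁ i hi
  obtain ⟨c₂, hc₂⟩ := h₂ i hi
  refine ⟨Δ₁' c₂ - Δ₂' c₁, ?_⟩
  rw [Derivation.commutator_apply, hc₂, hc₁, Derivation.leibniz, Derivation.leibniz, hc₁, hc₂]
  simp only [smul_eq_mul]
  ring

/-- A derivation over `B` that is logarithmic factors through the relative logarithmic forms. -/
lemma exists_functional_of_derivation {Δ : Derivation k A A}
    (hB : ∀ b, Δ (algebraMap B A b) = 0)
    (hd : ∀ ω ∈ polarForms k (algebraMap B A t),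
      algebraMap B A t ∣ Δ.liftKaehlerDifferential ω) :
    ∃ φ : RelLogForms k A I →ₗ[A] A, ∀ a, φ (relLogD k A I a) = Δ a := by
  have hp := h.isLogPair (A := A) ht
  have hz := hp.mem_total
  choose f hf using fun ω : polarForms k (algebraMap B A t) => hd ω.1 ω.2
  have hf' : ∀ {ω : polarForms k (algebraMap B A t)} {c : A},
      Δ.liftKaehlerDifferential ω.1 = algebraMap B A t * c → f ω = c := fun {ω} {c} hc =>
    (mul_cancel_left_mem_nonZeroDivisors hz).1 ((hf ω).symm.trans hc)
  let φ₀ : polarForms k (algebraMap B A t) →ₗ[A] A :=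
    { toFun := f
      map_add' := fun x y => hf' (by rw [Submodule.coe_add, map_add, hf, hf, mul_add])
      map_smul' := fun c x => hf' (by
        rw [Submodule.coe_smul, map_smul, hf, smul_eq_mul, RingHom.id_apply, smul_eq_mul]
        ring) }
  have hker : LinearMap.ker hp.toRel ≤ LinearMap.ker φ₀ := by
    intro ω hω
    rw [LinearMap.mem_ker, hp.toRel_eq_zero_iff] at hω
    have h1 : ∀ η ∈ pulledPolar k A t, Δ.liftKaehlerDifferential η = 0 := by
      intro η hη
      induction hη using Submodule.span_induction with
      | mem x hx =>
        obtain ⟨η, -, rfl⟩ := hx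
        have : η ∈ Submodule.span B (Set.range (KaehlerDifferential.D k B)) := by
          rw [KaehlerDifferential.span_range_derivation]; trivial
        induction this using Submodule.span_induction with
        | mem x hx =>
          obtain ⟨b, rfl⟩ := hx
          rw [KaehlerDifferential.map_D, Derivation.liftKaehlerDifferential_comp_D, hB]
        | zero => simp only [map_zero]
        | add x y _ _ hx hy => rw [map_add, map_add, hx, hy, add_zero]
        | smul c x _ hx => rw [map_smul, ← algebraMap_smul A c, map_smul, hx, smul_zero]
      | zero => rw [map_zero]
      | add x y _ _ hx hy => rw [map_add, hx, hy, add_zero]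
      | smul c x _ hx => rw [map_smul, hx, smul_zero]
    exact hf' (by rw [h1 _ hω, mul_zero])
  let φ : RelLogForms k A I →ₗ[A] A := ((LinearMap.ker hp.toRel).liftQ φ₀ hker).comp
    (hp.toRel.quotKerEquivOfSurjective hp.toRel_surjective).symm.toLinearMap
  refine ⟨φ, fun a => ?_⟩
  rw [hp.relLogD_eq]
  have h2 : (hp.toRel.quotKerEquivOfSurjective hp.toRel_surjective).symm (hp.toRel
      ⟨algebraMap B A t • KaehlerDifferential.D k A a, smul_mem_polarForms _ _⟩) =
      Submodule.Quotient.mk ⟨algebraMap B A t • KaehlerDifferential.D k A a,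
        smul_mem_polarForms _ _⟩ := by
    rw [LinearEquiv.symm_apply_eq]
    rfl
  rw [LinearMap.comp_apply, LinearEquiv.coe_coe, h2, Submodule.liftQ_apply]
  exact hf' (by rw [map_smul, Derivation.liftKaehlerDifferential_comp_D, smul_eq_mul])

/-- The derivation given by a functional on the relative logarithmic forms is logarithmic. -/
lemma dvd_lift_of_functional (φ : RelLogForms k A I →ₗ[A] A) {Δ : Derivation k A A}
    (hΔ : ∀ a, φ (relLogD k A I a) = Δ a) :
    ∀ ω ∈ polarForms k (algebraMap B A t), algebraMap B A t ∣ Δ.liftKaehlerDifferential ω := by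
  have hp := h.isLogPair (A := A) ht
  have h1 : ∀ ω : Ω[A⁄k], φ (hp.toRel ⟨algebraMap B A t • ω, smul_mem_polarForms _ _⟩) =
      Δ.liftKaehlerDifferential ω := by
    intro ω
    have : ω ∈ Submodule.span A (Set.range (KaehlerDifferential.D k A)) := by
      rw [KaehlerDifferential.span_range_derivation]; trivial
    induction this using Submodule.span_induction with
    | mem x hx =>
      obtain ⟨a, rfl⟩ := hx
      rw [← hp.relLogD_eq, hΔ, Derivation.liftKaehlerDifferential_comp_D]
    | zero =>
      rw [map_zero, ← map_zero φ, ← map_zero hp.toRel]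
      congr 2
    | add x y _ _ hx hy =>
      rw [map_add, ← hx, ← hy, ← map_add, ← map_add]
      congr 2
      exact Subtype.ext (smul_add _ _ _)
    | smul c x _ hx =>
      rw [map_smul, ← hx, ← map_smul, ← map_smul]
      congr 2
      exact Subtype.ext (smul_comm _ _ _)
  intro ω hω
  refine ⟨φ (hp.toRel ⟨ω, hω⟩), ?_⟩
  rw [← h1, ← smul_eq_mul, ← map_smul, ← map_smul]
  rfl

section Fibre
variable {C : Type} [CommRing C] [Algebra A C] (hC : IsFibreRing B A C)
include hC

/-- A functional on the logarithmic forms of the fibre lifts to the total space. -/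
lemma exists_lift (θ : FibreLogForms k A C I →ₗ[C] C) : ∃ (φ : RelLogForms k A I →ₗ[A] A)
    (Δ : Derivation k A A), (∀ r, algebraMap A C (φ r) = θ (1 ⊗ₜ r)) ∧
      (∀ a, φ (relLogD k A I a) = Δ a) ∧
      ∀ a, θ (fibreLogD k hC I (algebraMap A C a)) = algebraMap A C (Δ a) := by
  obtain ⟨e, b, b₀, hb, hb₀⟩ := h.exists_basis_relLogForms (A := A) ht
  choose l hl using fun i => hC.surj (θ (1 ⊗ₜ b₀ i))
  let φ : RelLogForms k A I →ₗ[A] A := b₀.constr A l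
  have hφ : ∀ r, algebraMap A C (φ r) = θ (1 ⊗ₜ r) := by
    have : (Algebra.linearMap A C).comp φ =
        (θ.restrictScalars A).comp (TensorProduct.mk A C _ 1) := by
      refine b₀.ext fun i => ?_
      rw [LinearMap.comp_apply, LinearMap.comp_apply]
      have : φ (b₀ i) = l i := b₀.constr_basis _ _ i
      rw [this]
      exact hl i
    exact fun r => LinearMap.congr_fun this r
  refine ⟨φ, φ.compDer (relLogD k A I), hφ, fun _ => rfl, fun a => ?_⟩
  rw [fibreLogD_algebraMap, ← hφ]
  rfl

/-- The bracket of two logarithmic derivations of the fibre is a logarithmic derivation. -/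
lemma exists_lie_functional (θ₁ θ₂ : FibreLogForms k A C I →ₗ[C] C) :
    ∃ θ : FibreLogForms k A C I →ₗ[C] C, ∀ c, θ (fibreLogD k hC I c) =
      θ₁ (fibreLogD k hC I (θ₂ (fibreLogD k hC I c))) -
        θ₂ (fibreLogD k hC I (θ₁ (fibreLogD k hC I c))) := by
  obtain ⟨φ₁, Δ₁, -, h₁, h₁'⟩ := h.exists_lift ht hC θ₁
  obtain ⟨φ₂, Δ₂, -, h₂, h₂'⟩ := h.exists_lift ht hC θ₂
  obtain ⟨φ, hφ⟩ := h.exists_functional_of_derivation ht (Δ := ⁅Δ₁, Δ₂⁆)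
    (fun b => by
      rw [Derivation.commutator_apply, ← h₁, ← h₂, ← h₁, ← h₂, relLogD_algebraMap]
      simp only [map_zero, sub_self])
    (h.dvd_lift_lie ht (h.dvd_lift_of_functional ht φ₁ h₁) (h.dvd_lift_of_functional ht φ₂ h₂))
  let θ : FibreLogForms k A C I →ₗ[C] C :=
    TensorProduct.AlgebraTensorModule.lift (LinearMap.toSpanSingleton C _
      ((Algebra.linearMap A C).comp φ))
  have hθ : ∀ r, θ (1 ⊗ₜ r) = algebraMap A C (φ r) := fun r => by
    rw [TensorProduct.AlgebraTensorModule.lift_tmul, LinearMap.toSpanSingleton_apply, one_smul]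
    rfl
  refine ⟨θ, fun c => ?_⟩
  obtain ⟨a, rfl⟩ := hC.surj c
  rw [h₂', h₁', h₁', h₂', fibreLogD_algebraMap, hθ, hφ, Derivation.commutator_apply, map_sub]

end Fibre

end IsLogChart
end Chart
end

section
/-! ### Étale homomorphisms of local rings -/

/-- Étale ring homomorphisms in the local sense: flat, formally étale and essentially of finite
type, as for the homomorphisms of local rings of an étale morphism. -/
structure IsEssEtale {R S : Type} [CommRing R] [CommRing S] (f : R →+* S) : Prop where
  flat : f.Flat
  formallyEtale : f.FormallyEtale
  essFiniteType : f.EssFiniteType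

namespace IsEssEtale
variable {R S T : Type} [CommRing R] [CommRing S] [CommRing T] {f : R →+* S} {g : S →+* T}

lemma comp (hf : IsEssEtale f) (hg : IsEssEtale g) : IsEssEtale (g.comp f) :=
  ⟨hf.flat.comp hg.flat, hf.formallyEtale.comp hg.formallyEtale,
    hf.essFiniteType.comp hg.essFiniteType⟩

lemma of_etale (hf : f.Etale) : IsEssEtale f := by
  algebraize [f]
  exact ⟨inferInstanceAs (Module.Flat R S), inferInstanceAs (Algebra.FormallyEtale R S),
    inferInstanceAs (Algebra.EssFiniteType R S)⟩

lemma of_bijective (hf : Function.Bijective f) : IsEssEtale f :=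
  of_etale (RingHom.Etale.of_bijective hf)

lemma of_isLocalization [Algebra R S] (M : Submonoid R) [IsLocalization M S] :
    IsEssEtale (algebraMap R S) where
  flat := (RingHom.flat_algebraMap_iff).2 (IsLocalization.flat S M)
  formallyEtale := RingHom.formallyEtale_algebraMap.2 (Algebra.FormallyEtale.of_isLocalization M)
  essFiniteType := (RingHom.essFiniteType_algebraMap).2 (Algebra.EssFiniteType.of_isLocalization S M)

lemma of_comp (hf : IsEssEtale f) (hgf : IsEssEtale (g.comp f)) : IsEssEtale g := by
  have h1 := hf.formallyEtale
  have h2 := hf.essFiniteType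
  have h3 := hgf.flat
  have h4 := hgf.formallyEtale
  let _ := f.toAlgebra
  let _ := g.toAlgebra
  let _ := (g.comp f).toAlgebra
  have : IsScalarTower R S T := IsScalarTower.of_algebraMap_eq' rfl
  have : Algebra.FormallyEtale R S := h1
  have : Algebra.EssFiniteType R S := h2
  have : Module.Flat R T := h3
  have : Algebra.FormallyEtale R T := h4
  exact ⟨Algebra.FormallyUnramified.flat_of_restrictScalars R S T,
    Algebra.FormallyEtale.of_restrictScalars (R := R), RingHom.EssFiniteType.of_comp f hgf.essFiniteType⟩

lemma mvPolynomial_map (σ : Type) (hf : IsEssEtale f) :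
    IsEssEtale (MvPolynomial.map f : MvPolynomial σ R →+* MvPolynomial σ S) := by
  have h1 := hf.flat
  have h2 := hf.formallyEtale
  have h3 := hf.essFiniteType
  let _ := f.toAlgebra
  have : Module.Flat R S := h1
  have : Algebra.FormallyEtale R S := h2
  have : Algebra.EssFiniteType R S := h3
  let ε := MvPolynomial.algebraTensorAlgEquiv R (σ := σ) S
  have h4 : IsEssEtale (algebraMap (MvPolynomial σ R) (MvPolynomial σ R ⊗[R] S)) :=
    ⟨RingHom.flat_algebraMap_iff.2 inferInstance, RingHom.formallyEtale_algebraMap.2 inferInstance,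
      RingHom.essFiniteType_algebraMap.2 inferInstance⟩
  have h5 : (MvPolynomial.map f : MvPolynomial σ R →+* MvPolynomial σ S) =
      (((Algebra.TensorProduct.comm R (MvPolynomial σ R) S).trans
        (ε.restrictScalars R)).toRingEquiv.toRingHom).comp
        (algebraMap (MvPolynomial σ R) (MvPolynomial σ R ⊗[R] S)) := by
    refine MvPolynomial.ringHom_ext (fun r => ?_) (fun i => ?_)
    · simp [ε, MvPolynomial.algebraTensorAlgEquiv_tmul, Algebra.smul_def, RingHom.algebraMap_toAlgebra]
    · simp [ε]
  rw [h5]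
  exact h4.comp (of_bijective (RingEquiv.bijective _))

end IsEssEtale

section Coordinates
variable {k : Type} [Field k] {A B : Type} [CommRing A] [CommRing B] [Algebra k A] [Algebra k B]
  {σ τ : Type}

lemma isCoordinates_iff {x : σ → A} :
    IsCoordinates k x ↔ IsEssEtale (MvPolynomial.aeval (R := k) x).toRingHom :=
  ⟨fun h => ⟨h.flat, h.formallyEtale, h.essFiniteType⟩,
    fun h => ⟨h.flat, h.formallyEtale, h.essFiniteType⟩⟩

lemma IsCoordinates.reindex {x : σ → A} (hx : IsCoordinates k x) (e : τ ≃ σ) :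
    IsCoordinates k (x ∘ e) := by
  rw [isCoordinates_iff] at hx ⊢
  have h1 : (MvPolynomial.aeval (R := k) (x ∘ e)).toRingHom =
      (MvPolynomial.aeval (R := k) x).toRingHom.comp
        (MvPolynomial.renameEquiv k e : MvPolynomial τ k →+* MvPolynomial σ k) := by
    refine MvPolynomial.ringHom_ext (fun r => ?_) (fun i => ?_) <;> simp
  rw [h1]
  exact (IsEssEtale.of_bijective (AlgEquiv.bijective _)).comp hx

variable [Algebra B A] [IsScalarTower k B A]

/-- Coordinates on the base and relative coordinates together form coordinates. -/
lemma IsCoordinates.extend {y : τ → B} (hy : IsCoordinates k y) {x : σ → A}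
    (hx : IsEssEtale (MvPolynomial.aeval (R := B) x).toRingHom) :
    IsCoordinates k (Sum.elim x fun j => algebraMap B A (y j)) := by
  rw [isCoordinates_iff] at hy ⊢
  have h1 : (MvPolynomial.aeval (R := k) (Sum.elim x fun j => algebraMap B A (y j))).toRingHom =
      ((MvPolynomial.aeval (R := B) x).toRingHom.comp
        (MvPolynomial.map (MvPolynomial.aeval (R := k) y).toRingHom)).comp
        (MvPolynomial.sumAlgEquiv k σ τ : MvPolynomial (σ ⊕ τ) k →+* _) := by
    refine MvPolynomial.ringHom_ext (fun r => ?_) (fun i => ?_)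
    · simp [← IsScalarTower.algebraMap_apply]
    · rcases i with i | j <;> simp
  rw [h1]
  exact (IsEssEtale.of_bijective (AlgEquiv.bijective _)).comp ((hy.mvPolynomial_map σ).comp hx)

end Coordinates

section Stalks
variable {X Y : Scheme.{0}}

lemma isEssEtale_localRingHom {R S : Type} [CommRing R] [CommRing S] {f : R →+* S}
    (hf : IsEssEtale f) (I : Ideal R) [I.IsPrime] (J : Ideal S) [J.IsPrime] (h : I = J.comap f) :
    IsEssEtale (Localization.localRingHom I J f h) := by
  refine IsEssEtale.of_comp (f := algebraMap R (Localization.AtPrime I))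
    (IsEssEtale.of_isLocalization I.primeCompl) ?_
  have : (Localization.localRingHom I J f h).comp (algebraMap R (Localization.AtPrime I)) =
      (algebraMap S (Localization.AtPrime J)).comp f :=
    RingHom.ext fun r => Localization.localRingHom_to_map _ _ _ h r
  rw [this]
  exact hf.comp (IsEssEtale.of_isLocalization J.primeCompl)

lemma isEssEtale_stalkMap (u : X ⟶ Y) [Etale u] (x : X) : IsEssEtale (u.stalkMap x).hom := by
  have hP : ∀ {R S : Type} [CommRing R] [CommRing S] (f : R →+* S) (_ : f.Etale)
      (J : Ideal S) (_ : J.IsPrime), IsEssEtale (Localization.localRingHom _ J f rfl) :=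
    fun f hf J _ => isEssEtale_localRingHom (IsEssEtale.of_etale hf) _ _ _
  have hi : RingHom.RespectsIso @IsEssEtale :=
    ⟨fun f e hf => hf.comp (IsEssEtale.of_bijective e.bijective),
      fun f e hf => (IsEssEtale.of_bijective e.bijective).comp hf⟩
  exact HasRingHomProperty.stalkMap_of_respectsIso (P := @Etale) (Q := @RingHom.Etale)
    hi hP inferInstance x

end Stalks
end

section
/-! ### Stalks of coordinates and of ideal sheaves -/

section Coordinates
variable {W : Scheme.{0}}

lemma isEssEtale_germ {U : W.Opens} (hU : IsAffineOpen U) (x : W) (hx : x ∈ U) :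
    IsEssEtale (W.presheaf.germ U x hx).hom := by
  let _ := (W.presheaf.germ U x hx).hom.toAlgebra
  have : IsLocalization (hU.primeIdealOf ⟨x, hx⟩).asIdeal.primeCompl (W.presheaf.stalk x) :=
    hU.isLocalization_stalk ⟨x, hx⟩
  exact IsEssEtale.of_isLocalization (R := Γ(W, U)) (S := W.presheaf.stalk x)
    (hU.primeIdealOf ⟨x, hx⟩).asIdeal.primeCompl

/-- The germs of étale coordinates are coordinates on the local rings. -/
lemma IsEtaleCoordinates.isCoordinates_germ {q : W ⟶ Spec (CommRingCat.of ℂ)} {n : Type}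
    {x : n → Γ(W, ⊤)} (h : IsEtaleCoordinates q x) (w : W) :
    letI := (stalkConst q w).toAlgebra
    IsCoordinates ℂ fun i => W.presheaf.germ ⊤ w trivial (x i) := by
  let _ := (stalkConst q w).toAlgebra
  rw [isCoordinates_iff]
  have hh : Etale (AffineSpace.homOfVector q x) := h
  let e := AffineSpace.homOfVector q x
  let ψ := (Scheme.ΓSpecIso (CommRingCat.of (MvPolynomial n ℂ))).inv ≫
    (AffineSpace.SpecIso n (CommRingCat.of ℂ)).hom.appTop
  have hiso : IsIso (AffineSpace.SpecIso n (CommRingCat.of ℂ)).hom.appTop :=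
    inferInstanceAs (IsIso ((AffineSpace.SpecIso n (CommRingCat.of ℂ)).hom.app ⊤))
  have hψi : IsIso ψ := IsIso.comp_isIso
  have hψ : IsEssEtale ψ.hom :=
    IsEssEtale.of_bijective (ConcreteCategory.bijective_of_isIso ψ)
  have hψ' : ψ = CommRingCat.ofHom (MvPolynomial.eval₂Hom ((Scheme.ΓSpecIso _).inv ≫
        (𝔸(n; Spec (CommRingCat.of ℂ)) ↘ Spec (CommRingCat.of ℂ)).appTop).hom
          (AffineSpace.coord (Spec (CommRingCat.of ℂ)))) := by
    rw [show ψ = _ ≫ _ from rfl, AffineSpace.SpecIso_hom_appTop, Iso.inv_hom_id_assoc]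
  have h1 : (MvPolynomial.aeval (R := ℂ) fun i => W.presheaf.germ ⊤ w trivial (x i)).toRingHom =
      ((e.stalkMap w).hom.comp (𝔸(n; Spec (CommRingCat.of ℂ)).presheaf.germ ⊤ (e w) trivial).hom).comp
        ψ.hom := by
    refine MvPolynomial.ringHom_ext (fun r => ?_) (fun i => ?_)
    · rw [hψ']
      simp only [AlgHom.toRingHom_eq_coe, RingHom.coe_coe, RingHom.comp_apply, CommRingCat.hom_ofHom,
        MvPolynomial.coe_eval₂Hom, MvPolynomial.eval₂_C, MvPolynomial.algHom_C]
      refine Eq.trans ?_ (Scheme.Hom.germ_stalkMap_apply e ⊤ w trivial _).symm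
      have h2 : e.appTop ((𝔸(n; Spec (CommRingCat.of ℂ)) ↘ Spec (CommRingCat.of ℂ)).appTop
          ((Scheme.ΓSpecIso (CommRingCat.of ℂ)).inv r)) =
          q.appTop ((Scheme.ΓSpecIso (CommRingCat.of ℂ)).inv r) := by
        have h3 := congrArg Scheme.Hom.appTop (AffineSpace.homOfVector_over q x)
        rw [Scheme.Hom.comp_appTop] at h3
        exact ConcreteCategory.congr_hom h3 _
      exact congrArg (W.presheaf.germ ⊤ w trivial) h2.symm
    · rw [hψ']
      simp only [AlgHom.toRingHom_eq_coe, RingHom.coe_coe, RingHom.comp_apply, CommRingCat.hom_ofHom,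
        MvPolynomial.coe_eval₂Hom, MvPolynomial.eval₂_X, MvPolynomial.aeval_X]
      refine Eq.trans ?_ (Scheme.Hom.germ_stalkMap_apply e ⊤ w trivial _).symm
      exact congrArg (W.presheaf.germ ⊤ w trivial) (AffineSpace.homOfVector_appTop_coord q x i).symm
  rw [h1]
  exact hψ.comp ((isEssEtale_germ (isAffineOpen_top _) _ _).comp (isEssEtale_stalkMap e w))

end Coordinates

section StalkIdeal
variable {X Y : Scheme.{0}}

lemma stalkIdeal_eq_map (I : Y.IdealSheafData) (U : Y.affineOpens) (y : Y) (hy : y ∈ U.1) :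
    stalkIdeal I y = (I.ideal U).map (Y.presheaf.germ U.1 y hy).hom := by
  refine le_antisymm (Ideal.span_le.2 ?_) (Ideal.span_mono ?_)
  · rintro _ ⟨U', hy', g, hg, rfl⟩
    obtain ⟨W, hW, hyW, hle⟩ := Opens.isBasis_iff_nbhd.mp Y.isBasis_affineOpens
      (show y ∈ U.1 ⊓ U'.1 from ⟨hy, hy'⟩)
    have h1 : Y.presheaf.map (homOfLE (hle.trans inf_le_right)).op g ∈ I.ideal ⟨W, hW⟩ :=
      I.ideal_le_comap_ideal (U := ⟨W, hW⟩) (V := U') (hle.trans inf_le_right) hg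
    rw [← I.map_ideal (U := ⟨W, hW⟩) (V := U) (hle.trans inf_le_left)] at h1
    have h2 := Ideal.mem_map_of_mem (Y.presheaf.germ W y hyW).hom h1
    rw [Ideal.map_map] at h2
    have h3 : (Y.presheaf.germ W y hyW).hom.comp
        (Y.presheaf.map (homOfLE (hle.trans inf_le_left)).op).hom = (Y.presheaf.germ U.1 y hy).hom := by
      rw [← CommRingCat.hom_comp, TopCat.Presheaf.germ_res]
    have h4 : Y.presheaf.germ W y hyW (Y.presheaf.map (homOfLE (hle.trans inf_le_right)).op g) =
        Y.presheaf.germ U'.1 y hy' g := TopCat.Presheaf.germ_res_apply _ _ _ _ _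
    rw [SetLike.mem_coe, ← h4, ← h3]
    exact h2
  · rintro _ ⟨g, hg, rfl⟩
    exact ⟨U, hy, g, hg, rfl⟩

lemma IsGeneratedBy.stalkIdeal_eq {I : Y.IdealSheafData} {t : Γ(Y, ⊤)} (h : IsGeneratedBy I t)
    (y : Y) : stalkIdeal I y = Ideal.span {Y.presheaf.germ ⊤ y trivial t} := by
  obtain ⟨W, hW, hyW, -⟩ := Opens.isBasis_iff_nbhd.mp Y.isBasis_affineOpens
    (show y ∈ (⊤ : Y.Opens) from trivial)
  rw [stalkIdeal_eq_map I ⟨W, hW⟩ y hyW, h, Ideal.map_span, Set.image_singleton]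
  congr 2
  exact TopCat.Presheaf.germ_res_apply _ _ _ _ _

/-- The pull-back of the ideal sheaf `I` along `f` is computed by extension of ideals on stalks. -/
def StalkwiseComap (f : X ⟶ Y) : Prop :=
  ∀ (I : Y.IdealSheafData) (x : X),
    stalkIdeal (I.comap f) x = (stalkIdeal I (f x)).map (f.stalkMap x).hom

lemma map_stalkMap_comp {Z : Scheme.{0}} (f : X ⟶ Y) (g : Y ⟶ Z) (x : X)
    (J : Ideal (Z.presheaf.stalk (g (f x)))) :
    Ideal.map ((f ≫ g).stalkMap x).hom J =
      (J.map (g.stalkMap (f x)).hom).map (f.stalkMap x).hom := by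
  rw [Ideal.map_map, ← CommRingCat.hom_comp, Scheme.Hom.stalkMap_comp]
  rfl

lemma StalkwiseComap.comp {Z : Scheme.{0}} {f : X ⟶ Y} {g : Y ⟶ Z} (hf : StalkwiseComap f)
    (hg : StalkwiseComap g) : StalkwiseComap (f ≫ g) := by
  intro I x
  rw [Scheme.IdealSheafData.comap_comp, hf, hg]
  exact (map_stalkMap_comp f g x _).symm

lemma stalkwiseComap_of_isOpenImmersion (f : X ⟶ Y) [IsOpenImmersion f] : StalkwiseComap f := by
  intro I x
  obtain ⟨W, hW, hxW, -⟩ := Opens.isBasis_iff_nbhd.mp X.isBasis_affineOpens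
    (show x ∈ (⊤ : X.Opens) from trivial)
  have hx : f x ∈ f ''ᵁ W := ⟨x, hxW, rfl⟩
  rw [stalkIdeal_eq_map _ ⟨W, hW⟩ x hxW, Scheme.IdealSheafData.ideal_comap_of_isOpenImmersion,
    stalkIdeal_eq_map I ⟨f ''ᵁ W, hW.image_of_isOpenImmersion f⟩ (f x) hx, Ideal.map_map,
    ← CommRingCat.hom_comp]
  have h1 : Y.presheaf.germ (f ''ᵁ W) (f x) hx ≫ f.stalkMap x =
      (f.appIso W).hom ≫ X.presheaf.germ W x hxW := by
    rw [Scheme.Hom.germ_stalkMap, Scheme.Hom.appIso_hom, Category.assoc, TopCat.Presheaf.germ_res]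
  have h2 : Ideal.map (f.appIso W).hom.hom
      (I.ideal ⟨f ''ᵁ W, hW.image_of_isOpenImmersion f⟩) =
      (I.ideal ⟨f ''ᵁ W, hW.image_of_isOpenImmersion f⟩).comap (f.appIso W).inv.hom :=
    Ideal.map_comap_of_equiv (f.appIso W).commRingCatIsoToRingEquiv
  rw [h1, CommRingCat.hom_comp, ← Ideal.map_map, h2]

lemma stalkwiseComap_of_isAffine (f : X ⟶ Y) [IsAffine X] [IsAffine Y] : StalkwiseComap f := by
  intro I x
  have h1 : (I.comap f).ideal ⟨⊤, isAffineOpen_top X⟩ =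
      (I.ideal ⟨⊤, isAffineOpen_top Y⟩).map f.appTop.hom := by
    refine le_antisymm ?_ ?_
    · let K := Scheme.IdealSheafData.ofIdealTop
        ((I.ideal ⟨⊤, isAffineOpen_top Y⟩).map f.appTop.hom)
      have h2 : K.ideal ⟨⊤, isAffineOpen_top X⟩ =
          (I.ideal ⟨⊤, isAffineOpen_top Y⟩).map f.appTop.hom := by
        simp [K]
      have h3 : I ≤ K.map f := by
        refine Scheme.IdealSheafData.le_of_isAffine ?_
        rw [Scheme.IdealSheafData.ideal_map_of_isAffineHom]
        exact Ideal.map_le_iff_le_comap.1 h2.ge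
      exact (Scheme.IdealSheafData.le_map_iff_comap_le.1 h3 _).trans h2.le
    · have h4 := I.le_map_comap f ⟨⊤, isAffineOpen_top Y⟩
      rw [Scheme.IdealSheafData.ideal_map_of_isAffineHom] at h4
      exact Ideal.map_le_iff_le_comap.2 h4
  rw [stalkIdeal_eq_map _ ⟨⊤, isAffineOpen_top X⟩ x trivial, h1,
    stalkIdeal_eq_map I ⟨⊤, isAffineOpen_top Y⟩ (f x) trivial, Ideal.map_map, Ideal.map_map,
    ← CommRingCat.hom_comp, ← CommRingCat.hom_comp]
  congr 2
  exact (Scheme.Hom.germ_stalkMap f ⊤ x trivial).symm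

lemma stalkwiseComap (f : X ⟶ Y) : StalkwiseComap f := by
  intro I x
  obtain ⟨U, hU, hyU, -⟩ := Opens.isBasis_iff_nbhd.mp Y.isBasis_affineOpens
    (show f x ∈ (⊤ : Y.Opens) from trivial)
  obtain ⟨W, hW, hxW, hle⟩ := Opens.isBasis_iff_nbhd.mp X.isBasis_affineOpens
    (show x ∈ f ⁻¹ᵁ U from hyU)
  have : IsAffine U := hU
  have : IsAffine W := hW
  have h1 : StalkwiseComap ((Scheme.Opens.ι W) ≫ f) := by
    rw [← Scheme.Hom.resLE_comp_ι f hle]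
    exact (stalkwiseComap_of_isAffine _).comp (stalkwiseComap_of_isOpenImmersion _)
  obtain ⟨x, rfl⟩ : ∃ x' : (Scheme.Opens.toScheme W), Scheme.Opens.ι W x' = x := ⟨⟨x, hxW⟩, rfl⟩
  have h2 := h1 I x
  rw [Scheme.IdealSheafData.comap_comp, stalkwiseComap_of_isOpenImmersion (Scheme.Opens.ι W)] at h2
  replace h2 := h2.trans (map_stalkMap_comp (Scheme.Opens.ι W) f x (stalkIdeal I _))
  have h3 := congrArg (Ideal.comap ((Scheme.Opens.ι W).stalkMap x).hom) h2
  have hb := ConcreteCategory.bijective_of_isIso ((Scheme.Opens.ι W).stalkMap x)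
  rw [Ideal.comap_map_of_bijective _ hb, Ideal.comap_map_of_bijective _ hb] at h3
  exact h3

end StalkIdeal
end

section
/-! ### Charts of schemes -/

section StalkMapOf
variable {U X : Scheme.{0}} (u : U ⟶ X) (w : U) (x : X) (h : u w = x)

/-- The map of stalks of `u` at `w`, with source the stalk at a point `x` equal to `u w`. -/
def stalkMapOf : X.presheaf.stalk x ⟶ U.presheaf.stalk w :=
  X.presheaf.stalkSpecializes (specializes_of_eq h) ≫ u.stalkMap w

lemma stalkMapOf_rfl : stalkMapOf u w (u w) rfl = u.stalkMap w := by
  rw [stalkMapOf, TopCat.Presheaf.stalkSpecializes_refl, Category.id_comp]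

lemma stalkMapOf_germ (V : X.Opens) (hV : x ∈ V) (a : Γ(X, V)) :
    (stalkMapOf u w x h).hom (X.presheaf.germ V x hV a) =
      U.presheaf.germ (u ⁻¹ᵁ V) w (show u w ∈ V from h ▸ hV) (u.app V a) := by
  subst h
  rw [stalkMapOf_rfl]
  exact Scheme.Hom.germ_stalkMap_apply u V w hV a

lemma stalkMapOf_stalkConst (q : X ⟶ Spec (CommRingCat.of ℂ)) :
    (stalkMapOf u w x h).hom.comp (stalkConst q x) = stalkConst (u ≫ q) w := by
  subst h
  rw [stalkMapOf_rfl]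
  exact stalkMap_stalkConst q u w

lemma isEssEtale_stalkMapOf [Etale u] : IsEssEtale (stalkMapOf u w x h).hom := by
  subst h
  rw [stalkMapOf_rfl]
  exact isEssEtale_stalkMap u w

lemma isLocalHom_stalkMapOf : IsLocalHom (stalkMapOf u w x h).hom := by
  subst h
  rw [stalkMapOf_rfl]
  infer_instance

lemma map_stalkMapOf (I : X.IdealSheafData) :
    (stalkIdeal I x).map (stalkMapOf u w x h).hom = stalkIdeal (I.comap u) w := by
  subst h
  rw [stalkMapOf_rfl]
  exact (stalkwiseComap u I w).symm

lemma stalkMapOf_comm {V S : Scheme.{0}} {f : X ⟶ S} {g : U ⟶ V} {v : V ⟶ S}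
    (hc : u ≫ f = g ≫ v) (h' : v (g w) = f x) :
    f.stalkMap x ≫ stalkMapOf u w x h = stalkMapOf v (g w) (f x) h' ≫ g.stalkMap w := by
  subst h
  rw [stalkMapOf_rfl, stalkMapOf, Category.assoc]
  have h1 := Scheme.Hom.stalkMap_comp u f w
  have h2 := Scheme.Hom.stalkMap_comp g v w
  have h3 := Scheme.Hom.stalkMap_congr_hom _ _ hc w
  rw [h1, h2] at h3
  exact h3

end StalkMapOf

/-- Étale neighbourhoods on the total space and on the base, with functions which define a
semistable chart on all local rings. -/
structure SchemeChart {X S : Scheme.{0}} (p : S ⟶ Spec (CommRingCat.of ℂ)) (f : X ⟶ S)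
    (Δ : S.IdealSheafData) where
  (U V : Scheme.{0})
  u : U ⟶ X
  v : V ⟶ S
  g : U ⟶ V
  [etale_u : Etale u]
  [etale_v : Etale v]
  comm : u ≫ f = g ≫ v
  shape : ChartShape
  ξ : shape.ι → Γ(U, ⊤)
  π : shape.κ → Γ(V, ⊤)
  base : ∀ y : V, letI := (stalkConst (v ≫ p) y).toAlgebra
    IsCoordinates ℂ fun j => V.presheaf.germ ⊤ y trivial (π j)
  total : ∀ w : U, letI := (stalkConst (u ≫ f ≫ p) w).toAlgebra
    IsCoordinates ℂ fun i : shape.Coord => U.presheaf.germ ⊤ w trivial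
      (Sum.elim ξ (fun j : {j // j ≠ shape.base} => g.appTop (π j.1)) i)
  prod_eq : g.appTop (π shape.base) = ∏ i ∈ shape.branches, ξ i
  ideal : IsGeneratedBy (Δ.comap v) (∏ j ∈ shape.divisor, π j)

section
variable {X S : Scheme.{0}} {p : S ⟶ Spec (CommRingCat.of ℂ)} {f : X ⟶ S}
    {Δ : S.IdealSheafData} {s : S}

namespace SchemeChart
attribute [instance] etale_u etale_v

variable (K : SchemeChart p f Δ)

lemma v_g {w : K.U} {x : X} (h : K.u w = x) : K.v (K.g w) = f x := by
  have := congrArg (fun φ : K.U ⟶ S => φ w) K.comm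
  rw [← h]
  exact this.symm

end SchemeChart
end
end

section
/-! ### Existence of charts -/

/-- Relative coordinates of a smooth morphism `q` stay relative coordinates on the local rings of
étale neighbourhoods `P` and `V` of source and target. -/
lemma isEssEtale_aeval_germ {W S V P : Scheme.{0}} {q : W ⟶ S} {a : P ⟶ W} {g : P ⟶ V}
    {v : V ⟶ S} [Etale a] [Etale v] (hc : a ≫ q = g ≫ v) {S₁ : S.Opens} (hS₁ : IsAffineOpen S₁)
    {X₁ : W.Opens} (hX₁ : IsAffineOpen X₁) (e : X₁ ≤ q ⁻¹ᵁ S₁) {d : ℕ}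
    {η : MvPolynomial (Fin d) Γ(S, S₁) →+* Γ(W, X₁)}
    (hη : η.comp MvPolynomial.C = (q.appLE S₁ X₁ e).hom) (hη' : η.Etale)
    (ha : ⊤ ≤ a ⁻¹ᵁ X₁) (w : P) :
    letI := (g.stalkMap w).hom.toAlgebra
    IsEssEtale (MvPolynomial.aeval (R := V.presheaf.stalk (g w)) fun i : Fin d =>
      P.presheaf.germ ⊤ w trivial (a.appLE X₁ ⊤ ha (η (MvPolynomial.X i)))).toRingHom := by
  let _ := (g.stalkMap w).hom.toAlgebra
  have hw : a w ∈ X₁ := ha (show w ∈ (⊤ : P.Opens) from trivial)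
  have hv : v (g w) = q (a w) := (congrArg (fun φ : P ⟶ S => φ w) hc).symm
  let ψ : Γ(S, S₁) →+* V.presheaf.stalk (g w) :=
    (stalkMapOf v (g w) _ hv).hom.comp (S.presheaf.germ S₁ (q (a w)) (e hw)).hom
  have hψ : IsEssEtale ψ := (isEssEtale_germ hS₁ _ _).comp (isEssEtale_stalkMapOf v (g w) _ hv)
  have hgerm : ∀ b : Γ(W, X₁), P.presheaf.germ ⊤ w trivial (a.appLE X₁ ⊤ ha b) =
      (stalkMapOf a w _ rfl).hom (W.presheaf.germ X₁ (a w) hw b) := by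
    intro b
    rw [stalkMapOf_germ, Scheme.Hom.appLE]
    exact TopCat.Presheaf.germ_res_apply _ _ _ _ _
  refine IsEssEtale.of_comp (hψ.mvPolynomial_map (Fin d)) ?_
  have h1 : (MvPolynomial.aeval (R := V.presheaf.stalk (g w)) fun i : Fin d =>
      P.presheaf.germ ⊤ w trivial (a.appLE X₁ ⊤ ha (η (MvPolynomial.X i)))).toRingHom.comp
        (MvPolynomial.map ψ) =
      ((stalkMapOf a w _ rfl).hom.comp (W.presheaf.germ X₁ (a w) hw).hom).comp η := by
    refine MvPolynomial.ringHom_ext (fun r => ?_) (fun i => ?_)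
    · simp only [AlgHom.toRingHom_eq_coe, RingHom.comp_apply, RingHom.coe_coe, MvPolynomial.map_C,
        MvPolynomial.algHom_C]
      have h2 : η (MvPolynomial.C r) = q.appLE S₁ X₁ e r := congrArg (fun φ => φ r) hη
      rw [h2]
      have h3 : W.presheaf.germ X₁ (a w) hw (q.appLE S₁ X₁ e r) =
          (q.stalkMap (a w)).hom (S.presheaf.germ S₁ (q (a w)) (e hw) r) := by
        refine Eq.trans ?_ (Scheme.Hom.germ_stalkMap_apply q S₁ (a w) (e hw) r).symm
        exact TopCat.Presheaf.germ_res_apply _ _ _ _ _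
      refine Eq.trans ?_ (congrArg (stalkMapOf a w _ rfl).hom h3.symm)
      exact (ConcreteCategory.congr_hom (stalkMapOf_comm a w _ rfl hc hv)
        (S.presheaf.germ S₁ (q (a w)) (e hw) r)).symm
    · simp only [AlgHom.toRingHom_eq_coe, RingHom.comp_apply, RingHom.coe_coe, MvPolynomial.map_X,
        MvPolynomial.aeval_X]
      exact hgerm _
  rw [h1]
  exact (IsEssEtale.of_etale hη').comp ((isEssEtale_germ hX₁ _ _).comp (isEssEtale_stalkMapOf a w _ rfl))

/-- Moving one index from the right summand to the left one. -/
def moveIndex (ι : Type) {κ : Type} [DecidableEq κ] (i₀ : κ) :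
    (Option ι ⊕ {j : κ // j ≠ i₀}) ≃ ι ⊕ κ where
  toFun := Sum.elim (fun o => o.elim (Sum.inr i₀) Sum.inl) fun j => Sum.inr j.1
  invFun := Sum.elim (fun i => Sum.inl (some i)) fun j =>
    if h : j = i₀ then Sum.inl none else Sum.inr ⟨j, h⟩
  left_inv := by
    rintro ((_ | i) | ⟨j, hj⟩)
    · simp
    · simp
    · simp [hj]
  right_inv := by
    rintro (i | j)
    · simp
    · by_cases h : j = i₀ <;> simp [h]

section
variable {X S : Scheme.{0}} {p : S ⟶ Spec (CommRingCat.of ℂ)} {f : X ⟶ S}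
    {Δ : S.IdealSheafData} {d : ℕ}

lemma HasSemistableChart.exists_schemeChart {x : X} (h : HasSemistableChart p f Δ d x) :
    ∃ (K : SchemeChart p f Δ) (w : K.U), K.u w = x := by
  obtain ⟨V, U, v, u, g, m, π, i, J, ξ, I, hv, hu, ⟨w, hw⟩, hc, hπ, hi, hJ, hξ, hI, hprod⟩ := h
  exact ⟨{ U := U, V := V, u := u, v := v, g := g, comm := hc
           shape := { ι := Fin (d + 1), κ := Fin m, base := i, divisor := J, base_mem := hi
                      branches := I, branch := hI.choose, branch_mem := hI.choose_spec }
           ξ := ξ, π := π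
           base := fun y => hπ.isCoordinates_germ y
           total := fun w => hξ.isCoordinates_germ w
           prod_eq := hprod
           ideal := hJ }, w, hw⟩

lemma IsSmoothAt.exists_schemeChart {x : X} (h : IsSmoothAt f d x)
    (hS : HasNormalCrossingChart p Δ (f x)) (hx : f x ∈ Δ.support) :
    ∃ (K : SchemeChart p f Δ) (w : K.U), K.u w = x := by
  obtain ⟨V, v, m, π, J, hv, ⟨y, hy⟩, hπ, hJ⟩ := hS
  obtain ⟨U₀, hxU, hU₀⟩ := h
  have hJ0 : J.Nonempty := by
    by_contra hne
    rw [Finset.not_nonempty_iff_eq_empty] at hne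
    subst hne
    have h1 : Δ.comap v = ⊤ := by
      refine Scheme.IdealSheafData.ext (funext fun U => ?_)
      rw [hJ U, Finset.prod_empty, map_one, Ideal.span_singleton_one]
      rfl
    have h2 : y ∈ (Δ.comap v).support := by
      rw [Scheme.IdealSheafData.support_comap]
      change v y ∈ Δ.support
      rwa [hy]
    rw [h1, Scheme.IdealSheafData.support_top] at h2
    exact h2
  obtain ⟨i₀, hi₀⟩ := hJ0
  obtain ⟨x, rfl⟩ : ∃ x' : U₀, U₀.ι x' = x := ⟨⟨x, hxU⟩, rfl⟩
  obtain ⟨S₁, hS₁, X₁, hX₁, hxX, e, hstd⟩ :=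
    hU₀.exists_isStandardSmoothOfRelativeDimension x
  obtain ⟨η, hη, hη'⟩ := hstd.exists_etale_mvPolynomial
  obtain ⟨x, rfl⟩ : ∃ x' : (Scheme.Opens.toScheme X₁), X₁.ι x' = x := ⟨⟨x, hxX⟩, rfl⟩
  let P := Limits.pullback (X₁.ι ≫ U₀.ι ≫ f) v
  let a : P ⟶ U₀ := Limits.pullback.fst (X₁.ι ≫ U₀.ι ≫ f) v ≫ X₁.ι
  let g : P ⟶ V := Limits.pullback.snd (X₁.ι ≫ U₀.ι ≫ f) v
  have hc : a ≫ U₀.ι ≫ f = g ≫ v := by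
    rw [← Limits.pullback.condition, Category.assoc]
  have : Etale (Limits.pullback.fst (X₁.ι ≫ U₀.ι ≫ f) v) :=
    inferInstance
  have : Etale a := inferInstance
  have ha : ⊤ ≤ a ⁻¹ᵁ X₁ := fun w _ => (Limits.pullback.fst (X₁.ι ≫ U₀.ι ≫ f) v w).2
  obtain ⟨w, hw, -⟩ := Scheme.Pullback.exists_preimage_pullback (f := X₁.ι ≫ U₀.ι ≫ f) (g := v) x y
    hy.symm
  let ξ : Fin d → Γ(P, ⊤) := fun i => a.appLE X₁ ⊤ ha (η (MvPolynomial.X i))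
  refine ⟨{ U := P, V := V, u := a ≫ U₀.ι, v := v, g := g
            comm := by rw [Category.assoc, hc]
            shape := { ι := Option (Fin d), κ := Fin m, base := i₀, divisor := J, base_mem := hi₀
                       branches := {none}, branch := none, branch_mem := Finset.mem_singleton_self _ }
            ξ := fun o => o.elim (g.appTop (π i₀)) ξ
            π := π
            base := fun y => hπ.isCoordinates_germ y
            total := ?_
            prod_eq := (Finset.prod_singleton _ _).symm
            ideal := hJ }, w, congrArg (fun x => U₀.ι (X₁.ι x)) hw⟩
  intro w
  let _ := (stalkConst ((a ≫ U₀.ι) ≫ f ≫ p) w).toAlgebra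
  let _ := (stalkConst (v ≫ p) (g w)).toAlgebra
  let _ := (g.stalkMap w).hom.toAlgebra
  have : IsScalarTower ℂ (V.presheaf.stalk (g w)) (P.presheaf.stalk w) :=
    IsScalarTower.of_algebraMap_eq' (by
      refine Eq.trans ?_ (stalkMap_stalkConst (v ≫ p) g w).symm
      change stalkConst ((a ≫ U₀.ι) ≫ f ≫ p) w = _
      rw [← Category.assoc g v p, ← hc]
      simp only [Category.assoc])
  have h1 := (IsCoordinates.extend (hπ.isCoordinates_germ (g w))
    (isEssEtale_aeval_germ hc hS₁ hX₁ e hη hη' ha w)).reindex (moveIndex (Fin d) i₀)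
  convert h1 using 1
  have h2 : ∀ j, P.presheaf.germ ⊤ w trivial (g.appTop (π j)) =
      algebraMap (V.presheaf.stalk (g w)) (P.presheaf.stalk w)
        (V.presheaf.germ ⊤ (g w) trivial (π j)) := fun j =>
    (Scheme.Hom.germ_stalkMap_apply g ⊤ w trivial (π j)).symm
  funext i
  rcases i with (_ | i) | j
  · exact h2 i₀
  · rfl
  · exact h2 j.1

/-- A log smooth family has semistable charts around all points over the divisor; a smooth point is
a semistable one with a single branch. -/
lemma IsLogSmoothFamily.exists_schemeChart (hf : IsLogSmoothFamily p f Δ d) {x : X}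
    (hx : f x ∈ Δ.support) : ∃ (K : SchemeChart p f Δ) (w : K.U), K.u w = x := by
  rcases hf.chart x with h | h
  · exact h.exists_schemeChart (hf.normalCrossing_base _) hx
  · exact h.exists_schemeChart

end
end

section
/-! ### Germs of functions and of differential forms -/

section FormMap
variable {k A A' A'' : Type} [CommRing k] [CommRing A] [CommRing A'] [CommRing A''] [Algebra k A]
  [Algebra k A'] [Algebra k A'']

/-- Pull-back of differential forms along a homomorphism of algebras. -/
def formMap (φ : A →ₐ[k] A') : Ω[A⁄k] →+ Ω[A'⁄k] :=
  letI := φ.toRingHom.toAlgebra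
  haveI : IsScalarTower k A A' := IsScalarTower.of_algebraMap_eq' φ.comp_algebraMap.symm
  (KaehlerDifferential.map k k A A').toAddMonoidHom

lemma formMap_smul (φ : A →ₐ[k] A') (a : A) (ω : Ω[A⁄k]) :
    formMap φ (a • ω) = φ a • formMap φ ω :=
  letI := φ.toRingHom.toAlgebra
  haveI : IsScalarTower k A A' := IsScalarTower.of_algebraMap_eq' φ.comp_algebraMap.symm
  ((KaehlerDifferential.map k k A A').map_smul a ω).trans (algebraMap_smul A' a _).symm

lemma formMap_D (φ : A →ₐ[k] A') (a : A) :
    formMap φ (KaehlerDifferential.D k A a) = KaehlerDifferential.D k A' (φ a) :=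
  letI := φ.toRingHom.toAlgebra
  haveI : IsScalarTower k A A' := IsScalarTower.of_algebraMap_eq' φ.comp_algebraMap.symm
  KaehlerDifferential.map_D k k A A' a

lemma exists_sum_D (ω : Ω[A⁄k]) : ∃ (n : ℕ) (b c : Fin n → A),
    ω = ∑ j, b j • KaehlerDifferential.D k A (c j) := by
  have h : ω ∈ Submodule.span A (Set.range (KaehlerDifferential.D k A)) := by
    rw [KaehlerDifferential.span_range_derivation]; trivial
  obtain ⟨n, b, c, h⟩ := Submodule.mem_span_set'.1 h
  choose c' hc using fun j => (c j).2
  exact ⟨n, b, c', by rw [← h]; simp only [hc]⟩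

lemma formMap_comp (φ : A →ₐ[k] A') (ψ : A' →ₐ[k] A'') (ω : Ω[A⁄k]) :
    formMap ψ (formMap φ ω) = formMap (ψ.comp φ) ω := by
  obtain ⟨n, b, c, rfl⟩ := exists_sum_D ω
  simp only [map_sum, formMap_smul, formMap_D, AlgHom.comp_apply]

lemma formMap_id (ω : Ω[A⁄k]) : formMap (AlgHom.id k A) ω = ω := by
  obtain ⟨n, b, c, rfl⟩ := exists_sum_D ω
  simp only [map_sum, formMap_smul, formMap_D, AlgHom.id_apply]

lemma map_eq_formMap [Algebra A A'] [IsScalarTower k A A'] (ω : Ω[A⁄k]) :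
    KaehlerDifferential.map k k A A' ω = formMap (IsScalarTower.toAlgHom k A A') ω := by
  obtain ⟨n, b, c, rfl⟩ := exists_sum_D ω
  simp only [map_sum, map_smul, formMap_smul, formMap_D, KaehlerDifferential.map_D,
    IsScalarTower.coe_toAlgHom', algebraMap_smul]

end FormMap

section Near
variable {X : Scheme.{0}}

/-- The local ring at a point of a scheme over `ℂ`, as an algebra; the structure morphism enters
through the algebra structure. -/
@[nolint unusedArguments]
def Stalk (_q : X ⟶ Spec (CommRingCat.of ℂ)) (x : X) : Type := X.presheaf.stalk x

variable (q : X ⟶ Spec (CommRingCat.of ℂ))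

instance (x : X) : CommRing (Stalk q x) := inferInstanceAs (CommRing (X.presheaf.stalk x))
instance (x : X) : IsLocalRing (Stalk q x) := inferInstanceAs (IsLocalRing (X.presheaf.stalk x))
instance (x : X) : Algebra ℂ (Stalk q x) := (stalkConst q x).toAlgebra

/-- The germ of a function. -/
def germAt (V : X.Opens) (x : X) (hx : x ∈ V) : Γ(X, V) →+* Stalk q x :=
  (X.presheaf.germ V x hx).hom

variable {q}

lemma germAt_res {V V' : X.Opens} (h : V' ≤ V) (x : X) (hx : x ∈ V') (a : Γ(X, V)) :
    germAt q V' x hx (resO h a) = germAt q V x (h hx) a :=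
  TopCat.Presheaf.germ_res_apply _ _ _ _ _

/-- A family of germs of functions comes from a function near the point `x₀`. -/
def IsFunNear (x₀ : X) (a : ∀ x, Stalk q x) : Prop :=
  ∃ (V : X.Opens) (_ : x₀ ∈ V) (r : Γ(X, V)), ∀ x (hx : x ∈ V), a x = germAt q V x hx r

/-- A family of germs of differential forms comes from a form near the point `x₀`. -/
def IsFormNear (x₀ : X) (ω : ∀ x, Ω[Stalk q x⁄ℂ]) : Prop :=
  ∃ (σ : Type) (_ : Fintype σ) (b c : σ → ∀ x, Stalk q x), (∀ j, IsFunNear x₀ (b j)) ∧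
    (∀ j, IsFunNear x₀ (c j)) ∧
    ∀ᶠ x in nhds x₀, ω x = ∑ j, b j x • KaehlerDifferential.D ℂ (Stalk q x) (c j x)

lemma eventually_mem {V : X.Opens} {x₀ : X} (h : x₀ ∈ V) : ∀ᶠ x in nhds x₀, x ∈ V :=
  V.isOpen.mem_nhds h

lemma exists_common_sections {x₀ : X} {σ : Type} [Finite σ] {a : σ → ∀ x, Stalk q x}
    (h : ∀ i, IsFunNear x₀ (a i)) (V₀ : X.Opens) (h₀ : x₀ ∈ V₀) :
    ∃ (V : X.Opens), IsAffineOpen V ∧ V ≤ V₀ ∧ ∃ (_ : x₀ ∈ V) (r : σ → Γ(X, V)),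
      ∀ i x (hx : x ∈ V), a i x = germAt q V x hx (r i) := by
  choose W hW r hr using h
  have hopen : IsOpen (⋂ i, (W i : Set X)) := isOpen_iInter_of_finite fun i => (W i).isOpen
  obtain ⟨V, hV, hxV, hle⟩ := Opens.isBasis_iff_nbhd.mp X.isBasis_affineOpens
    (show x₀ ∈ (⟨⋂ i, (W i : Set X), hopen⟩ ⊓ V₀ : X.Opens) from
      ⟨Set.mem_iInter.2 fun i => hW i, h₀⟩)
  have hVi : ∀ i, V ≤ W i := fun i x hx => Set.mem_iInter.1 (hle hx).1 i
  refine ⟨V, hV, fun x hx => (hle hx).2, hxV, fun i => resO (hVi i) (r i), fun i x hx => ?_⟩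
  rw [germAt_res]
  exact hr i x _

namespace IsFunNear
variable {x₀ : X} {a b : ∀ x, Stalk q x}

lemma add (ha : IsFunNear x₀ a) (hb : IsFunNear x₀ b) : IsFunNear x₀ (a + b) := by
  obtain ⟨V, hV, r, hr⟩ := ha
  obtain ⟨V', hV', r', hr'⟩ := hb
  refine ⟨V ⊓ V', ⟨hV, hV'⟩, resO inf_le_left r + resO inf_le_right r', fun x hx => ?_⟩
  rw [map_add, germAt_res, germAt_res, Pi.add_apply, hr x hx.1, hr' x hx.2]

lemma mul (ha : IsFunNear x₀ a) (hb : IsFunNear x₀ b) : IsFunNear x₀ (a * b) := by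
  obtain ⟨V, hV, r, hr⟩ := ha
  obtain ⟨V', hV', r', hr'⟩ := hb
  refine ⟨V ⊓ V', ⟨hV, hV'⟩, resO inf_le_left r * resO inf_le_right r', fun x hx => ?_⟩
  rw [map_mul, germAt_res, germAt_res, Pi.mul_apply, hr x hx.1, hr' x hx.2]

lemma neg (ha : IsFunNear x₀ a) : IsFunNear x₀ (-a) := by
  obtain ⟨V, hV, r, hr⟩ := ha
  exact ⟨V, hV, -r, fun x hx => by rw [map_neg, Pi.neg_apply, hr x hx]⟩

lemma intCast (n : ℤ) : IsFunNear x₀ (n : ∀ x, Stalk q x) :=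
  ⟨⊤, trivial, n, fun x hx => by rw [map_intCast, Pi.intCast_apply]⟩

lemma one : IsFunNear x₀ (1 : ∀ x, Stalk q x) := ⟨⊤, trivial, 1, fun x hx => by rw [map_one]; rfl⟩

lemma zero : IsFunNear x₀ (0 : ∀ x, Stalk q x) := ⟨⊤, trivial, 0, fun x hx => by rw [map_zero]; rfl⟩

lemma sub (ha : IsFunNear x₀ a) (hb : IsFunNear x₀ b) : IsFunNear x₀ (a - b) := by
  rw [sub_eq_add_neg]; exact ha.add hb.neg

lemma sum {σ : Type} (K : Finset σ) {a : σ → ∀ x, Stalk q x} (ha : ∀ i ∈ K, IsFunNear x₀ (a i)) :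
    IsFunNear x₀ (∑ i ∈ K, a i) :=
  Finset.sum_induction _ _ (fun _ _ => add) zero ha

lemma prod {σ : Type} (K : Finset σ) {a : σ → ∀ x, Stalk q x} (ha : ∀ i ∈ K, IsFunNear x₀ (a i)) :
    IsFunNear x₀ (∏ i ∈ K, a i) :=
  Finset.prod_induction _ _ (fun _ _ => mul) one ha

lemma eventually_isUnit (ha : IsFunNear x₀ a) (h : IsUnit (a x₀)) :
    ∀ᶠ x in nhds x₀, IsUnit (a x) := by
  obtain ⟨V, hV, r, hr⟩ := ha
  rw [hr x₀ hV] at h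
  have h1 : x₀ ∈ X.basicOpen r := (X.mem_basicOpen _ _ hV).2 h
  filter_upwards [eventually_mem h1] with x hx
  have hxV := X.basicOpen_le r hx
  rw [hr x hxV]
  exact (X.mem_basicOpen _ _ hxV).1 hx

end IsFunNear

open Classical in
/-- The germs of a section, extended by zero. -/
def germFun (q : X ⟶ Spec (CommRingCat.of ℂ)) {V : X.Opens} (r : Γ(X, V)) (x : X) : Stalk q x :=
  if hx : x ∈ V then germAt q V x hx r else 0

lemma germFun_apply {V : X.Opens} (r : Γ(X, V)) {x : X} (hx : x ∈ V) :
    germFun q r x = germAt q V x hx r := dif_pos hx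

lemma isFunNear_germFun {V : X.Opens} (r : Γ(X, V)) {x₀ : X} (hx : x₀ ∈ V) :
    IsFunNear x₀ (germFun q r) := ⟨V, hx, r, fun _ hx => germFun_apply r hx⟩

lemma exists_isFunNear (x₀ : X) (a₀ : Stalk q x₀) :
    ∃ a : ∀ x, Stalk q x, IsFunNear x₀ a ∧ a x₀ = a₀ := by
  obtain ⟨V, hV, r, hr⟩ := X.presheaf.exists_germ_eq a₀
  exact ⟨germFun q r, isFunNear_germFun r hV, (germFun_apply r hV).trans hr⟩

namespace IsFormNear
variable {x₀ : X} {ω η : ∀ x, Ω[Stalk q x⁄ℂ]} {a : ∀ x, Stalk q x}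

lemma d (ha : IsFunNear x₀ a) : IsFormNear x₀ fun x => KaehlerDifferential.D ℂ (Stalk q x) (a x) :=
  ⟨Unit, inferInstance, fun _ => 1, fun _ => a, fun _ => IsFunNear.one, fun _ => ha,
    Filter.Eventually.of_forall fun x => by simp⟩

lemma smul (ha : IsFunNear x₀ a) (hω : IsFormNear x₀ ω) : IsFormNear x₀ fun x => a x • ω x := by
  obtain ⟨σ, _, b, c, hb, hc, h⟩ := hω
  refine ⟨σ, inferInstance, fun j => a * b j, c, fun j => ha.mul (hb j), hc, ?_⟩
  filter_upwards [h] with x hx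
  rw [hx, Finset.smul_sum]
  simp only [smul_smul, Pi.mul_apply]

lemma add (hω : IsFormNear x₀ ω) (hη : IsFormNear x₀ η) : IsFormNear x₀ fun x => ω x + η x := by
  obtain ⟨σ, _, b, c, hb, hc, h⟩ := hω
  obtain ⟨τ, _, b', c', hb', hc', h'⟩ := hη
  refine ⟨σ ⊕ τ, inferInstance, Sum.elim b b', Sum.elim c c', ?_, ?_, ?_⟩
  · rintro (j | j); exacts [hb j, hb' j]
  · rintro (j | j); exacts [hc j, hc' j]
  · filter_upwards [h, h'] with x hx hx'
    rw [hx, hx', Fintype.sum_sum_type]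
    rfl

lemma zero : IsFormNear x₀ fun x => (0 : Ω[Stalk q x⁄ℂ]) :=
  ⟨Empty, inferInstance, fun j => j.elim, fun j => j.elim, fun j => j.elim, fun j => j.elim,
    Filter.Eventually.of_forall fun x => by simp⟩

lemma sum {σ : Type} (K : Finset σ) {ω : σ → ∀ x, Ω[Stalk q x⁄ℂ]}
    (h : ∀ i, IsFormNear x₀ (ω i)) : IsFormNear x₀ fun x => ∑ i ∈ K, ω i x := by
  classical
  induction K using Finset.induction_on with
  | empty => simpa using zero
  | insert i K hi ih =>
    simp only [Finset.sum_insert hi]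
    exact (h i).add ih

lemma congr (hω : IsFormNear x₀ ω) (h : ∀ᶠ x in nhds x₀, η x = ω x) : IsFormNear x₀ η := by
  obtain ⟨σ, i, b, c, hb, hc, h'⟩ := hω
  exact ⟨σ, i, b, c, hb, hc, by filter_upwards [h, h'] with x h1 h2; rw [h1, h2]⟩

lemma sub (hω : IsFormNear x₀ ω) (hη : IsFormNear x₀ η) : IsFormNear x₀ fun x => ω x - η x :=
  (hω.add (hη.smul (IsFunNear.one.neg))).congr (Filter.Eventually.of_forall fun x => by
    simp [sub_eq_add_neg])

/-- A differential form which vanishes at the stalk vanishes nearby: on an affine neighbourhood the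
stalk of the differential forms is a localization. -/
lemma eventually_eq_zero (hω : IsFormNear x₀ ω) (h₀ : ω x₀ = 0) : ∀ᶠ x in nhds x₀, ω x = 0 := by
  obtain ⟨σ, _, b, c, hb, hc, h⟩ := hω
  obtain ⟨V, hV, -, hxV, r, hr⟩ := exists_common_sections (a := Sum.elim b c)
    (by rintro (j | j); exacts [hb j, hc j]) ⊤ trivial
  let _ : Algebra ℂ Γ(X, V) :=
    ((Scheme.ΓSpecIso (CommRingCat.of ℂ)).inv ≫ q.appTop ≫ X.presheaf.map (homOfLE le_top).op).hom.toAlgebra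
  let φ : ∀ x (_ : x ∈ V), Γ(X, V) →ₐ[ℂ] Stalk q x := fun x hx =>
    { germAt q V x hx with
      commutes' := fun a => TopCat.Presheaf.germ_res_apply X.presheaf (homOfLE le_top) x hx
        (q.appTop ((Scheme.ΓSpecIso (CommRingCat.of ℂ)).inv a)) }
  have hφ : ∀ x hx a, φ x hx a = germAt q V x hx a := fun _ _ _ => rfl
  let m : Ω[Γ(X, V)⁄ℂ] := ∑ j, r (Sum.inl j) • KaehlerDifferential.D ℂ Γ(X, V) (r (Sum.inr j))
  have hm : ∀ᶠ x in nhds x₀, ∃ hx, ω x = formMap (φ x hx) m := by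
    filter_upwards [h, eventually_mem hxV] with x hx hxV
    refine ⟨hxV, ?_⟩
    rw [hx]
    simp only [m, map_sum, formMap_smul, formMap_D, hφ]
    refine Finset.sum_congr rfl fun j _ => ?_
    rw [← hr (Sum.inl j) x hxV, ← hr (Sum.inr j) x hxV]
    rfl
  obtain ⟨_, hm0⟩ := hm.self_of_nhds
  rw [h₀] at hm0
  obtain ⟨g, hg, hgm⟩ : ∃ g : Γ(X, V), x₀ ∈ X.basicOpen g ∧ g • m = 0 := by
    let _ : Algebra Γ(X, V) (Stalk q x₀) := (germAt q V x₀ hxV).toAlgebra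
    have : IsScalarTower ℂ Γ(X, V) (Stalk q x₀) :=
      IsScalarTower.of_algebraMap_eq' (φ x₀ hxV).comp_algebraMap.symm
    have hloc : IsLocalization (hV.primeIdealOf ⟨x₀, hxV⟩).asIdeal.primeCompl (Stalk q x₀) :=
      hV.isLocalization_stalk ⟨x₀, hxV⟩
    have := KaehlerDifferential.isLocalizedModule_map ℂ Γ(X, V) (Stalk q x₀)
      (hV.primeIdealOf ⟨x₀, hxV⟩).asIdeal.primeCompl
    have h1 : KaehlerDifferential.map ℂ ℂ Γ(X, V) (Stalk q x₀) m = 0 := hm0.symm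
    obtain ⟨g, hg⟩ := (IsLocalizedModule.eq_zero_iff
      (hV.primeIdealOf ⟨x₀, hxV⟩).asIdeal.primeCompl _).1 h1
    refine ⟨g.1, (X.mem_basicOpen _ _ hxV).2 ?_, hg⟩
    exact IsLocalization.map_units (Stalk q x₀) g
  filter_upwards [hm, eventually_mem hg] with x hx hxg
  obtain ⟨hxV, hx⟩ := hx
  have h2 : IsUnit (φ x hxV g) := (X.mem_basicOpen _ _ hxV).1 hxg
  rw [hx, ← h2.smul_eq_zero, ← formMap_smul, hgm, map_zero]

lemma eventually_eq (hω : IsFormNear x₀ ω) (hη : IsFormNear x₀ η) (h : ω x₀ = η x₀) :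
    ∀ᶠ x in nhds x₀, ω x = η x := by
  filter_upwards [(hω.sub hη).eventually_eq_zero (sub_eq_zero.2 h)] with x hx
  exact sub_eq_zero.1 hx

/-- On a neighbourhood, the form is a combination of differentials of functions. -/
lemma exists_sections (hω : IsFormNear x₀ ω) : ∃ (V : X.Opens) (_ : x₀ ∈ V) (n : ℕ)
    (b c : Fin n → Γ(X, V)), ∀ x (hx : x ∈ V), ω x = ∑ j, germAt q V x hx (b j) •
      KaehlerDifferential.D ℂ (Stalk q x) (germAt q V x hx (c j)) := by
  obtain ⟨σ, _, b, c, hb, hc, h⟩ := hω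
  obtain ⟨W, hW, hWo, hxW⟩ := eventually_nhds_iff.1 h
  obtain ⟨V, -, hVW, hxV, r, hr⟩ := exists_common_sections (a := Sum.elim b c)
    (by rintro (j | j); exacts [hb j, hc j]) ⟨W, hWo⟩ hxW
  let e := (Fintype.equivFin σ).symm
  refine ⟨V, hxV, Fintype.card σ, fun j => r (Sum.inl (e j)), fun j => r (Sum.inr (e j)),
    fun x hx => ?_⟩
  rw [hW x (hVW hx), ← e.sum_comp]
  refine Finset.sum_congr rfl fun j _ => ?_
  rw [← hr (Sum.inl (e j)) x hx, ← hr (Sum.inr (e j)) x hx]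
  rfl

end IsFormNear

lemma exists_isFormNear (x₀ : X) (ω₀ : Ω[Stalk q x₀⁄ℂ]) :
    ∃ ω : ∀ x, Ω[Stalk q x⁄ℂ], IsFormNear x₀ ω ∧ ω x₀ = ω₀ := by
  obtain ⟨n, b, c, rfl⟩ := exists_sum_D ω₀
  choose b' hb hb' using fun j => exists_isFunNear x₀ (b j)
  choose c' hc hc' using fun j => exists_isFunNear x₀ (c j)
  refine ⟨fun x => ∑ j, b' j x • KaehlerDifferential.D ℂ (Stalk q x) (c' j x),
    IsFormNear.sum _ fun j => (IsFormNear.d (hc j)).smul (hb j), ?_⟩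
  simp only [hb', hc']

end Near

section PullBack
variable {U X : Scheme.{0}} (u : U ⟶ X) (q : X ⟶ Spec (CommRingCat.of ℂ))

/-- The map of stalks as a homomorphism of algebras. -/
def stalkHom (w : U) : Stalk q (u w) →ₐ[ℂ] Stalk (u ≫ q) w :=
  { (u.stalkMap w).hom with
    commutes' := fun a => congrArg (fun φ => φ a) (stalkMap_stalkConst q u w) }

variable {u q} {w₀ : U}

lemma IsFunNear.pullBack {a : ∀ x, Stalk q x} (ha : IsFunNear (u w₀) a) :
    IsFunNear w₀ fun w => stalkHom u q w (a (u w)) := by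
  obtain ⟨V, hV, r, hr⟩ := ha
  refine ⟨u ⁻¹ᵁ V, hV, u.app V r, fun w hw => ?_⟩
  beta_reduce
  rw [hr (u w) hw]
  exact Scheme.Hom.germ_stalkMap_apply u V w hw r

lemma IsFormNear.pullBack {ω : ∀ x, Ω[Stalk q x⁄ℂ]} (hω : IsFormNear (u w₀) ω) :
    IsFormNear w₀ fun w => formMap (stalkHom u q w) (ω (u w)) := by
  obtain ⟨σ, _, b, c, hb, hc, h⟩ := hω
  refine ⟨σ, inferInstance, _, _, fun j => (hb j).pullBack, fun j => (hc j).pullBack, ?_⟩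
  filter_upwards [u.continuous.tendsto w₀ |>.eventually h] with w hw
  rw [hw]
  simp only [map_sum, formMap_smul, formMap_D]

end PullBack
end

section
/-! ### Frames of forms near a point of the fibre -/

section
variable {U X : Scheme.{0}} (u : U ⟶ X) (q : X ⟶ Spec (CommRingCat.of ℂ)) (w : U) (x : X)
  (h : u w = x)

/-- The map `stalkMapOf` as a homomorphism of algebras. -/
def stalkHomOf : Stalk q x →ₐ[ℂ] Stalk (u ≫ q) w :=
  { (stalkMapOf u w x h).hom with
    commutes' := fun a => congrArg (fun φ => φ a) (stalkMapOf_stalkConst u w x h q) }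

lemma formMap_stalkHomOf (ω : ∀ x, Ω[Stalk q x⁄ℂ]) :
    formMap (stalkHomOf u q w x h) (ω x) = formMap (stalkHom u q w) (ω (u w)) := by
  subst h
  have : stalkHomOf u q w (u w) rfl = stalkHom u q w :=
    AlgHom.ext fun a => congrArg (fun φ => φ.hom a) (stalkMapOf_rfl u w)
  rw [this]

end

/-- A semistable chart of the local rings at a point of the fibre: the étale homomorphism is
`φ : R.A → A'`, and `x` are the coordinates on `A'`. -/
structure ChartAt (R : FibreStalk) [IsLocalRing R.A] (S : ChartShape) (A' : Type) [CommRing A']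
    [IsLocalRing A'] [Algebra ℂ A'] (φ : R.A →ₐ[ℂ] A') (x : S.Coord → A') where
  B' : Type
  [ringB' : CommRing B'] [localB' : IsLocalRing B'] [algB' : Algebra ℂ B']
  [algBB' : Algebra R.B B'] [algAA' : Algebra R.A A']
  [algB'A' : Algebra B' A'] [algBA' : Algebra R.B A']
  [tower₁ : IsScalarTower ℂ R.B B'] [tower₂ : IsScalarTower ℂ R.A A']
  [tower₃ : IsScalarTower ℂ B' A'] [tower₄ : IsScalarTower R.B R.A A']
  [tower₅ : IsScalarTower R.B B' A']
  [etaleA : Algebra.FormallyEtale R.A A'] [flatA : Module.FaithfullyFlat R.A A']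
  [etaleB : Algebra.FormallyEtale R.B B'] [flatB : Module.FaithfullyFlat R.B B']
  [essFiniteB : Algebra.EssFiniteType R.B B'] [localHomB : IsLocalHom (algebraMap R.B B')]
  ξ : S.ι → A'
  π : S.κ → B'
  isLogChart : IsLogChart ℂ R.B (A' := A') S R.ideal ξ π
  toAlgHom_eq : IsScalarTower.toAlgHom ℂ R.A A' = φ
  coord_eq : S.coord ξ π = x

namespace ChartAt
attribute [instance] ringB' localB' algB' algBB' algB'A'
  tower₁ tower₂ tower₃ tower₄ tower₅ etaleA flatA etaleB flatB essFiniteB localHomB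

variable {R : FibreStalk} [IsLocalRing R.A] {S : ChartShape} {A' : Type} [CommRing A']
  [IsLocalRing A'] [Algebra ℂ A'] {φ : R.A →ₐ[ℂ] A'} {x : S.Coord → A'} (h : ChartAt R S A' φ x)
  {t : R.B} (ht : R.ideal = Ideal.span {t})

include h ht in
lemma isLogPair : IsLogPair ℂ R.A R.ideal t :=
  let _ := h.algAA'
  let _ := h.algBA'
  h.isLogChart.isLogPair ht

include h in
lemma exists_eq_span : ∃ t, R.ideal = Ideal.span {t} :=
  let _ := h.algAA'
  let _ := h.algBA'
  h.isLogChart.exists_eq_span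

include h ht in
lemma mem_polarForms_iff (ω : Ω[R.A⁄ℂ]) :
    ω ∈ polarForms ℂ (algebraMap R.B R.A t) ↔ ∃ a, S.form ℂ x a = formMap φ ω := by
  let _ := h.algAA'
  let _ := h.algBA'
  rw [h.isLogChart.mem_polarForms_iff_exists ht, h.coord_eq, map_eq_formMap, h.toAlgHom_eq]

include h ht in
/-- Forms whose relative coordinates in a chart have invertible determinant give a basis of the
relative logarithmic forms. -/
lemma exists_basis_of_isUnit_det (ω : S.Vert → Ω[R.A⁄ℂ]) (a : S.Vert → S.Coord → A')
    (ha : ∀ i, S.form ℂ x (a i) = formMap φ (ω i))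
    (hdet : IsUnit (Matrix.of fun i => S.vert (a i)).det) :
    ∃ (hω : ∀ i, ω i ∈ polarForms ℂ (algebraMap R.B R.A t))
      (b : Module.Basis S.Vert R.A (RelLogForms ℂ R.A R.ideal)),
      ∀ i, b i = (h.isLogPair ht).toRel ⟨ω i, hω i⟩ := by
  let _ := h.algAA'
  let _ := h.algBA'
  have hω := fun i => (h.mem_polarForms_iff ht (ω i)).2 ⟨a i, ha i⟩
  refine ⟨hω, ?_⟩
  have h1 : IsUnit ((Pi.basisFun A' S.Vert).det fun i => S.vert (a i)) := by
    rw [Pi.basisFun_det_apply]; exact hdet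
  obtain ⟨hli, hsp⟩ := Module.Basis.is_basis_iff_det _ |>.2 h1
  refine h.isLogChart.exists_basis_of_basis ht (fun i => ⟨ω i, hω i⟩)
    (Module.Basis.mk hli hsp.ge) fun i => ?_
  rw [Module.Basis.mk_apply]
  refine (IsLogChart.relCoord_eq _ ht ?_).symm
  rw [h.coord_eq, map_eq_formMap, h.toAlgHom_eq]
  exact ha i

include h ht in
lemma exists_forms_isUnit_det : ∃ (ω : S.Vert → Ω[R.A⁄ℂ]) (a : S.Vert → S.Coord → A'),
    (∀ i, S.form ℂ x (a i) = formMap φ (ω i)) ∧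
    IsUnit (Matrix.of fun i => S.vert (a i)).det := by
  let _ := h.algAA'
  let _ := h.algBA'
  obtain ⟨e, b, hb⟩ := h.isLogChart.exists_basis_relCoord (A := R.A) ht
  choose a ha using fun i => (h.isLogChart.mem_polarForms_iff_exists ht).1 (e i).2
  have hb' : ∀ i, b i = S.vert (a i) := fun i => by rw [hb, IsLogChart.relCoord_eq _ ht (ha i)]
  refine ⟨fun i => (e i).1, a, fun i => ?_, ?_⟩
  · rw [← h.toAlgHom_eq, ← map_eq_formMap, ← ha i, h.coord_eq]
  · have h1 := (Pi.basisFun A' S.Vert).isUnit_det b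
    rw [Pi.basisFun_det_apply] at h1
    have h2 : (Matrix.of fun i => S.vert (a i)) = Matrix.of b := by
      funext i; exact (hb' i).symm
    rw [h2]
    exact h1

include h in
/-- The image of the differential separates linear functionals. -/
lemma eq_zero_of_apply_d {θ : R.Forms →ₗ[R.C] R.C} (hθ : ∀ c, θ (R.d c) = 0) : θ = 0 := by
  let _ := h.algAA'
  let _ := h.algBA'
  obtain ⟨t, ht⟩ := h.exists_eq_span
  exact h.isLogChart.eq_zero_of_apply_d ht R.isFibreRing hθ

include h in
lemma exists_lie_functional (θ₁ θ₂ : R.Forms →ₗ[R.C] R.C) : ∃ θ : R.Forms →ₗ[R.C] R.C,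
    ∀ c, θ (R.d c) = θ₁ (R.d (θ₂ (R.d c))) - θ₂ (R.d (θ₁ (R.d c))) := by
  let _ := h.algAA'
  let _ := h.algBA'
  obtain ⟨t, ht⟩ := h.exists_eq_span
  exact h.isLogChart.exists_lie_functional ht R.isFibreRing θ₁ θ₂

end ChartAt

section
variable {X S : Scheme.{0}} {p : S ⟶ Spec (CommRingCat.of ℂ)} {f : X ⟶ S}
    {Δ : S.IdealSheafData} {s : S}

instance (z : f.fiber s) : IsLocalRing (fibreStalk p f Δ s z).A :=
  inferInstanceAs (IsLocalRing (X.presheaf.stalk (f.fiberι s z)))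

variable (p f Δ s) in
/-- The local ring of the total space at a point of the fibre. -/
def stalkA (z : f.fiber s) : Stalk (f ≫ p) (f.fiberι s z) ≃ₐ[ℂ] (fibreStalk p f Δ s z).A :=
  AlgEquiv.ofRingEquiv (f := RingEquiv.refl (X.presheaf.stalk (f.fiberι s z))) fun _ => rfl

variable (p f Δ s) in
/-- The local ring of the base at a point of the fibre. -/
def stalkB (z : f.fiber s) : Stalk p (f (f.fiberι s z)) ≃ₐ[ℂ] (fibreStalk p f Δ s z).B :=
  AlgEquiv.ofRingEquiv (f := RingEquiv.refl (S.presheaf.stalk (f (f.fiberι s z)))) fun _ => rfl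

variable (Δ s) in
/-- The germ at a point of the fibre of a family of forms on the total space. -/
def formA (ω : ∀ x, Ω[Stalk (f ≫ p) x⁄ℂ]) (z : f.fiber s) : Ω[(fibreStalk p f Δ s z).A⁄ℂ] :=
  formMap (stalkA p f Δ s z).toAlgHom (ω (f.fiberι s z))

namespace SchemeChart
variable (K : SchemeChart p f Δ)

/-- The coordinates of the total space of a chart. -/
def coordSection : K.shape.Coord → Γ(K.U, ⊤) :=
  Sum.elim K.ξ fun j => K.g.appTop (K.π j.1)

/-- The germs of the coordinates of the total space of a chart. -/
def coordAt (w : K.U) (i : K.shape.Coord) : Stalk (K.u ≫ f ≫ p) w :=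
  germAt (K.u ≫ f ≫ p) ⊤ w trivial (K.coordSection i)

lemma coord_eq_coordAt (w : K.U) :
    letI : Algebra (Stalk (K.v ≫ p) (K.g w)) (Stalk (K.u ≫ f ≫ p) w) :=
      (K.g.stalkMap w).hom.toAlgebra
    K.shape.coord (fun i => germAt (K.u ≫ f ≫ p) ⊤ w trivial (K.ξ i))
      (fun j => germAt (K.v ≫ p) ⊤ (K.g w) trivial (K.π j)) = K.coordAt w := by
  funext i
  rcases i with i | j
  · rfl
  · exact Scheme.Hom.germ_stalkMap_apply K.g ⊤ w trivial (K.π j.1)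

lemma isFunNear_coordAt (w₀ : K.U) (i : K.shape.Coord) : IsFunNear w₀ fun w => K.coordAt w i :=
  ⟨⊤, trivial, K.coordSection i, fun _ _ => rfl⟩

/-- The polar form with given coefficients in the coordinates of a chart. -/
def formAt (w : K.U) (a : K.shape.Coord → Stalk (K.u ≫ f ≫ p) w) : Ω[Stalk (K.u ≫ f ≫ p) w⁄ℂ] :=
  K.shape.form (A := Stalk (K.u ≫ f ≫ p) w) ℂ (K.coordAt w) a

lemma isFormNear_formAt {w₀ : K.U} {a : K.shape.Coord → ∀ w, Stalk (K.u ≫ f ≫ p) w}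
    (ha : ∀ i, IsFunNear w₀ (a i)) : IsFormNear w₀ fun w => K.formAt w fun i => a i w := by
  have h1 : (fun w => K.formAt w fun i => a i w) = fun w => ∑ i, (a i *
      ∏ j ∈ K.shape.log.erase i, fun w => K.coordAt w j) w •
        KaehlerDifferential.D ℂ (Stalk (K.u ≫ f ≫ p) w) (K.coordAt w i) := by
    funext w
    rw [formAt, ChartShape.form_apply]
    refine Finset.sum_congr rfl fun i _ => ?_
    rw [smul_smul, Pi.mul_apply, Finset.prod_apply]
  rw [h1]
  exact IsFormNear.sum _ fun i => (IsFormNear.d (K.isFunNear_coordAt w₀ i)).smul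
    ((ha i).mul (IsFunNear.prod _ fun j _ => K.isFunNear_coordAt w₀ j))

variable (z : f.fiber s) (w : K.U) (h : K.u w = f.fiberι s z)

/-- The map of local rings from a point of the fibre to a point of the chart above it. -/
def stalkHomAt : (fibreStalk p f Δ s z).A →ₐ[ℂ] Stalk (K.u ≫ f ≫ p) w :=
  (stalkHomOf K.u (f ≫ p) w (f.fiberι s z) h).comp (stalkA p f Δ s z).symm.toAlgHom

/-- The chart of the local rings at the point `z` of the fibre given by a point `w` above it. -/
def chartAt : ChartAt (fibreStalk p f Δ s z) K.shape (Stalk (K.u ≫ f ≫ p) w)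
    (K.stalkHomAt z w h) (K.coordAt w) :=
  letI φB : (fibreStalk p f Δ s z).B →+* Stalk (K.v ≫ p) (K.g w) :=
    (stalkMapOf K.v (K.g w) _ (K.v_g h)).hom
  letI i3 := φB.toAlgebra
  letI i4 := (K.stalkHomAt z w h).toRingHom.toAlgebra
  letI i5 : Algebra (Stalk (K.v ≫ p) (K.g w)) (Stalk (K.u ≫ f ≫ p) w) :=
    (K.g.stalkMap w).hom.toAlgebra
  letI i6 := ((K.stalkHomAt z w h).toRingHom.comp
    (algebraMap (fibreStalk p f Δ s z).B (fibreStalk p f Δ s z).A)).toAlgebra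
  have hA : IsEssEtale (K.stalkHomAt z w h).toRingHom := isEssEtale_stalkMapOf K.u w _ h
  have hB : IsEssEtale φB := isEssEtale_stalkMapOf K.v (K.g w) _ (K.v_g h)
  have t1 : IsScalarTower ℂ (fibreStalk p f Δ s z).B (Stalk (K.v ≫ p) (K.g w)) :=
    IsScalarTower.of_algebraMap_eq' (stalkMapOf_stalkConst K.v (K.g w) _ (K.v_g h) p).symm
  have t2 : IsScalarTower ℂ (fibreStalk p f Δ s z).A (Stalk (K.u ≫ f ≫ p) w) :=
    IsScalarTower.of_algebraMap_eq' (stalkMapOf_stalkConst K.u w _ h (f ≫ p)).symm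
  have t3 : IsScalarTower ℂ (Stalk (K.v ≫ p) (K.g w)) (Stalk (K.u ≫ f ≫ p) w) :=
    IsScalarTower.of_algebraMap_eq' (by
      refine Eq.trans ?_ (stalkMap_stalkConst (K.v ≫ p) K.g w).symm
      change stalkConst (K.u ≫ f ≫ p) w = _
      rw [← Category.assoc, K.comm, Category.assoc])
  have t4 : IsScalarTower (fibreStalk p f Δ s z).B (fibreStalk p f Δ s z).A
      (Stalk (K.u ≫ f ≫ p) w) := IsScalarTower.of_algebraMap_eq' rfl
  have t5 : IsScalarTower (fibreStalk p f Δ s z).B (Stalk (K.v ≫ p) (K.g w))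
      (Stalk (K.u ≫ f ≫ p) w) := IsScalarTower.of_algebraMap_eq'
        (congrArg CommRingCat.Hom.hom (stalkMapOf_comm K.u w _ h K.comm (K.v_g h)))
  have l1 : IsLocalHom (algebraMap (fibreStalk p f Δ s z).A (Stalk (K.u ≫ f ≫ p) w)) :=
    isLocalHom_stalkMapOf K.u w _ h
  have l2 : IsLocalHom (algebraMap (fibreStalk p f Δ s z).B (Stalk (K.v ≫ p) (K.g w))) :=
    isLocalHom_stalkMapOf K.v (K.g w) _ (K.v_g h)
  have f1 : Module.Flat (fibreStalk p f Δ s z).A (Stalk (K.u ≫ f ≫ p) w) := hA.flat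
  have f2 : Module.Flat (fibreStalk p f Δ s z).B (Stalk (K.v ≫ p) (K.g w)) := hB.flat
  { B' := Stalk (K.v ≫ p) (K.g w)
    tower₁ := t1
    tower₂ := t2
    tower₃ := t3
    tower₄ := t4
    tower₅ := t5
    etaleA := hA.formallyEtale
    etaleB := hB.formallyEtale
    flatA := Module.FaithfullyFlat.of_flat_of_isLocalHom
    flatB := Module.FaithfullyFlat.of_flat_of_isLocalHom
    essFiniteB := hB.essFiniteType
    localHomB := l2
    ξ := fun i => germAt (K.u ≫ f ≫ p) ⊤ w trivial (K.ξ i)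
    π := fun j => germAt (K.v ≫ p) ⊤ (K.g w) trivial (K.π j)
    isLogChart :=
      { base := K.base (K.g w)
        total := by
          rw [K.coord_eq_coordAt w]
          exact K.total w
        prod_eq := by
          refine (Scheme.Hom.germ_stalkMap_apply K.g ⊤ w trivial (K.π K.shape.base)).trans ?_
          refine (congrArg (K.U.presheaf.germ ⊤ w trivial) K.prod_eq).trans ?_
          exact map_prod (K.U.presheaf.germ ⊤ w trivial).hom _ _
        ideal := by
          refine (map_stalkMapOf K.v (K.g w) _ (K.v_g h) Δ).trans ?_
          rw [K.ideal.stalkIdeal_eq]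
          exact congrArg (fun b => Ideal.span {b})
            (map_prod (K.V.presheaf.germ ⊤ (K.g w) trivial).hom _ _) }
    toAlgHom_eq := AlgHom.ext fun _ => rfl
    coord_eq := K.coord_eq_coordAt w }

lemma formMap_stalkHomAt (ω : ∀ x, Ω[Stalk (f ≫ p) x⁄ℂ]) :
    formMap (K.stalkHomAt z w h) (formA Δ s ω z) =
      formMap (stalkHom K.u (f ≫ p) w) (ω (K.u w)) := by
  rw [← formMap_stalkHomOf K.u (f ≫ p) w _ h ω, formA, formMap_comp]
  congr 1

end SchemeChart

lemma IsFunNear.vert {U : Scheme.{0}} {q : U ⟶ Spec (CommRingCat.of ℂ)} {w₀ : U} (C : ChartShape)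
    {a : C.Coord → ∀ w, Stalk q w} (ha : ∀ i, IsFunNear w₀ (a i)) (i : C.Vert) :
    IsFunNear w₀ fun w => C.vert (fun k => a k w) i := by
  by_cases h : i.1 ∈ C.branches
  · simp only [ChartShape.vert_apply, h, if_true]
    exact (ha _).sub (ha _)
  · simp only [ChartShape.vert_apply, h, if_false, sub_zero]
    exact ha _

lemma IsFunNear.det {U : Scheme.{0}} {q : U ⟶ Spec (CommRingCat.of ℂ)} {w₀ : U} {n : Type}
    [Fintype n] [DecidableEq n] {a : n → n → ∀ w, Stalk q w} (ha : ∀ i j, IsFunNear w₀ (a i j)) :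
    IsFunNear w₀ fun w => (Matrix.of fun i j => a i j w).det := by
  have h1 : (fun w => (Matrix.of fun i j => a i j w).det) =
      ∑ σ : Equiv.Perm n, ((Equiv.Perm.sign σ : ℤ) : ∀ w, Stalk q w) * ∏ i, a (σ i) i := by
    funext w
    simp [Matrix.det_apply', Finset.sum_apply, Finset.prod_apply]
  rw [h1]
  exact IsFunNear.sum _ fun σ _ => (IsFunNear.intCast _).mul (IsFunNear.prod _ fun i _ => ha _ _)

lemma fiberι_mem (z : f.fiber s) : f (f.fiberι s z) = s :=
  congrArg (fun g : f.fiber s ⟶ S => g z) (f.fiber_fac s) |>.trans (by simp)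

/-- A local equation of the divisor at the point `s`, as a family of germs. -/
lemma exists_equation [hz : Nonempty (f.fiber s)]
    (hK : ∀ z : f.fiber s, ∃ (K : SchemeChart p f Δ) (w : K.U), K.u w = f.fiberι s z) :
    ∃ t : ∀ y, Stalk p y, IsFunNear s t ∧
      ∀ z : f.fiber s, (fibreStalk p f Δ s z).ideal =
    Ideal.span {stalkB p f Δ s z (t (f (f.fiberι s z)))} := by
  obtain ⟨z⟩ := hz
  obtain ⟨K, w, h⟩ := hK z
  obtain ⟨t₀, ht₀⟩ := (K.chartAt z w h).exists_eq_span
  obtain ⟨t, ht, hts⟩ := exists_isFunNear (q := p) (f (f.fiberι s z)) t₀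
  have h1 : ∀ y, y = f (f.fiberι s z) → stalkIdeal Δ y = Ideal.span {t y} := by
    rintro _ rfl
    rw [hts]
    exact ht₀
  rw [fiberι_mem] at ht
  exact ⟨t, ht, fun z' => h1 _ ((fiberι_mem z').trans (fiberι_mem z).symm)⟩

section Frame
variable (hK : ∀ z : f.fiber s, ∃ (K : SchemeChart p f Δ) (w : K.U), K.u w = f.fiberι s z)
  {t : ∀ y, Stalk p y}
  (ht : ∀ z : f.fiber s, (fibreStalk p f Δ s z).ideal =
    Ideal.span {stalkB p f Δ s z (t (f (f.fiberι s z)))})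

include hK ht in
lemma isLogPair_fibreStalk (z : f.fiber s) : IsLogPair ℂ (fibreStalk p f Δ s z).A
    (fibreStalk p f Δ s z).ideal (stalkB p f Δ s z (t (f (f.fiberι s z)))) := by
  obtain ⟨K, w, h⟩ := hK z
  exact (K.chartAt z w h).isLogPair (ht z)

/-- Near every point of the fibre there are forms which give bases of the relative logarithmic
forms at all points. -/
lemma exists_frame_forms (z₀ : f.fiber s) : ∃ (n : ℕ) (e : Fin n → ∀ x, Ω[Stalk (f ≫ p) x⁄ℂ]),
    (∀ i, IsFormNear (f.fiberι s z₀) (e i)) ∧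
    ∃ V : X.Opens, f.fiberι s z₀ ∈ V ∧ ∀ z : f.fiber s, f.fiberι s z ∈ V →
      ∃ (he : ∀ i, formA Δ s (e i) z ∈ polarForms ℂ
          (algebraMap _ (fibreStalk p f Δ s z).A (stalkB p f Δ s z (t (f (f.fiberι s z))))))
        (b : Module.Basis (Fin n) (fibreStalk p f Δ s z).A
          (RelLogForms ℂ (fibreStalk p f Δ s z).A (fibreStalk p f Δ s z).ideal)),
        ∀ i, b i = (isLogPair_fibreStalk hK ht z).toRel ⟨formA Δ s (e i) z, he i⟩ := by
  obtain ⟨K, w₀, h₀⟩ := hK z₀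
  obtain ⟨ω, a₀, ha₀, hdet⟩ := (K.chartAt z₀ w₀ h₀).exists_forms_isUnit_det (ht z₀)
  choose e he he' using fun i => exists_isFormNear (q := f ≫ p) (f.fiberι s z₀)
    (formMap (stalkA p f Δ s z₀).symm.toAlgHom (ω i))
  have he'' : ∀ i, formA Δ s (e i) z₀ = ω i := fun i => by
    rw [formA, he', formMap_comp]
    exact (congrArg (fun φ => formMap φ (ω i)) (AlgEquiv.comp_symm _)).trans (formMap_id _)
  choose a ha ha' using fun i k => exists_isFunNear (q := K.u ≫ f ≫ p) w₀ (a₀ i k)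
  have hev : ∀ᶠ w in nhds w₀, (∀ i, K.formAt w (fun k => a i k w) =
      formMap (stalkHom K.u (f ≫ p) w) (e i (K.u w))) ∧
      IsUnit (Matrix.of fun i j => K.shape.vert (fun k => a i k w) j).det := by
    refine (Filter.eventually_all.2 fun i => ?_).and ?_
    · refine (K.isFormNear_formAt (ha i)).eventually_eq
        (IsFormNear.pullBack (by rw [h₀]; exact he i)) ?_
      rw [← K.formMap_stalkHomAt z₀ w₀ h₀, he'', ← ha₀]
      simp only [ha']
      rfl
    · refine (IsFunNear.det fun i j => IsFunNear.vert K.shape (ha i) j).eventually_isUnit ?_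
      simp only [ha']
      exact hdet
  obtain ⟨W, hW, hWo, hwW⟩ := eventually_nhds_iff.1 hev
  let ε := (Fintype.equivFin K.shape.Vert).symm
  refine ⟨Fintype.card K.shape.Vert, fun i => e (ε i), fun i => he _,
    ⟨K.u '' W, K.u.isOpenMap _ hWo⟩, ⟨w₀, hwW, h₀⟩, ?_⟩
  rintro z ⟨w, hw, h⟩
  obtain ⟨h1, h2⟩ := hW w hw
  obtain ⟨hω, b, hb⟩ := (K.chartAt z w h).exists_basis_of_isUnit_det (ht z) (fun i => formA Δ s (e i) z)
    (fun i k => a i k w) (fun i => (h1 i).trans (K.formMap_stalkHomAt z w h (e i)).symm) h2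
  refine ⟨fun i => hω _, b.reindex ε.symm, fun i => ?_⟩
  rw [Module.Basis.reindex_apply, hb]
  rfl

end Frame
end
end

section
/-! ### Coefficients of rational forms -/

section
variable {k A A' : Type} [CommRing k] [CommRing A] [CommRing A'] [Algebra k A] [Algebra k A']

lemma formMap_symm_apply (ε : A ≃ₐ[k] A') (ω : Ω[A⁄k]) :
    formMap ε.symm.toAlgHom (formMap ε.toAlgHom ω) = ω := by
  rw [formMap_comp]
  exact (congrArg (fun φ => formMap φ ω) (AlgEquiv.symm_comp ε)).trans (formMap_id ω)

lemma formMap_apply_symm (ε : A ≃ₐ[k] A') (ω : Ω[A'⁄k]) :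
    formMap ε.toAlgHom (formMap ε.symm.toAlgHom ω) = ω := formMap_symm_apply ε.symm ω

lemma formMap_mem_polarForms (ε : A ≃ₐ[k] A') {t : A} {ω : Ω[A⁄k]} (h : ω ∈ polarForms k t) :
    formMap ε.toAlgHom ω ∈ polarForms k (ε t) := by
  let back : (Ω[A'⁄k] →ₗ[A'] A') → (Ω[A⁄k] →ₗ[A] A) := fun θ =>
    { toFun := fun ω => ε.symm (θ (formMap ε.toAlgHom ω))
      map_add' := fun ω ω' => by simp only [map_add]
      map_smul' := fun a ω => by
        have : formMap ε.toAlgHom (a • ω) = ε a • formMap ε.toAlgHom ω := formMap_smul _ _ _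
        rw [this, map_smul, smul_eq_mul, map_mul, AlgEquiv.symm_apply_apply]
        rfl }
  intro θ θ'
  have h1 := map_dvd ε (h (back θ) (back θ'))
  have h2 : formMap ε.toAlgHom (KaehlerDifferential.D k A t) = KaehlerDifferential.D k A' (ε t) :=
    formMap_D _ _
  simpa only [back, LinearMap.coe_mk, AddHom.coe_mk, map_sub, map_mul, AlgEquiv.apply_symm_apply,
    h2] using h1

end

section Algebra
variable {k B A : Type} [CommRing k] [CommRing B] [CommRing A] [Algebra k B]
  [Algebra k A] [Algebra B A] [IsScalarTower k B A] {I : Ideal B} {t : B}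

/-- A logarithmic form with an arbitrary denominator, written in a basis, up to forms from the
base. -/
lemma IsLogPair.exists_coefficients (h : IsLogPair k A I t) {ι : Type} [Fintype ι]
    {e : ι → polarForms k (algebraMap B A t)} {b : Module.Basis ι A (RelLogForms k A I)}
    (hb : ∀ i, b i = h.toRel (e i)) (l : logForms k (I.map (algebraMap B A))) {t' : A}
    {β : Ω[A⁄k]} (hl : t' • l.1 = toRational k A β) :
    ∃ (α : ι → A) (m : ℕ) (γ : Fin m → A) (θ : Fin m → Ω[B⁄k]), (∀ j, θ j ∈ polarForms k t) ∧
      t' • (∑ i, α i • (e i).1 + ∑ j, γ j • KaehlerDifferential.map k k B A (θ j)) =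
        algebraMap B A t • β := by
  obtain ⟨ω, hω⟩ := h.exists_polar l
  obtain ⟨n, ⟨ε⟩⟩ := h.free_total
  let α := fun i => b.repr (h.toRel ω) i
  have h1 : h.toRel (ω - ∑ i, α i • e i) = 0 := by
    rw [map_sub, map_sum, sub_eq_zero]
    simp only [map_smul, ← hb]
    exact (b.sum_repr _).symm
  rw [h.toRel_eq_zero_iff] at h1
  obtain ⟨m, γ, θ, h2⟩ := Submodule.mem_span_set'.1 h1
  choose θ' hθ' using fun j => (θ j).2
  refine ⟨α, m, γ, θ', fun j => (hθ' j).1, ?_⟩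
  have h3 : ∑ i, α i • (e i).1 + ∑ j, γ j • KaehlerDifferential.map k k B A (θ' j) = ω.1 := by
    simp only [fun j => (hθ' j).2]
    rw [h2]
    simp
  rw [h3]
  refine toRational_injective ε ?_
  rw [map_smul, map_smul, ← hl, ← hω, smul_comm]

lemma IsLogPair.mk_eq_sum (h : IsLogPair k A I t) {ι : Type} [Fintype ι]
    (e : ι → polarForms k (algebraMap B A t)) (l : logForms k (I.map (algebraMap B A))) {t' : A}
    (ht' : t' ∈ nonZeroDivisors A) {β : Ω[A⁄k]} (hl : t' • l.1 = toRational k A β)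
    (α : ι → A) {m : ℕ} (γ : Fin m → A) (θ : Fin m → Ω[B⁄k]) (hθ : ∀ j, θ j ∈ polarForms k t)
    (heq : t' • (∑ i, α i • (e i).1 + ∑ j, γ j • KaehlerDifferential.map k k B A (θ j)) =
        algebraMap B A t • β) :
    (Submodule.Quotient.mk l : RelLogForms k A I) = ∑ i, α i • h.toRel (e i) := by
  obtain ⟨ω, hω⟩ := h.exists_polar l
  obtain ⟨n, ⟨ε⟩⟩ := h.free_total
  have h1 : ω.1 = ∑ i, α i • (e i).1 + ∑ j, γ j • KaehlerDifferential.map k k B A (θ j) := by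
    refine toRational_injective ε (smul_rational_injective ht' ?_)
    rw [← map_smul (toRational k A), ← map_smul (toRational k A), heq, map_smul, map_smul, ← hl,
      ← hω, smul_comm]
  have h2 : h.toRel (ω - ∑ i, α i • e i) = 0 := by
    rw [h.toRel_eq_zero_iff]
    have h3 : (ω - ∑ i, α i • e i).1 = ∑ j, γ j • KaehlerDifferential.map k k B A (θ j) := by
      rw [Submodule.coe_sub, h1]
      simp
    rw [h3]
    exact Submodule.sum_mem _ fun j _ =>
      Submodule.smul_mem _ _ (Submodule.subset_span ⟨θ j, hθ j, rfl⟩)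
  rw [← h.toRel_eq_mk ω l hω]
  rw [map_sub, sub_eq_zero, map_sum] at h2
  simp only [map_smul] at h2
  exact h2

end Algebra

section
variable {X S : Scheme.{0}} {p : S ⟶ Spec (CommRingCat.of ℂ)} {f : X ⟶ S}
    {Δ : S.IdealSheafData} {s : S}

section FormA
variable (z : f.fiber s) {ω η : ∀ x, Ω[Stalk (f ≫ p) x⁄ℂ]}

lemma formA_smul (a : ∀ x, Stalk (f ≫ p) x) :
    formA Δ s (fun x => a x • ω x) z = stalkA p f Δ s z (a (f.fiberι s z)) • formA Δ s ω z :=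
  formMap_smul _ _ _

lemma formA_add : formA Δ s (fun x => ω x + η x) z = formA Δ s ω z + formA Δ s η z :=
  map_add _ _ _

lemma formA_sum {σ : Type} (K : Finset σ) (ω : σ → ∀ x, Ω[Stalk (f ≫ p) x⁄ℂ]) :
    formA Δ s (fun x => ∑ i ∈ K, ω i x) z = ∑ i ∈ K, formA Δ s (ω i) z :=
  map_sum _ _ _

lemma formA_D (a : ∀ x, Stalk (f ≫ p) x) :
    formA Δ s (fun x => KaehlerDifferential.D ℂ _ (a x)) z =
      KaehlerDifferential.D ℂ _ (stalkA p f Δ s z (a (f.fiberι s z))) := formMap_D _ _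

variable (Δ s) in
/-- The germ at a point of the fibre of a family of forms on the base. -/
def formB (θ : ∀ y, Ω[Stalk p y⁄ℂ]) (z : f.fiber s) : Ω[(fibreStalk p f Δ s z).B⁄ℂ] :=
  formMap (stalkB p f Δ s z).toAlgHom (θ (f (f.fiberι s z)))

lemma formA_pullBack (θ : ∀ y, Ω[Stalk p y⁄ℂ]) :
    formA Δ s (fun x => formMap (stalkHom f p x) (θ (f x))) z =
      KaehlerDifferential.map ℂ ℂ _ (fibreStalk p f Δ s z).A (formB Δ s θ z) := by
  rw [map_eq_formMap, formB, formA, formMap_comp, formMap_comp]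
  congr 1

end FormA

section Frame
variable (hK : ∀ z : f.fiber s, ∃ (K : SchemeChart p f Δ) (w : K.U), K.u w = f.fiberι s z)
  {t : ∀ y, Stalk p y}
  (ht : ∀ z : f.fiber s, (fibreStalk p f Δ s z).ideal =
    Ideal.span {stalkB p f Δ s z (t (f (f.fiberι s z)))})

variable (t) in
/-- The germ of the equation of the divisor. -/
abbrev eqAt (z : f.fiber s) : (fibreStalk p f Δ s z).B := stalkB p f Δ s z (t (f (f.fiberι s z)))

open Classical in
/-- The logarithmic form with a given polar form as numerator, restricted to the fibre. -/
def polarVal (z : f.fiber s) (ω : Ω[(fibreStalk p f Δ s z).A⁄ℂ]) : (fibreStalk p f Δ s z).Forms :=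
  if h : ω ∈ polarForms ℂ (algebraMap _ (fibreStalk p f Δ s z).A (eqAt t z)) then
    1 ⊗ₜ (isLogPair_fibreStalk hK ht z).toRel ⟨ω, h⟩ else 0

lemma polarVal_eq {z : f.fiber s} {ω : Ω[(fibreStalk p f Δ s z).A⁄ℂ]}
    (h : ω ∈ polarForms ℂ (algebraMap _ (fibreStalk p f Δ s z).A (eqAt t z))) :
    polarVal hK ht z ω = 1 ⊗ₜ (isLogPair_fibreStalk hK ht z).toRel ⟨ω, h⟩ := dif_pos h

/-- The forms `e` give a basis of the relative logarithmic forms at all points of the fibre which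
lie in `V`. -/
def IsFrameOn (V : X.Opens) {n : ℕ} (e : Fin n → ∀ x, Ω[Stalk (f ≫ p) x⁄ℂ]) : Prop :=
  ∀ z : f.fiber s, f.fiberι s z ∈ V →
    ∃ (he : ∀ i, formA Δ s (e i) z ∈ polarForms ℂ
        (algebraMap _ (fibreStalk p f Δ s z).A (eqAt t z)))
      (b : Module.Basis (Fin n) (fibreStalk p f Δ s z).A
        (RelLogForms ℂ (fibreStalk p f Δ s z).A (fibreStalk p f Δ s z).ideal)),
      ∀ i, b i = (isLogPair_fibreStalk hK ht z).toRel ⟨formA Δ s (e i) z, he i⟩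

variable {V : X.Opens} {n : ℕ} {e : Fin n → ∀ x, Ω[Stalk (f ≫ p) x⁄ℂ]}
  (hV : IsFrameOn hK ht V e)
include hV

lemma IsFrameOn.exists_basis {z : f.fiber s} (hz : f.fiberι s z ∈ V) :
    ∃ b : Module.Basis (Fin n) (fibreStalk p f Δ s z).C (fibreStalk p f Δ s z).Forms,
      ∀ i, b i = polarVal hK ht z (formA Δ s (e i) z) := by
  obtain ⟨he, b, hb⟩ := hV z hz
  refine ⟨b.baseChange _, fun i => ?_⟩
  rw [Module.Basis.baseChange_apply, hb, polarVal_eq]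

/-- A rational logarithmic form has, near a point, functions as coefficients. -/
lemma IsFrameOn.exists_coefficients (hts : IsFunNear s t) {z₀ : f.fiber s}
    (hz₀ : f.fiberι s z₀ ∈ V) (he : ∀ i, IsFormNear (f.fiberι s z₀) (e i))
    {W : (f.fiber s).Opens} {η : LogFamily p f Δ s W} (hη : IsRational p f Δ s η) (hW : z₀ ∈ W) :
    ∃ α : Fin n → ∀ x, Stalk (f ≫ p) x, (∀ i, IsFunNear (f.fiberι s z₀) (α i)) ∧
      ∀ᶠ z in nhds z₀, ∀ hz : z ∈ W, η ⟨z, hz⟩ = ∑ i,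
        algebraMap _ (fibreStalk p f Δ s z).C (stalkA p f Δ s z (α i (f.fiberι s z))) •
          polarVal hK ht z (formA Δ s (e i) z) := by
  obtain ⟨V', hV', t', m', b', c', H⟩ := hη
  -- the numerator, the denominator and the equation of the divisor, as families of germs
  let β : ∀ x, Ω[Stalk (f ≫ p) x⁄ℂ] := fun x => ∑ j, germFun (f ≫ p) (b' j) x •
    KaehlerDifferential.D ℂ (Stalk (f ≫ p) x) (germFun (f ≫ p) (c' j) x)
  have hβ : IsFormNear (f.fiberι s z₀) β := IsFormNear.sum _ fun j =>
    (IsFormNear.d (isFunNear_germFun (c' j) (hV' hW))).smul (isFunNear_germFun (b' j) (hV' hW))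
  let tX : ∀ x, Stalk (f ≫ p) x := fun x => stalkHom f p x (t (f x))
  have htX : IsFunNear (f.fiberι s z₀) tX := IsFunNear.pullBack (by rw [fiberι_mem]; exact hts)
  have hg : ∀ (z : f.fiber s) (hz : z ∈ W) (r : Γ(X, V')), stalkA p f Δ s z
      (germFun (f ≫ p) r (f.fiberι s z)) = germA p f Δ s V' z (hV' hz) r := fun z hz r =>
    congrArg (stalkA p f Δ s z) (germFun_apply r (show f.fiberι s z ∈ V' from hV' hz))
  have hβA : ∀ z : f.fiber s, ∀ hz : z ∈ W, formA Δ s β z = ∑ j,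
      germA p f Δ s V' z (hV' hz) (b' j) •
        KaehlerDifferential.D ℂ _ (germA p f Δ s V' z (hV' hz) (c' j)) := by
    intro z hz
    simp only [β, formA_sum, formA_smul, formA_D, hg z hz]
  have hrat : ∀ z : f.fiber s, ∀ hz : z ∈ W, toRational ℂ _ (formA Δ s β z) = ∑ j,
      germA p f Δ s V' z (hV' hz) (b' j) • KaehlerDifferential.D ℂ _
        (algebraMap _ _ (germA p f Δ s V' z (hV' hz) (c' j))) := by
    intro z hz
    rw [hβA z hz, map_sum]
    simp only [map_smul, toRational_D]
  obtain ⟨h₀, l₀, hl₀, -⟩ := H ⟨z₀, hW⟩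
  obtain ⟨he₀, b₀, hb₀⟩ := hV z₀ hz₀
  obtain ⟨α₀, m, γ₀, θ₀, hθ₀, heq₀⟩ := (isLogPair_fibreStalk hK ht z₀).exists_coefficients
    (e := fun i => ⟨_, he₀ i⟩) hb₀ l₀ (hl₀.trans (hrat z₀ hW).symm)
  choose α hα hα₀ using fun i => exists_isFunNear (q := f ≫ p) (f.fiberι s z₀)
    ((stalkA p f Δ s z₀).symm (α₀ i))
  choose γ hγ hγ₀ using fun j => exists_isFunNear (q := f ≫ p) (f.fiberι s z₀)
    ((stalkA p f Δ s z₀).symm (γ₀ j))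
  choose θ hθ hθ' using fun j => exists_isFormNear (q := p) (f (f.fiberι s z₀))
    (formMap (stalkB p f Δ s z₀).symm.toAlgHom (θ₀ j))
  have hθB : ∀ j, formB Δ s (θ j) z₀ = θ₀ j := fun j => by
    rw [formB, hθ', formMap_apply_symm]
  have hpol : ∀ j y, y = f (f.fiberι s z₀) → θ j y ∈ polarForms ℂ (t y) := by
    rintro j _ rfl
    have := formMap_mem_polarForms (stalkB p f Δ s z₀).symm (hθ₀ j)
    rwa [AlgEquiv.symm_apply_apply, ← hθ' j] at this
  -- the equation satisfied by the coefficients spreads out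
  let L : ∀ x, Ω[Stalk (f ≫ p) x⁄ℂ] := fun x => germFun (f ≫ p) t' x • (∑ i, α i x • e i x +
    ∑ j, γ j x • formMap (stalkHom f p x) (θ j (f x)))
  have hL : IsFormNear (f.fiberι s z₀) L :=
    ((IsFormNear.sum _ fun i => (he i).smul (hα i)).add
      (IsFormNear.sum _ fun j => (hθ j).pullBack.smul (hγ j))).smul
      (isFunNear_germFun t' (hV' hW))
  have hLA : ∀ z : f.fiber s, ∀ hz : z ∈ W, formA Δ s L z = germA p f Δ s V' z (hV' hz) t' •
      (∑ i, stalkA p f Δ s z (α i (f.fiberι s z)) • formA Δ s (e i) z +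
      ∑ j, stalkA p f Δ s z (γ j (f.fiberι s z)) •
        KaehlerDifferential.map ℂ ℂ _ (fibreStalk p f Δ s z).A (formB Δ s (θ j) z)) := by
    intro z hz
    simp only [L, formA_sum, formA_smul, formA_add, formA_pullBack, hg z hz]
  have hR : ∀ z : f.fiber s, formA Δ s (fun x => tX x • β x) z =
      algebraMap (fibreStalk p f Δ s z).B (fibreStalk p f Δ s z).A (eqAt t z) • formA Δ s β z := by
    intro z
    rw [formA_smul]
    rfl
  have h1 : L (f.fiberι s z₀) = tX (f.fiberι s z₀) • β (f.fiberι s z₀) := by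
    have h2 : formA Δ s L z₀ = formA Δ s (fun x => tX x • β x) z₀ := by
      rw [hR, hLA z₀ hW]
      simp only [hα₀, hγ₀, hθB, AlgEquiv.apply_symm_apply]
      exact heq₀
    have h3 := congrArg (formMap (stalkA p f Δ s z₀).symm.toAlgHom) h2
    rw [formA, formA, formMap_symm_apply, formMap_symm_apply] at h3
    exact h3
  have h2 := hL.eventually_eq (hβ.smul htX) h1
  refine ⟨α, hα, ?_⟩
  filter_upwards [(f.fiberι s).continuous.tendsto z₀ |>.eventually h2,
    (f.fiberι s).continuous.tendsto z₀ |>.eventually (eventually_mem hz₀)] with z hz hzV hzW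
  obtain ⟨hnz, l, hl, hηz⟩ := H ⟨z, hzW⟩
  obtain ⟨hez, -⟩ := hV z hzV
  have h3 : formA Δ s L z = formA Δ s (fun x => tX x • β x) z :=
    congrArg (formMap (stalkA p f Δ s z).toAlgHom) hz
  rw [hR, hLA z hzW] at h3
  have h4 := (isLogPair_fibreStalk hK ht z).mk_eq_sum (fun i => ⟨_, hez i⟩) l hnz
    (hl.trans (hrat z hzW).symm) (fun i => stalkA p f Δ s z (α i (f.fiberι s z)))
    (fun j => stalkA p f Δ s z (γ j (f.fiberι s z))) (fun j => formB Δ s (θ j) z)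
    (fun j => formMap_mem_polarForms (stalkB p f Δ s z)
      (hpol j _ ((fiberι_mem z).trans (fiberι_mem z₀).symm))) h3
  rw [hηz, FibreStalk.ofLogForm, h4, TensorProduct.tmul_sum]
  refine Finset.sum_congr rfl fun i _ => ?_
  rw [polarVal_eq hK ht (hez i), TensorProduct.tmul_smul, algebraMap_smul]

end Frame
end
end

section
/-! ### Local freeness of the logarithmic forms of the fibre -/

section
variable {X S : Scheme.{0}} {p : S ⟶ Spec (CommRingCat.of ℂ)} {f : X ⟶ S}
    {Δ : S.IdealSheafData} {s : S}

variable (p Δ) in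
/-- The germ at `z` of a section of the logarithmic forms of the fibre. -/
def formGerm (W : (f.fiber s).Opens) (z : f.fiber s) (hz : z ∈ W) :
    Γ(logCotangent p f Δ s, W) →+ (fibreStalk p f Δ s z).Forms where
  toFun η := (show logSections p f Δ s W from η).1 ⟨z, hz⟩
  map_zero' := rfl
  map_add' _ _ := rfl

variable (p Δ) in
/-- The germ at `z` of a function on the fibre. -/
def germF (W : (f.fiber s).Opens) (z : f.fiber s) (hz : z ∈ W) :
    Γ(f.fiber s, W) →+* (fibreStalk p f Δ s z).C := germC p f Δ s W ⟨z, hz⟩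

section Germ
variable {W W' : (f.fiber s).Opens} {z : f.fiber s}

lemma formGerm_smul (hz : z ∈ W) (a : Γ(f.fiber s, W)) (η : Γ(logCotangent p f Δ s, W)) :
    formGerm p Δ W z hz (a • η) = germF p Δ W z hz a • formGerm p Δ W z hz η := rfl

lemma formGerm_res (h : W' ≤ W) (hz : z ∈ W') (η : Γ(logCotangent p f Δ s, W)) :
    formGerm p Δ W' z hz (resM (logCotangent p f Δ s) h η) = formGerm p Δ W z (h hz) η := rfl

lemma germF_resO (h : W' ≤ W) (hz : z ∈ W') (a : Γ(f.fiber s, W)) :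
    germF p Δ W' z hz (resO h a) = germF p Δ W z (h hz) a :=
  germC_res p f Δ s h ⟨z, hz⟩ a

lemma formGerm_d (hz : z ∈ W) (a : Γ(f.fiber s, W)) :
    formGerm p Δ W z hz ((logDifferential p f Δ s).d W a) =
      (fibreStalk p f Δ s z).d (germF p Δ W z hz a) := rfl

lemma formGerm_ext {η η' : Γ(logCotangent p f Δ s, W)}
    (h : ∀ z (hz : z ∈ W), formGerm p Δ W z hz η = formGerm p Δ W z hz η') : η = η' :=
  Subtype.ext (funext fun z => h z.1 z.2)

variable (p Δ) in
lemma germF_ext {a b : Γ(f.fiber s, W)}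
    (h : ∀ z (hz : z ∈ W), germF p Δ W z hz a = germF p Δ W z hz b) : a = b :=
  TopCat.Presheaf.section_ext (f.fiber s).sheaf W a b fun z hz => h z hz

variable (p Δ) in
lemma exists_resO_eq_of_germF_eq {a : Γ(f.fiber s, W)} {b : Γ(f.fiber s, W')} (hz : z ∈ W)
    (hz' : z ∈ W') (h : germF p Δ W z hz a = germF p Δ W' z hz' b) :
    ∃ (V : (f.fiber s).Opens) (h : V ≤ W) (h' : V ≤ W'), z ∈ V ∧ resO h a = resO h' b := by
  obtain ⟨V, hV, i, i', hi⟩ := TopCat.Presheaf.germ_eq (f.fiber s).presheaf z hz hz' a b h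
  exact ⟨V, i.le, i'.le, hV, hi⟩

variable (p Δ) in
lemma exists_germF_eq (z : f.fiber s) (c : (fibreStalk p f Δ s z).C) :
    ∃ (V : (f.fiber s).Opens) (hV : z ∈ V) (a : Γ(f.fiber s, V)),
      germF p Δ V z hV a = c := by
  obtain ⟨V, hV, a, ha⟩ := (f.fiber s).presheaf.exists_germ_eq c
  exact ⟨V, hV, a, ha⟩

variable (p Δ) in
lemma germF_app {V : X.Opens} (hz : f.fiberι s z ∈ V) (r : Γ(X, V)) :
    germF p Δ (f.fiberι s ⁻¹ᵁ V) z hz ((f.fiberι s).app V r) =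
      algebraMap _ (fibreStalk p f Δ s z).C (germA p f Δ s V z hz r) :=
  (Scheme.Hom.germ_stalkMap_apply (f.fiberι s) V z hz r).symm

end Germ

/-- Near `z₀`, the family `η` is a combination of the families `ε` with functions on the fibre as
coefficients. -/
def IsCombinationNear {n : ℕ} (ε : Fin n → ∀ z, (fibreStalk p f Δ s z).Forms) (z₀ : f.fiber s)
    {U : (f.fiber s).Opens} (η : LogFamily p f Δ s U) : Prop :=
  ∃ (W : (f.fiber s).Opens) (h : W ≤ U), z₀ ∈ W ∧ ∃ c : Fin n → Γ(f.fiber s, W),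
    ∀ z (hz : z ∈ W), η ⟨z, h hz⟩ = ∑ i, germF p Δ W z hz (c i) • ε i z

namespace IsCombinationNear
variable {n : ℕ} {ε : Fin n → ∀ z, (fibreStalk p f Δ s z).Forms} {z₀ : f.fiber s}
  {U : (f.fiber s).Opens} {η η' : LogFamily p f Δ s U}

lemma zero (hz : z₀ ∈ U) : IsCombinationNear ε z₀ (0 : LogFamily p f Δ s U) :=
  ⟨U, le_rfl, hz, 0, fun z hz => by simp⟩

lemma add (h : IsCombinationNear ε z₀ η) (h' : IsCombinationNear ε z₀ η') :
    IsCombinationNear ε z₀ (η + η') := by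
  obtain ⟨W, hW, hz, c, hc⟩ := h
  obtain ⟨W', hW', hz', c', hc'⟩ := h'
  refine ⟨W ⊓ W', inf_le_left.trans hW, ⟨hz, hz'⟩,
    fun i => resO inf_le_left (c i) + resO inf_le_right (c' i), fun z hz => ?_⟩
  simp only [map_add, germF_resO inf_le_left hz, germF_resO inf_le_right hz, add_smul, Finset.sum_add_distrib]
  rw [← hc z hz.1, ← hc' z hz.2]
  rfl

lemma smul (h : IsCombinationNear ε z₀ η) (a : Γ(f.fiber s, U)) :
    IsCombinationNear ε z₀ (a • η) := by
  obtain ⟨W, hW, hz, c, hc⟩ := h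
  refine ⟨W, hW, hz, fun i => resO hW a * c i, fun z hz => ?_⟩
  simp only [map_mul, germF_resO hW hz, mul_smul, ← Finset.smul_sum, ← hc z hz]
  rfl

lemma of_restrict {V : (f.fiber s).Opens} (hV : V ≤ U)
    (h : IsCombinationNear ε z₀ (restrictFamily p f Δ s hV η)) : IsCombinationNear ε z₀ η := by
  obtain ⟨W, hW, hz, c, hc⟩ := h
  exact ⟨W, hW.trans hV, hz, c, hc⟩

lemma of_mem_logSections (hη : η ∈ logSections p f Δ s U) (hz₀ : z₀ ∈ U)
    (H : ∀ (W : (f.fiber s).Opens) (ξ : LogFamily p f Δ s W), IsRational p f Δ s ξ → z₀ ∈ W →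
      IsCombinationNear ε z₀ ξ) : IsCombinationNear ε z₀ η := by
  obtain ⟨W, hW, hzW, h⟩ := hη ⟨z₀, hz₀⟩
  refine of_restrict hW ?_
  generalize restrictFamily p f Δ s hW η = ξ at h
  induction h using Submodule.span_induction with
  | mem ξ hξ => exact H W ξ hξ hzW
  | zero => exact zero hzW
  | add _ _ _ _ h h' => exact h.add h'
  | smul a _ _ h => exact h.smul a

end IsCombinationNear

/-- Local freeness, given bases of the stalks which generate locally. -/
lemma isFrame_of_basis {n : ℕ} {ε : Fin n → ∀ z, (fibreStalk p f Δ s z).Forms}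
    {W₀ : (f.fiber s).Opens} (e : Fin n → Γ(logCotangent p f Δ s, W₀))
    (he : ∀ i z (hz : z ∈ W₀), formGerm p Δ W₀ z hz (e i) = ε i z)
    (hb : ∀ z ∈ W₀, ∃ b : Module.Basis (Fin n) (fibreStalk p f Δ s z).C
      (fibreStalk p f Δ s z).Forms, ∀ i, b i = ε i z)
    (hc : ∀ (W : (f.fiber s).Opens), W ≤ W₀ → ∀ η : LogFamily p f Δ s W,
      η ∈ logSections p f Δ s W → ∀ z ∈ W, IsCombinationNear ε z η) : IsFrame e := by
  intro W hW
  have hg : ∀ (V : (f.fiber s).Opens) (hV : V ≤ W₀) (c : Fin n → Γ(f.fiber s, V)) z (hz : z ∈ V),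
      formGerm p Δ V z hz (∑ i, c i • resM _ hV (e i)) =
        ∑ i, germF p Δ V z hz (c i) • ε i z := by
    intro V hV c z hz
    rw [map_sum]
    refine Finset.sum_congr rfl fun i _ => ?_
    rw [formGerm_smul, formGerm_res, he]
  have huniq : ∀ z ∈ W₀, ∀ c c' : Fin n → (fibreStalk p f Δ s z).C,
      ∑ i, c i • ε i z = ∑ i, c' i • ε i z → c = c' := by
    intro z hz c c' h
    obtain ⟨b, hb⟩ := hb z hz
    simp only [← hb] at h
    rw [← b.equivFun_symm_apply, ← b.equivFun_symm_apply] at h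
    exact b.equivFun.symm.injective h
  constructor
  · intro c c' h
    beta_reduce at h
    funext i
    refine germF_ext p Δ fun z hz => ?_
    have h1 := congrArg (formGerm p Δ W z hz) h
    rw [hg, hg] at h1
    exact congrFun (huniq z (hW hz) _ _ h1) i
  · intro η
    choose V hV hzV c hc using fun z : W => hc W hW (show logSections p f Δ s W from η).1
      (show logSections p f Δ s W from η).2 z.1 z.2
    choose a ha using fun i => function_glue V hV (fun x hx => ⟨⟨x, hx⟩, hzV ⟨x, hx⟩⟩)
      (fun z => c z i) (by
        intro z z'
        refine germF_ext p Δ fun x hx => ?_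
        rw [germF_resO, germF_resO]
        refine congrFun (huniq x (hW (hV z hx.1)) (fun i => germF p Δ _ x hx.1 (c z i))
          (fun i => germF p Δ _ x hx.2 (c z' i)) ?_) i
        rw [← hc z x hx.1, ← hc z' x hx.2])
    refine ⟨a, formGerm_ext fun z hz => ?_⟩
    rw [hg]
    refine Eq.trans ?_ (hc ⟨z, hz⟩ z (hzV ⟨z, hz⟩)).symm
    refine Finset.sum_congr rfl fun i _ => ?_
    rw [← ha i ⟨z, hz⟩, germF_resO]

lemma IsFormNear.eventually {U : Scheme.{0}} {q : U ⟶ Spec (CommRingCat.of ℂ)} {x₀ : U}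
    {ω : ∀ x, Ω[Stalk q x⁄ℂ]} (hω : IsFormNear x₀ ω) : ∀ᶠ x in nhds x₀, IsFormNear x ω := by
  obtain ⟨V, hx₀, n, b, c, h⟩ := hω.exists_sections
  filter_upwards [eventually_mem hx₀] with x hx
  refine (IsFormNear.sum Finset.univ fun j => (IsFormNear.d (isFunNear_germFun (c j) hx)).smul
    (isFunNear_germFun (b j) hx)).congr ?_
  filter_upwards [eventually_mem hx] with y hy
  simp only [h y hy, germFun_apply _ hy]

section Frame
variable {hK : ∀ z : f.fiber s, ∃ (K : SchemeChart p f Δ) (w : K.U), K.u w = f.fiberι s z}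
  {t : ∀ y, Stalk p y}
  {ht : ∀ z : f.fiber s, (fibreStalk p f Δ s z).ideal =
    Ideal.span {stalkB p f Δ s z (t (f (f.fiberι s z)))}}
  {V : X.Opens} {n : ℕ} {e : Fin n → ∀ x, Ω[Stalk (f ≫ p) x⁄ℂ]}
  (hV : IsFrameOn hK ht V e) (hts : IsFunNear s t) {z₀ : f.fiber s}
  (hz₀ : f.fiberι s z₀ ∈ V)
include hV hts hz₀

lemma IsFrameOn.isCombinationNear (he : ∀ i, IsFormNear (f.fiberι s z₀) (e i))
    {W : (f.fiber s).Opens} {η : LogFamily p f Δ s W} (hη : IsRational p f Δ s η) (hW : z₀ ∈ W) :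
    IsCombinationNear (fun i z => polarVal hK ht z (formA Δ s (e i) z)) z₀ η := by
  obtain ⟨α, hα, h⟩ := hV.exists_coefficients hK ht hts hz₀ he hη hW
  obtain ⟨V', -, -, hz₀', r, hr⟩ := exists_common_sections hα ⊤ trivial
  obtain ⟨O, hO, hOo, hz₀O⟩ := eventually_nhds_iff.1 h
  refine ⟨W ⊓ (⟨O, hOo⟩ ⊓ f.fiberι s ⁻¹ᵁ V'), inf_le_left, ⟨hW, hz₀O, hz₀'⟩,
    fun i => resO (inf_le_right.trans inf_le_right) ((f.fiberι s).app V' (r i)), fun z hz => ?_⟩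
  rw [hO z hz.2.1 hz.1]
  refine Finset.sum_congr rfl fun i _ => ?_
  rw [germF_resO]
  refine congrArg (fun c => c • polarVal hK ht z (formA Δ s (e i) z)) ?_
  refine Eq.trans ?_ (germF_app p Δ hz.2.2 (r i)).symm
  rw [hr i _ hz.2.2]
  rfl

lemma IsFrameOn.exists_isRational {i : Fin n} (he : IsFormNear (f.fiberι s z₀) (e i)) :
    ∃ W : (f.fiber s).Opens, z₀ ∈ W ∧
      IsRational p f Δ s fun z : W => polarVal hK ht z.1 (formA Δ s (e i) z.1) := by
  obtain ⟨V₁, hz₁, m, b, c, h⟩ := he.exists_sections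
  have htX : IsFunNear (f.fiberι s z₀) fun x => stalkHom f p x (t (f x)) :=
    IsFunNear.pullBack (by rw [fiberι_mem]; exact hts)
  obtain ⟨V₂, hz₂, r, hr⟩ := htX
  refine ⟨f.fiberι s ⁻¹ᵁ (V ⊓ (V₁ ⊓ V₂)), ⟨hz₀, hz₁, hz₂⟩, V ⊓ (V₁ ⊓ V₂), le_rfl,
    resO (inf_le_right.trans inf_le_right) r, m,
    fun j => resO (inf_le_right.trans inf_le_left) (b j),
    fun j => resO (inf_le_right.trans inf_le_left) (c j), ?_⟩
  rintro ⟨z, hz⟩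
  have hP := isLogPair_fibreStalk hK ht z
  have hg₁ : ∀ a : Γ(X, V₁), germA p f Δ s (V ⊓ (V₁ ⊓ V₂)) z hz
      (resO (inf_le_right.trans inf_le_left) a) =
        stalkA p f Δ s z (germAt (f ≫ p) V₁ (f.fiberι s z) hz.2.1 a) := fun a =>
    congrArg (stalkA p f Δ s z) (germAt_res (inf_le_right.trans inf_le_left) _ hz a)
  have hg₂ : germA p f Δ s (V ⊓ (V₁ ⊓ V₂)) z hz (resO (inf_le_right.trans inf_le_right) r) =
      algebraMap (fibreStalk p f Δ s z).B (fibreStalk p f Δ s z).A (eqAt t z) :=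
    congrArg (stalkA p f Δ s z)
      ((germAt_res (inf_le_right.trans inf_le_right) _ hz r).trans (hr _ hz.2.2).symm)
  obtain ⟨hez, -⟩ := hV z hz.1
  obtain ⟨l, hl⟩ := exists_smul_eq hP.mem_total (toRational ℂ _ (formA Δ s (e i) z))
  have hlm := hP.mem_logForms_iff.2 ⟨_, hez i, hl⟩
  dsimp only
  rw [hg₂]
  refine ⟨hP.mem_total, ⟨l, hlm⟩, hl.trans ?_, ?_⟩
  · simp only [hg₁, formA, h _ hz.2.1, map_sum, formMap_smul, formMap_D, map_smul, toRational_D]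
    rfl
  · rw [polarVal_eq hK ht (hez i), hP.toRel_eq_mk _ ⟨l, hlm⟩ hl]
    rfl

end Frame

/-- The sheaf of logarithmic forms of the fibre is locally free, and a frame gives bases of the
stalks. -/
lemma exists_frame_logCotangent
    (hK : ∀ z : f.fiber s, ∃ (K : SchemeChart p f Δ) (w : K.U), K.u w = f.fiberι s z)
    (z₀ : f.fiber s) :
    ∃ (W : (f.fiber s).Opens) (n : ℕ) (e : Fin n → Γ(logCotangent p f Δ s, W)), z₀ ∈ W ∧
      IsFrame e ∧ ∀ z (hz : z ∈ W), ∃ b : Module.Basis (Fin n) (fibreStalk p f Δ s z).C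
        (fibreStalk p f Δ s z).Forms, ∀ i, b i = formGerm p Δ W z hz (e i) := by
  have : Nonempty (f.fiber s) := ⟨z₀⟩
  obtain ⟨t, hts, ht⟩ := exists_equation hK
  obtain ⟨n, e, he, V, hz₀, hV⟩ := exists_frame_forms hK ht z₀
  have hV : IsFrameOn hK ht V e := hV
  choose W hzW hW using fun i => hV.exists_isRational hts hz₀ (he i)
  have hev : ∀ᶠ z in nhds z₀, (∀ i, z ∈ W i) ∧ f.fiberι s z ∈ V ∧
      ∀ i, IsFormNear (f.fiberι s z) (e i) :=
    (Filter.eventually_all.2 fun i => eventually_mem (hzW i)).and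
      ((f.fiberι s).continuous.tendsto z₀ |>.eventually ((eventually_mem hz₀).and
        (Filter.eventually_all.2 fun i => (he i).eventually)))
  obtain ⟨O, hO, hOo, hz₀O⟩ := eventually_nhds_iff.1 hev
  let W₀ : (f.fiber s).Opens := ⟨O, hOo⟩
  let ε : Fin n → ∀ z, (fibreStalk p f Δ s z).Forms := fun i z =>
    polarVal hK ht z (formA Δ s (e i) z)
  have hmem : ∀ i, (fun z : W₀ => ε i z.1) ∈ logSections p f Δ s W₀ := fun i z =>
    ⟨W₀, le_rfl, z.2, Submodule.subset_span
      ((hW i).restrict p f Δ s (fun z hz => (hO z hz).1 i : W₀ ≤ W i))⟩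
  refine ⟨W₀, n, fun i => ⟨_, hmem i⟩, hz₀O, isFrame_of_basis (ε := ε) _ (fun _ _ _ => rfl)
    (fun z hz => hV.exists_basis hK ht (hO z hz).2.1) ?_,
    fun z hz => hV.exists_basis hK ht (hO z hz).2.1⟩
  intro W hWW η hη z hz
  exact IsCombinationNear.of_mem_logSections hη hz fun W' ξ hξ hz' =>
    hV.isCombinationNear hts (hO z (hWW hz)).2.1 (hO z (hWW hz)).2.2 hξ hz'
end
end

section
/-! ### Logarithmic derivations of the fibre -/

lemma actO_sub_commutator {Z : Scheme.{0}} {U V : Z.Opens} (h : V ≤ U)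
    (P : LocalEnd (structureModule Z) V) (Q Q' : LocalEnd (structureModule Z) U) {W : Z.Opens}
    (hW : W ≤ V) (a : Γ(Z, W)) :
    LocalEnd.actO (P - LocalEnd.restrict h (Q * Q' - Q' * Q)) W hW a = LocalEnd.actO P W hW a -
      (LocalEnd.actO Q W (hW.trans h) (LocalEnd.actO Q' W (hW.trans h) a) -
        LocalEnd.actO Q' W (hW.trans h) (LocalEnd.actO Q W (hW.trans h) a)) := by
  rw [LocalEnd.actO_sub, LocalEnd.actO_restrict, LocalEnd.actO_sub, LocalEnd.actO_mul,
    LocalEnd.actO_mul]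

lemma restrict_eq_of_restrict_sub {Z : Scheme.{0}} {M : Z.Modules} {U V W : Z.Opens} (h : V ≤ U)
    (h' : W ≤ V) {P : LocalEnd M V} {Q : LocalEnd M U}
    (hPQ : LocalEnd.restrict h' (P - LocalEnd.restrict h Q) = 0) :
    LocalEnd.restrict h' P = LocalEnd.restrict (h'.trans h) Q := by
  rwa [RingHom.map_sub, sub_eq_zero] at hPQ

section LieDefect
variable {R : FibreStalk} (θ₁ θ₂ θ₃ : R.Forms →ₗ[R.C] R.C)

/-- The difference of the derivation `θ₃ ∘ d` and the commutator of `θ₁ ∘ d` and `θ₂ ∘ d`. -/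
def lieDefect (c : R.C) : R.C := θ₃ (R.d c) - (θ₁ (R.d (θ₂ (R.d c))) - θ₂ (R.d (θ₁ (R.d c))))

lemma lieDefect_add (c c' : R.C) : lieDefect θ₁ θ₂ θ₃ (c + c') =
    lieDefect θ₁ θ₂ θ₃ c + lieDefect θ₁ θ₂ θ₃ c' := by
  simp only [lieDefect, fibreLogD_add, map_add]
  ring

lemma lieDefect_mul (c c' : R.C) : lieDefect θ₁ θ₂ θ₃ (c * c') =
    c * lieDefect θ₁ θ₂ θ₃ c' + c' * lieDefect θ₁ θ₂ θ₃ c := by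
  simp only [lieDefect, fibreLogD_mul, fibreLogD_add, map_add, map_smul, smul_eq_mul]
  ring

lemma d_const (c : ℂ) : R.d (algebraMap R.A R.C (algebraMap ℂ R.A c)) = 0 := by
  rw [FibreStalk.d, fibreLogD_algebraMap, Derivation.map_algebraMap, TensorProduct.tmul_zero]

lemma d_zero : R.d 0 = 0 := by
  have := d_const (R := R) 0
  rwa [map_zero, map_zero] at this

lemma lieDefect_const (c : ℂ) :
    lieDefect θ₁ θ₂ θ₃ (algebraMap R.A R.C (algebraMap ℂ R.A c)) = 0 := by
  simp only [lieDefect, d_const, map_zero, d_zero, sub_zero]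

/-- A derivation of the local ring of the fibre which kills generators of an algebra of which `A` is
a localization vanishes. -/
lemma lieDefect_eq_zero {P : Type} [CommRing P] [Algebra ℂ P] (g : P →ₐ[ℂ] R.A) {G : Set P}
    (hG : Algebra.adjoin ℂ G = ⊤) (hg : ∀ a : R.A, ∃ b r : P, IsUnit (g b) ∧ a * g b = g r)
    (h : ∀ r ∈ G, lieDefect θ₁ θ₂ θ₃ (algebraMap R.A R.C (g r)) = 0) (c : R.C) :
    lieDefect θ₁ θ₂ θ₃ c = 0 := by
  have h1 : ∀ r : P, lieDefect θ₁ θ₂ θ₃ (algebraMap R.A R.C (g r)) = 0 := by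
    intro r
    have hr : r ∈ Algebra.adjoin ℂ G := hG ▸ trivial
    induction hr using Algebra.adjoin_induction with
    | mem r hr => exact h r hr
    | algebraMap c => rw [AlgHom.commutes, lieDefect_const]
    | add r r' _ _ hr hr' => rw [map_add, map_add, lieDefect_add, hr, hr', add_zero]
    | mul r r' _ _ hr hr' =>
      rw [map_mul, map_mul, lieDefect_mul, hr, hr', mul_zero, mul_zero, add_zero]
  obtain ⟨a, rfl⟩ := R.isFibreRing.surj c
  obtain ⟨b, r, hb, har⟩ := hg a
  have h2 := h1 r
  rw [← har, map_mul, lieDefect_mul, h1 b, mul_zero, zero_add] at h2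
  exact ((hb.map (algebraMap R.A R.C)).mul_right_eq_zero).1 h2

end LieDefect

section
variable {X S : Scheme.{0}} {p : S ⟶ Spec (CommRingCat.of ℂ)} {f : X ⟶ S}
    {Δ : S.IdealSheafData} {s : S}

lemma isUnit_natCast_of_hom {Z : Scheme.{0}} (q : Z ⟶ Spec (CommRingCat.of ℂ)) (U : Z.Opens)
    (n : ℕ) (hn : n ≠ 0) : IsUnit (n : Γ(Z, U)) := by
  have h1 : IsUnit (n : ℂ) := isUnit_iff_ne_zero.2 (Nat.cast_ne_zero.2 hn)
  have h2 := h1.map ((Scheme.ΓSpecIso (CommRingCat.of ℂ)).inv ≫ q.appTop ≫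
    Z.presheaf.map (homOfLE (le_top : U ≤ ⊤)).op).hom
  rwa [map_natCast] at h2

/-- Near every point, a scheme locally of finite type is the spectrum of a finitely generated
algebra, of which the local rings are localizations. -/
lemma exists_affine_generators {q : X ⟶ Spec (CommRingCat.of ℂ)} [LocallyOfFiniteType q] (x₀ : X) :
    ∃ (V : X.Opens) (_ : Algebra ℂ Γ(X, V)) (G : Finset Γ(X, V)), x₀ ∈ V ∧
      Algebra.adjoin ℂ (G : Set Γ(X, V)) = ⊤ ∧ ∀ x (hx : x ∈ V),
        ∃ g : Γ(X, V) →ₐ[ℂ] Stalk q x, (∀ r, g r = germAt q V x hx r) ∧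
          ∀ a, ∃ b r, IsUnit (g b) ∧ a * g b = g r := by
  obtain ⟨V, hV, hxV, -⟩ := Opens.isBasis_iff_nbhd.mp X.isBasis_affineOpens
    (show x₀ ∈ (⊤ : X.Opens) from trivial)
  have hV : IsAffineOpen V := hV
  let φ : CommRingCat.of ℂ ⟶ Γ(X, V) :=
    (Scheme.ΓSpecIso (CommRingCat.of ℂ)).inv ≫ q.appTop ≫ X.presheaf.map (homOfLE le_top).op
  have hφ : φ.hom.FiniteType := by
    have h1 := q.finiteType_appLE (isAffineOpen_top (Spec (CommRingCat.of ℂ))) hV le_top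
    have h2 : φ = (Scheme.ΓSpecIso (CommRingCat.of ℂ)).inv ≫ q.appLE ⊤ V le_top := rfl
    rw [h2, CommRingCat.hom_comp]
    exact h1.comp <| RingHom.FiniteType.of_surjective _
      ((Scheme.ΓSpecIso (CommRingCat.of ℂ)).symm.commRingCatIsoToRingEquiv.surjective)
  let _ : Algebra ℂ Γ(X, V) := φ.hom.toAlgebra
  have hft : Algebra.FiniteType ℂ Γ(X, V) := hφ
  obtain ⟨G, hG⟩ := hft.out
  refine ⟨V, inferInstance, G, hxV, hG, fun x hx => ⟨{ germAt q V x hx with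
      commutes' := fun a => TopCat.Presheaf.germ_res_apply X.presheaf (homOfLE le_top) x hx
        (q.appTop ((Scheme.ΓSpecIso (CommRingCat.of ℂ)).inv a)) }, fun _ => rfl, fun a => ?_⟩⟩
  let _ : Algebra Γ(X, V) (Stalk q x) := (germAt q V x hx).toAlgebra
  have hloc : IsLocalization (hV.primeIdealOf ⟨x, hx⟩).asIdeal.primeCompl (Stalk q x) :=
    hV.isLocalization_stalk ⟨x, hx⟩
  obtain ⟨⟨r, b⟩, h⟩ := IsLocalization.surj (hV.primeIdealOf ⟨x, hx⟩).asIdeal.primeCompl a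
  exact ⟨b, r, IsLocalization.map_units (Stalk q x) b, h⟩

lemma germF_sub {W : (f.fiber s).Opens} {z : f.fiber s} (hz : z ∈ W) (a b : Γ(f.fiber s, W)) :
    germF p Δ W z hz (a - b) = germF p Δ W z hz a - germF p Δ W z hz b :=
  RingHom.map_sub (germF p Δ W z hz) a b

lemma germF_actO_derOf {U : (f.fiber s).Opens} {u : LocalHom (logCotangent p f Δ s) U}
    {z : f.fiber s}
    {θ : (fibreStalk p f Δ s z).Forms →ₗ[(fibreStalk p f Δ s z).C] (fibreStalk p f Δ s z).C}
    (hθ : ∀ (W : (f.fiber s).Opens) (hW : W ≤ U) (hzW : z ∈ W) (η : Γ(logCotangent p f Δ s, W)),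
        germF p Δ W z hzW (u.1 ⟨W, hW⟩ η) = θ (formGerm p Δ W z hzW η))
    {W : (f.fiber s).Opens} (hW : W ≤ U) (hz : z ∈ W) (a : Γ(f.fiber s, W)) :
    germF p Δ W z hz (LocalEnd.actO (derOf (logDifferential p f Δ s) U u) W hW a) =
      θ ((fibreStalk p f Δ s z).d (germF p Δ W z hz a)) :=
  hθ W hW hz _

/-- An operator whose stalks are derivations over the constants vanishes near a point if it kills
the germs at the point. -/
lemma exists_restrict_eq_zero [LocallyOfFiniteType (f ≫ p)] {V : (f.fiber s).Opens}
    (E : LocalEnd (structureModule (f.fiber s)) V)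
    (θ₁ θ₂ θ₃ : ∀ z ∈ V, (fibreStalk p f Δ s z).Forms →ₗ[(fibreStalk p f Δ s z).C]
      (fibreStalk p f Δ s z).C)
    (hE : ∀ (W : (f.fiber s).Opens) (hW : W ≤ V) z (hz : z ∈ W) (a : Γ(f.fiber s, W)),
      germF p Δ W z hz (LocalEnd.actO E W hW a) =
        lieDefect (θ₁ z (hW hz)) (θ₂ z (hW hz)) (θ₃ z (hW hz)) (germF p Δ W z hz a))
    {z₀ : f.fiber s} (hzV : z₀ ∈ V)
    (hE₀ : ∀ (W : (f.fiber s).Opens) (hW : W ≤ V) (hz : z₀ ∈ W) (a : Γ(f.fiber s, W)),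
      germF p Δ W z₀ hz (LocalEnd.actO E W hW a) = 0) :
    ∃ (O : (f.fiber s).Opens) (h : O ≤ V), z₀ ∈ O ∧ LocalEnd.restrict h E = 0 := by
  obtain ⟨Y, _, G, hxY, hG, hloc⟩ := exists_affine_generators (q := f ≫ p) (f.fiberι s z₀)
  have hgen : ∀ r : Γ(X, Y), ∃ (W : (f.fiber s).Opens) (hW : W ≤ V ⊓ f.fiberι s ⁻¹ᵁ Y), z₀ ∈ W ∧
      LocalEnd.actO E W (hW.trans inf_le_left)
        (resO (hW.trans inf_le_right) ((f.fiberι s).app Y r)) = 0 := by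
    intro r
    have hz : z₀ ∈ V ⊓ f.fiberι s ⁻¹ᵁ Y := ⟨hzV, hxY⟩
    obtain ⟨W, hW, hW', hzW, h⟩ := exists_resO_eq_of_germF_eq p Δ hz hz
      ((hE₀ _ inf_le_left hz (resO inf_le_right ((f.fiberι s).app Y r))).trans (map_zero _).symm)
    refine ⟨W, hW, hzW, ?_⟩
    rw [LocalEnd.resO_actO, resO_resO, map_zero] at h
    exact h
  choose W hW hzW hEW using hgen
  let O : (f.fiber s).Opens := ⟨⋂ r : G, (W r : Set (f.fiber s)),
    isOpen_iInter_of_finite fun r => (W r).isOpen⟩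
  have hO : ∀ r : G, O ≤ W r := fun r x hx => Set.mem_iInter.1 hx r
  refine ⟨O ⊓ (V ⊓ f.fiberι s ⁻¹ᵁ Y), inf_le_right.trans inf_le_left,
    ⟨Set.mem_iInter.2 fun r => hzW r, hzV, hxY⟩, LocalEnd.ext_actO fun W' hW' a => ?_⟩
  change LocalEnd.actO E W' (hW'.trans (inf_le_right.trans inf_le_left)) a = 0
  refine germF_ext p Δ fun z hz => ?_
  rw [hE W' _ z hz, map_zero]
  have hzY : f.fiberι s z ∈ Y := (hW' hz).2.2
  obtain ⟨g, hg, hgu⟩ := hloc _ hzY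
  refine lieDefect_eq_zero _ _ _ ((stalkA p f Δ s z).toAlgHom.comp g) hG ?_ ?_ _
  · intro a
    obtain ⟨b, r, hb, hr⟩ := hgu ((stalkA p f Δ s z).symm a)
    refine ⟨b, r, hb.map (stalkA p f Δ s z), ?_⟩
    have := congrArg (stalkA p f Δ s z) hr
    rwa [map_mul, AlgEquiv.apply_symm_apply] at this
  · intro r hr
    have hzW' : z ∈ W r := hO ⟨r, hr⟩ (hW' hz).1
    have h2 := hE (W r) ((hW r).trans inf_le_left) z hzW'
      (resO ((hW r).trans inf_le_right) ((f.fiberι s).app Y r))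
    rw [hEW r, map_zero, germF_resO, germF_app p Δ hzY] at h2
    refine Eq.trans ?_ h2.symm
    congr 2
    exact congrArg (stalkA p f Δ s z) (hg r)

section Functional
variable (hK : ∀ z : f.fiber s, ∃ (K : SchemeChart p f Δ) (w : K.U), K.u w = f.fiberι s z)
include hK

/-- A homomorphism of sheaves induces functionals on the stalks. -/
lemma exists_stalk_functional {U : (f.fiber s).Opens} (u : LocalHom (logCotangent p f Δ s) U)
    {z : f.fiber s} (hz : z ∈ U) :
    ∃ θ : (fibreStalk p f Δ s z).Forms →ₗ[(fibreStalk p f Δ s z).C] (fibreStalk p f Δ s z).C,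
      ∀ (W : (f.fiber s).Opens) (hW : W ≤ U) (hzW : z ∈ W) (η : Γ(logCotangent p f Δ s, W)),
        germF p Δ W z hzW (u.1 ⟨W, hW⟩ η) = θ (formGerm p Δ W z hzW η) := by
  obtain ⟨W₀, n, e, hzW₀, he, hb⟩ := exists_frame_logCotangent hK z
  obtain ⟨b, hb⟩ := hb z hzW₀
  have he' := he.restrict (inf_le_left : W₀ ⊓ U ≤ W₀)
  refine ⟨b.constr (fibreStalk p f Δ s z).C fun i => germF p Δ (W₀ ⊓ U) z ⟨hzW₀, hz⟩
    (u.1 ⟨W₀ ⊓ U, inf_le_right⟩ (resM _ inf_le_left (e i))), fun W hW hzW η => ?_⟩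
  have hzV : z ∈ W ⊓ (W₀ ⊓ U) := ⟨hzW, hzW₀, hz⟩
  have h1 := he'.sum_coord inf_le_right (resM _ (inf_le_left : W ⊓ (W₀ ⊓ U) ≤ W) η)
  rw [← formGerm_res (inf_le_left : W ⊓ (W₀ ⊓ U) ≤ W) hzV, ← germF_resO inf_le_left hzV,
    LocalHom.natural, ← h1]
  simp only [map_sum, map_smul, smul_eq_mul, map_mul, formGerm_smul]
  refine Finset.sum_congr rfl fun i _ => ?_
  congr 1
  rw [formGerm_res, formGerm_res, ← hb, Module.Basis.constr_basis, ← germF_resO inf_le_right hzV,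
    LocalHom.natural]

/-- A functional on a stalk is induced by a homomorphism of sheaves near the point. -/
lemma exists_localHom {U : (f.fiber s).Opens} {z : f.fiber s} (hz : z ∈ U)
    (θ : (fibreStalk p f Δ s z).Forms →ₗ[(fibreStalk p f Δ s z).C] (fibreStalk p f Δ s z).C) :
    ∃ (V : (f.fiber s).Opens) (_ : V ≤ U) (_ : z ∈ V) (u : LocalHom (logCotangent p f Δ s) V),
      ∀ (W : (f.fiber s).Opens) (hW : W ≤ V) (hzW : z ∈ W) (η : Γ(logCotangent p f Δ s, W)),
        germF p Δ W z hzW (u.1 ⟨W, hW⟩ η) = θ (formGerm p Δ W z hzW η) := by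
  obtain ⟨W₀, n, e, hzW₀, he, -⟩ := exists_frame_logCotangent hK z
  choose V hV a ha using fun i => exists_germF_eq p Δ z (θ (formGerm p Δ W₀ z hzW₀ (e i)))
  let O : (f.fiber s).Opens :=
    ⟨⋂ i, (V i : Set (f.fiber s)), isOpen_iInter_of_finite fun i => (V i).isOpen⟩
  have hO : ∀ i, O ≤ V i := fun i x hx => Set.mem_iInter.1 hx i
  have hzO : z ∈ O := Set.mem_iInter.2 hV
  have he' := he.restrict (inf_le_left.trans inf_le_left : W₀ ⊓ O ⊓ U ≤ W₀)
  have hO' : ∀ i, W₀ ⊓ O ⊓ U ≤ V i := fun i => (inf_le_left.trans inf_le_right).trans (hO i)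
  refine ⟨W₀ ⊓ O ⊓ U, inf_le_right, ⟨⟨hzW₀, hzO⟩, hz⟩,
    ∑ i, resO (hO' i) (a i) • he'.coord i,
    fun W hW hzW η => ?_⟩
  let ev : LocalHom (logCotangent p f Δ s) (W₀ ⊓ O ⊓ U) →+ Γ(f.fiber s, W) :=
    { toFun := fun u => u.1 ⟨W, hW⟩ η
      map_zero' := rfl
      map_add' := fun _ _ => rfl }
  have h1 := he'.sum_coord hW η
  change germF p Δ W z hzW (ev _) = _
  rw [map_sum]
  conv_rhs => rw [← h1]
  simp only [map_sum, formGerm_smul, map_smul, smul_eq_mul]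
  refine Finset.sum_congr rfl fun i _ => ?_
  change germF p Δ W z hzW (resO hW _ * (he'.coord i).1 ⟨W, hW⟩ η) = _
  rw [map_mul, resO_resO, germF_resO, ha, formGerm_res, formGerm_res, mul_comm]

/-- A homomorphism which kills all differentials of functions vanishes, as it does on stalks. -/
lemma derOf_injective_logDifferential (U : (f.fiber s).Opens)
    (u : LocalHom (logCotangent p f Δ s) U) (hu : derOf (logDifferential p f Δ s) U u = 0) :
    u = 0 := by
  refine LocalHom.ext_sub fun W hW η => germF_ext p Δ fun z hz => ?_
  obtain ⟨θ, hθ⟩ := exists_stalk_functional hK u (hW hz)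
  obtain ⟨K, w, h⟩ := hK z
  have h0 : θ = 0 := by
    refine (K.chartAt z w h).eq_zero_of_apply_d fun c => ?_
    obtain ⟨V, hzV, a, rfl⟩ := exists_germF_eq p Δ z c
    have hzV' : z ∈ V ⊓ U := ⟨hzV, hW hz⟩
    rw [← germF_resO inf_le_left hzV', ← formGerm_d, ← hθ (V ⊓ U) inf_le_right]
    have h1 := congrArg (fun P => LocalEnd.actO P (V ⊓ U) inf_le_right (resO inf_le_left a)) hu
    beta_reduce at h1
    rw [actO_derOf] at h1
    rw [h1]
    exact map_zero _
  rw [hθ W hW hz, h0]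
  exact (map_zero (germF p Δ W z hz)).symm

/-- Locally the bracket of two logarithmic derivations is logarithmic: the functional which gives
the bracket at a point is induced by a homomorphism near that point, and the bracket and the
derivation of this homomorphism agree nearby since they do on finitely many functions. -/
lemma bracket_logDifferential [LocallyOfFiniteType (f ≫ p)] (U : (f.fiber s).Opens)
    (u₁ u₂ : LocalHom (logCotangent p f Δ s) U) (z₀ : f.fiber s) (hz₀ : z₀ ∈ U) :
    ∃ (W : (f.fiber s).Opens) (h : W ≤ U), z₀ ∈ W ∧
      LocalEnd.restrict h
        (derOf (logDifferential p f Δ s) U u₁ * derOf (logDifferential p f Δ s) U u₂ -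
          derOf (logDifferential p f Δ s) U u₂ * derOf (logDifferential p f Δ s) U u₁) ∈
        logDer (logDifferential p f Δ s) W := by
  obtain ⟨K, w, hw⟩ := hK z₀
  choose θ₁ hθ₁ using fun z hz => exists_stalk_functional hK u₁ (z := z) hz
  choose θ₂ hθ₂ using fun z hz => exists_stalk_functional hK u₂ (z := z) hz
  obtain ⟨θ, hθ⟩ := (K.chartAt z₀ w hw).exists_lie_functional (θ₁ z₀ hz₀) (θ₂ z₀ hz₀)
  obtain ⟨V, hVU, hzV, u, hu⟩ := exists_localHom hK hz₀ θ
  choose θ₃ hθ₃ using fun z hz => exists_stalk_functional hK u (z := z) hz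
  -- the derivation which measures the failure of `u` to be the commutator
  let E : LocalEnd (structureModule (f.fiber s)) V := derOf (logDifferential p f Δ s) V u -
    LocalEnd.restrict hVU
      (derOf (logDifferential p f Δ s) U u₁ * derOf (logDifferential p f Δ s) U u₂ -
        derOf (logDifferential p f Δ s) U u₂ * derOf (logDifferential p f Δ s) U u₁)
  have hE : ∀ (W : (f.fiber s).Opens) (hW : W ≤ V) z (hz : z ∈ W) (a : Γ(f.fiber s, W)),
      germF p Δ W z hz (LocalEnd.actO E W hW a) =
        lieDefect (θ₁ z (hVU (hW hz))) (θ₂ z (hVU (hW hz))) (θ₃ z (hW hz)) (germF p Δ W z hz a) := by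
    intro W hW z hz a
    have h₃ := germF_actO_derOf (hθ₃ z (hW hz)) hW hz a
    have h₁₂ := (germF_actO_derOf (hθ₁ z (hVU (hW hz))) (hW.trans hVU) hz _).trans
      (congrArg (fun c => θ₁ z (hVU (hW hz)) ((fibreStalk p f Δ s z).d c))
        (germF_actO_derOf (hθ₂ z (hVU (hW hz))) (hW.trans hVU) hz a))
    have h₂₁ := (germF_actO_derOf (hθ₂ z (hVU (hW hz))) (hW.trans hVU) hz _).trans
      (congrArg (fun c => θ₂ z (hVU (hW hz)) ((fibreStalk p f Δ s z).d c))
        (germF_actO_derOf (hθ₁ z (hVU (hW hz))) (hW.trans hVU) hz a))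
    rw [actO_sub_commutator, germF_sub, germF_sub]
    exact congrArg₂ (· - ·) h₃ (congrArg₂ (· - ·) h₁₂ h₂₁)
  have hE₀ : ∀ (W : (f.fiber s).Opens) (hW : W ≤ V) (hz : z₀ ∈ W) (a : Γ(f.fiber s, W)),
      germF p Δ W z₀ hz (LocalEnd.actO E W hW a) = 0 := by
    intro W hW hz a
    have h₃ := germF_actO_derOf (hθ₃ z₀ (hW hz)) hW hz a
    have h₄ := germF_actO_derOf hu hW hz a
    rw [hE W hW z₀ hz]
    exact sub_eq_zero.2 ((h₃.symm.trans h₄).trans (hθ _))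
  obtain ⟨O, hO, hzO, h⟩ := exists_restrict_eq_zero E (fun z hz => θ₁ z (hVU hz))
    (fun z hz => θ₂ z (hVU hz)) θ₃ hE hzV hE₀
  exact ⟨O, hO.trans hVU, hzO, LocalHom.restrict hO u, restrict_eq_of_restrict_sub hVU hO h⟩

end Functional

/-- The geometric input: all that is used of a log smooth family. -/
theorem isLogCalculus_logDifferential {d : ℕ} (hf : IsLogSmoothFamily p f Δ d)
    (hs : s ∈ Δ.support) : IsLogCalculus (logDifferential p f Δ s) := by
  have hK : ∀ z : f.fiber s, ∃ (K : SchemeChart p f Δ) (w : K.U), K.u w = f.fiberι s z :=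
    fun z => hf.exists_schemeChart (by rw [fiberι_mem]; exact hs)
  have := hf.smooth_total
  refine ⟨fun z => ?_, derOf_injective_logDifferential hK, ?_,
    isUnit_natCast_of_hom (f.fiberι s ≫ f ≫ p)⟩
  · obtain ⟨W, n, e, hz, he, -⟩ := exists_frame_logCotangent hK z
    exact ⟨W, n, e, hz, he⟩
  · rintro U _ ⟨u₁, rfl⟩ _ ⟨u₂, rfl⟩ z hz
    exact bracket_logDifferential hK U u₁ u₂ z hz

end
end

end LogHeat
end

open LogHeat

theorem proposition2p2 {X S : Scheme.{0}} (p : S ⟶ Spec (CommRingCat.of ℂ)) (f : X ⟶ S)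
    (Δ : S.IdealSheafData) (d : ℕ) (hf : IsLogSmoothFamily p f Δ d) (s : S) (hs : s ∈ Δ.support)
    (L : (f.fiber s).Modules) (hL : IsLineBundle L) :
    IsExactOne (logDifferential p f Δ s) L ∧
    (∀ c : HOne (logCotangent p f Δ s).presheaf,
      IsExtensionClass (logDifferential p f Δ s) L c ↔
        c = chernClass (logDifferential p f Δ s) hL) ∧
    ∀ ω : SymTensor (logCotangent p f Δ s),
      ∃ μL μO : HOne (logDerPresheaf (logDifferential p f Δ s)),
        (∀ c, IsMu (logDifferential p f Δ s) L ω c ↔ c = μL) ∧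
        (∀ c, IsMu (logDifferential p f Δ s) (structureModule (f.fiber s)) ω c ↔ c = μO) ∧
        μL = -cup (logDifferential p f Δ s) ω (chernClass (logDifferential p f Δ s) hL) + μO := by
  exact (isLogCalculus_logDifferential hf hs).comparison hL
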